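/- **Setting.** Let $\omega>0$ and let $q\in H^{-1}_{\rm loc}(\mathbb R)$ be a real-valued distribution which is periodic with period $\omega$. Let $T=-d^2/dx^2+q$ be the operator in $L^2(\mathbb R)$ associated with the form sum $(f',g')_{L^2(\mathbb R)}+q(\overline f g)$, $f,g\in H^1(\mathbb R)$ (the form being extended continuously from $C_0^\infty(\mathbb R)$ to $H^1(\mathbb R)$), and assume $T\ge 0$. **Theorem.** There is a real-valued $\phi\in L^2_{\rm loc\,unif}(\mathbb R)$, periodic with period $\omega$, such that $q=\phi^2-\phi'$ in the sense of distributions. For every such $\phi$ let $A=\frac{d}{dx}+\phi$ in $L^2(\mathbb R)$ with $\operatorname{dom}(A)=H^1(\mathbb R)$, let $$T_1=A^*A,\qquad T_2=AA^*,\qquad D=\begin{pmatrix}0&A^*\\A&0\end{pmatrix}\ \text{ in } L^2(\mathbb R)\oplus L^2(\mathbb R),$$ and for $\theta\in[0,2\pi]$ let $A_\theta=\frac{d}{dx}+\phi$ in $L^2([0,\omega])$ with $\operatorname{dom}(A_\theta)=\{g\in H^1((0,\omega)) : g(\omega)=e^{i\theta}g(0)\}$, and $$D_\theta=\begin{pmatrix}0&A_\theta^*\\A_\theta&0\end{pmatrix}\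 \text{ in } L^2([0,\omega])\oplus L^2([0,\omega]).$$ Then $T=T_1$, the operators $D$, $D_\theta$, $T_1$, $T_2$ are self-adjoint, and the following hold. 1. $D$ is unitarily equivalent to the direct integral $\frac1{2\pi}\int^{\oplus}_{[0,2\pi]}d\theta\,D_\theta$ with respect to the direct integral decomposition $L^2(\mathbb R)^2\simeq\frac1{2\pi}\int^\oplus_{[0,2\pi]}d\theta\,L^2([0,\omega])^2$; that is, the unitary Floquet transform, given by $(Vf)(\theta,x)=\sum_{n\in\mathbb Z}e^{-in\theta}f(x+n\omega)$ for $f$ vanishing outside a bounded set, transforms $D$ into this direct integral. 2. $\sigma_{\rm p}(D)=\sigma_{\rm sc}(D)=\emptyset$, and $D$ is purely absolutely continuous of uniform spectral multiplicity two. Moreover, there are real numbers $a_n<b_n\le a_{n+1}$, $n\in\mathbb Z$, with $a_n\to\pm\infty$ as $n\to\pm\infty$, such that $\sigma(D)=\bigcup_{n\in\mathbb Z}[a_n,b_n]$. 3. For $j=1,2$, $\sigma_{\rm p}(T_j)=\sigma_{\rm sc}(T_j)=\emptyset$, and $T_j$ is purely absolutely continuous of uniform spectral multiplicity two. Moreover,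 there are real numbers $a_n<b_n\le a_{n+1}$, $n\in\mathbb N_0$ (depending on $j$), with $a_n\to+\infty$ as $n\to\infty$, such that $\sigma(T_j)=\bigcup_{n\in\mathbb N_0}[a_n,b_n]$. (Uniform spectral multiplicity $n$ means unitary equivalence to multiplication by the independent variable in $L^2(\mathbb R,d\mu;\mathbb C^n)$ for some $\sigma$-finite Borel measure $\mu$ on $\mathbb R$.) -/

import Mathlib

open MeasureTheory Set Filter Topology TopologicalSpace
open scoped Distributions ENNReal LinearPMap

noncomputable section

/-! ### Real distributions on the line -/

/-- Real-valued distributions on `ℝ`. -/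
abbrev RealDistribution : Type := 𝓓'((⊤ : Opens ℝ), ℝ)

/-- Complex-valued test functions on `ℝ`. -/
abbrev TestC : Type := 𝓓((⊤ : Opens ℝ), ℂ)

/-- The complex Hilbert space `L²(ℝ; dx)`. -/
abbrev L2Line : Type := Lp ℂ 2 (volume : Measure ℝ)

/-- The complex Hilbert space `L²([0, ω]; dx)`. -/
abbrev L2Cell (ω : ℝ) : Type := Lp ℂ 2 ((volume : Measure ℝ).restrict (Icc 0 ω))

/-- `q ∈ H⁻¹_loc(ℝ)`: for every test function `ψ` the distribution `ψ q` belongs to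
`H⁻¹(ℝ) = H¹(ℝ)*`, i.e. `f ↦ q (ψ f)` is bounded in the `H¹`-norm. -/
def MemHNegOneLoc (q : RealDistribution) : Prop :=
  ∀ ψ : 𝓓((⊤ : Opens ℝ), ℝ), ∃ C : ℝ, ∀ f g : 𝓓((⊤ : Opens ℝ), ℝ),
    (∀ x, g x = ψ x * f x) →
      |q g| ≤ C * Real.sqrt ((∫ x, (f x) ^ 2) + ∫ x, (deriv (fun y => f y) x) ^ 2)

/-- `q` is periodic with period `ω`: it is invariant under translation of test functions. -/
def IsPeriodicDistribution (ω : ℝ) (q : RealDistribution) : Prop :=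
  ∀ f g : 𝓓((⊤ : Opens ℝ), ℝ), (∀ x, g x = f (x - ω)) → q g = q f

/-- The complex-linear extension of `q` to complex-valued test functions. -/
def evalC (q : RealDistribution) (w : TestC) : ℂ :=
  (q (TestFunction.postcompCLM Complex.reCLM w) : ℂ) +
    Complex.I * (q (TestFunction.postcompCLM Complex.imCLM w) : ℂ)

/-- The test function `x ↦ conj (g x) * f x`. -/
def conjMulTest (g f : TestC) : TestC where
  toFun x := starRingEnd ℂ (g x) * f x
  contDiff' := (Complex.conjCLE.contDiff.comp g.contDiff).mul f.contDiff
  hasCompactSupport' := f.hasCompactSupport.mul_left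
  tsupport_subset' := fun _ _ => trivial

/-- The derivative of a test function, as a test function. -/
def derivTest (f : TestC) : TestC where
  toFun := deriv (fun x => f x)
  contDiff' := ((contDiff_infty_iff_deriv (𝕜 := ℝ) (f := fun x => f x)).1 f.contDiff).2
  hasCompactSupport' := f.hasCompactSupport.deriv
  tsupport_subset' := fun _ _ => trivial

/-- A test function as an element of `L²(ℝ)`. -/
def testL2 (f : TestC) : L2Line :=
  (f.continuous.memLp_of_hasCompactSupport (μ := volume) (p := 2) f.hasCompactSupport).toLp f

/-! ### The Schrödinger operator with distributional potential -/

/-- The sesquilinear form `(g', f') + q(conj g · f)` of `-d²/dx² + q` on test functions. -/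
def schrodingerForm (q : RealDistribution) (g f : TestC) : ℂ :=
  inner ℂ (testL2 (derivTest g)) (testL2 (derivTest f)) + evalC q (conjMulTest g f)

/-- The test functions `F n` converge in `H¹(ℝ)`, with limit `f` (as an element of `L²(ℝ)`). -/
def TendstoH1 (F : ℕ → TestC) (f : L2Line) : Prop :=
  Tendsto (fun n => testL2 (F n)) atTop (𝓝 f) ∧
    ∃ d : L2Line, Tendsto (fun n => testL2 (derivTest (F n))) atTop (𝓝 d)

theorem testL2_add (f g : TestC) : testL2 (f + g) = testL2 f + testL2 g := rfl

theorem testL2_smul (c : ℂ) (f : TestC) : testL2 (c • f) = c • testL2 f := rfl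

theorem testL2_zero : testL2 0 = 0 := by
  have := testL2_smul 0 0
  simpa using this

theorem derivTest_add (f g : TestC) : derivTest (f + g) = derivTest f + derivTest g := by
  ext x
  exact deriv_add (f.contDiff.differentiable (by simp) x) (g.contDiff.differentiable (by simp) x)

theorem derivTest_smul (c : ℂ) (f : TestC) : derivTest (c • f) = c • derivTest f := by
  ext x
  exact deriv_const_smul c (f.contDiff.differentiable (by simp) x)

theorem evalC_add (q : RealDistribution) (v w : TestC) :
    evalC q (v + w) = evalC q v + evalC q w := by
  have h1 : TestFunction.postcompCLM Complex.reCLM (v + w) =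
      TestFunction.postcompCLM Complex.reCLM v + TestFunction.postcompCLM Complex.reCLM w :=
    map_add _ _ _
  have h2 : TestFunction.postcompCLM Complex.imCLM (v + w) =
      TestFunction.postcompCLM Complex.imCLM v + TestFunction.postcompCLM Complex.imCLM w :=
    map_add _ _ _
  simp only [evalC, h1, h2, map_add, Complex.ofReal_add]
  ring

theorem evalC_smul (q : RealDistribution) (c : ℂ) (w : TestC) :
    evalC q (c • w) = c * evalC q w := by
  have h1 : TestFunction.postcompCLM Complex.reCLM (c • w) =
      c.re • TestFunction.postcompCLM Complex.reCLM w -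
        c.im • TestFunction.postcompCLM Complex.imCLM w := by
    ext x
    exact Complex.mul_re _ _
  have h2 : TestFunction.postcompCLM Complex.imCLM (c • w) =
      c.re • TestFunction.postcompCLM Complex.imCLM w +
        c.im • TestFunction.postcompCLM Complex.reCLM w := by
    ext x
    exact Complex.mul_im _ _
  simp only [evalC, h1, h2, map_add, map_sub, map_smul, Complex.ofReal_add, Complex.ofReal_sub,
    smul_eq_mul, Complex.ofReal_mul]
  apply Complex.ext <;> simp

theorem schrodingerForm_add (q : RealDistribution) (g f₁ f₂ : TestC) :
    schrodingerForm q g (f₁ + f₂) = schrodingerForm q g f₁ + schrodingerForm q g f₂ := by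
  have h : conjMulTest g (f₁ + f₂) = conjMulTest g f₁ + conjMulTest g f₂ := by
    ext x
    exact mul_add _ _ _
  simp only [schrodingerForm, h, evalC_add, derivTest_add, testL2_add, inner_add_right]
  ring

theorem schrodingerForm_smul (q : RealDistribution) (c : ℂ) (g f : TestC) :
    schrodingerForm q g (c • f) = c * schrodingerForm q g f := by
  have h : conjMulTest g (c • f) = c • conjMulTest g f := by
    ext x
    exact mul_left_comm _ _ _
  simp only [schrodingerForm, h, evalC_smul, derivTest_smul, testL2_smul, inner_smul_right]
  ring

/-- The graph of the operator `T` associated with the form sum `(f', f') + q(|f|²)` on `H¹(ℝ)`: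
`(f, h)` belongs to it iff `f ∈ H¹(ℝ)` and `(g', f') + ⟨q f, g⟩ = (g, h)` for all `g` in the form
core `C₀^∞(ℝ)`, the form being extended from test functions to `f ∈ H¹(ℝ)` by continuity. -/
def schrodingerGraph (q : RealDistribution) : Submodule ℂ (L2Line × L2Line) where
  carrier := {p | ∃ F : ℕ → TestC, TendstoH1 F p.1 ∧
    ∀ g : TestC, Tendsto (fun n => schrodingerForm q g (F n)) atTop (𝓝 (inner ℂ (testL2 g) p.2))}
  zero_mem' := by
    have h0 : testL2 (derivTest 0) = 0 := by
      have := derivTest_smul 0 0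
      rw [zero_smul, zero_smul] at this
      rw [this, testL2_zero]
    refine ⟨fun _ => 0, ⟨?_, 0, ?_⟩, fun g => ?_⟩
    · simp only [testL2_zero]; exact tendsto_const_nhds
    · simp only [h0]; exact tendsto_const_nhds
    · have : schrodingerForm q g 0 = 0 := by
        have := schrodingerForm_smul q 0 g 0
        simpa using this
      simp only [this, Prod.snd_zero, inner_zero_right]
      exact tendsto_const_nhds
  add_mem' := by
    rintro p p' ⟨F, ⟨h1, d, h2⟩, h3⟩ ⟨F', ⟨h1', d', h2'⟩, h3'⟩
    refine ⟨fun n => F n + F' n, ⟨?_, d + d', ?_⟩, fun g => ?_⟩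
    · simp only [testL2_add]; exact h1.add h1'
    · simp only [derivTest_add, testL2_add]; exact h2.add h2'
    · simp only [schrodingerForm_add, Prod.snd_add, inner_add_right]; exact (h3 g).add (h3' g)
  smul_mem' := by
    rintro c p ⟨F, ⟨h1, d, h2⟩, h3⟩
    refine ⟨fun n => c • F n, ⟨?_, c • d, ?_⟩, fun g => ?_⟩
    · simp only [testL2_smul]; exact h1.const_smul c
    · simp only [derivTest_smul, testL2_smul]; exact h2.const_smul c
    · simp only [schrodingerForm_smul, Prod.smul_snd, inner_smul_right]; exact (h3 g).const_mul c

/-- The Schrödinger operator `T = -d²/dx² + q` in `L²(ℝ)`, defined as the operator associated with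
the form sum. -/
def schrodingerOp (q : RealDistribution) : L2Line →ₗ.[ℂ] L2Line :=
  (schrodingerGraph q).toLinearPMap

/-- `H ≥ 0` for an operator `H` in a Hilbert space. -/
def IsNonnegOp {E : Type*} [NormedAddCommGroup E] [InnerProductSpace ℂ E]
    (H : E →ₗ.[ℂ] E) : Prop :=
  ∀ f : H.domain, 0 ≤ (inner ℂ (f : E) (H f)).re

/-- `φ ∈ L²_loc unif(ℝ)` is real-valued, periodic with period `ω`, and `q = φ² - φ'` in the sense
of distributions. -/
structure IsPeriodicMiura (ω : ℝ) (q : RealDistribution) (φ : ℝ → ℝ) : Prop where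
  memLp : ∀ a b : ℝ, MemLp φ 2 ((volume : Measure ℝ).restrict (Icc a b))
  locUnif : ∃ C : ℝ, ∀ a : ℝ, ∫ x in Icc a (a + 1), φ x ^ 2 ≤ C
  periodic : ∀ᵐ x, φ (x + ω) = φ x
  eq_miura : ∀ f : 𝓓((⊤ : Opens ℝ), ℝ),
    q f = (∫ x, φ x ^ 2 * f x) + ∫ x, φ x * deriv (fun y => f y) x

/-! ### First-order operators on the line and on the period cell -/

/-- On the interval `I` the function `u` is (locally) absolutely continuous with derivative `v`. -/
def IsACWithDeriv (I : Set ℝ) (u v : ℝ → ℂ) : Prop :=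
  ∀ a ∈ I, ∀ b ∈ I, IntervalIntegrable v volume a b ∧ u b - u a = ∫ x in a..b, v x

theorem IsACWithDeriv.add {I : Set ℝ} {u v u' v' : ℝ → ℂ} (h : IsACWithDeriv I u v)
    (h' : IsACWithDeriv I u' v') :
    IsACWithDeriv I (fun x => u x + u' x) (fun x => v x + v' x) := by
  intro a ha b hb
  obtain ⟨h1, h2⟩ := h a ha b hb
  obtain ⟨h1', h2'⟩ := h' a ha b hb
  refine ⟨h1.add h1', ?_⟩
  rw [intervalIntegral.integral_add h1 h1', ← h2, ← h2']
  ring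

theorem IsACWithDeriv.smul {I : Set ℝ} {u v : ℝ → ℂ} (c : ℂ) (h : IsACWithDeriv I u v) :
    IsACWithDeriv I (fun x => c * u x) (fun x => c * v x) := by
  intro a ha b hb
  obtain ⟨h1, h2⟩ := h a ha b hb
  refine ⟨h1.const_mul c, ?_⟩
  rw [intervalIntegral.integral_const_mul, ← h2]
  ring

/-- The graph of `A = d/dx + φ` in `L²(ℝ)` with domain `H¹(ℝ)`. -/
def lineGraph (φ : ℝ → ℝ) : Submodule ℂ (L2Line × L2Line) where
  carrier := {p | ∃ u v : ℝ → ℂ, IsACWithDeriv univ u v ∧ MemLp v 2 volume ∧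
    (∀ᵐ x, p.1 x = u x) ∧ ∀ᵐ x, p.2 x = v x + φ x * u x}
  zero_mem' := by
    refine ⟨fun _ => 0, fun _ => 0, ?_, MemLp.zero, ?_, ?_⟩
    · intro a _ b _; simp
    · exact Lp.coeFn_zero ℂ 2 volume
    · filter_upwards [Lp.coeFn_zero ℂ 2 (volume : Measure ℝ)] with x hx
      simpa only [Prod.snd_zero, mul_zero, add_zero, Pi.zero_apply] using hx
  add_mem' := by
    rintro p p' ⟨u, v, h1, h2, h3, h4⟩ ⟨u', v', h1', h2', h3', h4'⟩
    refine ⟨_, _, h1.add h1', h2.add h2', ?_, ?_⟩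
    · filter_upwards [Lp.coeFn_add p.1 p'.1, h3, h3'] with x hx hx1 hx2
      simp only [Prod.fst_add, hx, Pi.add_apply, hx1, hx2]
    · filter_upwards [Lp.coeFn_add p.2 p'.2, h4, h4'] with x hx hx1 hx2
      simp only [Prod.snd_add, hx, Pi.add_apply, hx1, hx2]
      ring
  smul_mem' := by
    rintro c p ⟨u, v, h1, h2, h3, h4⟩
    refine ⟨_, _, h1.smul c, h2.const_mul c, ?_, ?_⟩
    · filter_upwards [Lp.coeFn_smul c p.1, h3] with x hx hx1
      simp only [Prod.smul_fst, hx, Pi.smul_apply, hx1, smul_eq_mul]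
    · filter_upwards [Lp.coeFn_smul c p.2, h4] with x hx hx1
      simp only [Prod.smul_snd, hx, Pi.smul_apply, hx1, smul_eq_mul]
      ring

/-- The operator `A = d/dx + φ` in `L²(ℝ)` with domain `H¹(ℝ)`. -/
def lineOp (φ : ℝ → ℝ) : L2Line →ₗ.[ℂ] L2Line := (lineGraph φ).toLinearPMap

/-- The graph of `A_θ = d/dx + φ` in `L²([0, ω])` with domain
`{g ∈ H¹((0, ω)) | g(ω) = e^{iθ} g(0)}`. -/
def cellGraph (ω : ℝ) (φ : ℝ → ℝ) (θ : ℝ) : Submodule ℂ (L2Cell ω × L2Cell ω) where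
  carrier := {p | ∃ u v : ℝ → ℂ, IsACWithDeriv (Icc 0 ω) u v ∧
    MemLp v 2 (volume.restrict (Icc 0 ω)) ∧ u ω = Complex.exp (Complex.I * θ) * u 0 ∧
    (∀ᵐ x ∂(volume.restrict (Icc 0 ω)), p.1 x = u x) ∧
    ∀ᵐ x ∂(volume.restrict (Icc 0 ω)), p.2 x = v x + φ x * u x}
  zero_mem' := by
    refine ⟨fun _ => 0, fun _ => 0, ?_, MemLp.zero, by simp, ?_, ?_⟩
    · intro a _ b _; simp
    · exact Lp.coeFn_zero ℂ 2 _
    · filter_upwards [Lp.coeFn_zero ℂ 2 ((volume : Measure ℝ).restrict (Icc 0 ω))] with x hx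
      simpa only [Prod.snd_zero, mul_zero, add_zero, Pi.zero_apply] using hx
  add_mem' := by
    rintro p p' ⟨u, v, h1, h2, hb, h3, h4⟩ ⟨u', v', h1', h2', hb', h3', h4'⟩
    refine ⟨_, _, h1.add h1', h2.add h2', by rw [hb, hb']; ring, ?_, ?_⟩
    · filter_upwards [Lp.coeFn_add p.1 p'.1, h3, h3'] with x hx hx1 hx2
      simp only [Prod.fst_add, hx, Pi.add_apply, hx1, hx2]
    · filter_upwards [Lp.coeFn_add p.2 p'.2, h4, h4'] with x hx hx1 hx2
      simp only [Prod.snd_add, hx, Pi.add_apply, hx1, hx2]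
      ring
  smul_mem' := by
    rintro c p ⟨u, v, h1, h2, hb, h3, h4⟩
    refine ⟨_, _, h1.smul c, h2.const_mul c, by rw [hb]; ring, ?_, ?_⟩
    · filter_upwards [Lp.coeFn_smul c p.1, h3] with x hx hx1
      simp only [Prod.smul_fst, hx, Pi.smul_apply, hx1, smul_eq_mul]
    · filter_upwards [Lp.coeFn_smul c p.2, h4] with x hx hx1
      simp only [Prod.smul_snd, hx, Pi.smul_apply, hx1, smul_eq_mul]
      ring

/-- The operator `A_θ` in `L²([0, ω])`. -/
def cellOp (ω : ℝ) (φ : ℝ → ℝ) (θ : ℝ) : L2Cell ω →ₗ.[ℂ] L2Cell ω :=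
  (cellGraph ω φ θ).toLinearPMap

/-! ### Operations on unbounded operators -/

section Operators

variable {E F G : Type*} [NormedAddCommGroup E] [InnerProductSpace ℂ E]
  [NormedAddCommGroup F] [InnerProductSpace ℂ F] [NormedAddCommGroup G] [InnerProductSpace ℂ G]

/-- The graph of the product `B A` with its natural domain `{f ∈ dom A | A f ∈ dom B}`. -/
def compGraph (B : F →ₗ.[ℂ] G) (A : E →ₗ.[ℂ] F) : Submodule ℂ (E × G) where
  carrier := {p | ∃ w : F, (p.1, w) ∈ A.graph ∧ (w, p.2) ∈ B.graph}
  zero_mem' := ⟨0, A.graph.zero_mem, B.graph.zero_mem⟩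
  add_mem' := by
    rintro p p' ⟨w, h1, h2⟩ ⟨w', h1', h2'⟩
    exact ⟨w + w', A.graph.add_mem h1 h1', B.graph.add_mem h2 h2'⟩
  smul_mem' := by
    rintro c p ⟨w, h1, h2⟩
    exact ⟨c • w, A.graph.smul_mem c h1, B.graph.smul_mem c h2⟩

/-- The product `B A` with its natural domain `{f ∈ dom A | A f ∈ dom B}`. -/
def opComp (B : F →ₗ.[ℂ] G) (A : E →ₗ.[ℂ] F) : E →ₗ.[ℂ] G := (compGraph B A).toLinearPMap

/-- The graph of the block operator `(0 B; A 0)` in `E ⊕ F`: it maps `(f₁, f₂)` to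
`(B f₂, A f₁)`, with domain `dom A ⊕ dom B`. -/
def offDiagGraph (A : E →ₗ.[ℂ] F) (B : F →ₗ.[ℂ] E) :
    Submodule ℂ (WithLp 2 (E × F) × WithLp 2 (E × F)) where
  carrier := {p | (p.1.fst, p.2.snd) ∈ A.graph ∧ (p.1.snd, p.2.fst) ∈ B.graph}
  zero_mem' := ⟨A.graph.zero_mem, B.graph.zero_mem⟩
  add_mem' h h' := ⟨A.graph.add_mem h.1 h'.1, B.graph.add_mem h.2 h'.2⟩
  smul_mem' c _ h := ⟨A.graph.smul_mem c h.1, B.graph.smul_mem c h.2⟩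

/-- The block operator `(0 B; A 0)` in the Hilbert space `E ⊕ F`. -/
def offDiagOp (A : E →ₗ.[ℂ] F) (B : F →ₗ.[ℂ] E) : WithLp 2 (E × F) →ₗ.[ℂ] WithLp 2 (E × F) :=
  (offDiagGraph A B).toLinearPMap

/-- The unitary `U` transforms `H` into `S`, i.e. `S = U H U⁻¹` including domains. -/
def Intertwines (U : E ≃ₗᵢ[ℂ] F) (H : E →ₗ.[ℂ] E) (S : F →ₗ.[ℂ] F) : Prop :=
  ∀ f h : E, (f, h) ∈ H.graph ↔ (U f, U h) ∈ S.graph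

/-- The graph of the direct integral of a family of operators `H x` in a fixed Hilbert space. -/
def directIntegralGraph {X : Type*} [MeasurableSpace X] (μ : Measure X)
    (H : X → E →ₗ.[ℂ] E) : Submodule ℂ (Lp E 2 μ × Lp E 2 μ) where
  carrier := {p | ∀ᵐ x ∂μ, (p.1 x, p.2 x) ∈ (H x).graph}
  zero_mem' := by
    filter_upwards [Lp.coeFn_zero E 2 μ] with x hx
    simp only [Prod.fst_zero, Prod.snd_zero, hx]
    exact (H x).graph.zero_mem
  add_mem' := by
    intro p p' h h'
    change ∀ᵐ x ∂μ, ((p + p').1 x, (p + p').2 x) ∈ (H x).graph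
    filter_upwards [Lp.coeFn_add p.1 p'.1, Lp.coeFn_add p.2 p'.2, h, h'] with x h1 h2 h3 h4
    simp only [Prod.fst_add, Prod.snd_add, h1, h2]
    exact (H x).graph.add_mem h3 h4
  smul_mem' := by
    intro c p h
    change ∀ᵐ x ∂μ, ((c • p).1 x, (c • p).2 x) ∈ (H x).graph
    filter_upwards [Lp.coeFn_smul c p.1, Lp.coeFn_smul c p.2, h] with x h1 h2 h3
    simp only [Prod.smul_fst, Prod.smul_snd, h1, h2]
    exact (H x).graph.smul_mem c h3

/-- The direct integral `∫⊕ dμ(x) H x` in `L²(X, μ; E) = ∫⊕ dμ(x) E`: its domain consists of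
all square-integrable `f` with `f x ∈ dom (H x)` for a.e. `x` and `x ↦ H x (f x)` in
`L²(X, μ; E)`, and it acts fiberwise. -/
def directIntegral {X : Type*} [MeasurableSpace X] (μ : Measure X) (H : X → E →ₗ.[ℂ] E) :
    Lp E 2 μ →ₗ.[ℂ] Lp E 2 μ :=
  (directIntegralGraph μ H).toLinearPMap

/-! ### Spectral notions for self-adjoint operators -/

/-- The spectrum of the part of `H` in the reducing subspace `K`: the complement of the set of `z`
for which `H - z` maps the domain of that part bijectively onto `K` with bounded inverse. -/
def partSpectrum (H : E →ₗ.[ℂ] E) (K : Set E) : Set ℂ :=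
  {z | ¬ ((∀ g ∈ K, ∃! f, f ∈ K ∧ (f, z • f + g) ∈ H.graph) ∧
    ∃ C : ℝ, ∀ f ∈ K, ∀ g ∈ K, (f, z • f + g) ∈ H.graph → ‖f‖ ≤ C * ‖g‖)}

/-- The spectrum `σ(H)`. -/
def opSpectrum (H : E →ₗ.[ℂ] E) : Set ℂ := partSpectrum H univ

/-- The point spectrum `σ_p(H)`, i.e. the set of eigenvalues. -/
def pointSpectrum (H : E →ₗ.[ℂ] E) : Set ℂ := {z | ∃ f : E, f ≠ 0 ∧ (f, z • f) ∈ H.graph}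

/-- `μ` is the spectral measure `d(f, E_H(λ) f)` of the self-adjoint operator `H` at `f`: the finite
Borel measure whose Stieltjes transform is `z ↦ (f, (H - z)⁻¹ f)`, `z ∈ ℂ \ ℝ`. -/
def IsSpectralMeasure (H : E →ₗ.[ℂ] E) (f : E) (μ : Measure ℝ) : Prop :=
  IsFiniteMeasure μ ∧ ∀ z : ℂ, z.im ≠ 0 → ∃ u : E, (u, z • u + f) ∈ H.graph ∧
    inner ℂ f u = ∫ t : ℝ, ((t : ℂ) - z)⁻¹ ∂μ

/-- The absolutely continuous subspace of `H`. -/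
def acSubspace (H : E →ₗ.[ℂ] E) : Set E :=
  {f | ∃ μ : Measure ℝ, IsSpectralMeasure H f μ ∧ μ ≪ volume}

/-- The singular continuous subspace of `H`. -/
def scSubspace (H : E →ₗ.[ℂ] E) : Set E :=
  {f | ∃ μ : Measure ℝ, IsSpectralMeasure H f μ ∧ μ ⟂ₘ volume ∧ ∀ t : ℝ, μ {t} = 0}

/-- The singular continuous spectrum `σ_sc(H)`. -/
def scSpectrum (H : E →ₗ.[ℂ] E) : Set ℂ := partSpectrum H (scSubspace H)

/-- `H` is purely absolutely continuous: its absolutely continuous subspace is everything. -/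
def IsPurelyAC (H : E →ₗ.[ℂ] E) : Prop := acSubspace H = univ

end Operators

/-- The graph of multiplication by the independent variable in `L²(ℝ, μ; ℂⁿ)`. -/
def mulGraph (n : ℕ) (μ : Measure ℝ) :
    Submodule ℂ (Lp (EuclideanSpace ℂ (Fin n)) 2 μ × Lp (EuclideanSpace ℂ (Fin n)) 2 μ) where
  carrier := {p | ∀ᵐ t ∂μ, p.2 t = (t : ℂ) • p.1 t}
  zero_mem' := by
    filter_upwards [Lp.coeFn_zero (EuclideanSpace ℂ (Fin n)) 2 μ] with t ht
    simp only [Prod.fst_zero, Prod.snd_zero, ht, Pi.zero_apply, smul_zero]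
  add_mem' := by
    intro p p' h h'
    change ∀ᵐ t ∂μ, (p + p').2 t = (t : ℂ) • (p + p').1 t
    filter_upwards [Lp.coeFn_add p.1 p'.1, Lp.coeFn_add p.2 p'.2, h, h'] with x h1 h2 h3 h4
    simp only [Prod.fst_add, Prod.snd_add, h1, h2, Pi.add_apply, h3, h4, smul_add]
  smul_mem' := by
    intro c p h
    change ∀ᵐ t ∂μ, (c • p).2 t = (t : ℂ) • (c • p).1 t
    filter_upwards [Lp.coeFn_smul c p.1, Lp.coeFn_smul c p.2, h] with x h1 h2 h3
    simp only [Prod.smul_fst, Prod.smul_snd, h1, h2, Pi.smul_apply, h3]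
    exact smul_comm _ _ _

/-- The maximal operator of multiplication by the independent variable in `L²(ℝ, μ; ℂⁿ)`. -/
def mulOp (n : ℕ) (μ : Measure ℝ) :
    Lp (EuclideanSpace ℂ (Fin n)) 2 μ →ₗ.[ℂ] Lp (EuclideanSpace ℂ (Fin n)) 2 μ :=
  (mulGraph n μ).toLinearPMap

/-- `H` has uniform spectral multiplicity `n`: it is unitarily equivalent to the multiplication by
the independent variable in `L²(ℝ, μ; ℂⁿ)` for some Borel measure `μ`. -/
def HasUniformMultiplicity {E : Type*} [NormedAddCommGroup E] [InnerProductSpace ℂ E]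
    (H : E →ₗ.[ℂ] E) (n : ℕ) : Prop :=
  ∃ μ : Measure ℝ, SigmaFinite μ ∧
    ∃ U : E ≃ₗᵢ[ℂ] Lp (EuclideanSpace ℂ (Fin n)) 2 μ, Intertwines U H (mulOp n μ)

/-- `S` is a union of nondegenerate compact intervals, any two of which have at most an endpoint in
common, that are ordered like `ℤ` and accumulate at `+∞` and `-∞` (and nowhere else). -/
def IsTwoSidedBandUnion (S : Set ℝ) : Prop :=
  ∃ a b : ℤ → ℝ, (∀ n, a n < b n ∧ b n ≤ a (n + 1)) ∧
    Tendsto a atTop atTop ∧ Tendsto a atBot atBot ∧ S = ⋃ n, Icc (a n) (b n)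

/-- `S` is a union of nondegenerate compact intervals, any two of which have at most an endpoint in
common, that are ordered like `ℕ` and accumulate at `+∞` (and nowhere else). -/
def IsOneSidedBandUnion (S : Set ℝ) : Prop :=
  ∃ a b : ℕ → ℝ, (∀ n, a n < b n ∧ b n ≤ a (n + 1)) ∧
    Tendsto a atTop atTop ∧ S = ⋃ n, Icc (a n) (b n)

/-! ### The periodic operators -/

/-- `T₁ = A* A`. -/
def opT1 (φ : ℝ → ℝ) : L2Line →ₗ.[ℂ] L2Line := opComp (lineOp φ)† (lineOp φ)

/-- `T₂ = A A*`. -/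
def opT2 (φ : ℝ → ℝ) : L2Line →ₗ.[ℂ] L2Line := opComp (lineOp φ) (lineOp φ)†

/-- The Dirac-type operator `D = (0 A*; A 0)` in `L²(ℝ) ⊕ L²(ℝ)`. -/
def diracOp (φ : ℝ → ℝ) : WithLp 2 (L2Line × L2Line) →ₗ.[ℂ] WithLp 2 (L2Line × L2Line) :=
  offDiagOp (lineOp φ) (lineOp φ)†

/-- The reduced Dirac-type operator `D_θ = (0 A_θ*; A_θ 0)` in `L²([0, ω]) ⊕ L²([0, ω])`. -/
def diracFiber (ω : ℝ) (φ : ℝ → ℝ) (θ : ℝ) :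
    WithLp 2 (L2Cell ω × L2Cell ω) →ₗ.[ℂ] WithLp 2 (L2Cell ω × L2Cell ω) :=
  offDiagOp (cellOp ω φ θ) (cellOp ω φ θ)†

/-- The measure `dθ / (2π)` on `[0, 2π]`. -/
def floquetMeasure : Measure ℝ :=
  ENNReal.ofReal (2 * Real.pi)⁻¹ • (volume : Measure ℝ).restrict (Icc 0 (2 * Real.pi))

/-- The Floquet sum `∑ₙ e^{-inθ} f(x + nω)`. -/
def floquetSum (ω : ℝ) (f : ℝ → ℂ) (θ x : ℝ) : ℂ :=
  ∑' n : ℤ, Complex.exp (-Complex.I * n * θ) * f (x + n * ω)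

/-- `V` realizes the direct integral decomposition
`L²(ℝ)² ≃ (2π)⁻¹ ∫⊕_{[0, 2π]} dθ L²([0, ω])²`: it is the Floquet transform, given on (pairs of)
functions vanishing outside a bounded set by the (then finite) Floquet sums. -/
def IsFloquetTransform (ω : ℝ)
    (V : WithLp 2 (L2Line × L2Line) ≃ₗᵢ[ℂ] Lp (WithLp 2 (L2Cell ω × L2Cell ω)) 2 floquetMeasure) :
    Prop :=
  ∀ f : WithLp 2 (L2Line × L2Line),
    (∃ R : ℝ, ∀ᵐ x, R < |x| → f.fst x = 0 ∧ f.snd x = 0) →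
    ∀ᵐ θ ∂floquetMeasure, ∀ᵐ x ∂((volume : Measure ℝ).restrict (Icc 0 ω)),
      (V f θ).fst x = floquetSum ω f.fst θ x ∧ (V f θ).snd x = floquetSum ω f.snd θ x

end

/-!
The potential `φ` comes from a positive Floquet solution. A periodic distribution in `H⁻¹_loc` is of
the form `β + α'` with periodic `α, β ∈ L²_loc` (`MemHNegOneLoc.exists_periodic_repr`), and the
equation `T y = 0` becomes the first order system `u' = α u + w`, `w' = κ u - α w` with
`κ = β - α²`, whose solutions are absolutely continuous. Nonnegativity of the form excludes
nontrivial solutions with two zeros (`eq_zero_of_two_zeros`), hence the monodromy matrix has trace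
at least `2`, there is a positive solution with a positive Floquet multiplier, and `r = w / u` is a
periodic solution of a Riccati equation (`exists_periodic_riccati`), for which `φ = -α - r` is as
required. In order to pass from `T ≥ 0`, a statement on the domain of the operator, to nonnegativity
of the form, the construction is first carried out for `q + C` with a large constant `C`, where the
form is nonnegative because `q` is relatively bounded; this exhibits `T + C` as a product `A* A`,
whose domain is dense in the form domain, so that the form of `T` is nonnegative and the construction
applies to `q` itself (`exists_isPeriodicMiura_of_repr`).

For locally uniformly square integrable `φ` the operators `A = d/dx + φ` and `-d/dx + φ` on `H¹(ℝ)`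
are adjoint to one another (`IsUnifLocL2.isAdjointPair`), and so are their analogues on the period
cell with quasi-periodic boundary conditions (`isAdjointPair_cellOp`). Consequently the off-diagonal
block operators and the products `A* A`, `A A*` are self-adjoint (von Neumann), and integration by
parts in the form identifies `T` with `A* A` (`schrodingerOp_eq_opT1`). Since `A A*` is the
operator `A* A` for `-φ` (`IsUnifLocL2.opT2_eq_opT1_neg`), the assertions on it need no separate
proof.

The Floquet transform is the composition of two decompositions of Hilbert spaces: `L²(ℝ)²` is the
Hilbert sum of the spaces `L²([n ω, (n + 1) ω])²`, and `L²([0, 2π]; X)` is the Hilbert sum of its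
Fourier modes. It carries elements of the graph of `D` to sections that lie in the graph of `D_τ` for
almost every `τ`; as `D` is self-adjoint and the direct integral of the `D_τ` is symmetric, the
inclusion of graphs is an equality (`intertwines_floquetEquiv`).

In the fibre over `τ` with `sin τ ≠ 0` the eigenvalues of `D_τ` are the solutions `s` of
`Δ(s) = 2 cos τ`, where the discriminant `Δ` is the trace of the monodromy matrix of the system
`A u = s v`, `A* v = s u`, and the eigenvectors are the Bloch solutions. These are complete, since
`A_τ* A_τ` has a compact inverse (`eq_zero_of_inner_cellU`, `eq_zero_of_inner_cellV`). The
quasi-momentum `θ(s) = arccos (Δ(s) / 2)` has nonzero derivative wherever it lies in `(0, π)`,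
because Green's formula expresses the derivative by the norm of a Bloch solution
(`exists_hasDerivAt_quasi`). By Rolle's theorem it is injective on each component of `{|Δ| < 2}`, a
band. By completeness it takes the value `π / 2` infinitely often (`infinite_quasi`), and the points
where it does so cannot accumulate. Hence the bands form a sequence that tends to infinity, and `θ`
maps each of them bijectively onto `(0, π)` (`exists_quasi_bands`).

The substitution `τ = θ(s)` on `(0, π)`, and `τ = 2π - θ(s)` on `(π, 2π)`, turns the Fourier
coefficients with respect to the eigenvectors of the fibres into functions of the spectral parameter
`s` on the bands. By Parseval's identity in the fibres this is a unitary map onto `L²(S; ℂ²)`, `S`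
the union of the open bands, and it carries the operator to multiplication by the independent
variable (`BandSystem.exists_intertwines`). The two components correspond to the two half periods;
this is the source of the multiplicity two. The argument applies to `D`
(`exists_intertwines_diracOp`), and, with spectral parameter `s²` and the first components of the
Bloch solutions, to `A* A` (`exists_intertwines_opT1`). The remaining spectral assertions are
properties of multiplication operators on `L²(S; ℂ²)`, transported by the unitary map
(`Intertwines.spectral_consequences`); there the spectral measures, given by their Stieltjes
transforms, are identified by Stieltjes inversion.
-/


noncomputable section

/-! ### Calculus of absolutely continuous functions -/

theorem AbsolutelyContinuousOnInterval.of_dist_le {X Y : Type*} [PseudoMetricSpace X]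
    [PseudoMetricSpace Y] {f : ℝ → X} {g : ℝ → Y} {a b : ℝ} (L : ℝ)
    (hf : AbsolutelyContinuousOnInterval f a b)
    (h : ∀ x ∈ uIcc a b, ∀ y ∈ uIcc a b, dist (g x) (g y) ≤ L * dist (f x) (f y)) :
    AbsolutelyContinuousOnInterval g a b := by
  unfold AbsolutelyContinuousOnInterval at hf ⊢
  apply squeeze_zero' ?_ ?_ (by simpa using hf.const_mul L)
  · exact Eventually.of_forall fun _ => Finset.sum_nonneg fun i _ => dist_nonneg
  rw [eventually_inf_principal]
  filter_upwards with (n, I) hnI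
  simp only [Finset.mul_sum]
  gcongr with i hi
  exact h _ (hnI.1 i hi).1 _ (hnI.1 i hi).2

/-- The complex version of the absolute continuity of a primitive, from the real and imaginary parts. -/
theorem IntervalIntegrable.absolutelyContinuousOnInterval_complex {v : ℝ → ℂ} {p q : ℝ}
    (h : IntervalIntegrable v volume p q) :
    AbsolutelyContinuousOnInterval (fun x => ∫ t in p..x, v t) p q := by
  have hre : IntervalIntegrable (fun x => (v x).re) volume p q :=
    ⟨h.1.re, h.2.re⟩
  have him : IntervalIntegrable (fun x => (v x).im) volume p q :=
    ⟨h.1.im, h.2.im⟩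
  have h1 := hre.absolutelyContinuousOnInterval_intervalIntegral (c := p) left_mem_uIcc
  have h2 := him.absolutelyContinuousOnInterval_intervalIntegral (c := p) left_mem_uIcc
  have c1 : AbsolutelyContinuousOnInterval (fun _ : ℝ => (1 : ℂ)) p q :=
    (LipschitzOnWith.absolutelyContinuousOnInterval (K := 0) (LipschitzWith.const (1 : ℂ)).lipschitzOnWith)
  have c2 : AbsolutelyContinuousOnInterval (fun _ : ℝ => Complex.I) p q :=
    (LipschitzOnWith.absolutelyContinuousOnInterval (K := 0) (LipschitzWith.const Complex.I).lipschitzOnWith)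
  refine AbsolutelyContinuousOnInterval.of_dist_le 1 ((h1.smul c1).add (h2.smul c2)) ?_
  have key : ∀ x ∈ uIcc p q, (∫ t in p..x, v t) =
      ((∫ t in p..x, (v t).re) • (1 : ℂ) + (∫ t in p..x, (v t).im) • Complex.I) := by
    intro x hx
    have hvx : IntervalIntegrable v volume p x := h.mono_set (uIcc_subset_uIcc_left hx)
    have e1 : (∫ t in p..x, v t).re = ∫ t in p..x, (v t).re :=
      (Complex.reCLM.intervalIntegral_comp_comm hvx).symm
    have e2 : (∫ t in p..x, v t).im = ∫ t in p..x, (v t).im :=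
      (Complex.imCLM.intervalIntegral_comp_comm hvx).symm
    apply Complex.ext
    · simp [e1]
    · simp [e2]
  intro x hx y hy
  simp only [Pi.add_apply, Pi.smul_apply', one_mul]
  rw [key x hx, key y hy]

namespace IsACWithDeriv

variable {I : Set ℝ} {u v a b : ℝ → ℂ}

theorem mono {J : Set ℝ} (h : IsACWithDeriv I u v) (hJ : J ⊆ I) : IsACWithDeriv J u v :=
  fun p hp q hq => h p (hJ hp) q (hJ hq)

theorem absolutelyContinuousOnInterval {p q : ℝ} (h : IsACWithDeriv (uIcc p q) u v) :
    AbsolutelyContinuousOnInterval u p q := by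
  refine AbsolutelyContinuousOnInterval.of_dist_le 1
    (h p left_mem_uIcc q right_mem_uIcc).1.absolutelyContinuousOnInterval_complex ?_
  intro x hx y hy
  have e : ∀ z ∈ uIcc p q, u z = u p + ∫ t in p..z, v t := by
    intro z hz
    rw [← (h p left_mem_uIcc z hz).2]; ring
  rw [e x hx, e y hy, dist_add_left, one_mul]

theorem ae_hasDerivAt {p q : ℝ} (h : IsACWithDeriv (uIcc p q) u v) :
    ∀ᵐ x, x ∈ uIcc p q → HasDerivAt u (v x) x := by
  have h1 := (h p left_mem_uIcc q right_mem_uIcc).1.ae_hasDerivAt_integral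
  have hp : ∀ᵐ x : ℝ, x ≠ p := by simp [ae_iff, measure_singleton]
  have hq : ∀ᵐ x : ℝ, x ≠ q := by simp [ae_iff, measure_singleton]
  filter_upwards [h1, hp, hq] with x hx hxp hxq hmem
  have h2 := (hx hmem p left_mem_uIcc).const_add (u p)
  refine h2.congr_of_eventuallyEq ?_
  have : uIcc p q ∈ 𝓝 x := by
    rcases le_total p q with hpq | hpq
    · rw [uIcc_of_le hpq] at hmem ⊢
      exact Icc_mem_nhds (lt_of_le_of_ne hmem.1 (Ne.symm hxp)) (lt_of_le_of_ne hmem.2 hxq)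
    · rw [uIcc_of_ge hpq] at hmem ⊢
      exact Icc_mem_nhds (lt_of_le_of_ne hmem.1 (Ne.symm hxq)) (lt_of_le_of_ne hmem.2 hxp)
  filter_upwards [this] with z hz
  rw [← (h p left_mem_uIcc z hz).2]; ring

/-- An absolutely continuous function whose derivative is a.e. equal to `v` is the primitive
of `v`. -/
theorem of_ae_hasDerivAt
    (hac : ∀ p ∈ I, ∀ q ∈ I, AbsolutelyContinuousOnInterval u p q)
    (hint : ∀ p ∈ I, ∀ q ∈ I, IntervalIntegrable v volume p q)
    (hder : ∀ p ∈ I, ∀ q ∈ I, ∀ᵐ x, x ∈ uIcc p q → HasDerivAt u (v x) x) :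
    IsACWithDeriv I u v := by
  intro p hp q hq
  refine ⟨hint p hp q hq, ?_⟩
  have h1 := (hint p hp q hq).absolutelyContinuousOnInterval_complex
  have h2 := (hac p hp q hq).sub h1
  obtain ⟨C, hC⟩ := h2.const_of_ae_hasDerivAt_zero (by
    filter_upwards [hder p hp q hq, (hint p hp q hq).ae_hasDerivAt_integral] with x hx1 hx2 hx
    convert! (hx1 hx).sub (hx2 hx p left_mem_uIcc) using 1
    simp)
  have e1 := hC p left_mem_uIcc
  have e2 := hC q right_mem_uIcc
  simp only [Pi.sub_apply, intervalIntegral.integral_same, sub_zero] at e1 e2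
  rw [← e2] at e1
  rw [e1]; ring

theorem restrict_uIcc (h : IsACWithDeriv I u v) (hI : I.OrdConnected) {p q : ℝ} (hp : p ∈ I)
    (hq : q ∈ I) : IsACWithDeriv (uIcc p q) u v := h.mono (hI.uIcc_subset hp hq)

theorem continuousOn_uIcc {p q : ℝ} (h : IsACWithDeriv (uIcc p q) u v) :
    ContinuousOn u (uIcc p q) := h.absolutelyContinuousOnInterval.continuousOn

theorem continuous (h : IsACWithDeriv univ u v) : Continuous u := by
  rw [continuous_iff_continuousAt]
  intro x
  have h1 := (h.mono (subset_univ (uIcc (x - 1) (x + 1)))).continuousOn_uIcc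
  refine h1.continuousAt ?_
  rw [uIcc_of_le (by linarith)]
  exact Icc_mem_nhds (by linarith) (by linarith)

theorem continuousOn_Icc {p q : ℝ} (h : IsACWithDeriv (Icc p q) u v) :
    ContinuousOn u (Icc p q) := by
  rcases le_or_gt p q with hpq | hpq
  · rw [← uIcc_of_le hpq] at h ⊢
    exact h.continuousOn_uIcc
  · rw [Icc_eq_empty (not_le.2 hpq)]; exact continuousOn_empty _

theorem mul (h : IsACWithDeriv I u v) (h' : IsACWithDeriv I a b) (hI : I.OrdConnected) :
    IsACWithDeriv I (fun x => u x * a x) (fun x => v x * a x + u x * b x) := by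
  refine of_ae_hasDerivAt ?_ ?_ ?_
  · intro p hp q hq
    exact (h.restrict_uIcc hI hp hq).absolutelyContinuousOnInterval.smul
      (h'.restrict_uIcc hI hp hq).absolutelyContinuousOnInterval
  · intro p hp q hq
    exact ((h p hp q hq).1.mul_continuousOn (h'.restrict_uIcc hI hp hq).continuousOn_uIcc).add
      ((h' p hp q hq).1.continuousOn_mul (h.restrict_uIcc hI hp hq).continuousOn_uIcc)
  · intro p hp q hq
    filter_upwards [(h.restrict_uIcc hI hp hq).ae_hasDerivAt,
      (h'.restrict_uIcc hI hp hq).ae_hasDerivAt] with x h1 h2 hx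
    exact (h1 hx).mul (h2 hx)

theorem conj (h : IsACWithDeriv I u v) :
    IsACWithDeriv I (fun x => starRingEnd ℂ (u x)) (fun x => starRingEnd ℂ (v x)) := by
  intro p hp q hq
  obtain ⟨h1, h2⟩ := h p hp q hq
  have h3 : IntervalIntegrable (fun x => starRingEnd ℂ (v x)) volume p q :=
    ⟨Complex.conjCLE.integrable_comp_iff.2 h1.1, Complex.conjCLE.integrable_comp_iff.2 h1.2⟩
  refine ⟨h3, ?_⟩
  rw [← map_sub, h2]
  exact (Complex.conjCLE.toContinuousLinearMap.intervalIntegral_comp_comm h1).symm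

theorem neg (h : IsACWithDeriv I u v) :
    IsACWithDeriv I (fun x => - u x) (fun x => - v x) := by
  simpa using h.smul (-1)

theorem sub (h : IsACWithDeriv I u v) (h' : IsACWithDeriv I a b) :
    IsACWithDeriv I (fun x => u x - a x) (fun x => v x - b x) := by
  simpa [sub_eq_add_neg] using h.add h'.neg

theorem const (I : Set ℝ) (c : ℂ) : IsACWithDeriv I (fun _ => c) (fun _ => 0) := by
  intro p _ q _
  simp

theorem congr_deriv {w : ℝ → ℂ} (h : IsACWithDeriv I u v) (hI : I.OrdConnected)
    (hw : ∀ᵐ x, x ∈ I → v x = w x) : IsACWithDeriv I u w := by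
  intro p hp q hq
  obtain ⟨h1, h2⟩ := h p hp q hq
  have e : ∀ᵐ x, x ∈ uIoc p q → v x = w x := by
    filter_upwards [hw] with x hx hxm
    exact hx (hI.uIcc_subset hp hq (uIoc_subset_uIcc hxm))
  refine ⟨h1.congr_ae ((ae_restrict_iff' measurableSet_uIoc).2 e), ?_⟩
  rw [h2, intervalIntegral.integral_congr_ae e]

theorem congr {w : ℝ → ℂ} (h : IsACWithDeriv I u v) (hw : ∀ x ∈ I, u x = w x) :
    IsACWithDeriv I w v := by
  intro p hp q hq
  rw [← hw p hp, ← hw q hq]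
  exact h p hp q hq

theorem exp (h : IsACWithDeriv I u v) (hI : I.OrdConnected) :
    IsACWithDeriv I (fun x => Complex.exp (u x)) (fun x => Complex.exp (u x) * v x) := by
  refine of_ae_hasDerivAt ?_ ?_ ?_
  · intro p hp q hq
    have h1 := (h.restrict_uIcc hI hp hq).absolutelyContinuousOnInterval
    obtain ⟨R, hR⟩ := h1.exists_bound
    refine AbsolutelyContinuousOnInterval.of_dist_le (Real.exp R) h1 ?_
    intro x hx y hy
    rw [dist_comm, dist_comm (u x), dist_eq_norm, dist_eq_norm]
    refine (convex_closedBall (0 : ℂ) R).norm_image_sub_le_of_norm_deriv_le (𝕜 := ℂ) ?_ ?_ ?_ ?_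
    · exact fun z _ => Complex.differentiableAt_exp
    · intro z hz
      rw [Complex.deriv_exp, Complex.norm_exp]
      gcongr
      exact (Complex.re_le_norm z).trans (by simpa using hz)
    · simpa using hR x hx
    · simpa using hR y hy
  · intro p hp q hq
    exact (h p hp q hq).1.continuousOn_mul
      (Complex.continuous_exp.comp_continuousOn (h.restrict_uIcc hI hp hq).continuousOn_uIcc)
  · intro p hp q hq
    filter_upwards [(h.restrict_uIcc hI hp hq).ae_hasDerivAt] with x h1 hx
    exact (h1 hx).cexp

theorem of_hasDerivAt (h : ∀ x, HasDerivAt u (v x) x) (hv : Continuous v) (I : Set ℝ) :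
    IsACWithDeriv I u v := by
  intro p _ q _
  exact ⟨hv.intervalIntegrable p q,
    (intervalIntegral.integral_eq_sub_of_hasDerivAt (fun x _ => h x)
      (hv.intervalIntegrable p q)).symm⟩

theorem primitive (hv : ∀ p q, IntervalIntegrable v volume p q) (c : ℝ) (I : Set ℝ) :
    IsACWithDeriv I (fun x => ∫ t in c..x, v t) v := by
  intro p _ q _
  exact ⟨hv p q, intervalIntegral.integral_interval_sub_left (hv c q) (hv c p)⟩

theorem comp_add_right (h : IsACWithDeriv univ u v) (c : ℝ) :
    IsACWithDeriv univ (fun x => u (x + c)) (fun x => v (x + c)) := by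
  intro p _ q _
  obtain ⟨h1, h2⟩ := h (p + c) trivial (q + c) trivial
  refine ⟨by simpa using h1.comp_add_right c, ?_⟩
  rw [h2, intervalIntegral.integral_comp_add_right]

theorem intervalIntegrable (h : IsACWithDeriv univ u v) (p q : ℝ) :
    IntervalIntegrable v volume p q := (h p trivial q trivial).1

theorem eq_of_deriv_zero (h : IsACWithDeriv I u (fun _ => 0)) {p q : ℝ} (hp : p ∈ I) (hq : q ∈ I) :
    u p = u q := by
  have := (h q hq p hp).2
  simpa [sub_eq_zero] using this

end IsACWithDeriv

theorem isACWithDeriv_test (f : TestC) (I : Set ℝ) : IsACWithDeriv I f (derivTest f) := by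
  refine IsACWithDeriv.of_hasDerivAt (fun x => ?_) (derivTest f).continuous I
  exact (f.contDiff.differentiable (by simp) x).hasDerivAt

/-! ### Closed operators in Hilbert spaces -/

theorem Submodule.le_topologicalClosure_of_orthogonal {H : Type*} [NormedAddCommGroup H]
    [InnerProductSpace ℂ H] [CompleteSpace H] {K' K : Submodule ℂ H} (hK : IsClosed (K : Set H))
    (hle : K' ≤ K) (h : ∀ x ∈ K, (∀ y ∈ K', inner ℂ y x = 0) → x = 0) :
    K ≤ K'.topologicalClosure := by
  intro x hx
  obtain ⟨y, hy, z, hz, rfl⟩ := K'.topologicalClosure.exists_add_mem_mem_orthogonal x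
  have hyK : y ∈ K := K'.topologicalClosure_minimal hle hK hy
  have hzK : z ∈ K := by simpa using K.sub_mem hx hyK
  have : z = 0 := h z hzK fun w hw =>
    (Submodule.mem_orthogonal _ _).1 hz w (K'.le_topologicalClosure hw)
  simpa [this] using hy

section Operators

variable {E F : Type*} [NormedAddCommGroup E] [InnerProductSpace ℂ E]
  [NormedAddCommGroup F] [InnerProductSpace ℂ F]

/-- `A` and `B` are densely defined and adjoint to each other. -/
structure IsAdjointPair [CompleteSpace E] [CompleteSpace F] (A : E →ₗ.[ℂ] F) (B : F →ₗ.[ℂ] E) :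
    Prop where
  dense_left : Dense (A.domain : Set E)
  dense_right : Dense (B.domain : Set F)
  adjoint_left : A† = B
  adjoint_right : B† = A

theorem graph_offDiagOp (A : E →ₗ.[ℂ] F) (B : F →ₗ.[ℂ] E) :
    (offDiagOp A B).graph = offDiagGraph A B := by
  refine Submodule.toLinearPMap_graph_eq _ ?_
  rintro ⟨x, y⟩ ⟨h1, h2⟩ (hx : x = 0)
  subst hx
  have e1 : y.snd = 0 := A.graph_fst_eq_zero_snd h1 rfl
  have e2 : y.fst = 0 := B.graph_fst_eq_zero_snd h2 rfl
  exact WithLp.ofLp_injective 2 (Prod.ext e2 e1)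

theorem graph_opComp {G : Type*} [NormedAddCommGroup G] [InnerProductSpace ℂ G]
    (B : F →ₗ.[ℂ] G) (A : E →ₗ.[ℂ] F) : (opComp B A).graph = compGraph B A := by
  refine Submodule.toLinearPMap_graph_eq _ ?_
  rintro ⟨x, y⟩ ⟨w, h1, h2⟩ (hx : x = 0)
  exact B.graph_fst_eq_zero_snd h2 (A.graph_fst_eq_zero_snd h1 hx)

theorem mem_graph_opComp {G : Type*} [NormedAddCommGroup G] [InnerProductSpace ℂ G]
    {B : F →ₗ.[ℂ] G} {A : E →ₗ.[ℂ] F} {f : E} {h : G} :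
    (f, h) ∈ (opComp B A).graph ↔ ∃ w : F, (f, w) ∈ A.graph ∧ (w, h) ∈ B.graph := by
  rw [graph_opComp]; rfl

theorem mem_graph_offDiagOp {A : E →ₗ.[ℂ] F} {B : F →ₗ.[ℂ] E} {f h : WithLp 2 (E × F)} :
    (f, h) ∈ (offDiagOp A B).graph ↔ (f.fst, h.snd) ∈ A.graph ∧ (f.snd, h.fst) ∈ B.graph := by
  rw [graph_offDiagOp]; rfl

/-- A positive symmetric operator `T` is self-adjoint as soon as `1 + T` is onto. -/
theorem isSelfAdjoint_of_surjective_one_add [CompleteSpace E] {T : E →ₗ.[ℂ] E}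
    (hsymm : ∀ f h g k : E, (f, h) ∈ T.graph → (g, k) ∈ T.graph → inner ℂ h g = inner ℂ f k)
    (hpos : ∀ f h : E, (f, h) ∈ T.graph → 0 ≤ (inner ℂ h f).re)
    (hsurj : ∀ f : E, ∃ u, (u, f - u) ∈ T.graph) : IsSelfAdjoint T := by
  have hd : Dense (T.domain : Set E) := by
    rw [Submodule.dense_iff_topologicalClosure_eq_top, Submodule.topologicalClosure_eq_top_iff,
      Submodule.eq_bot_iff]
    intro h hh
    obtain ⟨u, hu⟩ := hsurj h
    have h1 : inner ℂ h u = 0 :=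
      inner_eq_zero_symm.1 ((Submodule.mem_orthogonal _ _).1 hh u (LinearPMap.mem_domain_of_mem_graph hu))
    have h2 := hpos _ _ hu
    rw [inner_sub_left, h1, zero_sub, Complex.neg_re, inner_self_eq_norm_sq_to_K] at h2
    have h3 : ‖u‖ = 0 := by
      have h4 : 0 ≤ -(‖u‖ ^ 2) := by exact_mod_cast h2
      nlinarith [norm_nonneg u, sq_nonneg ‖u‖]
    have hu0 : u = 0 := norm_eq_zero.1 h3
    subst hu0
    simpa using T.graph_fst_eq_zero_snd hu rfl
  rw [LinearPMap.isSelfAdjoint_def]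
  apply LinearPMap.eq_of_eq_graph
  rw [LinearPMap.adjoint_graph_eq_graph_adjoint hd]
  ext ⟨g, k⟩
  rw [Submodule.mem_adjoint_iff]
  constructor
  · intro hgk
    obtain ⟨u, hu⟩ := hsurj (g + k)
    have hgu : g - u = 0 := by
      obtain ⟨f, hf⟩ := hsurj (g - u)
      have e1 := hgk _ _ hf
      have e2 := hsymm _ _ _ _ hf hu
      simp only at e1
      have : inner ℂ (g - u) (g - u) = 0 := by
        have e3 : inner ℂ (g - u) (g - u) = inner ℂ (g - u - f) g - inner ℂ (g - u - f) u
            + inner ℂ f (g - u) := by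
          rw [← inner_sub_right, ← inner_add_left]; congr 1; abel
        rw [e3, e2, sub_eq_zero.1 e1, ← inner_sub_right, ← inner_add_right]
        convert! inner_zero_right f using 2
        abel
      exact inner_self_eq_zero.1 this
    have hgu' : u = g := (sub_eq_zero.1 hgu).symm
    subst hgu'
    simpa using hu
  · intro hgk a b hab
    rw [hsymm _ _ _ _ hab hgk, sub_self]

namespace IsAdjointPair

variable [CompleteSpace E] [CompleteSpace F] {A : E →ₗ.[ℂ] F} {B : F →ₗ.[ℂ] E}

theorem symm (h : IsAdjointPair A B) : IsAdjointPair B A :=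
  ⟨h.dense_right, h.dense_left, h.adjoint_right, h.adjoint_left⟩

theorem mem_right_iff (h : IsAdjointPair A B) {x : F × E} :
    x ∈ B.graph ↔ ∀ a b, (a, b) ∈ A.graph → inner ℂ b x.1 - inner ℂ a x.2 = 0 := by
  rw [← h.adjoint_left, LinearPMap.adjoint_graph_eq_graph_adjoint h.dense_left,
    Submodule.mem_adjoint_iff]

theorem inner_eq (h : IsAdjointPair A B) {f h' : E} {g k : F} (h1 : (f, g) ∈ A.graph)
    (h2 : (k, h') ∈ B.graph) : inner ℂ g k = inner ℂ f h' :=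
  sub_eq_zero.1 (h.mem_right_iff.1 h2 _ _ h1)

theorem isClosed_right (h : IsAdjointPair A B) : IsClosed (B.graph : Set (F × E)) := by
  rw [← h.adjoint_left]
  exact LinearPMap.adjoint_isClosed h.dense_left

theorem isClosed_left (h : IsAdjointPair A B) : IsClosed (A.graph : Set (E × F)) :=
  h.symm.isClosed_right

/-- The block operator of two mutually adjoint operators is self-adjoint: testing an element of the
domain of its adjoint against `(f, 0)` and `(0, g)` separates the two components. -/
theorem isSelfAdjoint_offDiagOp (h : IsAdjointPair A B) : IsSelfAdjoint (offDiagOp A B) := by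
  have hdom : ∀ f : WithLp 2 (E × F), f ∈ (offDiagOp A B).domain ↔
      f.fst ∈ A.domain ∧ f.snd ∈ B.domain := by
    intro f
    simp only [LinearPMap.mem_domain_iff, mem_graph_offDiagOp]
    constructor
    · rintro ⟨y, h1, h2⟩
      exact ⟨⟨_, h1⟩, ⟨_, h2⟩⟩
    · rintro ⟨⟨y, h1⟩, ⟨z, h2⟩⟩
      exact ⟨WithLp.toLp 2 (z, y), h1, h2⟩
  have hd : Dense ((offDiagOp A B).domain : Set (WithLp 2 (E × F))) := by
    have h1 := h.dense_left.prod h.dense_right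
    have h2 := h1.preimage (WithLp.homeomorphProd 2 E F).isOpenMap
    convert! h2 using 1
    ext f
    exact hdom f
  rw [LinearPMap.isSelfAdjoint_def]
  apply LinearPMap.eq_of_eq_graph
  rw [LinearPMap.adjoint_graph_eq_graph_adjoint hd]
  ext ⟨g, k⟩
  rw [Submodule.mem_adjoint_iff, mem_graph_offDiagOp]
  constructor
  · intro H
    constructor
    · rw [h.symm.mem_right_iff]
      intro a b hab
      have := H (WithLp.toLp 2 (0, a)) (WithLp.toLp 2 (b, 0))
        (mem_graph_offDiagOp.2 ⟨A.graph.zero_mem, hab⟩)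
      simpa [WithLp.prod_inner_apply] using this
    · rw [h.mem_right_iff]
      intro a b hab
      have := H (WithLp.toLp 2 (a, 0)) (WithLp.toLp 2 (0, b))
        (mem_graph_offDiagOp.2 ⟨hab, B.graph.zero_mem⟩)
      simpa [WithLp.prod_inner_apply] using this
  · rintro ⟨h1, h2⟩ a b hab
    obtain ⟨h3, h4⟩ := mem_graph_offDiagOp.1 hab
    have e1 := h.inner_eq h3 h2
    have e2 := h.symm.inner_eq h4 h1
    simp only [WithLp.prod_inner_apply] at *
    change inner ℂ b.fst g.fst + inner ℂ b.snd g.snd -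
      (inner ℂ a.fst k.fst + inner ℂ a.snd k.snd) = 0
    rw [e1, e2]; ring

/-- Von Neumann's theorem: `1 + A* A` is onto. The solution of `u + A* A u = f` is the first
component of the projection of `(f, 0)` onto the graph of `A`. -/
theorem exists_one_add (h : IsAdjointPair A B) (f : E) :
    ∃ u, (u, f - u) ∈ (opComp B A).graph := by
  let K : Submodule ℂ (WithLp 2 (E × F)) :=
    A.graph.comap (WithLp.linearEquiv 2 ℂ (E × F)).toLinearMap
  have hK : IsClosed (K : Set (WithLp 2 (E × F))) :=
    h.isClosed_left.preimage (WithLp.prod_continuous_ofLp 2 E F)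
  have : CompleteSpace K := hK.completeSpace_coe
  obtain ⟨p, hp, hperp⟩ := Submodule.HasOrthogonalProjection.exists_orthogonal (K := K)
    (WithLp.toLp 2 (f, 0))
  refine ⟨p.fst, mem_graph_opComp.2 ⟨p.snd, hp, ?_⟩⟩
  rw [h.mem_right_iff]
  intro a b hab
  have := (Submodule.mem_orthogonal _ _).1 hperp (WithLp.toLp 2 (a, b)) hab
  simp only [WithLp.prod_inner_apply] at this
  simp at this
  rw [inner_sub_right] at this ⊢
  linear_combination -this

theorem isSelfAdjoint_opComp (h : IsAdjointPair A B) : IsSelfAdjoint (opComp B A) := by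
  refine isSelfAdjoint_of_surjective_one_add ?_ ?_ h.exists_one_add
  · intro f y g k h1 h2
    obtain ⟨w, h3, h4⟩ := mem_graph_opComp.1 h1
    obtain ⟨w', h5, h6⟩ := mem_graph_opComp.1 h2
    rw [h.symm.inner_eq h4 h5, h.inner_eq h3 h6]
  · intro f y h1
    obtain ⟨w, h3, h4⟩ := mem_graph_opComp.1 h1
    rw [h.symm.inner_eq h4 h3, inner_self_eq_norm_sq_to_K]
    have h4 : 0 ≤ ‖w‖ ^ 2 := by positivity
    exact_mod_cast h4

/-- The domain of `A* A` is a core for `A`. -/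
theorem mem_closure_graph_restrict (h : IsAdjointPair A B) {f : E} {g : F}
    (hfg : (f, g) ∈ A.graph) :
    (f, g) ∈ closure {p : E × F | p ∈ A.graph ∧ p.2 ∈ B.domain} := by
  let e := (WithLp.linearEquiv 2 ℂ (E × F)).toLinearMap
  let K : Submodule ℂ (WithLp 2 (E × F)) := A.graph.comap e
  let K' : Submodule ℂ (WithLp 2 (E × F)) :=
    K ⊓ (B.domain.comap (LinearMap.snd ℂ E F)).comap e
  have hK : IsClosed (K : Set (WithLp 2 (E × F))) :=
    h.isClosed_left.preimage (WithLp.prod_continuous_ofLp 2 E F)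
  have key : K ≤ K'.topologicalClosure := by
    refine Submodule.le_topologicalClosure_of_orthogonal hK inf_le_left ?_
    intro x hx hperp
    obtain ⟨u, hu⟩ := h.exists_one_add x.fst
    obtain ⟨w, hw1, hw2⟩ := mem_graph_opComp.1 hu
    have h1 := hperp (WithLp.toLp 2 (u, w))
      ⟨hw1, LinearPMap.mem_domain_of_mem_graph hw2⟩
    simp only [WithLp.prod_inner_apply] at h1
    change inner ℂ u x.fst + inner ℂ w x.snd = 0 at h1
    have hx' : (x.fst, x.snd) ∈ A.graph := hx
    rw [← h.symm.inner_eq hw2 hx', inner_sub_left, add_sub_cancel, inner_self_eq_zero] at h1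
    have h2 : x.snd = 0 := A.graph_fst_eq_zero_snd hx' h1
    exact WithLp.ofLp_injective 2 (Prod.ext h1 h2)
  have h1 : WithLp.toLp 2 (f, g) ∈ closure (K' : Set (WithLp 2 (E × F))) := key hfg
  have h2 := map_mem_closure (WithLp.prod_continuous_ofLp 2 E F) h1 (t := {p : E × F | p ∈ A.graph ∧ p.2 ∈ B.domain})
    (fun x hx => ⟨hx.1, hx.2⟩)
  exact h2

end IsAdjointPair

/-- A self-adjoint operator has no proper symmetric extension. -/
theorem IsSelfAdjoint.mem_graph_of_forall_inner [CompleteSpace E] {T : E →ₗ.[ℂ] E}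
    (hT : IsSelfAdjoint T) {f h : E}
    (H : ∀ g k, (g, k) ∈ T.graph → inner ℂ k f = inner ℂ g h) : (f, h) ∈ T.graph := by
  have hT' := LinearPMap.isSelfAdjoint_def.1 hT
  rw [← hT', LinearPMap.adjoint_graph_eq_graph_adjoint hT.dense_domain, Submodule.mem_adjoint_iff]
  intro a b hab
  rw [H a b hab, sub_self]

theorem IsSelfAdjoint.inner_eq [CompleteSpace E] {T : E →ₗ.[ℂ] E}
    (hT : IsSelfAdjoint T) {f h g k : E} (h1 : (f, h) ∈ T.graph) (h2 : (g, k) ∈ T.graph) :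
    inner ℂ h g = inner ℂ f k := by
  have hT' := LinearPMap.isSelfAdjoint_def.1 hT
  rw [← hT', LinearPMap.adjoint_graph_eq_graph_adjoint hT.dense_domain,
    Submodule.mem_adjoint_iff] at h2
  exact sub_eq_zero.1 (h2 _ _ h1)

end Operators

/-! ### Uniqueness of the Stieltjes transform -/

theorem im_resolvent_kernel (t x ε : ℝ) :
    (((t : ℂ) - (x + ε * Complex.I))⁻¹).im = ε / (ε ^ 2 + (x - t) ^ 2) := by
  rw [Complex.inv_im, Complex.normSq_apply]
  simp
  congr 1
  ring

theorem integrable_poisson (t : ℝ) {ε : ℝ} (hε : 0 < ε) :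
    Integrable (fun x : ℝ => ε / (ε ^ 2 + (x - t) ^ 2)) ∧
      ∫ x : ℝ, ε / (ε ^ 2 + (x - t) ^ 2) = Real.pi := by
  have e : ∀ x : ℝ, ε / (ε ^ 2 + (x - t) ^ 2) = ε⁻¹ * (1 + ((x - t) / ε) ^ 2)⁻¹ := by
    intro x
    field_simp
  have h1 : Integrable (fun y : ℝ => (1 + (y / ε) ^ 2)⁻¹) :=
    integrable_inv_one_add_sq.comp_div hε.ne'
  have h2 := (h1.comp_sub_right t).const_mul ε⁻¹
  simp only [e]
  refine ⟨h2, ?_⟩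
  rw [integral_const_mul, integral_sub_right_eq_self (fun y : ℝ => (1 + (y / ε) ^ 2)⁻¹),
    Measure.integral_comp_div (fun y : ℝ => (1 + y ^ 2)⁻¹), integral_univ_inv_one_add_sq,
    abs_of_pos hε, smul_eq_mul, ← mul_assoc, inv_mul_cancel₀ hε.ne', one_mul]

theorem integral_mul_poisson (g : ℝ → ℝ) (t : ℝ) {ε : ℝ} (hε : 0 < ε) :
    ∫ x : ℝ, g x * (ε / (ε ^ 2 + (x - t) ^ 2)) = ∫ y : ℝ, g (t + ε * y) * (1 + y ^ 2)⁻¹ := by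
  have h1 := Measure.integral_comp_mul_left
    (fun x : ℝ => g (t + x) * (ε / (ε ^ 2 + x ^ 2))) ε
  have h2 : ∫ x : ℝ, g x * (ε / (ε ^ 2 + (x - t) ^ 2)) =
      ∫ x : ℝ, g (t + x) * (ε / (ε ^ 2 + x ^ 2)) := by
    rw [← integral_add_left_eq_self _ t]
    simp
  rw [h2]
  have h3 : ∀ y : ℝ, g (t + ε * y) * (ε / (ε ^ 2 + (ε * y) ^ 2)) =
      ε⁻¹ * (g (t + ε * y) * (1 + y ^ 2)⁻¹) := by
    intro y
    have : 1 + y ^ 2 ≠ 0 := by positivity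
    field_simp
  simp only [h3] at h1
  rw [integral_const_mul, abs_of_pos (inv_pos.2 hε), smul_eq_mul] at h1
  exact (mul_left_cancel₀ (inv_ne_zero hε.ne') h1).symm

/-- Stieltjes inversion: smearing the imaginary part of the Stieltjes transform with a bounded
continuous function recovers the integral of that function. -/
theorem tendsto_stieltjes_smear (μ : Measure ℝ) [IsFiniteMeasure μ]
    (g : BoundedContinuousFunction ℝ ℝ) :
    Tendsto (fun ε : ℝ => ∫ x : ℝ, g x * (∫ t, ((t : ℂ) - (x + ε * Complex.I))⁻¹ ∂μ).im)
      (𝓝[>] 0) (𝓝 (Real.pi * ∫ t, g t ∂μ)) := by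
  have key : ∀ ε : ℝ, 0 < ε →
      ∫ x : ℝ, g x * (∫ t, ((t : ℂ) - (x + ε * Complex.I))⁻¹ ∂μ).im =
        ∫ t, (∫ y : ℝ, g (t + ε * y) * (1 + y ^ 2)⁻¹) ∂μ := by
    intro ε hε
    have hne : ∀ t x : ℝ, (t : ℂ) - (x + ε * Complex.I) ≠ 0 := by
      intro t x h0
      have := congrArg Complex.im h0
      simp at this
      exact hε.ne' this
    have h1 : ∀ x : ℝ, (∫ t, ((t : ℂ) - (x + ε * Complex.I))⁻¹ ∂μ).im =
        ∫ t, ε / (ε ^ 2 + (x - t) ^ 2) ∂μ := by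
      intro x
      have hint : Integrable (fun t : ℝ => ((t : ℂ) - (x + ε * Complex.I))⁻¹) μ := by
        refine Integrable.of_bound (C := ε⁻¹) ?_ (Eventually.of_forall fun t => ?_)
        · exact (Continuous.inv₀ (by fun_prop) (fun t => hne t x)).aestronglyMeasurable
        · rw [norm_inv]
          gcongr
          calc ε = |((t : ℂ) - (x + ε * Complex.I)).im| := by simp [abs_of_pos hε]
            _ ≤ _ := Complex.abs_im_le_norm _
      have := Complex.imCLM.integral_comp_comm hint
      simp only [Complex.imCLM_apply] at this
      rw [← this]
      simp only [im_resolvent_kernel]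
    simp only [h1, ← integral_const_mul]
    have hcont : Continuous (fun p : ℝ × ℝ => ε / (ε ^ 2 + (p.1 - p.2) ^ 2)) := by
      refine Continuous.div continuous_const (by fun_prop) (fun p => ?_)
      positivity
    have hk : Integrable (fun p : ℝ × ℝ => ε / (ε ^ 2 + (p.1 - p.2) ^ 2)) (volume.prod μ) := by
      rw [integrable_prod_iff' hcont.aestronglyMeasurable]
      refine ⟨Eventually.of_forall fun t => (integrable_poisson t hε).1, ?_⟩
      have : ∀ t : ℝ, ∫ x : ℝ, ‖ε / (ε ^ 2 + (x - t) ^ 2)‖ = Real.pi := by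
        intro t
        rw [← (integrable_poisson t hε).2]
        refine integral_congr_ae (Eventually.of_forall fun x => ?_)
        exact Real.norm_of_nonneg (by positivity)
      simp only [this]
      exact integrable_const _
    have hgk : Integrable (fun p : ℝ × ℝ => g p.1 * (ε / (ε ^ 2 + (p.1 - p.2) ^ 2)))
        (volume.prod μ) := by
      refine (hk.const_mul ‖g‖).mono
        ((g.continuous.comp continuous_fst).mul hcont).aestronglyMeasurable
        (Eventually.of_forall fun p => ?_)
      rw [norm_mul, norm_mul, norm_norm]
      gcongr
      exact g.norm_coe_le_norm _
    rw [integral_integral_swap hgk]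
    refine integral_congr_ae (Eventually.of_forall fun t => ?_)
    exact integral_mul_poisson g t hε
  have hlim : Tendsto (fun ε : ℝ => ∫ t, (∫ y : ℝ, g (t + ε * y) * (1 + y ^ 2)⁻¹) ∂μ)
      (𝓝[>] 0) (𝓝 (∫ t, g t * Real.pi ∂μ)) := by
    have hint : ∀ (ε t : ℝ), ‖∫ y : ℝ, g (t + ε * y) * (1 + y ^ 2)⁻¹‖ ≤ ‖g‖ * Real.pi := by
      intro ε t
      rw [← integral_univ_inv_one_add_sq, ← integral_const_mul]
      refine norm_integral_le_of_norm_le (integrable_inv_one_add_sq.const_mul _)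
        (Eventually.of_forall fun y => ?_)
      rw [norm_mul, Real.norm_of_nonneg (r := (1 + y ^ 2)⁻¹) (by positivity)]
      gcongr
      exact g.norm_coe_le_norm _
    have hin : ∀ t : ℝ, Tendsto (fun ε : ℝ => ∫ y : ℝ, g (t + ε * y) * (1 + y ^ 2)⁻¹) (𝓝[>] 0)
        (𝓝 (g t * Real.pi)) := by
      intro t
      rw [← integral_univ_inv_one_add_sq, ← integral_const_mul]
      refine tendsto_integral_filter_of_dominated_convergence
        (fun y => ‖g‖ * (1 + y ^ 2)⁻¹) (Eventually.of_forall fun ε => ?_)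
        (Eventually.of_forall fun ε => Eventually.of_forall fun y => ?_)
        (integrable_inv_one_add_sq.const_mul _) (Eventually.of_forall fun y => ?_)
      · exact (Continuous.mul (by fun_prop) (Continuous.inv₀ (by fun_prop)
          (fun y => by positivity))).aestronglyMeasurable
      · rw [norm_mul, Real.norm_of_nonneg (r := (1 + y ^ 2)⁻¹) (by positivity)]
        gcongr
        exact g.norm_coe_le_norm _
      · refine Tendsto.mul_const _ ?_
        have : Continuous (fun ε : ℝ => g (t + ε * y)) := by fun_prop
        have h0 := this.tendsto 0
        simp only [zero_mul, add_zero] at h0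
        exact h0.mono_left nhdsWithin_le_nhds
    refine tendsto_integral_filter_of_dominated_convergence (fun _ => ‖g‖ * Real.pi)
      (Eventually.of_forall fun ε => ?_)
      (Eventually.of_forall fun ε => Eventually.of_forall fun t => hint ε t)
      (integrable_const _) (Eventually.of_forall hin)
    refine Continuous.aestronglyMeasurable ?_
    refine continuous_of_dominated (F := fun t y => g (t + ε * y) * (1 + y ^ 2)⁻¹)
      (bound := fun y => ‖g‖ * (1 + y ^ 2)⁻¹) (fun t => ?_)
      (fun t => Eventually.of_forall fun y => ?_) (integrable_inv_one_add_sq.const_mul _)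
      (Eventually.of_forall fun y => by fun_prop)
    · exact (Continuous.mul (by fun_prop) (Continuous.inv₀ (by fun_prop)
          (fun y => by positivity))).aestronglyMeasurable
    · rw [norm_mul, Real.norm_of_nonneg (r := (1 + y ^ 2)⁻¹) (by positivity)]
      gcongr
      exact g.norm_coe_le_norm _
  rw [integral_mul_const, mul_comm] at hlim
  refine hlim.congr' ?_
  filter_upwards [self_mem_nhdsWithin] with ε hε
  exact (key ε hε).symm

theorem Measure.ext_of_stieltjes {μ ν : Measure ℝ} [IsFiniteMeasure μ] [IsFiniteMeasure ν]
    (h : ∀ z : ℂ, z.im ≠ 0 → ∫ t : ℝ, ((t : ℂ) - z)⁻¹ ∂μ = ∫ t : ℝ, ((t : ℂ) - z)⁻¹ ∂ν) :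
    μ = ν := by
  refine ext_of_forall_integral_eq_of_IsFiniteMeasure fun g => ?_
  have h1 := tendsto_stieltjes_smear μ g
  have h2 := tendsto_stieltjes_smear ν g
  have h3 : Real.pi * ∫ t, g t ∂μ = Real.pi * ∫ t, g t ∂ν := by
    refine tendsto_nhds_unique h1 (h2.congr' ?_)
    filter_upwards [self_mem_nhdsWithin] with ε hε
    refine integral_congr_ae (Eventually.of_forall fun x => ?_)
    simp only
    rw [h]
    simpa using hε.ne'
  exact mul_left_cancel₀ Real.pi_ne_zero h3

/-! ### Spectral properties of multiplication operators -/

theorem graph_mulOp (n : ℕ) (μ : Measure ℝ) : (mulOp n μ).graph = mulGraph n μ := by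
  refine Submodule.toLinearPMap_graph_eq _ ?_
  rintro ⟨x, y⟩ (h : ∀ᵐ t ∂μ, y t = (t : ℂ) • x t) (hx : x = 0)
  subst hx
  refine Lp.ext ?_
  filter_upwards [h, Lp.coeFn_zero (EuclideanSpace ℂ (Fin n)) 2 μ] with t h1 h2
  rw [h1, h2]
  simp

theorem mem_graph_mulOp {n : ℕ} {μ : Measure ℝ} {F G : Lp (EuclideanSpace ℂ (Fin n)) 2 μ} :
    (F, G) ∈ (mulOp n μ).graph ↔ ∀ᵐ t ∂μ, G t = (t : ℂ) • F t := by
  rw [graph_mulOp]; rfl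

/-- Multiplication of a vector-valued `L²` function by an essentially bounded scalar function. -/
theorem Lp.exists_smul_of_bound {α X : Type*} [MeasurableSpace α] [NormedAddCommGroup X]
    [NormedSpace ℂ X] {μ : Measure α} {m : α → ℂ} (hm : AEStronglyMeasurable m μ)
    (F : Lp X 2 μ) (C : ℝ) (hC : ∀ᵐ t ∂μ, F t ≠ 0 → ‖m t‖ ≤ C) :
    ∃ G : Lp X 2 μ, (∀ᵐ t ∂μ, G t = m t • F t) ∧ ‖G‖ ≤ C * ‖F‖ := by
  have hle : ∀ᵐ t ∂μ, ‖m t • F t‖ ≤ C * ‖F t‖ := by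
    filter_upwards [hC] with t ht
    rw [norm_smul]
    by_cases h0 : F t = 0
    · simp [h0]
    · gcongr
      exact ht h0
  have hmem : MemLp (fun t => m t • F t) 2 μ :=
    MemLp.of_le_mul (Lp.memLp F) (hm.smul (Lp.aestronglyMeasurable F)) hle
  refine ⟨hmem.toLp _, hmem.coeFn_toLp, ?_⟩
  refine Lp.norm_le_mul_norm_of_ae_le_mul ?_
  filter_upwards [hle, hmem.coeFn_toLp] with t h1 h2
  rw [h2]; exact h1

section MulOp

variable {E : Type*} [NormedAddCommGroup E] [InnerProductSpace ℂ E] {H : E →ₗ.[ℂ] E} {n : ℕ}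
  {μ : Measure ℝ} {U : E ≃ₗᵢ[ℂ] Lp (EuclideanSpace ℂ (Fin n)) 2 μ}

theorem Intertwines.mem_graph_shift_iff (h : Intertwines U H (mulOp n μ)) {f g : E} {z : ℂ} :
    (f, z • f + g) ∈ H.graph ↔ ∀ᵐ t ∂μ, U g t = ((t : ℂ) - z) • U f t := by
  rw [h, mem_graph_mulOp, map_add, map_smul]
  constructor
  · intro h1
    filter_upwards [h1, Lp.coeFn_add (z • U f) (U g), Lp.coeFn_smul z (U f)] with t h2 h3 h4
    rw [h3, Pi.add_apply, h4, Pi.smul_apply] at h2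
    rw [sub_smul, ← h2, add_sub_cancel_left]
  · intro h1
    filter_upwards [h1, Lp.coeFn_add (z • U f) (U g), Lp.coeFn_smul z (U f)] with t h2 h3 h4
    rw [h3, Pi.add_apply, h4, Pi.smul_apply, h2, sub_smul, add_sub_cancel]

/-- An eigenfunction is carried by one point, which is a null set of an absolutely continuous
measure. -/
theorem Intertwines.pointSpectrum_eq_empty (h : Intertwines U H (mulOp n μ)) (hμ : μ ≪ volume) :
    pointSpectrum H = ∅ := by
  rw [eq_empty_iff_forall_notMem]
  rintro z ⟨f, hf, hfz⟩
  have h1 := (h.mem_graph_shift_iff (f := f) (g := 0) (z := z)).1 (by simpa using hfz)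
  apply hf
  have h2 : ∀ᵐ t ∂μ, t ≠ z.re := by
    refine hμ.ae_le ?_
    exact compl_mem_ae_iff.2 (measure_singleton z.re)
  have : U f = 0 := by
    refine Lp.ext ?_
    rw [map_zero] at h1
    filter_upwards [h1, h2, Lp.coeFn_zero (EuclideanSpace ℂ (Fin n)) 2 μ] with t h3 h4 h5
    rw [h5] at h3 ⊢
    have h6 : (t : ℂ) - z ≠ 0 := by
      intro h0
      apply h4
      have := congrArg Complex.re h0
      simpa [sub_eq_zero] using this
    exact (smul_eq_zero.1 h3.symm).resolve_left h6
  simpa using this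

/-- The spectral measure of `f` has density `‖(U f) t‖²` with respect to `μ`. -/
theorem Intertwines.isSpectralMeasure (h : Intertwines U H (mulOp n μ)) (f : E) :
    IsSpectralMeasure H f (μ.withDensity fun t => ((‖U f t‖₊ ^ 2 : NNReal) : ℝ≥0∞)) := by
  have hmeas : Measurable fun t => ‖U f t‖₊ ^ 2 :=
    (Lp.stronglyMeasurable (U f)).measurable.nnnorm.pow_const 2
  refine ⟨?_, fun z hz => ?_⟩
  · refine isFiniteMeasure_withDensity ?_
    have := (Lp.memLp (U f)).eLpNorm_lt_top
    have h2 := lintegral_rpow_enorm_lt_top_of_eLpNorm_lt_top (by simp) (by simp) this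
    refine ne_of_lt ?_
    convert! h2 using 3 with t
    simp [enorm_eq_nnnorm]
  · have hne : ∀ t : ℝ, (t : ℂ) - z ≠ 0 := by
      intro t h0
      apply hz
      have := congrArg Complex.im h0
      simpa using this
    obtain ⟨G, hG, -⟩ := Lp.exists_smul_of_bound (μ := μ) (m := fun t : ℝ => ((t : ℂ) - z)⁻¹)
      (Continuous.inv₀ (by fun_prop) hne).aestronglyMeasurable (U f) (|z.im|⁻¹)
      (Eventually.of_forall fun t _ => by
        rw [norm_inv]
        have : |z.im| ≤ ‖(t : ℂ) - z‖ := by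
          simpa using Complex.abs_im_le_norm ((t : ℂ) - z)
        gcongr)
    refine ⟨U.symm G, ?_, ?_⟩
    · rw [h.mem_graph_shift_iff]
      filter_upwards [hG] with t ht
      rw [U.apply_symm_apply, ht, smul_smul, mul_inv_cancel₀ (hne t), one_smul]
    · rw [← U.inner_map_map, U.apply_symm_apply, L2.inner_def,
        integral_withDensity_eq_integral_smul hmeas]
      refine integral_congr_ae ?_
      filter_upwards [hG] with t ht
      rw [ht, inner_smul_right, inner_self_eq_norm_sq_to_K, NNReal.smul_def, Complex.real_smul, mul_comm]
      simp

theorem Intertwines.isPurelyAC (h : Intertwines U H (mulOp n μ)) (hμ : μ ≪ volume) :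
    IsPurelyAC H :=
  eq_univ_of_forall fun f => ⟨_, h.isSpectralMeasure f,
    (withDensity_absolutelyContinuous _ _).trans hμ⟩

/-- The spectral measure is determined by its Stieltjes transform. -/
theorem IsSpectralMeasure.unique {f : E} {ν ν' : Measure ℝ} (h : IsSpectralMeasure H f ν)
    (h' : IsSpectralMeasure H f ν') (hinj : ∀ z : ℂ, z.im ≠ 0 → ∀ u, (u, z • u) ∈ H.graph → u = 0) :
    ν = ν' := by
  have := h.1
  have := h'.1
  refine Measure.ext_of_stieltjes fun z hz => ?_
  obtain ⟨u, hu, e⟩ := h.2 z hz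
  obtain ⟨u', hu', e'⟩ := h'.2 z hz
  rw [← e, ← e']
  have h1 := H.graph.sub_mem hu hu'
  have h2 : u - u' = 0 := by
    apply hinj z hz
    convert! h1 using 1
    ext1
    · rfl
    · simp [smul_sub]
  rw [sub_eq_zero.1 h2]

/-- All spectral measures are absolutely continuous, so the singular continuous subspace is trivial,
and an operator in the zero space has empty spectrum. -/
theorem Intertwines.scSpectrum_eq_empty (h : Intertwines U H (mulOp n μ)) (hμ : μ ≪ volume) :
    scSpectrum H = ∅ := by
  have hinj : ∀ z : ℂ, z.im ≠ 0 → ∀ u, (u, z • u) ∈ H.graph → u = 0 := by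
    intro z _ u hu
    by_contra h0
    have : z ∈ pointSpectrum H := ⟨u, h0, hu⟩
    rw [h.pointSpectrum_eq_empty hμ] at this
    exact this
  have hsc : scSubspace H = {0} := by
    refine subset_antisymm ?_ ?_
    · rintro f ⟨ν, hν, hs, -⟩
      have e := hν.unique (h.isSpectralMeasure f) hinj
      have hac : ν ≪ volume := by
        rw [e]
        exact (withDensity_absolutelyContinuous _ _).trans hμ
      have hν0 : ν = 0 := Measure.eq_zero_of_absolutelyContinuous_of_mutuallySingular hac hs
      rw [e] at hν0
      have hmeas : Measurable fun t => ((‖U f t‖₊ ^ 2 : NNReal) : ℝ≥0∞) :=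
        ((Lp.stronglyMeasurable (U f)).measurable.nnnorm.pow_const 2).coe_nnreal_ennreal
      rw [withDensity_eq_zero_iff hmeas.aemeasurable] at hν0
      have : U f = 0 := by
        refine Lp.ext ?_
        filter_upwards [hν0, Lp.coeFn_zero (EuclideanSpace ℂ (Fin n)) 2 μ] with t h1 h2
        rw [h2]
        simpa using h1
      simpa using this
    · rintro f rfl
      refine ⟨0, ⟨inferInstance, fun z _ => ⟨0, ?_, ?_⟩⟩, ?_, by simp⟩
      · simp
      · simp
      · exact Measure.MutuallySingular.zero_left
  rw [scSpectrum, hsc, eq_empty_iff_forall_notMem]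
  intro z hz
  apply hz
  refine ⟨?_, 0, ?_⟩
  · rintro g rfl
    refine ⟨0, ⟨rfl, ?_⟩, fun f hf => hf.1⟩
    simp
  · rintro f rfl g _ _
    simp

/-- The spectrum of multiplication by the independent variable is the support of the measure. -/
theorem Intertwines.opSpectrum_eq [SigmaFinite μ] [NeZero n] (h : Intertwines U H (mulOp n μ)) :
    opSpectrum H = (fun t : ℝ => (t : ℂ)) '' μ.support := by
  ext z
  constructor
  · intro hz
    by_contra hnot
    apply hz
    -- outside the support `|t - z|` is bounded below, and its inverse is a bounded multiplier
    obtain ⟨δ, hδ, hb⟩ : ∃ δ : ℝ, 0 < δ ∧ ∀ᵐ t : ℝ ∂μ, δ ≤ ‖(t : ℂ) - z‖ := by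
      by_cases him : z.im = 0
      · have hz' : z = (z.re : ℂ) := by
          apply Complex.ext <;> simp [him]
        have hre : z.re ∉ μ.support := fun hm => hnot ⟨z.re, hm, hz'.symm⟩
        rw [Measure.notMem_support_iff_exists] at hre
        obtain ⟨W, hW, hW0⟩ := hre
        obtain ⟨δ, hδ, hball⟩ := Metric.mem_nhds_iff.1 hW
        refine ⟨δ, hδ, ?_⟩
        have : ∀ᵐ t ∂μ, t ∉ W := by
          rw [ae_iff]; simpa using hW0
        filter_upwards [this] with t ht
        by_contra hlt
        apply ht
        apply hball
        rw [Metric.mem_ball, Real.dist_eq]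
        rw [hz', ← Complex.ofReal_sub, Complex.norm_real, Real.norm_eq_abs] at hlt
        exact not_le.1 hlt
      · refine ⟨|z.im|, abs_pos.2 him, Eventually.of_forall fun t => ?_⟩
        have := Complex.abs_im_le_norm ((t : ℂ) - z)
        rwa [Complex.sub_im, Complex.ofReal_im, zero_sub, abs_neg] at this
    have hne : ∀ᵐ t : ℝ ∂μ, (t : ℂ) - z ≠ 0 := by
      filter_upwards [hb] with t ht h0
      rw [h0, norm_zero] at ht
      linarith
    have hbound : ∀ f g : E, (f, z • f + g) ∈ H.graph → ‖f‖ ≤ δ⁻¹ * ‖g‖ := by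
      intro f g hfg
      rw [h.mem_graph_shift_iff] at hfg
      rw [← U.norm_map f, ← U.norm_map g]
      refine Lp.norm_le_mul_norm_of_ae_le_mul ?_
      filter_upwards [hfg, hb] with t h1 h2
      rw [h1, norm_smul, ← mul_assoc]
      refine le_mul_of_one_le_left (norm_nonneg _) ?_
      rw [inv_mul_eq_div, one_le_div hδ]
      exact h2
    refine ⟨fun g _ => ?_, δ⁻¹, fun f _ g _ hfg => hbound f g hfg⟩
    obtain ⟨G, hG, -⟩ := Lp.exists_smul_of_bound (μ := μ) (m := fun t : ℝ => ((t : ℂ) - z)⁻¹)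
      (by
        have : Measurable fun t : ℝ => ((t : ℂ) - z)⁻¹ :=
          (Complex.measurable_ofReal.sub_const z).inv
        exact this.aestronglyMeasurable) (U g) (δ⁻¹) (by
        filter_upwards [hb] with t ht _
        rw [norm_inv]
        gcongr)
    refine ⟨U.symm G, ⟨trivial, ?_⟩, ?_⟩
    · rw [h.mem_graph_shift_iff]
      filter_upwards [hG, hne] with t ht h0
      rw [U.apply_symm_apply, ht, smul_smul, mul_inv_cancel₀ h0, one_smul]
    · rintro f ⟨-, hf⟩
      rw [h.mem_graph_shift_iff] at hf
      rw [← U.symm_apply_apply f]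
      congr 1
      refine Lp.ext ?_
      filter_upwards [hG, hne, hf] with t ht h0 h1
      rw [ht, h1, smul_smul, inv_mul_cancel₀ h0, one_smul]
  · rintro ⟨x, hx, rfl⟩ ⟨-, C, hC⟩
    -- a function carried by a ball of radius `ε` around `x` with `|C| ε < 1` violates the bound
    set ε : ℝ := (|C| + 1)⁻¹ with hε
    have hεpos : 0 < ε := by positivity
    have hpos : 0 < μ (Metric.ball x ε) :=
      (Measure.mem_support_iff_forall x).1 hx _ (Metric.ball_mem_nhds x hεpos)
    obtain ⟨s, hs, hsub, h0, hfin⟩ :=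
      Measure.exists_subset_measure_lt_top measurableSet_ball hpos
    set F : Lp (EuclideanSpace ℂ (Fin n)) 2 μ :=
      indicatorConstLp 2 hs hfin.ne (EuclideanSpace.single (0 : Fin n) (1 : ℂ)) with hF
    have hFs : ∀ᵐ t ∂μ, F t = s.indicator
        (fun _ => EuclideanSpace.single (0 : Fin n) (1 : ℂ)) t := indicatorConstLp_coeFn
    obtain ⟨G, hG, hGn⟩ := Lp.exists_smul_of_bound (μ := μ) (m := fun t : ℝ => (t : ℂ) - (x : ℂ))
      (by fun_prop) F ε (by
        filter_upwards [hFs] with t ht hne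
        have hts : t ∈ s := by
          by_contra hts
          rw [ht, indicator_of_notMem hts] at hne
          exact hne rfl
        have := hsub hts
        rw [Metric.mem_ball, Real.dist_eq] at this
        rw [← Complex.ofReal_sub, Complex.norm_real, Real.norm_eq_abs]
        exact this.le)
    have hle := hC (U.symm F) trivial (U.symm G) trivial (by
      rw [h.mem_graph_shift_iff]
      simpa using hG)
    rw [U.symm.norm_map, U.symm.norm_map] at hle
    have hFpos : 0 < ‖F‖ := by
      rw [hF, norm_indicatorConstLp (by simp) (by simp)]
      have : 0 < μ.real s := ENNReal.toReal_pos h0.ne' hfin.ne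
      simp
      positivity
    have h1 : ‖F‖ ≤ |C| * (ε * ‖F‖) :=
      hle.trans (by gcongr; exact le_abs_self C)
    have h2 : |C| * ε < 1 := by
      rw [hε, ← div_eq_mul_inv, div_lt_one (by positivity)]
      linarith
    nlinarith

end MulOp

/-! ### Uniformly locally square-integrable multipliers on `H¹(ℝ)` -/

/-- `φ ∈ L²_loc unif(ℝ)`. -/
structure IsUnifLocL2 (φ : ℝ → ℝ) : Prop where
  memLp : ∀ a b : ℝ, MemLp φ 2 ((volume : Measure ℝ).restrict (Icc a b))
  locUnif : ∃ C : ℝ, ∀ a : ℝ, ∫ x in Icc a (a + 1), φ x ^ 2 ≤ C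

theorem IsPeriodicMiura.isUnifLocL2 {ω : ℝ} {q : RealDistribution} {φ : ℝ → ℝ}
    (h : IsPeriodicMiura ω q φ) : IsUnifLocL2 φ := ⟨h.memLp, h.locUnif⟩

theorem Lp.enorm_sq_eq_lintegral {α X : Type*} [MeasurableSpace α] [NormedAddCommGroup X]
    {μ : Measure α} (F : Lp X 2 μ) : ‖F‖ₑ ^ 2 = ∫⁻ t, ‖F t‖ₑ ^ 2 ∂μ := by
  rw [Lp.enorm_def, eLpNorm_eq_lintegral_rpow_enorm_toReal (by simp) (by simp)]
  simp only [ENNReal.toReal_ofNat, ENNReal.rpow_ofNat]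
  rw [← ENNReal.rpow_natCast, ← ENNReal.rpow_mul]
  simp

theorem memLp_two_iff_lintegral {α X : Type*} [MeasurableSpace α] [NormedAddCommGroup X]
    {μ : Measure α} {f : α → X} (hf : AEStronglyMeasurable f μ) :
    MemLp f 2 μ ↔ ∫⁻ t, ‖f t‖ₑ ^ 2 ∂μ < ∞ := by
  rw [MemLp, and_iff_right hf, eLpNorm_lt_top_iff_lintegral_rpow_enorm_lt_top (by simp) (by simp)]
  simp

namespace IsUnifLocL2

variable {φ : ℝ → ℝ}

theorem neg (h : IsUnifLocL2 φ) : IsUnifLocL2 (fun x => - φ x) := by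
  obtain ⟨C, hC⟩ := h.locUnif
  exact ⟨fun a b => (h.memLp a b).neg, C, fun a => by simpa using hC a⟩

theorem zero : IsUnifLocL2 (fun _ => 0) :=
  ⟨fun _ _ => MemLp.zero, 0, fun a => by simp⟩

theorem aestronglyMeasurable (h : IsUnifLocL2 φ) : AEStronglyMeasurable φ volume := by
  have : (volume : Measure ℝ) = volume.restrict (⋃ n : ℕ, Icc (-(n : ℝ)) n) := by
    have hU : (⋃ n : ℕ, Icc (-(n : ℝ)) n) = univ := by
      refine eq_univ_of_forall fun x => ?_
      obtain ⟨n, hn⟩ := exists_nat_ge |x|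
      exact mem_iUnion.2 ⟨n, abs_le.1 hn⟩
    rw [hU, Measure.restrict_univ]
  rw [this, aestronglyMeasurable_iUnion_iff]
  exact fun n => (h.memLp _ _).1

theorem intervalIntegrable_sq (h : IsUnifLocL2 φ) (a b : ℝ) :
    IntervalIntegrable (fun x => φ x ^ 2) volume a b := by
  rw [intervalIntegrable_iff]
  refine IntegrableOn.mono_set (t := Icc (min a b) (max a b)) ?_ Ioc_subset_Icc_self
  exact (memLp_two_iff_integrable_sq (h.memLp _ _).1).1 (h.memLp _ _)

theorem intervalIntegrable (h : IsUnifLocL2 φ) (a b : ℝ) :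
    IntervalIntegrable φ volume a b := by
  rw [intervalIntegrable_iff]
  refine IntegrableOn.mono_set (t := Icc (min a b) (max a b)) ?_ Ioc_subset_Icc_self
  exact (h.memLp _ _).integrable (by norm_num)

theorem exists_lintegral_le (h : IsUnifLocL2 φ) :
    ∃ C : NNReal, ∀ y : ℝ, ∫⁻ x in Icc (y - 1) y, ‖φ x‖ₑ ^ 2 ≤ C := by
  obtain ⟨C, hC⟩ := h.locUnif
  refine ⟨C.toNNReal, fun y => ?_⟩
  have h1 := hC (y - 1)
  rw [sub_add_cancel] at h1
  have h2 : Integrable (fun x => φ x ^ 2) (volume.restrict (Icc (y - 1) y)) :=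
    (memLp_two_iff_integrable_sq (h.memLp _ _).1).1 (h.memLp _ _)
  have h3 := ofReal_integral_eq_lintegral_ofReal h2 (Eventually.of_forall fun x => sq_nonneg (φ x))
  have h4 : ∀ x, ‖φ x‖ₑ ^ 2 = ENNReal.ofReal (φ x ^ 2) := by
    intro x
    rw [← ofReal_norm, ← ENNReal.ofReal_pow (norm_nonneg _), Real.norm_eq_abs, sq_abs]
  simp only [h4]
  rw [← h3]
  exact ENNReal.ofReal_le_ofReal h1

/-- If `|u(x)|²` is controlled by the integral of `k` over `[x, x + ℓ]`, `ℓ ≤ 1`, then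
`‖φ u‖²` is controlled by the integral of `k`: exchange the order of integration. -/
theorem lintegral_mul_le (h : IsUnifLocL2 φ) {C : NNReal}
    (hC : ∀ y : ℝ, ∫⁻ x in Icc (y - 1) y, ‖φ x‖ₑ ^ 2 ≤ C) {u : ℝ → ℂ} {k : ℝ → ℝ≥0∞}
    (hk : AEMeasurable k volume) {l : ℝ} (hl : l ≤ 1)
    (hu : ∀ x, ‖u x‖ₑ ^ 2 ≤ ∫⁻ y in Icc x (x + l), k y) :
    ∫⁻ x, ‖(φ x : ℂ) * u x‖ₑ ^ 2 ≤ C * ∫⁻ y, k y := by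
  have hφ := h.aestronglyMeasurable.enorm.pow_const 2
  have h1 : ∀ x, ‖(φ x : ℂ) * u x‖ₑ ^ 2 ≤
      ∫⁻ y, ‖φ x‖ₑ ^ 2 * ({p : ℝ × ℝ | p.1 ≤ p.2 ∧ p.2 ≤ p.1 + l}.indicator (fun p => k p.2) (x, y)) := by
    intro x
    have e : ‖(φ x : ℂ)‖ₑ = ‖φ x‖ₑ := by
      rw [← ofReal_norm, ← ofReal_norm, Complex.norm_real]
    have hm : AEMeasurable (fun y => {p : ℝ × ℝ | p.1 ≤ p.2 ∧ p.2 ≤ p.1 + l}.indicator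
        (fun p => k p.2) (x, y)) volume := by
      have : (fun y => {p : ℝ × ℝ | p.1 ≤ p.2 ∧ p.2 ≤ p.1 + l}.indicator
        (fun p => k p.2) (x, y)) = (Icc x (x + l)).indicator k := by
        ext y; simp [indicator_apply]
      rw [this]
      exact hk.indicator measurableSet_Icc
    rw [enorm_mul, mul_pow, e, lintegral_const_mul'' _ hm]
    gcongr
    refine (hu x).trans (le_of_eq ?_)
    rw [← lintegral_indicator measurableSet_Icc]
    refine lintegral_congr fun y => ?_
    simp [indicator_apply]
  have hS : MeasurableSet {p : ℝ × ℝ | p.1 ≤ p.2 ∧ p.2 ≤ p.1 + l} :=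
    (measurableSet_le measurable_fst measurable_snd).inter
      (measurableSet_le measurable_snd (measurable_fst.add_const l))
  refine (lintegral_mono h1).trans ?_
  rw [lintegral_lintegral_swap]
  · rw [← lintegral_const_mul'' _ hk]
    refine lintegral_mono fun y => ?_
    have h2 : ∀ x, ‖φ x‖ₑ ^ 2 * ({p : ℝ × ℝ | p.1 ≤ p.2 ∧ p.2 ≤ p.1 + l}.indicator
        (fun p => k p.2) (x, y)) ≤ ((Icc (y - 1) y).indicator (fun x => ‖φ x‖ₑ ^ 2) x) * k y := by
      intro x
      by_cases hx : x ≤ y ∧ y ≤ x + l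
      · rw [indicator_of_mem (show (x, y) ∈ {p : ℝ × ℝ | p.1 ≤ p.2 ∧ p.2 ≤ p.1 + l} from hx),
          indicator_of_mem (show x ∈ Icc (y - 1) y from ⟨by linarith [hx.2], hx.1⟩)]
      · rw [indicator_of_notMem (show (x, y) ∉ {p : ℝ × ℝ | p.1 ≤ p.2 ∧ p.2 ≤ p.1 + l} from hx),
          mul_zero]
        exact bot_le
    refine (lintegral_mono h2).trans ?_
    rw [lintegral_mul_const'' _ (hφ.indicator measurableSet_Icc),
      lintegral_indicator measurableSet_Icc]
    gcongr
    exact hC y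
  · exact (hφ.comp_fst).mul ((hk.comp_snd).indicator hS)

end IsUnifLocL2

theorem sq_intervalIntegral_le {f : ℝ → ℝ} {a b : ℝ} (hab : a ≤ b)
    (hf : IntervalIntegrable f volume a b) (hf2 : IntervalIntegrable (fun x => f x ^ 2) volume a b) :
    (∫ x in a..b, f x) ^ 2 ≤ (b - a) * ∫ x in a..b, f x ^ 2 := by
  rcases hab.eq_or_lt with rfl | hlt
  · simp
  set m := (∫ x in a..b, f x) / (b - a) with hm
  have h0 : 0 ≤ ∫ x in a..b, (f x - m) ^ 2 :=
    intervalIntegral.integral_nonneg hab fun x _ => sq_nonneg _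
  have e : ∀ x, (f x - m) ^ 2 = f x ^ 2 - 2 * m * f x + m ^ 2 := fun x => by ring
  simp only [e] at h0
  rw [intervalIntegral.integral_add (hf2.sub (hf.const_mul _)) intervalIntegrable_const,
    intervalIntegral.integral_sub hf2 (hf.const_mul _), intervalIntegral.integral_const_mul,
    intervalIntegral.integral_const, smul_eq_mul] at h0
  have hpos : 0 < b - a := sub_pos.2 hlt
  have hI : ∫ x in a..b, f x = m * (b - a) := by rw [hm]; field_simp
  rw [hI] at h0 ⊢
  nlinarith

theorem MemLp.intervalIntegrable_norm_sq {v : ℝ → ℂ} (hv : MemLp v 2 volume) (a b : ℝ) :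
    IntervalIntegrable (fun x => ‖v x‖ ^ 2) volume a b :=
  ((memLp_two_iff_integrable_sq_norm hv.1).1 hv).intervalIntegrable

theorem MemLp.intervalIntegrable_two {v : ℝ → ℂ} (hv : MemLp v 2 volume) (a b : ℝ) :
    IntervalIntegrable v volume a b := by
  rw [intervalIntegrable_iff]
  exact (hv.restrict (Ioc (min a b) (max a b))).integrable (by norm_num)

theorem ofReal_intervalIntegral_eq {k : ℝ → ℝ} {a b : ℝ} (hab : a ≤ b)
    (hk : IntervalIntegrable k volume a b) (h0 : ∀ x, 0 ≤ k x) :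
    ENNReal.ofReal (∫ x in a..b, k x) = ∫⁻ x in Icc a b, ENNReal.ofReal (k x) := by
  rw [intervalIntegral.integral_of_le hab, ← integral_Icc_eq_integral_Ioc,
    ofReal_integral_eq_lintegral_ofReal ((intervalIntegrable_iff_integrableOn_Icc_of_le hab).1 hk)
    (Eventually.of_forall h0)]

theorem enorm_sq_eq_ofReal (z : ℂ) : ‖z‖ₑ ^ 2 = ENNReal.ofReal (‖z‖ ^ 2) := by
  rw [← ofReal_norm, ← ENNReal.ofReal_pow (norm_nonneg _)]

/-- The elementary Sobolev inequality: `|u(x)|²` is bounded by an average of `|u|²` and a small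
multiple of the integral of `|v|²` near `x`, where `v` is the derivative. -/
theorem IsACWithDeriv.enorm_sq_le {u v : ℝ → ℂ} (h : IsACWithDeriv univ u v)
    (hv : MemLp v 2 volume) {l : ℝ} (hl : 0 < l) (x : ℝ) :
    ‖u x‖ₑ ^ 2 ≤ ∫⁻ y in Icc x (x + l), ENNReal.ofReal (2 / l * ‖u y‖ ^ 2 + 2 * l * ‖v y‖ ^ 2) := by
  have hxl : x ≤ x + l := by linarith
  have hu2 : IntervalIntegrable (fun y => ‖u y‖ ^ 2) volume x (x + l) :=
    (h.continuous.norm.pow 2).intervalIntegrable _ _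
  have hv2 := MemLp.intervalIntegrable_norm_sq hv x (x + l)
  have hv1 := (MemLp.intervalIntegrable_two hv x (x + l)).norm
  set J := ∫ y in x..(x + l), ‖v y‖ ^ 2 with hJ
  have hJv : (∫ y in x..(x + l), ‖v y‖) ^ 2 ≤ l * J := by
    simpa using sq_intervalIntegral_le hxl hv1 hv2
  have hpt : ∀ y ∈ Icc x (x + l), ‖u x‖ ^ 2 - 2 * l * J ≤ 2 * ‖u y‖ ^ 2 := by
    intro y hy
    have h1 : u x = u y - ∫ t in x..y, v t := by
      rw [← (h x trivial y trivial).2]; ring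
    have h2 : ‖∫ t in x..y, v t‖ ≤ ∫ t in x..(x + l), ‖v t‖ :=
      (intervalIntegral.norm_integral_le_integral_norm hy.1).trans
        (intervalIntegral.integral_mono_interval le_rfl hy.1 hy.2
          (Eventually.of_forall fun t => norm_nonneg _) hv1)
    have h3 : ‖u x‖ ≤ ‖u y‖ + ∫ t in x..(x + l), ‖v t‖ := by
      rw [h1]
      exact (norm_sub_le _ _).trans (by gcongr)
    have h4 : ‖u x‖ ^ 2 ≤ (‖u y‖ + ∫ t in x..(x + l), ‖v t‖) ^ 2 := by gcongr
    nlinarith [sq_nonneg (‖u y‖ - ∫ t in x..(x + l), ‖v t‖)]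
  have hint := intervalIntegral.integral_mono_on hxl (intervalIntegrable_const (c := ‖u x‖ ^ 2 - 2 * l * J))
    (hu2.const_mul 2) hpt
  rw [intervalIntegral.integral_const, intervalIntegral.integral_const_mul, smul_eq_mul,
    add_sub_cancel_left] at hint
  have hfin : ‖u x‖ ^ 2 ≤ ∫ y in x..(x + l), (2 / l * ‖u y‖ ^ 2 + 2 * l * ‖v y‖ ^ 2) := by
    rw [intervalIntegral.integral_add (hu2.const_mul _) (hv2.const_mul _),
      intervalIntegral.integral_const_mul, intervalIntegral.integral_const_mul, ← hJ]
    have : ‖u x‖ ^ 2 - 2 * l * J ≤ 2 / l * ∫ y in x..(x + l), ‖u y‖ ^ 2 := by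
      rw [div_mul_eq_mul_div, le_div_iff₀ hl]
      linarith
    linarith
  rw [enorm_sq_eq_ofReal, ← ofReal_intervalIntegral_eq hxl ((hu2.const_mul _).add (hv2.const_mul _))
    (fun y => by positivity)]
  exact ENNReal.ofReal_le_ofReal hfin

/-- `f ∈ H¹(ℝ)` with derivative `d`. -/
def HasL2Deriv (f d : L2Line) : Prop :=
  ∃ u : ℝ → ℂ, IsACWithDeriv univ u d ∧ ∀ᵐ x, f x = u x

theorem hasL2Deriv_test (f : TestC) : HasL2Deriv (testL2 f) (testL2 (derivTest f)) := by
  refine ⟨f, (isACWithDeriv_test f univ).congr_deriv ordConnected_univ ?_, MemLp.coeFn_toLp _⟩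
  have : ∀ᵐ x, testL2 (derivTest f) x = derivTest f x := MemLp.coeFn_toLp _
  filter_upwards [this] with x hx _
  exact hx.symm

theorem HasL2Deriv.sub {f d f' d' : L2Line} (h : HasL2Deriv f d) (h' : HasL2Deriv f' d') :
    HasL2Deriv (f - f') (d - d') := by
  obtain ⟨u, hu, hfu⟩ := h
  obtain ⟨u', hu', hfu'⟩ := h'
  refine ⟨_, (hu.sub hu').congr_deriv ordConnected_univ ?_, ?_⟩
  · filter_upwards [Lp.coeFn_sub d d'] with x hx _
    exact hx.symm
  · filter_upwards [Lp.coeFn_sub f f', hfu, hfu'] with x h1 h2 h3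
    rw [h1, Pi.sub_apply, h2, h3]

theorem mem_lineGraph_iff {φ : ℝ → ℝ} {f g : L2Line} : (f, g) ∈ lineGraph φ ↔
    ∃ d, HasL2Deriv f d ∧ ∀ᵐ x, g x = d x + φ x * f x := by
  constructor
  · rintro ⟨u, v, h1, h2, h3, h4⟩
    refine ⟨h2.toLp v, ⟨u, h1.congr_deriv ordConnected_univ ?_, h3⟩, ?_⟩
    · filter_upwards [h2.coeFn_toLp] with x hx _
      exact hx.symm
    · filter_upwards [h2.coeFn_toLp, h3, h4] with x e1 e2 e3
      rw [e1, e2, e3]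
  · rintro ⟨d, ⟨u, h1, h2⟩, h3⟩
    refine ⟨u, d, h1, Lp.memLp d, h2, ?_⟩
    filter_upwards [h2, h3] with x e1 e2
    rw [e2, e1]

theorem ofReal_sq_norm {X : Type*} [NormedAddCommGroup X] (f : X) : ‖f‖ₑ ^ 2 = ENNReal.ofReal (‖f‖ ^ 2) := by
  rw [← ofReal_norm, ← ENNReal.ofReal_pow (norm_nonneg _)]

/-- Multiplication by `φ ∈ L²_loc unif` maps `H¹(ℝ)` to `L²(ℝ)`, with relative bound zero with
respect to the derivative. -/
theorem IsUnifLocL2.exists_mul {φ : ℝ → ℝ} (h : IsUnifLocL2 φ) {ε : ℝ} (hε : 0 < ε) :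
    ∃ C : ℝ, 0 ≤ C ∧ ∀ f d : L2Line, HasL2Deriv f d → ∃ m : L2Line,
      (∀ᵐ x, m x = φ x * f x) ∧ ‖m‖ ^ 2 ≤ ε * ‖d‖ ^ 2 + C * ‖f‖ ^ 2 := by
  obtain ⟨C₀, hC₀⟩ := h.exists_lintegral_le
  set l : ℝ := min 1 (ε / (2 * (C₀ + 1))) with hl
  have hlpos : 0 < l := by positivity
  have hl1 : l ≤ 1 := min_le_left _ _
  have hle : C₀ * (2 * l) ≤ ε := by
    have h1 : l ≤ ε / (2 * (C₀ + 1)) := min_le_right _ _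
    rw [le_div_iff₀ (by positivity)] at h1
    have : (0 : ℝ) ≤ C₀ := C₀.2
    nlinarith
  refine ⟨C₀ * (2 / l), by positivity, fun f d hfd => ?_⟩
  obtain ⟨u, hu, hfu⟩ := hfd
  have hd := Lp.memLp d
  set k : ℝ → ℝ≥0∞ := fun y => ENNReal.ofReal (2 / l * ‖u y‖ ^ 2 + 2 * l * ‖d y‖ ^ 2) with hk
  have hkm : AEMeasurable k volume :=
    (((hu.continuous.aestronglyMeasurable.norm.pow 2).const_mul _).add
      ((hd.1.norm.pow 2).const_mul _)).aemeasurable.ennreal_ofReal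
  have h1 := h.lintegral_mul_le hC₀ hkm hl1 (fun x => hu.enorm_sq_le hd hlpos x)
  have hf2 : ∫⁻ x, ‖u x‖ₑ ^ 2 = ‖f‖ₑ ^ 2 := by
    rw [Lp.enorm_sq_eq_lintegral]
    refine lintegral_congr_ae ?_
    filter_upwards [hfu] with x hx
    rw [hx]
  have h2 : ∫⁻ y, k y = ENNReal.ofReal (2 / l) * ‖f‖ₑ ^ 2 + ENNReal.ofReal (2 * l) * ‖d‖ₑ ^ 2 := by
    rw [← hf2, Lp.enorm_sq_eq_lintegral,
      ← lintegral_const_mul' _ _ ENNReal.ofReal_ne_top,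
      ← lintegral_const_mul' _ _ ENNReal.ofReal_ne_top, ← lintegral_add_left']
    · refine lintegral_congr fun y => ?_
      simp only [hk]
      rw [enorm_sq_eq_ofReal, enorm_sq_eq_ofReal, ← ENNReal.ofReal_mul (by positivity),
        ← ENNReal.ofReal_mul (by positivity), ENNReal.ofReal_add (by positivity) (by positivity)]
    · exact (hu.continuous.aestronglyMeasurable.enorm.pow_const 2).const_mul _
  have hφu : AEStronglyMeasurable (fun x => (φ x : ℂ) * u x) volume :=
    (Complex.continuous_ofReal.comp_aestronglyMeasurable h.aestronglyMeasurable).mul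
      hu.continuous.aestronglyMeasurable
  have hbound : ∫⁻ x, ‖(φ x : ℂ) * u x‖ₑ ^ 2 ≤
      ENNReal.ofReal (ε * ‖d‖ ^ 2 + C₀ * (2 / l) * ‖f‖ ^ 2) := by
    refine h1.trans ?_
    rw [h2, ofReal_sq_norm, ofReal_sq_norm, ← ENNReal.ofReal_mul (by positivity),
      ← ENNReal.ofReal_mul (by positivity), ← ENNReal.ofReal_add (by positivity) (by positivity),
      ← ENNReal.ofReal_coe_nnreal, ← ENNReal.ofReal_mul (by positivity)]
    refine ENNReal.ofReal_le_ofReal ?_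
    have := mul_le_mul_of_nonneg_right hle (sq_nonneg ‖d‖)
    linarith
  have hmem : MemLp (fun x => (φ x : ℂ) * u x) 2 volume :=
    (memLp_two_iff_lintegral hφu).2 (hbound.trans_lt ENNReal.ofReal_lt_top)
  refine ⟨hmem.toLp _, ?_, ?_⟩
  · filter_upwards [hmem.coeFn_toLp, hfu] with x e1 e2
    rw [e1, e2]
  · rw [← ENNReal.ofReal_le_ofReal_iff (by positivity), ← ofReal_sq_norm, Lp.enorm_sq_eq_lintegral]
    refine le_trans (le_of_eq ?_) hbound
    refine lintegral_congr_ae ?_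
    filter_upwards [hmem.coeFn_toLp] with x e1
    rw [e1]

/-! ### The operator `d/dx + φ` on the line and its adjoint -/

theorem HasCompactSupport.exists_abs_le {X : Type*} [Zero X] {f : ℝ → X}
    (hf : HasCompactSupport f) : ∃ R : ℝ, 0 < R ∧ ∀ x, R ≤ |x| → f x = 0 := by
  obtain ⟨R, hR⟩ := hf.isCompact.isBounded.subset_ball 0
  refine ⟨max R 1, by positivity, fun x hx => ?_⟩
  by_contra h0
  have := hR (subset_tsupport f h0)
  rw [mem_ball_zero_iff, Real.norm_eq_abs] at this
  exact absurd (le_max_left R 1) (by linarith)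

/-- A smooth compactly supported function of mean zero is the derivative of a test function. -/
theorem exists_test_primitive {d : ℝ → ℝ} (hd : ContDiff ℝ (⊤ : ℕ∞) d) (hc : HasCompactSupport d)
    (h0 : ∫ x, d x = 0) : ∃ D : TestC, ∀ x, derivTest D x = d x := by
  obtain ⟨R, hR, hsupp⟩ := hc.exists_abs_le
  have hder : ∀ x, HasDerivAt (fun x => ((∫ t in (-R)..x, d t : ℝ) : ℂ)) (d x) x := fun x =>
    (hd.continuous.integral_hasStrictDerivAt (-R) x).hasDerivAt.ofReal_comp
  have hderiv : deriv (fun x => ((∫ t in (-R)..x, d t : ℝ) : ℂ)) = fun x => (d x : ℂ) :=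
    funext fun x => (hder x).deriv
  let D : TestC :=
    { toFun := fun x => ((∫ t in (-R)..x, d t : ℝ) : ℂ)
      contDiff' := by
        refine (contDiff_infty_iff_deriv (𝕜 := ℝ)).2 ⟨fun x => (hder x).differentiableAt, ?_⟩
        rw [hderiv]
        exact Complex.ofRealCLM.contDiff.comp hd
      hasCompactSupport' := by
        refine HasCompactSupport.intro (isCompact_Icc (a := -R) (b := R)) fun x hx => ?_
        rw [Complex.ofReal_eq_zero]
        rw [mem_Icc, not_and_or, not_le, not_le] at hx
        rcases hx with hx | hx
        · rw [intervalIntegral.integral_symm, neg_eq_zero]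
          refine (intervalIntegral.integral_congr fun t ht => ?_).trans intervalIntegral.integral_zero
          rw [uIcc_of_le hx.le] at ht
          refine hsupp t ?_
          rw [abs_of_nonpos (by linarith [ht.2])]
          linarith [ht.2]
        · rw [intervalIntegral.integral_eq_integral_of_support_subset, h0]
          intro t ht
          by_contra hnot
          apply ht
          apply hsupp
          rw [mem_Ioc, not_and_or, not_lt, not_le] at hnot
          rcases hnot with h1 | h1
          · rw [abs_of_nonpos (by linarith)]; linarith
          · rw [abs_of_nonneg (by linarith)]; linarith
      tsupport_subset' := fun _ _ => trivial }
  exact ⟨D, fun x => (hder x).deriv⟩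

theorem integral_eq_intervalIntegral_of_abs {f : ℝ → ℂ} {R : ℝ}
    (hf : ∀ x, R ≤ |x| → f x = 0) : ∫ x, f x = ∫ x in (-R)..R, f x := by
  rw [intervalIntegral.integral_eq_integral_of_support_subset]
  intro t ht
  by_contra hnot
  apply ht
  apply hf
  rw [mem_Ioc, not_and_or, not_lt, not_le] at hnot
  rcases hnot with h1 | h1
  · exact le_abs.2 (Or.inr (by linarith))
  · exact le_abs.2 (Or.inl h1.le)

/-- Integration by parts against a compactly supported function. -/
theorem IsACWithDeriv.integral_mul_compact {G k u v : ℝ → ℂ} (hG : IsACWithDeriv univ G k)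
    (hu : IsACWithDeriv univ u v) {R : ℝ} (hu0 : ∀ x, R ≤ |x| → u x = 0)
    (hv0 : ∀ x, R ≤ |x| → v x = 0) :
    ∫ x, G x * v x = - ∫ x, k x * u x := by
  have h := (hG.mul hu ordConnected_univ) (-R) trivial R trivial
  rw [integral_eq_intervalIntegral_of_abs (f := fun x => G x * v x) (R := R)
      (fun x hx => by rw [hv0 x hx, mul_zero]),
    integral_eq_intervalIntegral_of_abs (f := fun x => k x * u x) (R := R)
      (fun x hx => by rw [hu0 x hx, mul_zero])]
  have h1 : G R * u R - G (-R) * u (-R) = ∫ x in (-R)..R, (k x * u x + G x * v x) := h.2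
  rw [hu0 R (le_abs_self R), hu0 (-R) (by rw [abs_neg]; exact le_abs_self R),
    intervalIntegral.integral_add] at h1
  · linear_combination -h1
  · exact (hG.intervalIntegrable _ _).mul_continuousOn hu.continuous.continuousOn
  · exact (hu.intervalIntegrable _ _).continuousOn_mul hG.continuous.continuousOn

theorem exists_abs_le_test (f : TestC) : ∃ R : ℝ, 0 < R ∧ (∀ x, R ≤ |x| → f x = 0) ∧
    ∀ x, R ≤ |x| → derivTest f x = 0 := by
  obtain ⟨R, hR, h1⟩ := f.hasCompactSupport.exists_abs_le
  obtain ⟨R', hR', h2⟩ := (derivTest f).hasCompactSupport.exists_abs_le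
  exact ⟨max R R', by positivity, fun x hx => h1 x ((le_max_left _ _).trans hx),
    fun x hx => h2 x ((le_max_right _ _).trans hx)⟩

/-- The lemma of du Bois-Reymond: a function whose distributional derivative is locally
integrable is absolutely continuous. -/
theorem exists_isACWithDeriv_of_integral_test {g k : ℝ → ℂ} (hg : LocallyIntegrable g volume)
    (hk : ∀ p q, IntervalIntegrable k volume p q)
    (h : ∀ η : TestC, ∫ x, g x * derivTest η x = - ∫ x, k x * η x) :
    ∃ u, IsACWithDeriv univ u k ∧ ∀ᵐ x, g x = u x := by
  set G : ℝ → ℂ := fun x => ∫ t in (0 : ℝ)..x, k t with hGdef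
  have hG : IsACWithDeriv univ G k := IsACWithDeriv.primitive hk 0 univ
  have hloc : LocallyIntegrable (fun x => g x - G x) volume :=
    hg.sub hG.continuous.locallyIntegrable
  have h1 : ∀ η : TestC, ∫ x, derivTest η x * (g x - G x) = 0 := by
    intro η
    obtain ⟨R, hR, e1, e2⟩ := exists_abs_le_test η
    have i1 := hG.integral_mul_compact (isACWithDeriv_test η univ) e1 e2
    have j1 : Integrable (fun x => derivTest η x • g x) :=
      hg.integrable_smul_left_of_hasCompactSupport (derivTest η).continuous (derivTest η).hasCompactSupport
    have j2 : Integrable (fun x => derivTest η x • G x) :=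
      hG.continuous.locallyIntegrable.integrable_smul_left_of_hasCompactSupport
        (derivTest η).continuous (derivTest η).hasCompactSupport
    simp only [smul_eq_mul] at j1 j2
    simp only [mul_sub]
    rw [integral_sub j1 j2]
    have i2 := h η
    simp only [mul_comm (derivTest η _)]
    rw [i1, i2, sub_self]
  let b : ContDiffBump (0 : ℝ) := ⟨1, 2, by norm_num, by norm_num⟩
  set c : ℂ := ∫ x, b.normed volume x • (g x - G x) with hc
  have hbi : ∫ x, b.normed volume x = 1 := b.integral_normed
  have hz : ∀ᵐ x, g x - G x - c = 0 := by
    refine ae_eq_zero_of_integral_contDiff_smul_eq_zero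
      (hloc.sub continuous_const.locallyIntegrable) ?_
    intro η hη hηc
    set m := ∫ x, η x with hm
    have hηi : Integrable η := hη.continuous.integrable_of_hasCompactSupport hηc
    have hbint : Integrable (b.normed volume) := b.integrable_normed
    obtain ⟨D, hD⟩ := exists_test_primitive (d := fun x => η x - m * b.normed volume x)
      (hη.sub (contDiff_const.mul b.contDiff_normed))
      (hηc.sub b.hasCompactSupport_normed.mul_left) (by
        rw [integral_sub hηi (hbint.const_mul m), integral_const_mul, hbi, mul_one, hm, sub_self])
    have e := h1 D
    have i1 : Integrable (fun x => η x • (g x - G x)) :=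
      hloc.integrable_smul_left_of_hasCompactSupport hη.continuous hηc
    have i2 : Integrable (fun x => b.normed volume x • (g x - G x)) :=
      hloc.integrable_smul_left_of_hasCompactSupport b.continuous_normed b.hasCompactSupport_normed
    have e2 : ∫ x, derivTest D x * (g x - G x) =
        (∫ x, η x • (g x - G x)) - (m : ℂ) * c := by
      rw [hc, ← integral_const_mul, ← integral_sub i1 (i2.const_mul _)]
      refine integral_congr_ae (Eventually.of_forall fun x => ?_)
      simp only [hD, Complex.ofReal_sub, Complex.ofReal_mul, Complex.real_smul]
      ring
    have e3 : ∫ x, η x • (g x - G x - c) = (∫ x, η x • (g x - G x)) - (m : ℂ) * c := by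
      simp only [smul_sub]
      rw [integral_sub (by simpa only [smul_sub] using i1) (hηi.smul_const c), integral_smul_const, Complex.real_smul]
    change ∫ x, η x • (g x - G x - c) = 0
    rw [e3, ← e2, e]
  refine ⟨fun x => G x + c, by simpa using hG.add (IsACWithDeriv.const univ c), ?_⟩
  filter_upwards [hz] with x hx
  linear_combination hx

/-- The complex conjugate of a test function. -/
def conjTest (f : TestC) : TestC where
  toFun x := starRingEnd ℂ (f x)
  contDiff' := Complex.conjCLE.contDiff.comp f.contDiff
  hasCompactSupport' := f.hasCompactSupport.comp_left (map_zero _)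
  tsupport_subset' := fun _ _ => trivial

theorem derivTest_conjTest (f : TestC) (x : ℝ) :
    derivTest (conjTest f) x = starRingEnd ℂ (derivTest f x) := by
  have h1 : HasDerivAt f (derivTest f x) x :=
    (f.contDiff.differentiable (by simp) x).hasDerivAt
  exact (Complex.conjCLE.toContinuousLinearMap.hasFDerivAt.comp_hasDerivAt x h1).deriv

theorem conjTest_apply (f : TestC) (x : ℝ) : conjTest f x = starRingEnd ℂ (f x) := rfl

theorem coeFn_testL2 (f : TestC) : ∀ᵐ x, testL2 f x = f x := MemLp.coeFn_toLp _

theorem Lp.locallyIntegrable_two (g : L2Line) : LocallyIntegrable g volume :=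
  (Lp.memLp g).locallyIntegrable (by norm_num)

theorem sq_intervalIntegral_mul_le {f g : ℝ → ℝ} {a b : ℝ} (hab : a ≤ b)
    (hf : IntervalIntegrable (fun x => f x ^ 2) volume a b)
    (hg : IntervalIntegrable (fun x => g x ^ 2) volume a b)
    (hfg : IntervalIntegrable (fun x => f x * g x) volume a b) :
    (∫ x in a..b, f x * g x) ^ 2 ≤ (∫ x in a..b, f x ^ 2) * ∫ x in a..b, g x ^ 2 := by
  have h : ∀ t : ℝ, 0 ≤ (∫ x in a..b, g x ^ 2) * (t * t) + (-2 * ∫ x in a..b, f x * g x) * t +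
      ∫ x in a..b, f x ^ 2 := by
    intro t
    have h0 : 0 ≤ ∫ x in a..b, (f x - t * g x) ^ 2 :=
      intervalIntegral.integral_nonneg hab fun x _ => sq_nonneg _
    have e : ∀ x, (f x - t * g x) ^ 2 = f x ^ 2 - 2 * t * (f x * g x) + t ^ 2 * g x ^ 2 :=
      fun x => by ring
    simp only [e] at h0
    rw [intervalIntegral.integral_add (hf.sub (hfg.const_mul _)) (hg.const_mul _),
      intervalIntegral.integral_sub hf (hfg.const_mul _), intervalIntegral.integral_const_mul,
      intervalIntegral.integral_const_mul] at h0
    linarith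
  have := discrim_le_zero h
  rw [discrim] at this
  linarith

namespace IsUnifLocL2

variable {φ : ℝ → ℝ}

theorem exists_mul_test (h : IsUnifLocL2 φ) (f : TestC) :
    ∃ a, (testL2 f, a) ∈ lineGraph φ ∧ ∀ᵐ x, a x = derivTest f x + φ x * f x := by
  obtain ⟨C, -, hC⟩ := h.exists_mul one_pos
  obtain ⟨m, hm, -⟩ := hC _ _ (hasL2Deriv_test f)
  refine ⟨testL2 (derivTest f) + m, mem_lineGraph_iff.2 ⟨_, hasL2Deriv_test f, ?_⟩, ?_⟩
  · filter_upwards [Lp.coeFn_add (testL2 (derivTest f)) m, hm] with x h1 h2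
    rw [h1, Pi.add_apply, h2]
  · filter_upwards [Lp.coeFn_add (testL2 (derivTest f)) m, hm, coeFn_testL2 f,
      coeFn_testL2 (derivTest f)] with x h1 h2 h3 h4
    rw [h1, Pi.add_apply, h2, h3, h4]

theorem intervalIntegrable_ofReal_mul (h : IsUnifLocL2 φ) {g : ℝ → ℂ} (hg : MemLp g 2 volume)
    (p q : ℝ) : IntervalIntegrable (fun x => (φ x : ℂ) * g x) volume p q := by
  rw [intervalIntegrable_iff]
  refine IntegrableOn.mono_set (t := Icc (min p q) (max p q)) ?_ Ioc_subset_Icc_self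
  exact MemLp.integrable_mul (p := 2) (q := 2) ((h.memLp _ _).ofReal (K := ℂ)) (hg.restrict _)

/-- A solution in `L²` of `u' = φ u - h` with `h ∈ L²` has `φ u ∈ L²`. -/
theorem memLp_mul_of_isACWithDeriv (h : IsUnifLocL2 φ) {u : ℝ → ℂ} {b : ℝ → ℂ}
    (hb : MemLp b 2 volume) (hu2 : MemLp u 2 volume)
    (hu : IsACWithDeriv univ u (fun x => φ x * u x - b x)) :
    MemLp (fun x => (φ x : ℂ) * u x) 2 volume := by
  obtain ⟨C₀, hC₀⟩ := h.exists_lintegral_le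
  have hsq : ∀ x, ∫ y in x..(x + 1), φ y ^ 2 ≤ C₀ := by
    intro x
    have h1 := hC₀ (x + 1)
    have h2 := ofReal_intervalIntegral_eq (by linarith) (h.intervalIntegrable_sq x (x + 1))
      (fun y => sq_nonneg (φ y))
    have h3 : ∀ y, ENNReal.ofReal (φ y ^ 2) = ‖φ y‖ₑ ^ 2 := by
      intro y
      rw [← ofReal_norm, ← ENNReal.ofReal_pow (norm_nonneg _), Real.norm_eq_abs, sq_abs]
    simp only [h3] at h2
    rw [add_sub_cancel_right, ← h2, ← ENNReal.ofReal_coe_nnreal,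
      ENNReal.ofReal_le_ofReal_iff C₀.coe_nonneg] at h1
    exact h1
  set k : ℝ → ℝ := fun y => 3 * (1 + C₀) * ‖u y‖ ^ 2 + 3 * ‖b y‖ ^ 2 with hk
  have hu2' := MemLp.intervalIntegrable_norm_sq hu2
  have hb2' := MemLp.intervalIntegrable_norm_sq hb
  have hpt : ∀ x, ‖u x‖ₑ ^ 2 ≤ ∫⁻ y in Icc x (x + 1), ENNReal.ofReal (k y) := by
    intro x
    have hx1 : x ≤ x + 1 := by linarith
    have iφu : IntervalIntegrable (fun y => ‖(φ y : ℂ) * u y‖) volume x (x + 1) :=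
      (h.intervalIntegrable_ofReal_mul hu2 _ _).norm
    have ib := (MemLp.intervalIntegrable_two hb x (x + 1)).norm
    set J := ∫ y in x..(x + 1), ‖u y‖ ^ 2 with hJ
    set K := ∫ y in x..(x + 1), ‖b y‖ ^ 2 with hK
    have hJ0 : 0 ≤ J := intervalIntegral.integral_nonneg hx1 fun y _ => sq_nonneg _
    have hP : (∫ y in x..(x + 1), ‖(φ y : ℂ) * u y‖) ^ 2 ≤ C₀ * J := by
      have h1 := sq_intervalIntegral_mul_le hx1 (f := fun y => |φ y|) (g := fun y => ‖u y‖)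
        (by simpa using h.intervalIntegrable_sq x (x + 1)) (hu2' _ _)
        (by simpa using iφu)
      simp only [sq_abs] at h1
      have h2 : ∀ y, ‖(φ y : ℂ) * u y‖ = |φ y| * ‖u y‖ := fun y => by
        rw [norm_mul, Complex.norm_real, Real.norm_eq_abs]
      simp only [h2]
      exact h1.trans (by gcongr; exact hsq x)
    have hB : (∫ y in x..(x + 1), ‖b y‖) ^ 2 ≤ K := by
      simpa using sq_intervalIntegral_le hx1 ib (hb2' _ _)
    set P := ∫ y in x..(x + 1), ‖(φ y : ℂ) * u y‖ with hPdef
    set B := ∫ y in x..(x + 1), ‖b y‖ with hBdef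
    have hy : ∀ y ∈ Icc x (x + 1), ‖u x‖ ^ 2 - 3 * (C₀ * J + K) ≤ 3 * ‖u y‖ ^ 2 := by
      intro y hy
      have h1 : u x = u y - ∫ t in x..y, (φ t * u t - b t) := by
        rw [← (hu x trivial y trivial).2]; ring
      have h2 : ‖∫ t in x..y, (φ t * u t - b t)‖ ≤ P + B := by
        rw [hPdef, hBdef, ← intervalIntegral.integral_add iφu ib]
        refine (intervalIntegral.norm_integral_le_integral_norm hy.1).trans ?_
        refine le_trans ?_ (intervalIntegral.integral_mono_interval le_rfl hy.1 hy.2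
          (Eventually.of_forall fun t => by positivity) (iφu.add ib))
        refine intervalIntegral.integral_mono_on hy.1 (hu.intervalIntegrable _ _).norm
          ((h.intervalIntegrable_ofReal_mul hu2 _ _).norm.add
            (MemLp.intervalIntegrable_two hb _ _).norm) fun t _ => norm_sub_le _ _
      have h3 : ‖u x‖ ≤ ‖u y‖ + (P + B) := by
        rw [h1]
        exact (norm_sub_le _ _).trans (by gcongr)
      have h4 : ‖u x‖ ^ 2 ≤ (‖u y‖ + (P + B)) ^ 2 := by gcongr
      nlinarith [sq_nonneg (‖u y‖ - P), sq_nonneg (‖u y‖ - B), sq_nonneg (P - B)]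
    have hint := intervalIntegral.integral_mono_on hx1
      (intervalIntegrable_const (c := ‖u x‖ ^ 2 - 3 * (C₀ * J + K)))
      ((hu2' x (x + 1)).const_mul 3) hy
    rw [intervalIntegral.integral_const, intervalIntegral.integral_const_mul, smul_eq_mul,
      add_sub_cancel_left, one_mul] at hint
    have ik : IntervalIntegrable k volume x (x + 1) :=
      ((hu2' _ _).const_mul _).add ((hb2' _ _).const_mul _)
    rw [enorm_sq_eq_ofReal, ← ofReal_intervalIntegral_eq hx1 ik
      (fun y => by simp only [hk]; positivity)]
    refine ENNReal.ofReal_le_ofReal ?_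
    rw [hk, intervalIntegral.integral_add ((hu2' _ _).const_mul _) ((hb2' _ _).const_mul _),
      intervalIntegral.integral_const_mul, intervalIntegral.integral_const_mul]
    linarith
  have hki : Integrable k :=
    (((memLp_two_iff_integrable_sq_norm hu2.1).1 hu2).const_mul _).add
      (((memLp_two_iff_integrable_sq_norm hb.1).1 hb).const_mul _)
  have h1 := h.lintegral_mul_le hC₀ hki.1.aemeasurable.ennreal_ofReal le_rfl hpt
  refine (memLp_two_iff_lintegral ?_).2 (h1.trans_lt ?_)
  · exact (Complex.continuous_ofReal.comp_aestronglyMeasurable h.aestronglyMeasurable).mul hu2.1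
  · refine ENNReal.mul_lt_top ENNReal.coe_lt_top ?_
    rw [← ofReal_integral_eq_lintegral_ofReal hki
      (Eventually.of_forall fun y => by simp only [hk]; positivity)]
    exact ENNReal.ofReal_lt_top

/-- An element of the domain of the adjoint of `d/dx + φ`, restricted to test functions, belongs
to `H¹(ℝ)`. -/
theorem mem_lineGraph_neg_of_test (h : IsUnifLocL2 φ) {g k : L2Line}
    (H : ∀ (f : TestC) (a : L2Line), (testL2 f, a) ∈ lineGraph φ →
      inner ℂ a g = inner ℂ (testL2 f) k) :
    (g, -k) ∈ lineGraph (fun x => - φ x) := by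
  have hint : ∀ p q, IntervalIntegrable (fun x => (φ x : ℂ) * g x - k x) volume p q := fun p q =>
    (h.intervalIntegrable_ofReal_mul (Lp.memLp g) p q).sub
      (MemLp.intervalIntegrable_two (Lp.memLp k) p q)
  obtain ⟨u, hu, hgu⟩ := exists_isACWithDeriv_of_integral_test (Lp.locallyIntegrable_two g) hint (by
    intro η
    obtain ⟨a, ha, hae⟩ := h.exists_mul_test (conjTest η)
    have h1 := H _ _ ha
    rw [L2.inner_def, L2.inner_def] at h1
    have i1 : Integrable (fun x => g x * derivTest η x) :=
      (Lp.memLp g).integrable_mul (q := 2) (p := 2)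
        ((derivTest η).continuous.memLp_of_hasCompactSupport (derivTest η).hasCompactSupport)
    have i3 : Integrable (fun x => k x * η x) :=
      (Lp.memLp k).integrable_mul (q := 2) (p := 2)
        (η.continuous.memLp_of_hasCompactSupport η.hasCompactSupport)
    have i2 : Integrable (fun x => (φ x : ℂ) * g x * η x) := by
      have j : Integrable (fun x => a x * starRingEnd ℂ (g x)) :=
        (Lp.memLp a).integrable_mul (q := 2) (p := 2) (Lp.memLp g).star
      have j2 : Integrable (fun x => starRingEnd ℂ (a x * starRingEnd ℂ (g x))) :=
        Complex.conjCLE.integrable_comp_iff.2 j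
      refine (j2.sub i1).congr ?_
      filter_upwards [hae] with x hx
      simp only [Pi.sub_apply]
      rw [hx, derivTest_conjTest]
      simp [conjTest_apply]
      ring
    have e1 : ∫ x, inner ℂ (a x) (g x) = (∫ x, g x * derivTest η x) + ∫ x, (φ x : ℂ) * g x * η x := by
      rw [← integral_add i1 i2]
      refine integral_congr_ae ?_
      filter_upwards [hae] with x hx
      rw [hx, derivTest_conjTest]
      simp [conjTest_apply]
      ring
    have e2 : ∫ x, inner ℂ (testL2 (conjTest η) x) (k x) = ∫ x, k x * η x := by
      refine integral_congr_ae ?_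
      filter_upwards [coeFn_testL2 (conjTest η)] with x hx
      rw [hx]
      simp [conjTest_apply]
    rw [e1, e2] at h1
    have e3 : ∫ x, ((φ x : ℂ) * g x - k x) * η x =
        (∫ x, (φ x : ℂ) * g x * η x) - ∫ x, k x * η x := by
      rw [← integral_sub i2 i3]
      refine integral_congr_ae (Eventually.of_forall fun x => ?_)
      simp only
      ring
    rw [e3]
    linear_combination h1)
  have hu' : IsACWithDeriv univ u (fun x => φ x * u x - k x) := by
    refine hu.congr_deriv ordConnected_univ ?_
    filter_upwards [hgu] with x hx _
    rw [hx]
  have hu2 : MemLp u 2 volume := (memLp_congr_ae hgu).1 (Lp.memLp g)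
  have hφu := h.memLp_mul_of_isACWithDeriv (Lp.memLp k) hu2 hu'
  refine ⟨u, _, hu', hφu.sub (Lp.memLp k), hgu, ?_⟩
  filter_upwards [Lp.coeFn_neg k] with x hx
  rw [hx]
  simp
  ring

end IsUnifLocL2

/-- An integrable absolutely continuous function with integrable derivative has total increment
zero. -/
theorem IsACWithDeriv.integral_deriv_eq_zero {w w' : ℝ → ℂ} (h : IsACWithDeriv univ w w')
    (hw : Integrable w) (hw' : Integrable w') : ∫ x, w' x = 0 := by
  have h1 : Tendsto (fun R : ℝ => ∫ x in (-R)..R, w' x) atTop (𝓝 (∫ x, w' x)) :=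
    intervalIntegral_tendsto_integral hw' tendsto_neg_atTop_atBot tendsto_id
  have h2 : (fun R : ℝ => ∫ x in (-R)..R, w' x) = fun R => w R - w (-R) := by
    ext R
    rw [(h (-R) trivial R trivial).2]
  rw [h2] at h1
  have h3 : Integrable (fun R => w R - w (-R)) := hw.sub hw.comp_neg
  refine IntegrableAtFilter.eq_zero_of_tendsto (h3.integrableAtFilter atTop) ?_ h1
  intro s hs
  obtain ⟨b, hb⟩ := mem_atTop_sets.1 hs
  rw [← top_le_iff, ← Real.volume_Ici (a := b)]
  exact measure_mono hb

/-- `d/dx + φ` and `-d/dx + φ` are formally adjoint on `H¹(ℝ)`. -/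
theorem inner_lineGraph {φ : ℝ → ℝ} {f k g l : L2Line} (h1 : (f, k) ∈ lineGraph φ)
    (h2 : (g, l) ∈ lineGraph (fun x => - φ x)) : inner ℂ k g = - inner ℂ f l := by
  obtain ⟨u, v, hu, hv, hfu, hkv⟩ := h1
  obtain ⟨a, b, ha, hb, hga, hlb⟩ := h2
  simp only at hfu hkv hga hlb
  have hw := hu.conj.mul ha ordConnected_univ
  have hu2 : MemLp u 2 volume := (memLp_congr_ae hfu).1 (Lp.memLp f)
  have ha2 : MemLp a 2 volume := (memLp_congr_ae hga).1 (Lp.memLp g)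
  have hdint : Integrable (fun x => starRingEnd ℂ (v x) * a x + starRingEnd ℂ (u x) * b x) :=
    (hv.star.integrable_mul (q := 2) (p := 2) ha2).add
      (hu2.star.integrable_mul (q := 2) (p := 2) hb)
  have h0 := hw.integral_deriv_eq_zero (hu2.star.integrable_mul (q := 2) (p := 2) ha2) hdint
  rw [eq_neg_iff_add_eq_zero, L2.inner_def, L2.inner_def, ← integral_add, ← h0]
  · refine integral_congr_ae ?_
    filter_upwards [hfu, hkv, hga, hlb] with x e1 e2 e3 e4
    rw [e1, e2, e3, e4]
    simp
    ring
  · exact L2.integrable_inner k g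
  · exact L2.integrable_inner f l

/-- The first component determines the second, because an absolutely continuous function that
vanishes almost everywhere has zero derivative. -/
theorem lineGraph_functional {φ : ℝ → ℝ} : ∀ p ∈ lineGraph φ, p.1 = 0 → p.2 = 0 := by
  rintro ⟨f, g⟩ hfg (rfl : f = 0)
  obtain ⟨u, v, hu, hv, hfu, hgv⟩ := hfg
  simp only at hfu hgv
  have hu0 : ∀ᵐ x, u x = 0 := by
    filter_upwards [hfu, Lp.coeFn_zero ℂ 2 (volume : Measure ℝ)] with x h1 h2
    rw [← h1, h2]; rfl
  have hu0' : u = fun _ => 0 :=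
    (hu.continuous.ae_eq_iff_eq volume continuous_const).1 hu0
  subst hu0'
  have hv0 : ∀ᵐ x, v x = 0 := by
    have hd : ∀ n : ℕ, ∀ᵐ x, x ∈ uIcc (-(n : ℝ)) n → HasDerivAt (fun _ : ℝ => (0 : ℂ)) (v x) x :=
      fun n => (hu.mono (subset_univ _)).ae_hasDerivAt
    rw [← ae_all_iff] at hd
    filter_upwards [hd] with x hx
    obtain ⟨n, hn⟩ := exists_nat_ge |x|
    have h1 := hx n (by
      rw [uIcc_of_le (by linarith [abs_nonneg x])]
      exact abs_le.1 hn)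
    exact h1.unique (hasDerivAt_const x 0)
  refine Lp.ext ?_
  filter_upwards [hgv, hv0, Lp.coeFn_zero ℂ 2 (volume : Measure ℝ)] with x e1 e2 e3
  rw [e1, e2, e3]
  simp

theorem graph_lineOp (φ : ℝ → ℝ) : (lineOp φ).graph = lineGraph φ :=
  Submodule.toLinearPMap_graph_eq _ lineGraph_functional

theorem mem_graph_neg {E F : Type*} [NormedAddCommGroup E] [InnerProductSpace ℂ E]
    [NormedAddCommGroup F] [InnerProductSpace ℂ F] {A : E →ₗ.[ℂ] F} {x : E} {y : F} :
    (x, y) ∈ (-A).graph ↔ (x, -y) ∈ A.graph := by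
  simp only [LinearPMap.mem_graph_iff]
  constructor
  · rintro ⟨z, h1, h2⟩
    exact ⟨z, h1, by rw [← h2]; exact (neg_neg _).symm⟩
  · rintro ⟨z, h1, h2⟩
    refine ⟨z, h1, ?_⟩
    change -(A z) = y
    rw [h2, neg_neg]

theorem dense_test : Dense (range testL2) := by
  have h := Lp.dense_hasCompactSupport_contDiff (E := ℝ) (F := ℂ) (μ := volume) (p := 2) (by simp)
  refine h.mono ?_
  rintro f ⟨g, hfg, hgc, hg⟩
  refine ⟨⟨g, hg, hgc, fun _ _ => trivial⟩, ?_⟩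
  refine Lp.ext ?_
  filter_upwards [hfg, coeFn_testL2 ⟨g, hg, hgc, fun _ _ => trivial⟩] with x h1 h2
  rw [h1, h2]
  rfl

/-- The operators `d/dx + φ` and `-d/dx + φ` on `H¹(ℝ)` are adjoint to each other. -/
theorem IsUnifLocL2.isAdjointPair {φ : ℝ → ℝ} (h : IsUnifLocL2 φ) :
    IsAdjointPair (lineOp φ) (-(lineOp fun x => - φ x)) := by
  have hd : ∀ {ψ : ℝ → ℝ}, IsUnifLocL2 ψ → Dense ((lineOp ψ).domain : Set L2Line) := by
    intro ψ hψ
    refine dense_test.mono ?_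
    rintro _ ⟨f, rfl⟩
    obtain ⟨a, ha, -⟩ := hψ.exists_mul_test f
    rw [← graph_lineOp] at ha
    exact LinearPMap.mem_domain_of_mem_graph ha
  have hd2 : Dense ((-(lineOp fun x => - φ x)).domain : Set L2Line) := hd h.neg
  refine ⟨hd h, hd2, ?_, ?_⟩
  · apply LinearPMap.eq_of_eq_graph
    rw [LinearPMap.adjoint_graph_eq_graph_adjoint (hd h)]
    ext ⟨g, k⟩
    rw [Submodule.mem_adjoint_iff, mem_graph_neg, graph_lineOp, graph_lineOp]
    constructor
    · intro H
      exact h.mem_lineGraph_neg_of_test fun f a ha => sub_eq_zero.1 (H _ _ ha)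
    · intro H a b hab
      rw [inner_lineGraph hab H, inner_neg_right]
      ring
  · apply LinearPMap.eq_of_eq_graph
    rw [LinearPMap.adjoint_graph_eq_graph_adjoint hd2]
    ext ⟨g, k⟩
    rw [Submodule.mem_adjoint_iff, graph_lineOp]
    constructor
    · intro H
      have := h.neg.mem_lineGraph_neg_of_test (g := g) (k := -k) fun f a ha => by
        have := H (testL2 f) (-a) (by rw [mem_graph_neg, graph_lineOp, neg_neg]; exact ha)
        simp only [inner_neg_left] at this
        rw [inner_neg_right]
        linear_combination -this
      simpa using this
    · intro H a b hab
      rw [mem_graph_neg, graph_lineOp] at hab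
      have h2 : (g, k) ∈ lineGraph (fun x => - (fun x => - φ x) x) := by simpa using H
      have := inner_lineGraph hab h2
      rw [inner_neg_left] at this
      simp only
      linear_combination -this

theorem IsUnifLocL2.opT1_eq {φ : ℝ → ℝ} (h : IsUnifLocL2 φ) :
    opT1 φ = opComp (-(lineOp fun x => - φ x)) (lineOp φ) := by
  rw [opT1, h.isAdjointPair.adjoint_left]

theorem IsUnifLocL2.opT2_eq {φ : ℝ → ℝ} (h : IsUnifLocL2 φ) :
    opT2 φ = opComp (lineOp φ) (-(lineOp fun x => - φ x)) := by
  rw [opT2, h.isAdjointPair.adjoint_left]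

theorem IsUnifLocL2.diracOp_eq {φ : ℝ → ℝ} (h : IsUnifLocL2 φ) :
    diracOp φ = offDiagOp (lineOp φ) (-(lineOp fun x => - φ x)) := by
  rw [diracOp, h.isAdjointPair.adjoint_left]

/-- Test functions are dense in `H¹(ℝ)`. -/
theorem HasL2Deriv.exists_test {f d : L2Line} (h : HasL2Deriv f d) :
    ∃ F : ℕ → TestC, Tendsto (fun n => testL2 (F n)) atTop (𝓝 f) ∧
      Tendsto (fun n => testL2 (derivTest (F n))) atTop (𝓝 d) := by
  have hz := IsUnifLocL2.zero
  let e := (WithLp.linearEquiv 2 ℂ (L2Line × L2Line)).toLinearMap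
  let K : Submodule ℂ (WithLp 2 (L2Line × L2Line)) := (lineGraph fun _ => 0).comap e
  let K' : Submodule ℂ (WithLp 2 (L2Line × L2Line)) :=
    { carrier := {p | ∃ η : TestC, p.fst = testL2 η ∧ p.snd = testL2 (derivTest η)}
      add_mem' := by
        rintro p p' ⟨η, h1, h2⟩ ⟨η', h1', h2'⟩
        exact ⟨η + η', by rw [testL2_add, ← h1, ← h1']; rfl,
          by rw [derivTest_add, testL2_add, ← h2, ← h2']; rfl⟩
      zero_mem' := ⟨0, by rw [testL2_zero]; rfl, by
        have := derivTest_smul 0 0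
        rw [zero_smul, zero_smul] at this
        rw [this, testL2_zero]; rfl⟩
      smul_mem' := by
        rintro c p ⟨η, h1, h2⟩
        exact ⟨c • η, by rw [testL2_smul, ← h1]; rfl,
          by rw [derivTest_smul, testL2_smul, ← h2]; rfl⟩ }
  have hmem : ∀ {f d : L2Line}, HasL2Deriv f d → (f, d) ∈ lineGraph fun _ => 0 := by
    intro f d h
    exact mem_lineGraph_iff.2 ⟨d, h, Eventually.of_forall fun x => by simp⟩
  have hK : IsClosed (K : Set (WithLp 2 (L2Line × L2Line))) := by
    have h1 := hz.isAdjointPair.isClosed_left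
    rw [graph_lineOp] at h1
    exact h1.preimage (WithLp.prod_continuous_ofLp 2 L2Line L2Line)
  have key : K ≤ K'.topologicalClosure := by
    refine Submodule.le_topologicalClosure_of_orthogonal hK ?_ ?_
    · rintro p ⟨η, h1, h2⟩
      have : (p.fst, p.snd) ∈ lineGraph fun _ => 0 := by
        rw [h1, h2]
        exact hmem (hasL2Deriv_test η)
      exact this
    · intro x hx hperp
      have hx' : (x.fst, x.snd) ∈ lineGraph fun _ => 0 := hx
      have h1 : (x.snd, - -x.fst) ∈ lineGraph (fun _ => - 0) := by
        refine hz.mem_lineGraph_neg_of_test fun η a ha => ?_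
        have ha' : a = testL2 (derivTest η) := by
          have := (lineGraph fun _ => 0).sub_mem ha (hmem (hasL2Deriv_test η))
          exact sub_eq_zero.1 (lineGraph_functional _ this (sub_self _))
        have h2 := hperp (WithLp.toLp 2 (testL2 η, a)) ⟨η, rfl, ha'⟩
        simp only [WithLp.prod_inner_apply] at h2
        change inner ℂ (testL2 η) x.fst + inner ℂ a x.snd = 0 at h2
        rw [inner_neg_right]
        linear_combination h2
      have h2 := inner_lineGraph hx' h1
      rw [neg_neg] at h2
      have h3 : inner ℂ x x = 0 := by
        simp only [WithLp.prod_inner_apply]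
        change inner ℂ x.fst x.fst + inner ℂ x.snd x.snd = 0
        rw [h2]; ring
      exact inner_self_eq_zero.1 h3
  have h1 : WithLp.toLp 2 (f, d) ∈ closure (K' : Set (WithLp 2 (L2Line × L2Line))) := key (hmem h)
  obtain ⟨p, hp, hlim⟩ := mem_closure_iff_seq_limit.1 h1
  choose F hF1 hF2 using hp
  refine ⟨F, ?_, ?_⟩
  · have := ((continuous_fst.comp (WithLp.prod_continuous_ofLp 2 L2Line L2Line)).tendsto _).comp hlim
    refine this.congr fun n => hF1 n
  · have := ((continuous_snd.comp (WithLp.prod_continuous_ofLp 2 L2Line L2Line)).tendsto _).comp hlim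
    refine this.congr fun n => hF2 n

/-! ### The form sum and the factorization of the Schrödinger operator -/

theorem hasDerivAt_test (w : TestC) (x : ℝ) : HasDerivAt (fun y => w y) (derivTest w x) x :=
  (w.contDiff.differentiable (by simp) x).hasDerivAt

theorem integrable_mul_test {β : ℝ → ℝ} (hβ : LocallyIntegrable β volume) (w : TestC) :
    Integrable (fun x => (β x : ℂ) * w x) := by
  have h1 : LocallyIntegrable (fun x => (β x : ℂ)) volume := by
    intro x
    obtain ⟨s, hs, h⟩ := hβ x
    exact ⟨s, hs, h.ofReal⟩
  have := h1.integrable_smul_left_of_hasCompactSupport w.continuous w.hasCompactSupport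
  simpa only [smul_eq_mul, mul_comm] using this

/-- If `q = β + α'` on real test functions then the same holds for the complex extension. -/
theorem evalC_eq {q : RealDistribution} {α β : ℝ → ℝ} (hα : LocallyIntegrable α volume)
    (hβ : LocallyIntegrable β volume)
    (hq : ∀ f : 𝓓((⊤ : Opens ℝ), ℝ), q f = (∫ x, β x * f x) - ∫ x, α x * deriv (fun y => f y) x)
    (w : TestC) :
    evalC q w = (∫ x, (β x : ℂ) * w x) - ∫ x, (α x : ℂ) * derivTest w x := by
  have i1 := integrable_mul_test hβ w
  have i2 := integrable_mul_test hα (derivTest w)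
  have hre : ∀ x, TestFunction.postcompCLM Complex.reCLM w x = (w x).re := fun x => rfl
  have him : ∀ x, TestFunction.postcompCLM Complex.imCLM w x = (w x).im := fun x => rfl
  have dre : ∀ x, deriv (fun y => TestFunction.postcompCLM Complex.reCLM w y) x =
      (derivTest w x).re := fun x =>
    (Complex.reCLM.hasFDerivAt.comp_hasDerivAt x (hasDerivAt_test w x)).deriv
  have dim : ∀ x, deriv (fun y => TestFunction.postcompCLM Complex.imCLM w y) x =
      (derivTest w x).im := fun x =>
    (Complex.imCLM.hasFDerivAt.comp_hasDerivAt x (hasDerivAt_test w x)).deriv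
  have r1 := Complex.reCLM.integral_comp_comm i1
  have r2 := Complex.reCLM.integral_comp_comm i2
  have m1 := Complex.imCLM.integral_comp_comm i1
  have m2 := Complex.imCLM.integral_comp_comm i2
  simp only [Complex.reCLM_apply, Complex.imCLM_apply, Complex.re_ofReal_mul,
    Complex.im_ofReal_mul] at r1 r2 m1 m2
  rw [evalC, hq, hq]
  simp only [dre, dim]
  simp only [hre, him]
  rw [r1, r2, m1, m2]
  apply Complex.ext <;> simp

theorem IsUnifLocL2.locallyIntegrable {φ : ℝ → ℝ} (h : IsUnifLocL2 φ) :
    LocallyIntegrable φ volume := by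
  intro x
  refine ⟨Icc (x - 1) (x + 1), Icc_mem_nhds (by linarith) (by linarith), ?_⟩
  exact (h.memLp _ _).integrable (by norm_num)

theorem IsUnifLocL2.locallyIntegrable_sq {φ : ℝ → ℝ} (h : IsUnifLocL2 φ) :
    LocallyIntegrable (fun x => φ x ^ 2) volume := by
  intro x
  refine ⟨Icc (x - 1) (x + 1), Icc_mem_nhds (by linarith) (by linarith), ?_⟩
  exact (memLp_two_iff_integrable_sq (h.memLp _ _).1).1 (h.memLp _ _)

theorem conjMulTest_apply (g f : TestC) (x : ℝ) :
    conjMulTest g f x = starRingEnd ℂ (g x) * f x := rfl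

theorem derivTest_conjMulTest (g f : TestC) (x : ℝ) :
    derivTest (conjMulTest g f) x =
      starRingEnd ℂ (derivTest g x) * f x + starRingEnd ℂ (g x) * derivTest f x := by
  have h1 := (Complex.conjCLE.toContinuousLinearMap.hasFDerivAt.comp_hasDerivAt x
    (hasDerivAt_test g x)).mul (hasDerivAt_test f x)
  exact h1.deriv

/-- The distribution `q` equals `φ² - φ' - C`. -/
def IsMiura (q : RealDistribution) (φ : ℝ → ℝ) (C : ℝ) : Prop :=
  ∀ f : 𝓓((⊤ : Opens ℝ), ℝ),
    q f = (∫ x, φ x ^ 2 * f x) + (∫ x, φ x * deriv (fun y => f y) x) - C * ∫ x, f x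

section

variable {q : RealDistribution} {φ : ℝ → ℝ} {C : ℝ}

/-- The Schrödinger form is `(A g, A f) - C (g, f)` if `q = φ² - φ' - C`. -/
theorem schrodingerForm_eq (h : IsUnifLocL2 φ) (hq : IsMiura q φ C) {g f : TestC} {a b : L2Line}
    (ha : (testL2 g, a) ∈ lineGraph φ) (hb : (testL2 f, b) ∈ lineGraph φ) :
    schrodingerForm q g f = inner ℂ a b - C * inner ℂ (testL2 g) (testL2 f) := by
  have hae : ∀ {η : TestC} {c : L2Line}, (testL2 η, c) ∈ lineGraph φ →
      ∀ᵐ x, c x = derivTest η x + φ x * η x := by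
    intro η c hc
    obtain ⟨c', hc', h'⟩ := h.exists_mul_test η
    have := (lineGraph φ).sub_mem hc hc'
    have e : c = c' := sub_eq_zero.1 (lineGraph_functional _ this (sub_self _))
    rw [e]; exact h'
  have l1 : LocallyIntegrable (fun x => φ x ^ 2 - C) volume :=
    h.locallyIntegrable_sq.sub continuous_const.locallyIntegrable
  have l2 : LocallyIntegrable (fun x => - φ x) volume := h.neg.locallyIntegrable
  have e := evalC_eq l2 l1 (q := q) (fun η => by
    have iη : Integrable (fun x => η x) :=
      η.continuous.integrable_of_hasCompactSupport η.hasCompactSupport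
    have iφη : Integrable (fun x => φ x ^ 2 * η x) := by
      have := h.locallyIntegrable_sq.integrable_smul_left_of_hasCompactSupport η.continuous
        η.hasCompactSupport
      simpa only [smul_eq_mul, mul_comm] using this
    rw [hq η]
    have : ∫ x, (φ x ^ 2 - C) * η x = (∫ x, φ x ^ 2 * η x) - C * ∫ x, η x := by
      rw [← integral_const_mul, ← integral_sub iφη (iη.const_mul C)]
      refine integral_congr_ae (Eventually.of_forall fun x => ?_)
      simp only; ring
    rw [this]
    simp only [neg_mul, integral_neg]
    ring) (conjMulTest g f)
  have i1 := integrable_mul_test l1 (conjMulTest g f)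
  have i2 := integrable_mul_test l2 (derivTest (conjMulTest g f))
  have i3 : Integrable fun x => ((φ x ^ 2 - C : ℝ) : ℂ) * conjMulTest g f x -
      ((-φ x : ℝ) : ℂ) * derivTest (conjMulTest g f) x := i1.sub i2
  rw [schrodingerForm, e, L2.inner_def, L2.inner_def, L2.inner_def, ← integral_sub i1 i2,
    ← integral_add (L2.integrable_inner _ _) i3, ← integral_const_mul,
    ← integral_sub (L2.integrable_inner _ _) ((L2.integrable_inner _ _).const_mul _)]
  refine integral_congr_ae ?_
  filter_upwards [hae ha, hae hb, coeFn_testL2 g, coeFn_testL2 f, coeFn_testL2 (derivTest g),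
    coeFn_testL2 (derivTest f)] with x e1 e2 e3 e4 e5 e6
  simp only [e1, e2, e3, e4, e5, e6, conjMulTest_apply, derivTest_conjMulTest,
    RCLike.inner_apply, map_add, map_mul, Complex.conj_ofReal, Complex.ofReal_neg,
    Complex.ofReal_sub, Complex.ofReal_pow]
  ring

theorem hasL2Deriv_of_tendsto {F D : ℕ → L2Line} {f d : L2Line}
    (h : ∀ n, HasL2Deriv (F n) (D n)) (hF : Tendsto F atTop (𝓝 f)) (hD : Tendsto D atTop (𝓝 d)) :
    HasL2Deriv f d := by
  have hcl := IsUnifLocL2.zero.isAdjointPair.isClosed_left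
  rw [graph_lineOp] at hcl
  have h1 : (f, d) ∈ lineGraph fun _ => 0 :=
    hcl.mem_of_tendsto (hF.prodMk_nhds hD) (Eventually.of_forall fun n =>
      mem_lineGraph_iff.2 ⟨D n, h n, Eventually.of_forall fun x => by simp⟩)
  obtain ⟨d', h2, h3⟩ := mem_lineGraph_iff.1 h1
  have : d = d' := Lp.ext (by filter_upwards [h3] with x hx; simpa using hx)
  rwa [this]

/-- `d/dx + φ` is continuous from `H¹(ℝ)` to `L²(ℝ)`. -/
theorem IsUnifLocL2.tendsto_of_hasL2Deriv (h : IsUnifLocL2 φ) {F D A : ℕ → L2Line}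
    {f d a : L2Line} (hFD : ∀ n, HasL2Deriv (F n) (D n)) (hfd : HasL2Deriv f d)
    (hF : Tendsto F atTop (𝓝 f)) (hD : Tendsto D atTop (𝓝 d))
    (hA : ∀ n, (F n, A n) ∈ lineGraph φ) (ha : (f, a) ∈ lineGraph φ) :
    Tendsto A atTop (𝓝 a) := by
  obtain ⟨C, hC0, hC⟩ := h.exists_mul one_pos
  have hb : ∀ n, ‖A n - a‖ ≤ ‖D n - d‖ + Real.sqrt (1 * ‖D n - d‖ ^ 2 + C * ‖F n - f‖ ^ 2) := by
    intro n
    obtain ⟨m, hm, hmb⟩ := hC _ _ ((hFD n).sub hfd)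
    have h1 : (F n - f, (D n - d) + m) ∈ lineGraph φ := by
      refine mem_lineGraph_iff.2 ⟨_, (hFD n).sub hfd, ?_⟩
      filter_upwards [Lp.coeFn_add (D n - d) m, hm] with x e1 e2
      rw [e1, Pi.add_apply, e2]
    have h2 := (lineGraph φ).sub_mem ((lineGraph φ).sub_mem (hA n) ha) h1
    have h3 : A n - a = D n - d + m :=
      sub_eq_zero.1 (lineGraph_functional _ h2 (sub_self _))
    rw [h3]
    refine (norm_add_le _ _).trans ?_
    gcongr
    exact Real.le_sqrt_of_sq_le hmb
  rw [tendsto_iff_norm_sub_tendsto_zero] at hF hD ⊢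
  refine squeeze_zero (fun _ => norm_nonneg _) hb ?_
  have := hD.add ((((hD.pow 2).const_mul 1).add ((hF.pow 2).const_mul C)).sqrt)
  simpa using this

theorem IsUnifLocL2.exists_mem_lineGraph (h : IsUnifLocL2 φ) {f d : L2Line} (hfd : HasL2Deriv f d) :
    ∃ a, (f, a) ∈ lineGraph φ := by
  obtain ⟨C, -, hC⟩ := h.exists_mul one_pos
  obtain ⟨m, hm, -⟩ := hC _ _ hfd
  refine ⟨d + m, mem_lineGraph_iff.2 ⟨_, hfd, ?_⟩⟩
  filter_upwards [Lp.coeFn_add d m, hm] with x e1 e2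
  rw [e1, Pi.add_apply, e2]

/-- The operator associated with the form sum is `A* A - C` if `q = φ² - φ' - C`. -/
theorem mem_schrodingerGraph_iff (h : IsUnifLocL2 φ) (hq : IsMiura q φ C) {f k : L2Line} :
    (f, k) ∈ schrodingerGraph q ↔ (f, k + (C : ℂ) • f) ∈ (opT1 φ).graph := by
  rw [h.opT1_eq, mem_graph_opComp]
  simp only [mem_graph_neg, graph_lineOp]
  choose A hA using fun η : TestC => h.exists_mem_lineGraph (hasL2Deriv_test η)
  have hform : ∀ g η : TestC, schrodingerForm q g η =
      inner ℂ (A g) (A η) - C * inner ℂ (testL2 g) (testL2 η) := fun g η =>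
    schrodingerForm_eq h hq (hA g) (hA η)
  have hlim : ∀ (F : ℕ → TestC) (d a : L2Line), Tendsto (fun n => testL2 (F n)) atTop (𝓝 f) →
      Tendsto (fun n => testL2 (derivTest (F n))) atTop (𝓝 d) → (f, a) ∈ lineGraph φ →
      ∀ g, Tendsto (fun n => schrodingerForm q g (F n)) atTop
        (𝓝 (inner ℂ (A g) a - C * inner ℂ (testL2 g) f)) := by
    intro F d a hF hD ha g
    have hfd := hasL2Deriv_of_tendsto (fun n => hasL2Deriv_test (F n)) hF hD
    have hAn := h.tendsto_of_hasL2Deriv (fun n => hasL2Deriv_test (F n)) hfd hF hD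
      (fun n => hA (F n)) ha
    simp only [hform]
    exact (tendsto_const_nhds.inner hAn).sub ((tendsto_const_nhds.inner hF).const_mul _)
  constructor
  · rintro ⟨F, ⟨hF, d, hD⟩, hconv⟩
    have hfd := hasL2Deriv_of_tendsto (fun n => hasL2Deriv_test (F n)) hF hD
    obtain ⟨a, ha⟩ := h.exists_mem_lineGraph hfd
    refine ⟨a, ha, h.mem_lineGraph_neg_of_test fun g b hb => ?_⟩
    have e := tendsto_nhds_unique (hlim F d a hF hD ha g) (hconv g)
    have hbA : b = A g :=
      sub_eq_zero.1 (lineGraph_functional _ ((lineGraph φ).sub_mem hb (hA g)) (sub_self _))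
    rw [hbA, inner_add_right, inner_smul_right]
    simp only at e
    linear_combination e
  · rintro ⟨a, ha, hak⟩
    obtain ⟨d, hfd, -⟩ := mem_lineGraph_iff.1 ha
    obtain ⟨F, hF, hD⟩ := hfd.exists_test
    refine ⟨F, ⟨hF, d, hD⟩, fun g => ?_⟩
    have e := hlim F d a hF hD ha g
    have e2 := inner_lineGraph (hA g) hak
    rw [inner_neg_right, inner_add_right, inner_smul_right] at e2
    have e3 : inner ℂ (A g) a - C * inner ℂ (testL2 g) f = inner ℂ (testL2 g) k := by
      rw [e2]; ring
    rw [e3] at e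
    exact e

theorem schrodingerOp_eq_opT1 (h : IsUnifLocL2 φ) (hq : IsMiura q φ 0) :
    schrodingerOp q = opT1 φ := by
  have hg : schrodingerGraph q = (opT1 φ).graph := by
    ext ⟨f, k⟩
    simpa using mem_schrodingerGraph_iff h hq (f := f) (k := k)
  apply LinearPMap.eq_of_eq_graph
  rw [schrodingerOp, Submodule.toLinearPMap_graph_eq, hg]
  intro x hx hx0
  rw [hg] at hx
  exact (opT1 φ).graph_fst_eq_zero_snd hx hx0

/-- If the operator associated with the form sum is nonnegative, then so is its form. -/
theorem mul_norm_sq_le_of_isNonnegOp (h : IsUnifLocL2 φ) (hq : IsMiura q φ C)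
    (hT : IsNonnegOp (schrodingerOp q)) {f a : L2Line} (hfa : (f, a) ∈ lineGraph φ) :
    C * ‖f‖ ^ 2 ≤ ‖a‖ ^ 2 := by
  have hfun : ∀ p ∈ schrodingerGraph q, p.1 = 0 → p.2 = 0 := by
    rintro ⟨f, k⟩ hfk (rfl : f = 0)
    have := (mem_schrodingerGraph_iff h hq).1 hfk
    rw [smul_zero, add_zero] at this
    exact (opT1 φ).graph_fst_eq_zero_snd this rfl
  have hP := h.isAdjointPair
  have hre : ∀ r t : ℝ, ((r : ℂ) ^ 2 - C * (t : ℂ) ^ 2).re = r ^ 2 - C * t ^ 2 := fun r t => by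
    rw [← Complex.ofReal_pow, ← Complex.ofReal_pow, ← Complex.ofReal_mul, ← Complex.ofReal_sub,
      Complex.ofReal_re]
  have h1 : ∀ p ∈ {p : L2Line × L2Line | p ∈ (lineOp φ).graph ∧
      p.2 ∈ (-(lineOp fun x => - φ x)).domain}, C * ‖p.1‖ ^ 2 ≤ ‖p.2‖ ^ 2 := by
    rintro ⟨f, a⟩ ⟨hfa, ha⟩
    obtain ⟨k, hk⟩ := LinearPMap.mem_domain_iff.1 ha
    have h2 : (f, k - (C : ℂ) • f) ∈ schrodingerGraph q := by
      rw [mem_schrodingerGraph_iff h hq, sub_add_cancel, h.opT1_eq, mem_graph_opComp]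
      exact ⟨a, hfa, hk⟩
    rw [← Submodule.toLinearPMap_graph_eq _ hfun] at h2
    obtain ⟨y, hy1, hy2⟩ := (LinearPMap.mem_graph_iff _).1 h2
    have h3 := hT y
    simp only at hy1 hy2
    have hy2' : schrodingerOp q y = k - (C : ℂ) • f := hy2
    rw [hy2', hy1, inner_sub_right, inner_smul_right, ← hP.inner_eq hfa hk,
      inner_self_eq_norm_sq_to_K, inner_self_eq_norm_sq_to_K] at h3
    exact sub_nonneg.1 (h3.trans_eq (hre _ _))
  have hcl : IsClosed {p : L2Line × L2Line | C * ‖p.1‖ ^ 2 ≤ ‖p.2‖ ^ 2} :=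
    isClosed_le (by fun_prop) (by fun_prop)
  have h2 : (f, a) ∈ (lineOp φ).graph := by rw [graph_lineOp]; exact hfa
  have h3 := closure_minimal h1 hcl (hP.mem_closure_graph_restrict h2)
  exact sub_nonneg.1 (sub_nonneg.2 h3)

end

/-! ### The first-order operator on the period cell -/

/-- An integral operator with a square-integrable family of functionals as its kernel is
compact: it is a limit of operators with simple kernels, which have finite rank. -/
theorem isCompactOperator_compLp {X H : Type*} [MeasurableSpace X] {μ : Measure X}
    [NormedAddCommGroup H] [NormedSpace ℂ H] (W : Lp (H →L[ℂ] ℂ) 2 μ) :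
    IsCompactOperator
      ((ContinuousLinearMap.compLpL₂ 2 μ (ContinuousLinearMap.apply ℂ ℂ (E := H))).flip W) := by
  induction W using Lp.induction (p := 2) ENNReal.ofNat_ne_top with
  | indicatorConst c hs hμs =>
    rename_i s
    set T := (ContinuousLinearMap.compLpL₂ 2 μ (ContinuousLinearMap.apply ℂ ℂ (E := H))).flip
      (Lp.simpleFunc.indicatorConst 2 hs hμs.ne c : Lp (H →L[ℂ] ℂ) 2 μ) with hT
    have e : T = ((ContinuousLinearMap.id ℂ ℂ).smulRight
        (indicatorConstLp 2 hs hμs.ne (1 : ℂ))).comp c := by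
      ext1 f
      refine Lp.ext ?_
      have h1 := (ContinuousLinearMap.apply ℂ ℂ f).coeFn_compLp
        (Lp.simpleFunc.indicatorConst 2 hs hμs.ne c : Lp (H →L[ℂ] ℂ) 2 μ)
      have h2 : ∀ᵐ x ∂μ, (indicatorConstLp 2 hs hμs.ne c) x = s.indicator (fun _ => c) x :=
        indicatorConstLp_coeFn
      have h3 : ∀ᵐ x ∂μ, (indicatorConstLp 2 hs hμs.ne (1 : ℂ)) x = s.indicator (fun _ => 1) x :=
        indicatorConstLp_coeFn
      filter_upwards [h1, h2, h3, Lp.coeFn_smul (c f) (indicatorConstLp 2 hs hμs.ne (1 : ℂ))]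
        with x e1 e2 e3 e4
      refine e1.trans ?_
      rw [Lp.simpleFunc.coe_indicatorConst, e2]
      refine Eq.trans ?_ e4.symm
      rw [Pi.smul_apply, e3]
      by_cases hx : x ∈ s <;> simp [hx]
    have hc : IsCompactOperator ((ContinuousLinearMap.id ℂ ℂ).smulRight
        (indicatorConstLp 2 hs hμs.ne (1 : ℂ))) :=
      isCompactOperator_of_locallyCompactSpace_rng _
    rw [e]
    exact hc.comp_clm c
  | add hf hg _ h1 h2 =>
    rw [map_add]
    exact h1.add h2
  | isClosed =>
    exact isClosed_setOfPred_isCompactOperator.preimage (ContinuousLinearMap.continuous _)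

section

variable {E : Type*} [NormedAddCommGroup E] [InnerProductSpace ℂ E] [CompleteSpace E]

theorem dense_and_adjoint_eq_of_surjective {A B : E →ₗ.[ℂ] E}
    (hAB : ∀ f g k l : E, (f, g) ∈ A.graph → (k, l) ∈ B.graph → inner ℂ g k = inner ℂ f l)
    (c : ℝ) {K K' : E → E} (hK : ∀ h, (K h, h - (c : ℂ) • K h) ∈ A.graph)
    (hK' : ∀ h, (K' h, h - (c : ℂ) • K' h) ∈ B.graph) :
    Dense (A.domain : Set E) ∧ A† = B := by
  have key : ∀ f g, inner ℂ f (K' g) = inner ℂ (K f) g := by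
    intro f g
    have := hAB _ _ _ _ (hK f) (hK' g)
    simp only [inner_sub_left, inner_sub_right, inner_smul_left, inner_smul_right,
      Complex.conj_ofReal] at this
    linear_combination this
  have dA : Dense (A.domain : Set E) := by
    rw [Submodule.dense_iff_topologicalClosure_eq_top, Submodule.topologicalClosure_eq_top_iff,
      Submodule.eq_bot_iff]
    intro f hf
    have hz : K' f = 0 := by
      refine inner_self_eq_zero (𝕜 := ℂ).1 ?_
      rw [key]
      exact (Submodule.mem_orthogonal _ _).1 hf _ (LinearPMap.mem_domain_of_mem_graph (hK _))
    have := hK' f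
    rw [hz, smul_zero, sub_zero] at this
    exact B.graph_fst_eq_zero_snd this rfl
  refine ⟨dA, LinearPMap.eq_of_eq_graph ?_⟩
  rw [LinearPMap.adjoint_graph_eq_graph_adjoint dA]
  ext ⟨k, l⟩
  rw [Submodule.mem_adjoint_iff]
  constructor
  · intro H
    have hk : k = K' (l + (c : ℂ) • k) := by
      refine ext_inner_left ℂ fun h => ?_
      have := H _ _ (hK h)
      rw [key, inner_add_right, inner_smul_right]
      simp only [inner_sub_left, inner_smul_left, Complex.conj_ofReal] at this
      linear_combination this
    have := hK' (l + (c : ℂ) • k)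
    rw [← hk, add_sub_cancel_right] at this
    exact this
  · intro H a b hab
    exact sub_eq_zero.2 (hAB _ _ _ _ hab H)

/-- Two formally adjoint operators are adjoint to each other if both have the same real number
`-c` in their resolvent sets. -/
theorem IsAdjointPair.of_surjective {A B : E →ₗ.[ℂ] E}
    (hAB : ∀ f g k l : E, (f, g) ∈ A.graph → (k, l) ∈ B.graph → inner ℂ g k = inner ℂ f l)
    (c : ℝ) {K K' : E → E} (hK : ∀ h, (K h, h - (c : ℂ) • K h) ∈ A.graph)
    (hK' : ∀ h, (K' h, h - (c : ℂ) • K' h) ∈ B.graph) : IsAdjointPair A B := by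
  obtain ⟨h1, h2⟩ := dense_and_adjoint_eq_of_surjective hAB c hK hK'
  obtain ⟨h3, h4⟩ := dense_and_adjoint_eq_of_surjective (A := B) (B := A)
    (fun f g k l h h' => by
      rw [← inner_conj_symm, ← hAB _ _ _ _ h' h, inner_conj_symm]) c hK' hK
  exact ⟨h1, h3, h2, h4⟩

end

section

variable {ω : ℝ} {φ : ℝ → ℝ} {θ : ℝ}

theorem IsACWithDeriv.primitive_Icc {v : ℝ → ℂ} (hω : 0 ≤ ω)
    (hv : IntegrableOn v (Icc 0 ω)) :
    IsACWithDeriv (Icc 0 ω) (fun x => ∫ t in (0 : ℝ)..x, v t) v := by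
  have hi : ∀ p ∈ Icc 0 ω, ∀ q ∈ Icc 0 ω, IntervalIntegrable v volume p q := by
    intro p hp q hq
    rw [intervalIntegrable_iff]
    exact hv.mono_set (uIoc_subset_uIcc.trans (ordConnected_Icc.uIcc_subset hp hq))
  intro p hp q hq
  have h0 : (0 : ℝ) ∈ Icc 0 ω := ⟨le_rfl, hω⟩
  exact ⟨hi p hp q hq, intervalIntegral.integral_interval_sub_left (hi 0 h0 q hq) (hi 0 h0 p hp)⟩

/-- `d/dx + φ` and `-d/dx + φ` with the same quasi-periodic boundary condition are formally adjoint: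
the boundary terms cancel since the multiplier has modulus one. -/
theorem inner_cellGraph (hω : 0 < ω) {f k g l : L2Cell ω} (h1 : (f, k) ∈ cellGraph ω φ θ)
    (h2 : (g, l) ∈ cellGraph ω (fun x => - φ x) θ) : inner ℂ k g = - inner ℂ f l := by
  obtain ⟨u, v, hu, hv, hbu, hfu, hkv⟩ := h1
  obtain ⟨a, b, ha, hb, hba, hga, hlb⟩ := h2
  simp only at hfu hkv hga hlb
  have hw := (hu.conj.mul ha ordConnected_Icc) 0 ⟨le_rfl, hω.le⟩ ω ⟨hω.le, le_rfl⟩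
  have hz : starRingEnd ℂ (u ω) * a ω - starRingEnd ℂ (u 0) * a 0 = 0 := by
    have e : starRingEnd ℂ (Complex.exp (Complex.I * θ)) * Complex.exp (Complex.I * θ) = 1 := by
      rw [← Complex.exp_conj, ← Complex.exp_add]
      simp
    rw [hbu, hba, map_mul]
    linear_combination starRingEnd ℂ (u 0) * a 0 * e
  have h0 := hw.2
  simp only at h0
  rw [hz, intervalIntegral.integral_of_le hω.le, ← integral_Icc_eq_integral_Ioc] at h0
  rw [eq_neg_iff_add_eq_zero, L2.inner_def, L2.inner_def, ← integral_add, h0]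
  · refine integral_congr_ae ?_
    filter_upwards [hfu, hkv, hga, hlb] with x e1 e2 e3 e4
    rw [e1, e2, e3, e4]
    simp
    ring
  · exact L2.integrable_inner k g
  · exact L2.integrable_inner f l

theorem cellGraph_functional (hω : 0 < ω) :
    ∀ p ∈ cellGraph ω φ θ, p.1 = 0 → p.2 = 0 := by
  rintro ⟨f, g⟩ hfg (rfl : f = 0)
  obtain ⟨u, v, hu, hv, -, hfu, hgv⟩ := hfg
  simp only at hfu hgv
  have hu0 : ∀ᵐ x ∂(volume.restrict (Icc 0 ω)), u x = 0 := by
    filter_upwards [hfu, Lp.coeFn_zero ℂ 2 ((volume : Measure ℝ).restrict (Icc 0 ω))] with x h1 h2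
    rw [← h1, h2]; rfl
  have hu0' : EqOn u (fun _ => 0) (Icc 0 ω) :=
    Measure.eqOn_Icc_of_ae_eq volume hω.ne hu0 hu.continuousOn_Icc continuousOn_const
  have hv0 : ∀ᵐ x ∂(volume.restrict (Icc 0 ω)), v x = 0 := by
    rw [ae_restrict_iff' measurableSet_Icc]
    have h1 := hu.congr (w := fun _ => 0) hu0'
    rw [← uIcc_of_le hω.le] at h1 ⊢
    filter_upwards [h1.ae_hasDerivAt] with x hx hxm
    exact (hx hxm).unique (hasDerivAt_const x 0)
  refine Lp.ext ?_
  filter_upwards [hgv, hv0, hu0, Lp.coeFn_zero ℂ 2 ((volume : Measure ℝ).restrict (Icc 0 ω))]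
    with x e1 e2 e3 e4
  rw [e1, e2, e3, e4]
  simp

theorem graph_cellOp (hω : 0 < ω) : (cellOp ω φ θ).graph = cellGraph ω φ θ :=
  Submodule.toLinearPMap_graph_eq _ (cellGraph_functional hω)

theorem mem_cellGraph_add_const {f g : L2Cell ω} {c : ℝ}
    (h : (f, g) ∈ cellGraph ω (fun x => φ x + c) θ) :
    (f, g - (c : ℂ) • f) ∈ cellGraph ω φ θ := by
  obtain ⟨u, v, hu, hv, hb, hf, hg⟩ := h
  refine ⟨u, v, hu, hv, hb, hf, ?_⟩
  filter_upwards [hf, hg, Lp.coeFn_sub g ((c : ℂ) • f), Lp.coeFn_smul (c : ℂ) f] with x e1 e2 e3 e4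
  rw [e3, Pi.sub_apply, e4, Pi.smul_apply, e1, e2, smul_eq_mul]
  push_cast
  ring

theorem setIntegral_norm_sq_le {X : Type*} [MeasurableSpace X] {μ : Measure X} (f : Lp ℂ 2 μ)
    (s : Set X) : ∫ t in s, ‖f t‖ ^ 2 ∂μ ≤ ‖f‖ ^ 2 := by
  have h1 : Integrable (fun t => ‖f t‖ ^ 2) μ :=
    (memLp_two_iff_integrable_sq_norm (Lp.memLp f).1).1 (Lp.memLp f)
  have h2 : ‖f‖ ^ 2 = ∫ t, ‖f t‖ ^ 2 ∂μ := by
    have h3 := Lp.enorm_sq_eq_lintegral f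
    simp only [ofReal_sq_norm] at h3
    rw [← ofReal_integral_eq_lintegral_ofReal h1 (Eventually.of_forall fun t => sq_nonneg _),
      ENNReal.ofReal_eq_ofReal_iff (sq_nonneg _) (integral_nonneg fun t => sq_nonneg _)] at h3
    exact h3
  rw [h2]
  exact setIntegral_le_integral h1 (Eventually.of_forall fun t => sq_nonneg _)

theorem L2Cell.integrableOn (f : L2Cell ω) : IntegrableOn f (Icc 0 ω) :=
  (Lp.memLp f).integrable (by norm_num)

/-- The functionals `f ↦ ∫₀ˣ E f` depend continuously on `x`. -/
theorem exists_continuousOn_functional (hω : 0 < ω) {E : ℝ → ℂ} (hE : ContinuousOn E (Icc 0 ω)) :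
    ∃ G : ℝ → (L2Cell ω →L[ℂ] ℂ), ContinuousOn G (Icc 0 ω) ∧
      ∀ x ∈ Icc 0 ω, ∀ f, G x f = ∫ t in (0 : ℝ)..x, E t * f t := by
  obtain ⟨M, hM⟩ := isCompact_Icc.exists_bound_of_continuousOn hE
  have hM0 : 0 ≤ M := (norm_nonneg _).trans (hM 0 ⟨le_rfl, hω.le⟩)
  have hmem : ∀ x : ℝ, MemLp ((Icc 0 x).indicator fun t => starRingEnd ℂ (E t)) 2
      (volume.restrict (Icc 0 ω)) := by
    intro x
    refine MemLp.indicator measurableSet_Icc (MemLp.of_bound (C := M) ?_ ?_)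
    · exact (Complex.continuous_conj.comp_continuousOn hE).aestronglyMeasurable measurableSet_Icc
    · filter_upwards [ae_restrict_mem measurableSet_Icc] with t ht
      simpa using hM t ht
  have hint : ∀ f : L2Cell ω, IntegrableOn (fun t => E t * f t) (Icc 0 ω) := fun f =>
    (L2Cell.integrableOn f).continuousOn_mul hE isCompact_Icc
  have hii : ∀ (f : L2Cell ω), ∀ p ∈ Icc 0 ω, ∀ q ∈ Icc 0 ω,
      IntervalIntegrable (fun t => E t * f t) volume p q := fun f p hp q hq => by
    rw [intervalIntegrable_iff]
    exact (hint f).mono_set (uIoc_subset_uIcc.trans (ordConnected_Icc.uIcc_subset hp hq))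
  have hG : ∀ x ∈ Icc 0 ω, ∀ f : L2Cell ω, innerSL ℂ (hmem x).toLp f =
      ∫ t in (0 : ℝ)..x, E t * f t := by
    intro x hx f
    rw [innerSL_apply_apply, L2.inner_def, intervalIntegral.integral_of_le hx.1,
      ← integral_Icc_eq_integral_Ioc]
    have e : (volume : Measure ℝ).restrict (Icc 0 x) =
        (volume.restrict (Icc 0 ω)).restrict (Icc 0 x) := by
      rw [Measure.restrict_restrict measurableSet_Icc,
        inter_eq_left.2 (Icc_subset_Icc_right hx.2)]
    rw [e, ← integral_indicator (f := fun t => E t * f t) measurableSet_Icc]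
    refine integral_congr_ae ?_
    filter_upwards [(hmem x).coeFn_toLp] with t ht
    rw [ht]
    by_cases h : t ∈ Icc 0 x
    · rw [indicator_of_mem h, indicator_of_mem h]; simp [mul_comm]
    · rw [indicator_of_notMem h, indicator_of_notMem h]; simp
  have hdiff : ∀ x ∈ Icc 0 ω, ∀ y ∈ Icc 0 ω, x ≤ y →
      ‖innerSL ℂ (hmem y).toLp - innerSL ℂ (hmem x).toLp‖ ≤ M * Real.sqrt (y - x) := by
    intro x hx y hy hxy
    refine ContinuousLinearMap.opNorm_le_bound _ (by positivity) fun f => ?_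
    have h0 : (0 : ℝ) ∈ Icc 0 ω := ⟨le_rfl, hω.le⟩
    have hfi : IntegrableOn f (Ioc x y) :=
      (L2Cell.integrableOn f).mono_set fun t ht => ⟨hx.1.trans ht.1.le, ht.2.trans hy.2⟩
    have hf2 : IntegrableOn (fun t => ‖f t‖ ^ 2) (Icc 0 ω) :=
      (memLp_two_iff_integrable_sq_norm (Lp.memLp f).1).1 (Lp.memLp f)
    rw [sub_apply, hG y hy, hG x hx,
      intervalIntegral.integral_interval_sub_left (hii f 0 h0 y hy) (hii f 0 h0 x hx)]
    have h1 : ‖∫ t in x..y, E t * f t‖ ≤ M * ∫ t in x..y, ‖f t‖ := by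
      rw [← intervalIntegral.integral_const_mul]
      refine (intervalIntegral.norm_integral_le_integral_norm hxy).trans ?_
      refine intervalIntegral.integral_mono_on hxy (hii f x hx y hy).norm
        (((intervalIntegrable_iff_integrableOn_Ioc_of_le hxy).2 hfi).norm.const_mul M) ?_
      intro t ht
      rw [norm_mul]
      gcongr
      exact hM t ⟨hx.1.trans ht.1, ht.2.trans hy.2⟩
    have h2 := sq_intervalIntegral_le hxy
      ((intervalIntegrable_iff_integrableOn_Ioc_of_le hxy).2 hfi).norm
      ((intervalIntegrable_iff_integrableOn_Ioc_of_le hxy).2 (hf2.mono_set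
        fun t ht => ⟨hx.1.trans ht.1.le, ht.2.trans hy.2⟩))
    have h3 : ∫ t in x..y, ‖f t‖ ^ 2 ≤ ‖f‖ ^ 2 := by
      rw [intervalIntegral.integral_of_le hxy]
      have e : Ioc x y = Ioc x y ∩ Icc 0 ω := by
        rw [left_eq_inter]; exact fun t ht => ⟨hx.1.trans ht.1.le, ht.2.trans hy.2⟩
      rw [e, ← Measure.restrict_restrict measurableSet_Ioc]
      exact setIntegral_norm_sq_le f _
    have h4 : ∫ t in x..y, ‖f t‖ ≤ Real.sqrt (y - x) * ‖f‖ := by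
      have h5 : 0 ≤ y - x := sub_nonneg.2 hxy
      refine abs_le_of_sq_le_sq' ?_ (by positivity) |>.2
      rw [mul_pow, Real.sq_sqrt h5]
      exact h2.trans (by gcongr)
    calc _ ≤ M * ∫ t in x..y, ‖f t‖ := h1
      _ ≤ M * (Real.sqrt (y - x) * ‖f‖) := by gcongr
      _ = _ := by ring
  refine ⟨fun x => innerSL ℂ (hmem x).toLp, fun x hx => ?_, hG⟩
  rw [ContinuousWithinAt, tendsto_iff_norm_sub_tendsto_zero]
  refine squeeze_zero' (g := fun y => M * Real.sqrt |y - x|)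
    (Eventually.of_forall fun _ => norm_nonneg _) ?_ ?_
  · filter_upwards [self_mem_nhdsWithin] with y hy
    rcases le_total x y with h | h
    · rw [abs_of_nonneg (sub_nonneg.2 h)]; exact hdiff x hx y hy h
    · rw [abs_of_nonpos (sub_nonpos.2 h), neg_sub, norm_sub_rev]; exact hdiff y hy x hx h
  · have : Continuous fun y => M * Real.sqrt |y - x| := by fun_prop
    have h := (this.tendsto x).mono_left (nhdsWithin_le_nhds (s := Icc 0 ω))
    simpa using h

/-- If `e^{iθ} exp (∫ φ) ≠ 1`, then the operator `d/dx + φ` on the cell has a compact inverse,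
given by variation of constants. -/
theorem exists_compact_inverse (hω : 0 < ω) (hφ : MemLp φ 2 (volume.restrict (Icc 0 ω)))
    (hne : Complex.exp (Complex.I * θ + (∫ t in (0 : ℝ)..ω, φ t : ℝ)) ≠ 1) :
    ∃ K : L2Cell ω →L[ℂ] L2Cell ω, IsCompactOperator K ∧
      ∀ f, (K f, f) ∈ cellGraph ω φ θ := by
  set P : ℝ → ℝ := fun x => ∫ t in (0 : ℝ)..x, φ t with hP
  have h0 : (0 : ℝ) ∈ Icc 0 ω := ⟨le_rfl, hω.le⟩
  have h1 : ω ∈ Icc 0 ω := ⟨hω.le, le_rfl⟩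
  have hφi : IntegrableOn φ (Icc 0 ω) := hφ.integrable (by norm_num)
  have hPac : IsACWithDeriv (Icc 0 ω) (fun x => (P x : ℂ)) (fun x => (φ x : ℂ)) := by
    have := IsACWithDeriv.primitive_Icc hω.le (v := fun x => (φ x : ℂ)) hφi.ofReal
    simpa only [intervalIntegral.integral_ofReal] using this
  have hEp := hPac.exp ordConnected_Icc
  have hEm := hPac.neg.exp ordConnected_Icc
  obtain ⟨G, hGc, hG⟩ := exists_continuousOn_functional hω hEp.continuousOn_Icc
  set c : ℂ := (Complex.exp (Complex.I * θ + P ω) - 1)⁻¹ with hc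
  set W : ℝ → (L2Cell ω →L[ℂ] ℂ) := fun x => Complex.exp (-(P x : ℂ)) • (c • G ω + G x) with hW
  have hWc : ContinuousOn W (Icc 0 ω) :=
    hEm.continuousOn_Icc.smul (continuousOn_const.add hGc)
  obtain ⟨M, hM⟩ := isCompact_Icc.exists_bound_of_continuousOn hWc
  have hWm : MemLp W 2 (volume.restrict (Icc 0 ω)) := by
    refine MemLp.of_bound (C := M) (hWc.aestronglyMeasurable measurableSet_Icc) ?_
    filter_upwards [ae_restrict_mem measurableSet_Icc] with t ht
    exact hM t ht
  refine ⟨_, isCompactOperator_compLp hWm.toLp, fun f => ?_⟩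
  have hfi := L2Cell.integrableOn f
  have hEf : IntegrableOn (fun t => Complex.exp (P t) * f t) (Icc 0 ω) :=
    hfi.continuousOn_mul hEp.continuousOn_Icc isCompact_Icc
  set u : ℝ → ℂ := fun x => Complex.exp (-(P x : ℂ)) *
    (c * (∫ t in (0 : ℝ)..ω, Complex.exp (P t) * f t) +
      ∫ t in (0 : ℝ)..x, Complex.exp (P t) * f t) with hu
  have huW : ∀ x ∈ Icc 0 ω, W x f = u x := by
    intro x hx
    simp only [hW, hu, smul_apply, add_apply, smul_eq_mul]
    rw [hG ω h1, hG x hx]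
  have huac : IsACWithDeriv (Icc 0 ω) u (fun x => f x - φ x * u x) := by
    have h2 := hEm.mul ((IsACWithDeriv.const (Icc 0 ω)
      (c * (∫ t in (0 : ℝ)..ω, Complex.exp (P t) * f t))).add
      (IsACWithDeriv.primitive_Icc hω.le hEf)) ordConnected_Icc
    refine h2.congr_deriv ordConnected_Icc (Eventually.of_forall fun x hx => ?_)
    have e : Complex.exp (-(P x : ℂ)) * Complex.exp (P x) = 1 := by
      rw [← Complex.exp_add]; simp
    simp only [hu]
    linear_combination f x * e
  have hφu : MemLp (fun x => (φ x : ℂ) * u x) 2 (volume.restrict (Icc 0 ω)) := by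
    obtain ⟨M', hM'⟩ := isCompact_Icc.exists_bound_of_continuousOn huac.continuousOn_Icc
    have h2 : MemLp u ⊤ (volume.restrict (Icc 0 ω)) := by
      refine memLp_top_of_bound (huac.continuousOn_Icc.aestronglyMeasurable measurableSet_Icc) M' ?_
      filter_upwards [ae_restrict_mem measurableSet_Icc] with t ht
      exact hM' t ht
    have h3 : MemLp (fun x => (φ x : ℂ)) 2 (volume.restrict (Icc 0 ω)) := hφ.ofReal
    exact h2.mul h3
  refine ⟨u, _, huac, (Lp.memLp f).sub hφu, ?_, ?_, ?_⟩
  · have hd : Complex.exp (Complex.I * θ + P ω) - 1 ≠ 0 := sub_ne_zero.2 hne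
    have hP0 : P 0 = 0 := by simp [hP]
    simp only [hu, hP0, intervalIntegral.integral_same, Complex.ofReal_zero, neg_zero,
      Complex.exp_zero, add_zero, one_mul]
    set J := ∫ t in (0 : ℝ)..ω, Complex.exp (P t) * f t
    have e1 : c + 1 = c * (Complex.exp (Complex.I * θ) * Complex.exp (P ω)) := by
      rw [← Complex.exp_add, hc]
      field_simp
      ring
    have e2 : Complex.exp (-(P ω : ℂ)) * Complex.exp (P ω) = 1 := by
      rw [← Complex.exp_add]; simp
    calc Complex.exp (-(P ω : ℂ)) * (c * J + J) = Complex.exp (-(P ω : ℂ)) * ((c + 1) * J) := by ring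
      _ = Complex.exp (Complex.I * θ) * (c * J) *
          (Complex.exp (-(P ω : ℂ)) * Complex.exp (P ω)) := by rw [e1]; ring
      _ = _ := by rw [e2, mul_one]
  · have h2 := (ContinuousLinearMap.apply ℂ ℂ f).coeFn_compLp hWm.toLp
    filter_upwards [h2, hWm.coeFn_toLp, ae_restrict_mem measurableSet_Icc] with x e1 e2 hx
    refine e1.trans ?_
    rw [e2, ← huW x hx]
    rfl
  · exact Eventually.of_forall fun x => by simp

/-- The operators `A_θ` and `-d/dx + φ`, with the same quasi-periodic boundary condition, are
adjoint to each other. -/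
theorem isAdjointPair_cellOp (hω : 0 < ω) (hφ : MemLp φ 2 (volume.restrict (Icc 0 ω))) (θ : ℝ) :
    IsAdjointPair (cellOp ω φ θ) (-(cellOp ω (fun x => - φ x) θ)) := by
  have hφi : IntervalIntegrable φ volume 0 ω := by
    rw [intervalIntegrable_iff_integrableOn_Icc_of_le hω.le]
    exact hφ.integrable (by norm_num)
  -- a shift by a constant makes the multiplier `e^{iθ} exp (∫ φ)` of modulus different from one
  set c : ℝ := (1 - ∫ t in (0 : ℝ)..ω, φ t) / ω with hc
  have hi : ∫ t in (0 : ℝ)..ω, (φ t + c) = 1 := by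
    rw [intervalIntegral.integral_add hφi intervalIntegrable_const, intervalIntegral.integral_const,
      hc, smul_eq_mul]
    field_simp
    ring
  have hi' : ∫ t in (0 : ℝ)..ω, (- φ t + -c) = -1 := by
    rw [← hi, ← intervalIntegral.integral_neg]
    congr 1; ext t; ring
  have hne : ∀ r : ℝ, r ≠ 0 → Complex.exp (Complex.I * θ + (r : ℝ)) ≠ 1 := by
    intro r hr h
    have h1 := congrArg norm h
    rw [Complex.norm_exp, norm_one, Real.exp_eq_one_iff] at h1
    simp at h1
    exact hr h1
  have hcm : ∀ c : ℝ, MemLp (fun _ : ℝ => c) 2 (volume.restrict (Icc 0 ω)) := fun c =>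
    memLp_const c
  obtain ⟨K, -, hK⟩ := exists_compact_inverse (θ := θ) hω (hφ.add (hcm c))
    (by simp only [Pi.add_apply]; rw [hi]; exact hne 1 one_ne_zero)
  obtain ⟨K', -, hK'⟩ := exists_compact_inverse (θ := θ) hω (hφ.neg.add (hcm (-c)))
    (by simp only [Pi.add_apply, Pi.neg_apply]; rw [hi']; exact hne (-1) (by norm_num))
  refine IsAdjointPair.of_surjective (c := c) (K := K) (K' := fun h => K' (-h)) ?_ ?_ ?_
  · intro f g k l h1 h2
    rw [graph_cellOp hω] at h1
    rw [mem_graph_neg, graph_cellOp hω] at h2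
    rw [inner_cellGraph hω h1 h2, inner_neg_right, neg_neg]
  · intro h
    rw [graph_cellOp hω]
    exact mem_cellGraph_add_const (hK h)
  · intro h
    rw [mem_graph_neg, graph_cellOp hω]
    have h2 := mem_cellGraph_add_const (φ := fun x => - φ x) (hK' (-h))
    convert h2 using 2
    push_cast
    module

theorem diracFiber_eq (hω : 0 < ω) (hφ : MemLp φ 2 (volume.restrict (Icc 0 ω))) (θ : ℝ) :
    diracFiber ω φ θ = offDiagOp (cellOp ω φ θ) (-(cellOp ω (fun x => - φ x) θ)) := by
  rw [diracFiber, (isAdjointPair_cellOp hω hφ θ).adjoint_left]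

theorem isSelfAdjoint_diracFiber (hω : 0 < ω) (hφ : MemLp φ 2 (volume.restrict (Icc 0 ω)))
    (θ : ℝ) : IsSelfAdjoint (diracFiber ω φ θ) := by
  rw [diracFiber_eq hω hφ]
  exact (isAdjointPair_cellOp hω hφ θ).isSelfAdjoint_offDiagOp

end

/-! ### Linear systems with integrable coefficients -/

theorem intervalIntegrable_complex_ofReal {b : ℝ → ℝ} {p q : ℝ} (h : IntervalIntegrable b volume p q) :
    IntervalIntegrable (fun x => (b x : ℂ)) volume p q :=
  ⟨h.1.ofReal, h.2.ofReal⟩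

section Volterra

variable {E : Type*} [NormedAddCommGroup E] [NormedSpace ℝ E]

/-- The terms of the Picard series: iterated integrals of the coefficient matrix. -/
def picardTerm (B : ℝ → E →L[ℝ] E) (y : E) : ℕ → ℝ → E
  | 0, _ => y
  | n + 1, x => ∫ t in (0 : ℝ)..x, B t (picardTerm B y n t)

variable {B : ℝ → E →L[ℝ] E} {y : E}

theorem IntervalIntegrable.clm_apply_continuous (hB : ∀ p q, IntervalIntegrable B volume p q)
    {f : ℝ → E} (hf : Continuous f) (p q : ℝ) :
    IntervalIntegrable (fun t => B t (f t)) volume p q := by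
  have hm : AEStronglyMeasurable (fun t => B t (f t)) (volume.restrict (uIoc p q)) :=
    (ContinuousLinearMap.apply ℝ E).aestronglyMeasurable_comp₂
      hf.aestronglyMeasurable ((intervalIntegrable_iff.1 (hB p q)).1)
  obtain ⟨C, hC⟩ := (isCompact_uIcc (a := p) (b := q)).exists_bound_of_continuousOn hf.continuousOn
  rw [intervalIntegrable_iff]
  refine ((intervalIntegrable_iff.1 (hB p q)).norm.mul_const C).mono' hm ?_
  filter_upwards [ae_restrict_mem measurableSet_uIoc] with t ht
  refine ((B t).le_opNorm _).trans ?_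
  gcongr
  exact hC t (uIoc_subset_uIcc ht)

theorem continuous_picardTerm (hB : ∀ p q, IntervalIntegrable B volume p q) (n : ℕ) :
    Continuous (picardTerm B y n) := by
  induction n with
  | zero => exact continuous_const
  | succ n ih =>
    exact intervalIntegral.continuous_primitive
      (IntervalIntegrable.clm_apply_continuous hB ih) 0

theorem intervalIntegral_mul_primitive_pow {b : ℝ → ℝ}
    (hb : ∀ p q, IntervalIntegrable b volume p q) (n : ℕ) (x : ℝ) :
    ∫ t in (0 : ℝ)..x, b t * (∫ r in (0 : ℝ)..t, b r) ^ n =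
      (∫ r in (0 : ℝ)..x, b r) ^ (n + 1) / (n + 1) := by
  have hm : IsACWithDeriv univ (fun x => ((∫ r in (0 : ℝ)..x, b r : ℝ) : ℂ)) (fun x => b x) := by
    have := IsACWithDeriv.primitive (v := fun x => (b x : ℂ)) (fun p q => intervalIntegrable_complex_ofReal (hb p q)) 0 univ
    simpa only [intervalIntegral.integral_ofReal] using this
  have hp : ∀ n : ℕ, IsACWithDeriv univ (fun x => ((∫ r in (0 : ℝ)..x, b r : ℝ) : ℂ) ^ (n + 1))
      (fun x => (n + 1) * (b x * ((∫ r in (0 : ℝ)..x, b r : ℝ) : ℂ) ^ n)) := by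
    intro n
    induction n with
    | zero => simpa using hm
    | succ n ih =>
      refine ((ih.mul hm ordConnected_univ).congr (fun x _ => (pow_succ _ _).symm)).congr_deriv
        ordConnected_univ (Eventually.of_forall fun x _ => ?_)
      push_cast
      ring
  have h := (hp n 0 trivial x trivial).2
  simp only [intervalIntegral.integral_same, Complex.ofReal_zero] at h
  rw [zero_pow (Nat.succ_ne_zero n), sub_zero, intervalIntegral.integral_const_mul] at h
  rw [eq_div_iff (by positivity), mul_comm]
  have h2 : ∫ t in (0 : ℝ)..x, (b t : ℂ) * ((∫ r in (0 : ℝ)..t, b r : ℝ) : ℂ) ^ n =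
      ((∫ t in (0 : ℝ)..x, b t * (∫ r in (0 : ℝ)..t, b r) ^ n : ℝ) : ℂ) := by
    rw [← intervalIntegral.integral_ofReal]
    push_cast
    rfl
  rw [h2] at h
  exact_mod_cast h.symm

/-- The standard bound of the Picard series by an exponential series. -/
theorem norm_picardTerm_le (hB : ∀ p q, IntervalIntegrable B volume p q) (n : ℕ) (x : ℝ) :
    ‖picardTerm B y n x‖ ≤ ‖y‖ * (|∫ t in (0 : ℝ)..x, ‖B t‖| ^ n / n.factorial) := by
  induction n generalizing x with
  | zero => simp [picardTerm]
  | succ n ih =>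
    have hb : ∀ p q, IntervalIntegrable (fun t => ‖B t‖) volume p q := fun p q => (hB p q).norm
    have hmc : Continuous fun x => ∫ t in (0 : ℝ)..x, ‖B t‖ :=
      intervalIntegral.continuous_primitive hb 0
    set m : ℝ → ℝ := fun x => ∫ t in (0 : ℝ)..x, ‖B t‖ with hm
    have hg : ∀ p q, IntervalIntegrable (fun t => ‖y‖ / n.factorial * (‖B t‖ * |m t| ^ n))
        volume p q := fun p q =>
      ((hb p q).mul_continuousOn (hmc.abs.pow n).continuousOn).const_mul _
    have h1 : ‖picardTerm B y (n + 1) x‖ ≤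
        |∫ t in (0 : ℝ)..x, ‖y‖ / n.factorial * (‖B t‖ * |m t| ^ n)| := by
      refine intervalIntegral.norm_integral_le_abs_of_norm_le ?_ (hg 0 x)
      refine Eventually.of_forall fun t => ((B t).le_opNorm _).trans ?_
      calc ‖B t‖ * ‖picardTerm B y n t‖ ≤ ‖B t‖ * (‖y‖ * (|m t| ^ n / n.factorial)) := by
            gcongr; exact ih t
        _ = _ := by ring
    refine h1.trans (le_of_eq ?_)
    -- the primitive `m` has a constant sign between `0` and `x`
    have h2 : |∫ t in (0 : ℝ)..x, ‖B t‖ * |m t| ^ n| = |∫ t in (0 : ℝ)..x, ‖B t‖ * m t ^ n| := by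
      rcases le_total 0 x with hx | hx
      · congr 1
        refine intervalIntegral.integral_congr fun t ht => ?_
        rw [uIcc_of_le hx] at ht
        have : 0 ≤ m t := intervalIntegral.integral_nonneg ht.1 fun _ _ => norm_nonneg _
        simp only [abs_of_nonneg this]
      · have : ∫ t in (0 : ℝ)..x, ‖B t‖ * |m t| ^ n =
            (-1) ^ n * ∫ t in (0 : ℝ)..x, ‖B t‖ * m t ^ n := by
          rw [← intervalIntegral.integral_const_mul]
          refine intervalIntegral.integral_congr fun t ht => ?_
          rw [uIcc_of_ge hx] at ht
          have : m t ≤ 0 := by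
            simp only [hm]
            rw [intervalIntegral.integral_symm]
            exact neg_nonpos.2 (intervalIntegral.integral_nonneg ht.2 fun _ _ => norm_nonneg _)
          simp only [abs_of_nonpos this, neg_pow (m t)]
          ring
        rw [this, abs_mul, abs_pow, abs_neg, abs_one, one_pow, one_mul]
    have h3 : |‖y‖ / n.factorial| = ‖y‖ / n.factorial := abs_of_nonneg (by positivity)
    rw [intervalIntegral.integral_const_mul, abs_mul, h3, h2,
      intervalIntegral_mul_primitive_pow hb, abs_div, abs_pow,
      abs_of_pos (by positivity : (0 : ℝ) < n + 1), Nat.factorial_succ]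
    push_cast
    field_simp

/-- The linear equation `Y' = s B Y` with integrable `B`: the solution with given initial value
exists and is jointly continuous in the parameter and the variable. -/
theorem exists_volterra_solution [CompleteSpace E] (hB : ∀ p q, IntervalIntegrable B volume p q)
    (y : E) : ∃ Y : ℝ → ℝ → E, Continuous (fun p : ℝ × ℝ => Y p.1 p.2) ∧
      ∀ s x, Y s x = y + s • ∫ t in (0 : ℝ)..x, B t (Y s t) := by
  have hc := continuous_picardTerm (y := y) hB
  -- a summable bound for the terms on compact sets
  have hbd : ∀ L R : ℝ, 0 ≤ L → ∃ D : ℝ, ∀ n : ℕ, ∀ s x : ℝ, |s| ≤ L → |x| ≤ R →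
      ‖s ^ n • picardTerm B y n x‖ ≤ ‖y‖ * ((L * D) ^ n / n.factorial) := by
    intro L R hL
    have hmc : Continuous fun x => ∫ t in (0 : ℝ)..x, ‖B t‖ :=
      intervalIntegral.continuous_primitive (fun p q => (hB p q).norm) 0
    obtain ⟨D, hD⟩ := (isCompact_Icc (a := -R) (b := R)).exists_bound_of_continuousOn
      hmc.continuousOn
    refine ⟨D, fun n s x hs hx => ?_⟩
    rw [norm_smul, norm_pow, Real.norm_eq_abs]
    have h1 := norm_picardTerm_le (y := y) hB n x
    have h2 := hD x (abs_le.1 hx)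
    rw [Real.norm_eq_abs] at h2
    calc |s| ^ n * ‖picardTerm B y n x‖
        ≤ L ^ n * (‖y‖ * (D ^ n / n.factorial)) := by
          gcongr
          exact h1.trans (by gcongr)
      _ = _ := by rw [mul_pow]; ring
  have hsum : ∀ r : ℝ, Summable fun n : ℕ => ‖y‖ * (r ^ n / n.factorial) := fun r =>
    (Real.summable_pow_div_factorial r).mul_left _
  have hsm : ∀ s x : ℝ, Summable fun n : ℕ => s ^ n • picardTerm B y n x := by
    intro s x
    obtain ⟨D, hD⟩ := hbd |s| |x| (abs_nonneg s)
    exact Summable.of_norm_bounded (hsum _) fun n => hD n s x le_rfl le_rfl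
  have hcont : Continuous (fun p : ℝ × ℝ => ∑' n : ℕ, p.1 ^ n • picardTerm B y n p.2) := by
    rw [continuous_iff_continuousAt]
    rintro ⟨s, x⟩
    obtain ⟨D, hD⟩ := hbd (|s| + 1) (|x| + 1) (by positivity)
    have h1 : ContinuousOn (fun p : ℝ × ℝ => ∑' n : ℕ, p.1 ^ n • picardTerm B y n p.2)
        {p : ℝ × ℝ | |p.1| ≤ |s| + 1 ∧ |p.2| ≤ |x| + 1} :=
      continuousOn_tsum (fun n => by have := hc n; fun_prop) (hsum _)
        fun n p hp => hD n p.1 p.2 hp.1 hp.2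
    refine h1.continuousAt ?_
    have h2 : {p : ℝ × ℝ | |p.1| < |s| + 1 ∧ |p.2| < |x| + 1} ∈ 𝓝 (s, x) :=
      (((isOpen_lt (by fun_prop) (by fun_prop)).inter
        (isOpen_lt (by fun_prop) (by fun_prop)) : IsOpen
          ({p : ℝ × ℝ | |p.1| < |s| + 1} ∩ {p : ℝ × ℝ | |p.2| < |x| + 1}))).mem_nhds
        ⟨by simp, by simp⟩
    filter_upwards [h2] with p hp
    exact ⟨hp.1.le, hp.2.le⟩
  refine ⟨fun s x => ∑' n : ℕ, s ^ n • picardTerm B y n x, hcont, fun s x => ?_⟩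
  obtain ⟨D, hD⟩ := hbd |s| |x| (abs_nonneg s)
  have hint : HasSum (fun n : ℕ => ∫ t in (0 : ℝ)..x, B t (s ^ n • picardTerm B y n t))
      (∫ t in (0 : ℝ)..x, B t (∑' n : ℕ, s ^ n • picardTerm B y n t)) := by
    refine intervalIntegral.hasSum_integral_of_dominated_convergence
      (fun n t => ‖B t‖ * (‖y‖ * ((|s| * D) ^ n / n.factorial))) ?_ ?_ ?_ ?_ ?_
    · intro n
      exact (intervalIntegrable_iff.1 (IntervalIntegrable.clm_apply_continuous hB
        ((hc n).const_smul (s ^ n)) 0 x)).1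
    · intro n
      refine Eventually.of_forall fun t ht => ((B t).le_opNorm _).trans ?_
      gcongr
      refine hD n s t le_rfl ?_
      have := abs_sub_left_of_mem_uIcc (uIoc_subset_uIcc ht)
      simpa using this
    · exact Eventually.of_forall fun t _ => (hsum _).mul_left _
    · simp only [tsum_mul_left]
      exact ((hB 0 x).norm.mul_const _)
    · exact Eventually.of_forall fun t _ => (B t).hasSum (hsm s t).hasSum
  have h1 : HasSum (fun n : ℕ => s ^ (n + 1) • picardTerm B y (n + 1) x)
      (s • ∫ t in (0 : ℝ)..x, B t (∑' n : ℕ, s ^ n • picardTerm B y n t)) := by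
    refine (hint.const_smul s).congr_fun fun n => ?_
    simp only [map_smul, intervalIntegral.integral_smul, picardTerm, smul_smul]
    rw [pow_succ']
  change ∑' n : ℕ, s ^ n • picardTerm B y n x = _
  rw [(hsm s x).tsum_eq_zero_add, h1.tsum_eq]
  simp [picardTerm]

end Volterra

/-- The system `u' = s (a u + b v)`, `v' = s (c u + d v)` with locally integrable coefficients:
the solution with given initial values, continuous in the parameter and the variable. -/
theorem exists_planar_solution {a b c d : ℝ → ℝ} (ha : ∀ p q, IntervalIntegrable a volume p q)
    (hb : ∀ p q, IntervalIntegrable b volume p q) (hc : ∀ p q, IntervalIntegrable c volume p q)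
    (hd : ∀ p q, IntervalIntegrable d volume p q) (u₀ v₀ : ℝ) :
    ∃ u v : ℝ → ℝ → ℝ, Continuous (fun p : ℝ × ℝ => u p.1 p.2) ∧
      Continuous (fun p : ℝ × ℝ => v p.1 p.2) ∧ (∀ s, u s 0 = u₀) ∧ (∀ s, v s 0 = v₀) ∧
      ∀ s : ℝ, IsACWithDeriv univ (fun x => (u s x : ℂ))
          (fun x => (s : ℂ) * (a x * u s x + b x * v s x)) ∧
        IsACWithDeriv univ (fun x => (v s x : ℂ))
          (fun x => (s : ℂ) * (c x * u s x + d x * v s x)) := by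
  set B : ℝ → ℝ × ℝ →L[ℝ] ℝ × ℝ := fun t =>
    (a t • ContinuousLinearMap.fst ℝ ℝ ℝ + b t • ContinuousLinearMap.snd ℝ ℝ ℝ).prod
      (c t • ContinuousLinearMap.fst ℝ ℝ ℝ + d t • ContinuousLinearMap.snd ℝ ℝ ℝ) with hBdef
  have hB : ∀ p q, IntervalIntegrable B volume p q := by
    intro p q
    have e : B = fun t =>
        a t • (ContinuousLinearMap.inl ℝ ℝ ℝ).comp (ContinuousLinearMap.fst ℝ ℝ ℝ) +
        b t • (ContinuousLinearMap.inl ℝ ℝ ℝ).comp (ContinuousLinearMap.snd ℝ ℝ ℝ) +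
        (c t • (ContinuousLinearMap.inr ℝ ℝ ℝ).comp (ContinuousLinearMap.fst ℝ ℝ ℝ) +
        d t • (ContinuousLinearMap.inr ℝ ℝ ℝ).comp (ContinuousLinearMap.snd ℝ ℝ ℝ)) := by
      funext t
      ext <;> simp [hBdef]
    rw [e]
    have hs : ∀ {f : ℝ → ℝ} (T : ℝ × ℝ →L[ℝ] ℝ × ℝ), IntervalIntegrable f volume p q →
        IntervalIntegrable (fun t => f t • T) volume p q := fun T h =>
      ⟨h.1.smul_const T, h.2.smul_const T⟩
    exact ((hs _ (ha p q)).add (hs _ (hb p q))).add ((hs _ (hc p q)).add (hs _ (hd p q)))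
  obtain ⟨Y, hYc, hY⟩ := exists_volterra_solution hB ((u₀, v₀) : ℝ × ℝ)
  have hYs : ∀ s, Continuous (Y s) := fun s => by fun_prop
  have hi : ∀ s p q, IntervalIntegrable (fun t => B t (Y s t)) volume p q := fun s =>
    IntervalIntegrable.clm_apply_continuous hB (hYs s)
  have h1 : ∀ s x, (Y s x).1 = u₀ + s * ∫ t in (0 : ℝ)..x, (B t (Y s t)).1 := by
    intro s x
    have e := congrArg Prod.fst (hY s x)
    have e2 := (ContinuousLinearMap.fst ℝ ℝ ℝ).intervalIntegral_comp_comm (hi s 0 x)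
    simp only [ContinuousLinearMap.coe_fst'] at e2
    rw [e2]; exact e
  have h2 : ∀ s x, (Y s x).2 = v₀ + s * ∫ t in (0 : ℝ)..x, (B t (Y s t)).2 := by
    intro s x
    have e := congrArg Prod.snd (hY s x)
    have e2 := (ContinuousLinearMap.snd ℝ ℝ ℝ).intervalIntegral_comp_comm (hi s 0 x)
    simp only [ContinuousLinearMap.coe_snd'] at e2
    rw [e2]; exact e
  have hac : ∀ (s r : ℝ) (f g : ℝ → ℝ), (∀ p q, IntervalIntegrable g volume p q) →
      (∀ x, f x = r + s * ∫ t in (0 : ℝ)..x, g t) →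
      IsACWithDeriv univ (fun x => (f x : ℂ)) (fun x => (s : ℂ) * g x) := by
    intro s r f g hg hf
    have h3 := (IsACWithDeriv.const univ (r : ℂ)).add ((IsACWithDeriv.primitive
      (v := fun x => (g x : ℂ)) (fun p q => intervalIntegrable_complex_ofReal (hg p q)) 0 univ).smul (s : ℂ))
    simp only [zero_add] at h3
    refine h3.congr fun x _ => ?_
    rw [hf x, intervalIntegral.integral_ofReal]
    push_cast
    rfl
  refine ⟨fun s x => (Y s x).1, fun s x => (Y s x).2, by fun_prop, by fun_prop, fun s => ?_,
    fun s => ?_, fun s => ⟨?_, ?_⟩⟩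
  · exact (h1 s 0).trans (by simp)
  · exact (h2 s 0).trans (by simp)
  · refine (hac s u₀ _ _ (fun p q => ?_) (h1 s)).congr_deriv ordConnected_univ
      (Eventually.of_forall fun x _ => ?_)
    · exact ⟨(hi s p q).1.fst, (hi s p q).2.fst⟩
    · simp [hBdef]
  · refine (hac s v₀ _ _ (fun p q => ?_) (h2 s)).congr_deriv ordConnected_univ
      (Eventually.of_forall fun x _ => ?_)
    · exact ⟨(hi s p q).1.snd, (hi s p q).2.snd⟩
    · simp [hBdef]

/-- The Wronskian of two solutions of a system with trace zero is constant. -/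
theorem IsACWithDeriv.wronskian {I : Set ℝ} (hI : I.OrdConnected) {p q r u v f g : ℝ → ℂ}
    (hu : IsACWithDeriv I u (fun x => p x * u x + q x * v x))
    (hv : IsACWithDeriv I v (fun x => r x * u x - p x * v x))
    (hf : IsACWithDeriv I f (fun x => p x * f x + q x * g x))
    (hg : IsACWithDeriv I g (fun x => r x * f x - p x * g x)) {x y : ℝ} (hx : x ∈ I) (hy : y ∈ I) :
    u x * g x - v x * f x = u y * g y - v y * f y := by
  have h := ((hu.mul hg hI).sub (hv.mul hf hI)).congr_deriv (w := fun _ => 0) hI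
    (Eventually.of_forall fun x _ => by ring)
  exact h.eq_of_deriv_zero hx hy

/-- Every solution of a planar system with trace zero is a combination of two solutions with
Wronskian one. -/
theorem IsACWithDeriv.eq_combination {I : Set ℝ} (hI : I.OrdConnected)
    {p q r u₁ v₁ u₂ v₂ f g : ℝ → ℂ}
    (hu₁ : IsACWithDeriv I u₁ (fun x => p x * u₁ x + q x * v₁ x))
    (hv₁ : IsACWithDeriv I v₁ (fun x => r x * u₁ x - p x * v₁ x))
    (hu₂ : IsACWithDeriv I u₂ (fun x => p x * u₂ x + q x * v₂ x))
    (hv₂ : IsACWithDeriv I v₂ (fun x => r x * u₂ x - p x * v₂ x))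
    (hf : IsACWithDeriv I f (fun x => p x * f x + q x * g x))
    (hg : IsACWithDeriv I g (fun x => r x * f x - p x * g x))
    {z : ℝ} (hz : z ∈ I) (hu1 : u₁ z = 1) (hv1 : v₁ z = 0) (hu2 : u₂ z = 0) (hv2 : v₂ z = 1)
    {x : ℝ} (hx : x ∈ I) :
    f x = f z * u₁ x + g z * u₂ x ∧ g x = f z * v₁ x + g z * v₂ x := by
  have e1 := IsACWithDeriv.wronskian hI hu₁ hv₁ hu₂ hv₂ hx hz
  have e2 := IsACWithDeriv.wronskian hI hf hg hu₂ hv₂ hx hz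
  have e3 := IsACWithDeriv.wronskian hI hu₁ hv₁ hf hg hx hz
  rw [hu1, hv1, hu2, hv2] at e1
  rw [hu2, hv2] at e2
  rw [hu1, hv1] at e3
  constructor
  · linear_combination -f x * e1 + u₁ x * e2 + u₂ x * e3
  · linear_combination -g x * e1 + v₁ x * e2 + v₂ x * e3

/-! ### Positive forms and the Riccati equation -/

/-- The reciprocal of a zero-free absolutely continuous function. -/
theorem IsACWithDeriv.inv {I : Set ℝ} {u v : ℝ → ℂ} (h : IsACWithDeriv I u v) (hI : I.OrdConnected)
    (h0 : ∀ x ∈ I, u x ≠ 0) :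
    IsACWithDeriv I (fun x => (u x)⁻¹) (fun x => - v x / u x ^ 2) := by
  have hc : ∀ p ∈ I, ∀ q ∈ I, ContinuousOn (fun x => (u x)⁻¹) (uIcc p q) := fun p hp q hq =>
    (h.restrict_uIcc hI hp hq).continuousOn_uIcc.inv₀ fun x hx => h0 x (hI.uIcc_subset hp hq hx)
  refine of_ae_hasDerivAt ?_ ?_ ?_
  · intro p hp q hq
    obtain ⟨R, hR⟩ := isCompact_uIcc.exists_bound_of_continuousOn (hc p hp q hq)
    refine AbsolutelyContinuousOnInterval.of_dist_le (R * R)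
      (h.restrict_uIcc hI hp hq).absolutelyContinuousOnInterval ?_
    intro x hx y hy
    have hx0 := h0 x (hI.uIcc_subset hp hq hx)
    have hy0 := h0 y (hI.uIcc_subset hp hq hy)
    rw [dist_inv_inv₀ hx0 hy0, div_eq_mul_inv, mul_inv, mul_comm]
    have e1 := hR x hx
    have e2 := hR y hy
    rw [norm_inv] at e1 e2
    have : 0 ≤ R := (by positivity : (0 : ℝ) ≤ ‖u x‖⁻¹).trans e1
    gcongr
  · intro p hp q hq
    have e : (fun x => - v x / u x ^ 2) = fun x => v x * (-((u x)⁻¹ * (u x)⁻¹)) := by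
      funext x
      rw [div_eq_mul_inv, ← mul_inv, sq]
      ring
    rw [e]
    exact (h p hp q hq).1.mul_continuousOn ((hc p hp q hq).mul (hc p hp q hq)).neg
  · intro p hp q hq
    filter_upwards [(h.restrict_uIcc hI hp hq).ae_hasDerivAt] with x h1 hx
    exact (h1 hx).inv (h0 x (hI.uIcc_subset hp hq hx))

/-- A positive sequence cannot satisfy an elliptic (or negative hyperbolic) recursion: it would be
concave, hence nondecreasing, and then its differences would tend to `-∞`. -/
theorem not_forall_pos_of_recursion {t : ℝ} (ht : t < 2) {a : ℕ → ℝ}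
    (ha : ∀ n, a (n + 2) = t * a (n + 1) - a n) (hpos : ∀ n, 0 < a n) : False := by
  have hd : ∀ n, a (n + 2) - a (n + 1) = a (n + 1) - a n - (2 - t) * a (n + 1) := fun n => by
    rw [ha]; ring
  have hstep : ∀ n, a (n + 2) - a (n + 1) ≤ a (n + 1) - a n := fun n => by
    rw [hd]; nlinarith [hpos (n + 1)]
  have hmono : ∀ n, 0 ≤ a (n + 1) - a n := by
    intro N
    by_contra hN
    push Not at hN
    have h1 : ∀ k : ℕ, a (N + k + 1) - a (N + k) ≤ a (N + 1) - a N := by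
      intro k
      induction k with
      | zero => exact le_rfl
      | succ k ih => exact (hstep (N + k)).trans ih
    have h2 : ∀ k : ℕ, a (N + k) ≤ a N + k * (a (N + 1) - a N) := by
      intro k
      induction k with
      | zero => simp
      | succ k ih =>
        have := h1 k
        rw [← add_assoc]
        push_cast
        linarith
    obtain ⟨k, hk⟩ := exists_nat_gt (a N / -(a (N + 1) - a N))
    rw [div_lt_iff₀ (by linarith)] at hk
    have := h2 k
    have := hpos (N + k)
    nlinarith
  have hge : ∀ n, a 0 ≤ a n := by
    intro n
    induction n with
    | zero => exact le_rfl
    | succ n ih => linarith [hmono n]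
  have h3 : ∀ n : ℕ, a (n + 1) - a n ≤ a 1 - a 0 - n * ((2 - t) * a 0) := by
    intro n
    induction n with
    | zero => simp
    | succ n ih =>
      rw [hd]
      push_cast
      nlinarith [hge (n + 1)]
  have h4 : 0 < (2 - t) * a 0 := mul_pos (by linarith) (hpos 0)
  obtain ⟨n, hn⟩ := exists_nat_gt ((a 1 - a 0) / ((2 - t) * a 0))
  rw [div_lt_iff₀ h4] at hn
  linarith [h3 n, hmono n]

/-- The real function `h` is absolutely continuous with derivative `k ∈ L²`, and both vanish
outside a bounded set. -/
structure IsH1Compact (h k : ℝ → ℝ) : Prop where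
  ac : IsACWithDeriv univ (fun x => (h x : ℂ)) (fun x => (k x : ℂ))
  memLp : MemLp k 2 volume
  bounded : ∃ R, ∀ x, R ≤ |x| → h x = 0 ∧ k x = 0

namespace IsH1Compact

variable {h k η l : ℝ → ℝ}

theorem continuous (H : IsH1Compact h k) : Continuous h := by
  have := Complex.continuous_re.comp H.ac.continuous
  simpa [Function.comp_def] using this

theorem add_smul (H : IsH1Compact h k) (H' : IsH1Compact η l) (c : ℝ) :
    IsH1Compact (fun x => h x + c * η x) (fun x => k x + c * l x) := by
  obtain ⟨R, hR⟩ := H.bounded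
  obtain ⟨R', hR'⟩ := H'.bounded
  refine ⟨?_, H.memLp.add (H'.memLp.const_mul c), max R R', fun x hx => ?_⟩
  · have := H.ac.add (H'.ac.smul c)
    push_cast
    exact this
  · obtain ⟨e1, e2⟩ := hR x ((le_max_left _ _).trans hx)
    obtain ⟨e3, e4⟩ := hR' x ((le_max_right _ _).trans hx)
    rw [e1, e2, e3, e4]
    simp

theorem hasCompactSupport (H : IsH1Compact h k) : HasCompactSupport h := by
  obtain ⟨R, hR⟩ := H.bounded
  refine HasCompactSupport.of_support_subset_isCompact (isCompact_Icc (a := -R) (b := R)) ?_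
  intro x hx
  by_contra hn
  refine hx (hR x ?_).1
  rw [mem_Icc, ← abs_le, not_le] at hn
  exact hn.le

theorem memLp_two (H : IsH1Compact h k) : MemLp h 2 volume :=
  H.continuous.memLp_of_hasCompactSupport H.hasCompactSupport

variable {α β : ℝ → ℝ}

theorem memLp_sub_mul (H : IsH1Compact h k)
    (hα : ∀ a b, MemLp α 2 (volume.restrict (Icc a b))) :
    MemLp (fun x => k x - α x * h x) 2 volume := by
  obtain ⟨R, hR⟩ := H.bounded
  have h1 : MemLp ((Icc (-R) R).indicator α) 2 volume :=
    (memLp_indicator_iff_restrict measurableSet_Icc).2 (hα _ _)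
  have h2 : MemLp h ⊤ volume := H.continuous.memLp_top_of_hasCompactSupport H.hasCompactSupport _
  have e : (fun x => k x - α x * h x) = fun x => k x - h x * (Icc (-R) R).indicator α x := by
    funext x
    by_cases hx : x ∈ Icc (-R) R
    · rw [indicator_of_mem hx, mul_comm]
    · rw [mem_Icc, ← abs_le, not_le] at hx
      rw [(hR x hx.le).1]; simp
  rw [e]
  exact H.memLp.sub (h1.mul h2)

theorem integrable_mul (H : IsH1Compact h k) (H' : IsH1Compact η l)
    (hβ : LocallyIntegrable β volume) : Integrable fun x => β x * (h x * η x) := by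
  have := hβ.integrable_smul_left_of_hasCompactSupport (g := fun x => h x * η x)
    (H.continuous.mul H'.continuous) H.hasCompactSupport.mul_right
  simpa only [smul_eq_mul, mul_comm] using this

/-- The density of the form `(h', η') + (β + α')(h η)`. -/
theorem integrable_formDensity (H : IsH1Compact h k) (H' : IsH1Compact η l)
    (hα : ∀ a b, MemLp α 2 (volume.restrict (Icc a b))) (hβ : LocallyIntegrable β volume) :
    Integrable fun x =>
      (k x - α x * h x) * (l x - α x * η x) + β x * (h x * η x) :=
  ((H.memLp_sub_mul hα).integrable_mul (H'.memLp_sub_mul hα)).add (H.integrable_mul H' hβ)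

end IsH1Compact

section Riccati

variable {α κ : ℝ → ℝ} {u w : ℝ → ℝ} {x₀ x₁ : ℝ}

/-- The restriction of a solution to the interval between two of its zeros. -/
theorem isH1Compact_indicator (hα : ∀ a b, MemLp α 2 (volume.restrict (Icc a b)))
    (hu : IsACWithDeriv univ (fun x => (u x : ℂ)) (fun x => (α x : ℂ) * u x + w x))
    (hw : Continuous w) (h01 : x₀ ≤ x₁) (h0 : u x₀ = 0) (h1 : u x₁ = 0) :
    IsH1Compact ((Ioc x₀ x₁).indicator u) ((Ioc x₀ x₁).indicator fun x => α x * u x + w x) := by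
  have huc : Continuous u := by
    have := Complex.continuous_re.comp hu.continuous
    simpa [Function.comp_def] using this
  have hk2 : MemLp ((Ioc x₀ x₁).indicator fun x => α x * u x + w x) 2 volume := by
    rw [memLp_indicator_iff_restrict measurableSet_Ioc]
    have hc : ∀ g : ℝ → ℝ, Continuous g → MemLp g ⊤ (volume.restrict (Ioc x₀ x₁)) := by
      intro g hg
      obtain ⟨M, hM⟩ := (isCompact_Icc (a := x₀) (b := x₁)).exists_bound_of_continuousOn
        hg.continuousOn
      refine memLp_top_of_bound hg.aestronglyMeasurable M ?_
      filter_upwards [ae_restrict_mem measurableSet_Ioc] with t ht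
      exact hM t (Ioc_subset_Icc_self ht)
    have hα' : MemLp α 2 (volume.restrict (Ioc x₀ x₁)) :=
      (hα x₀ x₁).mono_measure (Measure.restrict_mono Ioc_subset_Icc_self le_rfl)
    exact (MemLp.mul (hc u huc) hα').add ((hc w hw).mono_exponent le_top)
  have hki : Integrable ((Ioc x₀ x₁).indicator fun x => α x * u x + w x) := by
    rw [integrable_indicator_iff measurableSet_Ioc]
    exact ((memLp_indicator_iff_restrict measurableSet_Ioc).1 hk2).integrable (by norm_num)
  refine ⟨?_, hk2, max |x₀| |x₁| + 1, fun x hx => ?_⟩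
  · have h2 := IsACWithDeriv.primitive (fun p q => intervalIntegrable_complex_ofReal
      (hki.intervalIntegrable (a := p) (b := q))) x₀ univ
    refine h2.congr fun x _ => ?_
    have hin : ∀ x, x ∈ Icc x₀ x₁ → ∫ t in x₀..x,
        ((((Ioc x₀ x₁).indicator fun x => α x * u x + w x) t : ℝ) : ℂ) = u x := by
      intro x hx
      have e := (hu x₀ trivial x trivial).2
      simp only [h0, Complex.ofReal_zero, sub_zero] at e
      rw [e]
      refine intervalIntegral.integral_congr_ae (Eventually.of_forall fun t ht => ?_)
      rw [uIoc_of_le hx.1] at ht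
      rw [indicator_of_mem (show t ∈ Ioc x₀ x₁ from ⟨ht.1, ht.2.trans hx.2⟩)]
      push_cast
      rfl
    rcases le_or_gt x x₀ with hx | hx
    · rw [indicator_of_notMem (fun h => not_lt.2 hx h.1), Complex.ofReal_zero,
        intervalIntegral.integral_symm, neg_eq_zero]
      refine intervalIntegral.integral_zero_ae (Eventually.of_forall fun t ht => ?_)
      rw [uIoc_of_le hx] at ht
      rw [indicator_of_notMem (fun h => not_lt.2 ht.2 h.1), Complex.ofReal_zero]
    rcases le_or_gt x x₁ with hx' | hx'
    · rw [hin x ⟨hx.le, hx'⟩, indicator_of_mem (show x ∈ Ioc x₀ x₁ from ⟨hx, hx'⟩)]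
    · rw [indicator_of_notMem (fun h => not_le.2 hx' h.2), Complex.ofReal_zero,
        ← intervalIntegral.integral_add_adjacent_intervals (b := x₁) (h2.intervalIntegrable _ _)
          (h2.intervalIntegrable _ _), hin x₁ ⟨h01, le_rfl⟩, h1, Complex.ofReal_zero, zero_add]
      refine intervalIntegral.integral_zero_ae (Eventually.of_forall fun t ht => ?_)
      rw [uIoc_of_le hx'.le] at ht
      rw [indicator_of_notMem (fun h => not_le.2 ht.1 h.2), Complex.ofReal_zero]
  · have hn : x ∉ Ioc x₀ x₁ := by
      rintro ⟨e1, e2⟩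
      have e3 := abs_le_max_abs_abs e1.le e2
      linarith
    exact ⟨indicator_of_notMem hn _, indicator_of_notMem hn _⟩

/-- The form, evaluated at a solution cut off at two zeros and another function, is a boundary
term. -/
theorem integral_formDensity_indicator
    (hw : IsACWithDeriv univ (fun x => (w x : ℂ)) (fun x => (κ x : ℂ) * u x - α x * w x))
    (h01 : x₀ ≤ x₁) {η l : ℝ → ℝ}
    (hη : IsACWithDeriv univ (fun x => (η x : ℂ)) (fun x => (l x : ℂ))) :
    ∫ x, (((Ioc x₀ x₁).indicator (fun x => α x * u x + w x) x - α x * (Ioc x₀ x₁).indicator u x) *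
        (l x - α x * η x) + κ x * ((Ioc x₀ x₁).indicator u x * η x)) =
      w x₁ * η x₁ - w x₀ * η x₀ := by
  have e := ((hw.mul hη ordConnected_univ) x₀ trivial x₁ trivial).2
  rw [← setIntegral_eq_integral_of_forall_compl_eq_zero (s := Ioc x₀ x₁) (fun x hx => by
    rw [indicator_of_notMem hx, indicator_of_notMem hx]; ring),
    ← intervalIntegral.integral_of_le h01]
  have e2 : ∫ x in x₀..x₁, (((κ x : ℂ) * u x - α x * w x) * η x + w x * l x) =
      ((∫ x in x₀..x₁, (((Ioc x₀ x₁).indicator (fun x => α x * u x + w x) x -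
        α x * (Ioc x₀ x₁).indicator u x) *
        (l x - α x * η x) + κ x * ((Ioc x₀ x₁).indicator u x * η x)) : ℝ) : ℂ) := by
    rw [← intervalIntegral.integral_ofReal]
    refine intervalIntegral.integral_congr_ae (Eventually.of_forall fun t ht => ?_)
    rw [uIoc_of_le h01] at ht
    rw [indicator_of_mem ht, indicator_of_mem ht]
    push_cast
    ring
  simp only at e
  rw [e2] at e
  exact_mod_cast e.symm

theorem isH1Compact_contDiffBump {c : ℝ} (b : ContDiffBump c) : IsH1Compact b (deriv b) := by
  have hb : ContDiff ℝ 1 (b : ℝ → ℝ) := b.contDiff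
  have hd : Continuous (deriv b) := hb.continuous_deriv le_rfl
  refine ⟨IsACWithDeriv.of_hasDerivAt (fun x => ?_) (Complex.continuous_ofReal.comp hd) _,
    hd.memLp_of_hasCompactSupport b.hasCompactSupport.deriv, ?_⟩
  · exact ((hb.differentiable one_ne_zero x).hasDerivAt).ofReal_comp
  · obtain ⟨R, -, hR⟩ := b.hasCompactSupport.exists_abs_le
    obtain ⟨R', -, hR'⟩ := b.hasCompactSupport.deriv.exists_abs_le
    exact ⟨max R R', fun x hx => ⟨hR x ((le_max_left _ _).trans hx),
      hR' x ((le_max_right _ _).trans hx)⟩⟩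

/-- A nontrivial solution has at most one zero if the form is nonnegative: a solution cut off at
two zeros is a zero of the form, hence a minimum, but it has a kink. -/
theorem eq_zero_of_two_zeros (hα : ∀ a b, MemLp α 2 (volume.restrict (Icc a b)))
    (hκ : LocallyIntegrable κ volume)
    (hpos : ∀ h k, IsH1Compact h k →
      0 ≤ ∫ x, ((k x - α x * h x) * (k x - α x * h x) + κ x * (h x * h x)))
    (hu : IsACWithDeriv univ (fun x => (u x : ℂ)) (fun x => (α x : ℂ) * u x + w x))
    (hw : IsACWithDeriv univ (fun x => (w x : ℂ)) (fun x => (κ x : ℂ) * u x - α x * w x))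
    (h01 : x₀ < x₁) (h0 : u x₀ = 0) (h1 : u x₁ = 0) : w x₀ = 0 := by
  have hwc : Continuous w := by
    have := Complex.continuous_re.comp hw.continuous
    simpa [Function.comp_def] using this
  have H := isH1Compact_indicator hα hu hwc h01.le h0 h1
  set b : ContDiffBump x₀ := ⟨(x₁ - x₀) / 2, x₁ - x₀, by linarith, by linarith⟩ with hb
  have H' := isH1Compact_contDiffBump b
  have hb0 : b x₀ = 1 := b.one_of_mem_closedBall (Metric.mem_closedBall_self (by
    simp only [hb]; linarith))
  have hb1 : b x₁ = 0 := b.zero_of_le_dist (by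
    simp only [hb]; rw [Real.dist_eq, abs_of_pos (by linarith)])
  set h := (Ioc x₀ x₁).indicator u with hh
  set k := (Ioc x₀ x₁).indicator fun x => α x * u x + w x with hk
  have e1 := integral_formDensity_indicator hw h01.le H.ac
  have e2 := integral_formDensity_indicator hw h01.le H'.ac
  rw [← hh, ← hk] at e1 e2
  have hh0 : h x₀ = 0 := indicator_of_notMem (fun h => lt_irrefl _ h.1) _
  have hh1 : h x₁ = 0 := by rw [hh, indicator_of_mem (show x₁ ∈ Ioc x₀ x₁ from ⟨h01, le_rfl⟩), h1]
  rw [hh0, hh1, mul_zero, mul_zero, sub_zero] at e1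
  rw [hb0, hb1, mul_zero, mul_one, zero_sub] at e2
  have i1 := H.integrable_formDensity H hα hκ
  have i2 := H.integrable_formDensity H' hα hκ
  have i3 := H'.integrable_formDensity H' hα hκ
  set D := ∫ x, ((deriv b x - α x * b x) * (deriv b x - α x * b x) + κ x * (b x * b x)) with hD
  have key : ∀ c : ℝ, 0 ≤ D * (c * c) + (-2 * w x₀) * c + 0 := by
    intro c
    have h2 := hpos _ _ (H.add_smul H' c)
    have e3 : ∀ x, (k x + c * deriv b x - α x * (h x + c * b x)) *
        (k x + c * deriv b x - α x * (h x + c * b x)) +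
        κ x * ((h x + c * b x) * (h x + c * b x)) =
        ((k x - α x * h x) * (k x - α x * h x) + κ x * (h x * h x)) +
        (2 * c) * ((k x - α x * h x) * (deriv b x - α x * b x) + κ x * (h x * b x)) +
        (c * c) * ((deriv b x - α x * b x) * (deriv b x - α x * b x) + κ x * (b x * b x)) :=
      fun x => by ring
    simp only [e3] at h2
    have i4 := i2.const_mul (2 * c)
    have i5 : Integrable fun x => ((k x - α x * h x) * (k x - α x * h x) + κ x * (h x * h x)) +
        (2 * c) * ((k x - α x * h x) * (deriv b x - α x * b x) + κ x * (h x * b x)) := i1.add i4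
    rw [integral_add i5 (i3.const_mul _), integral_add i1 i4, integral_const_mul, integral_const_mul, e1, e2,
      ← hD] at h2
    linarith
  have := discrim_le_zero key
  rw [discrim] at this
  nlinarith [sq_nonneg (w x₀)]

/-- If the form is nonnegative and the coefficients are periodic, then the system
`u' = α u + w`, `w' = κ u - α w` has a positive Floquet solution, and `r = w / u` is a periodic
solution of the associated Riccati equation. -/
theorem exists_periodic_riccati {ω : ℝ} (hω : 0 < ω)
    (hα : ∀ a b, MemLp α 2 (volume.restrict (Icc a b))) (hκ : LocallyIntegrable κ volume)
    (pα : Function.Periodic α ω) (pκ : Function.Periodic κ ω)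
    (hpos : ∀ h k, IsH1Compact h k →
      0 ≤ ∫ x, ((k x - α x * h x) * (k x - α x * h x) + κ x * (h x * h x))) :
    ∃ r : ℝ → ℝ, Function.Periodic r ω ∧ IsACWithDeriv univ (fun x => (r x : ℂ))
      (fun x => ((κ x - 2 * α x * r x - r x ^ 2 : ℝ) : ℂ)) := by
  have hαi : ∀ p q, IntervalIntegrable α volume p q := fun p q => by
    rw [intervalIntegrable_iff]
    refine IntegrableOn.mono_set (t := Icc (min p q) (max p q)) ?_ Ioc_subset_Icc_self
    exact (hα _ _).integrable (by norm_num)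
  have hκi : ∀ p q, IntervalIntegrable κ volume p q := fun p q =>
    (intervalIntegrable_iff.2 ((hκ.integrableOn_isCompact isCompact_uIcc).mono_set
      uIoc_subset_uIcc))
  have sol : ∀ a b : ℝ, ∃ u w : ℝ → ℝ, u 0 = a ∧ w 0 = b ∧
      IsACWithDeriv univ (fun x => (u x : ℂ)) (fun x => (α x : ℂ) * u x + w x) ∧
      IsACWithDeriv univ (fun x => (w x : ℂ)) (fun x => (κ x : ℂ) * u x - α x * w x) := by
    intro a b
    obtain ⟨u, w, -, -, e1, e2, e3⟩ := exists_planar_solution hαi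
      (b := fun _ => 1) (fun _ _ => intervalIntegrable_const) hκi (d := fun x => - α x)
      (fun p q => (hαi p q).neg) a b
    refine ⟨u 1, w 1, e1 1, e2 1, ?_, ?_⟩
    · refine (e3 1).1.congr_deriv ordConnected_univ (Eventually.of_forall fun x _ => ?_)
      push_cast; ring
    · refine (e3 1).2.congr_deriv ordConnected_univ (Eventually.of_forall fun x _ => ?_)
      push_cast; ring
  obtain ⟨u₁, w₁, a1, b1, hu1, hw1⟩ := sol 1 0
  obtain ⟨u₂, w₂, a2, b2, hu2, hw2⟩ := sol 0 1
  have comb : ∀ f g : ℝ → ℝ,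
      IsACWithDeriv univ (fun x => (f x : ℂ)) (fun x => (α x : ℂ) * f x + g x) →
      IsACWithDeriv univ (fun x => (g x : ℂ)) (fun x => (κ x : ℂ) * f x - α x * g x) →
      ∀ x, f x = f 0 * u₁ x + g 0 * u₂ x ∧ g x = f 0 * w₁ x + g 0 * w₂ x := by
    intro f g hf hg x
    have one : ∀ z : ℂ, z = (fun _ : ℝ => (1 : ℂ)) 0 * z := fun z => (one_mul z).symm
    have := IsACWithDeriv.eq_combination (q := fun _ => 1) ordConnected_univ
      (by simpa only [one_mul] using hu1) hw1 (by simpa only [one_mul] using hu2) hw2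
      (by simpa only [one_mul] using hf) hg (z := 0) trivial (by simp [a1]) (by simp [b1])
      (by simp [a2]) (by simp [b2]) (x := x) trivial
    exact_mod_cast this
  have shift : ∀ f g : ℝ → ℝ,
      IsACWithDeriv univ (fun x => (f x : ℂ)) (fun x => (α x : ℂ) * f x + g x) →
      IsACWithDeriv univ (fun x => (g x : ℂ)) (fun x => (κ x : ℂ) * f x - α x * g x) →
      ∀ x, f (x + ω) = f ω * u₁ x + g ω * u₂ x ∧ g (x + ω) = f ω * w₁ x + g ω * w₂ x := by
    intro f g hf hg x
    have := comb (fun x => f (x + ω)) (fun x => g (x + ω))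
      (by simpa only [pα _] using hf.comp_add_right ω)
      (by simpa only [pα _, pκ _] using hg.comp_add_right ω) x
    simpa only [zero_add] using this
  -- the monodromy matrix has determinant one; let `t` be its trace
  have hdet : u₁ ω * w₂ ω - w₁ ω * u₂ ω = 1 := by
    have := IsACWithDeriv.wronskian (q := fun _ => 1) ordConnected_univ
      (by simpa only [one_mul] using hu1) hw1 (by simpa only [one_mul] using hu2) hw2
      (x := ω) (y := 0) trivial trivial
    simp only [a1, a2, b1, b2] at this
    have h2 : u₁ ω * w₂ ω - w₁ ω * u₂ ω = 1 * 1 - 0 * 0 := by exact_mod_cast this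
    linarith
  have hu2c : Continuous u₂ := by
    have := Complex.continuous_re.comp hu2.continuous
    simpa [Function.comp_def] using this
  have hu2ne : ∀ x, 0 < x → u₂ x ≠ 0 := fun x hx h0 => by
    have := eq_zero_of_two_zeros hα hκ hpos hu2 hw2 hx a2 h0
    rw [b2] at this
    exact one_ne_zero this
  set t := u₁ ω + w₂ ω with ht
  -- `u₂ (n ω)` satisfies the recursion of the trace, and is positive as `u₂` has no second zero
  have ht2 : 2 ≤ t := by
    by_contra hlt
    push Not at hlt
    refine not_forall_pos_of_recursion hlt (a := fun n : ℕ => u₂ (n * ω + ω) / u₂ ω) ?_ ?_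
    · intro n
      have e1 := fun x => (shift u₁ w₁ hu1 hw1 x).1
      have e2 := fun x => (shift u₂ w₂ hu2 hw2 x).1
      have e3 : ∀ x, u₂ (x + ω + ω) = t * u₂ (x + ω) - u₂ x := fun x => by
        rw [e2 (x + ω), e1, e2, ht]
        linear_combination -u₂ x * hdet
      push_cast
      have e4 : (n + 2 : ℝ) * ω + ω = (n * ω + ω) + ω + ω := by ring
      have e5 : (n + 1 : ℝ) * ω + ω = (n * ω + ω) + ω := by ring
      rw [e4, e5, e3]
      ring
    · intro n
      by_contra hn
      push Not at hn
      have hle : ω ≤ n * ω + ω := by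
        have : 0 ≤ (n : ℝ) * ω := by positivity
        linarith
      have hc : ContinuousOn (fun x => u₂ x / u₂ ω) (Icc ω (n * ω + ω)) := by fun_prop
      obtain ⟨z, hz, hz0⟩ := intermediate_value_Icc' hle hc
        (show (0 : ℝ) ∈ _ from ⟨hn, by simp only [div_self (hu2ne ω hω)]; norm_num⟩)
      have hz0' : u₂ z / u₂ ω = 0 := hz0
      rw [div_eq_zero_iff] at hz0'
      rcases hz0' with h | h
      · exact hu2ne z (hω.trans_le hz.1) h
      · exact hu2ne ω hω h
  -- a real multiplier, and the corresponding Floquet solution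
  set ρ := (t + Real.sqrt (t ^ 2 - 4)) / 2 with hρ
  have hρ2 : ρ ^ 2 = t * ρ - 1 := by
    have := Real.sq_sqrt (show 0 ≤ t ^ 2 - 4 by nlinarith)
    rw [hρ]
    nlinarith
  have hρ0 : ρ ≠ 0 := by
    intro h; rw [h] at hρ2; norm_num at hρ2
  set A := u₂ ω with hA
  set B := ρ - u₁ ω with hB
  set u : ℝ → ℝ := fun x => A * u₁ x + B * u₂ x with hu
  set w : ℝ → ℝ := fun x => A * w₁ x + B * w₂ x with hw
  have huac : IsACWithDeriv univ (fun x => (u x : ℂ)) (fun x => (α x : ℂ) * u x + w x) := by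
    refine (((hu1.smul A).add (hu2.smul B)).congr fun x _ => ?_).congr_deriv ordConnected_univ
      (Eventually.of_forall fun x _ => ?_)
    · simp only [hu]; push_cast; ring
    · simp only [hu, hw]; push_cast; ring
  have hwac : IsACWithDeriv univ (fun x => (w x : ℂ)) (fun x => (κ x : ℂ) * u x - α x * w x) := by
    refine (((hw1.smul A).add (hw2.smul B)).congr fun x _ => ?_).congr_deriv ordConnected_univ
      (Eventually.of_forall fun x _ => ?_)
    · simp only [hw]; push_cast; ring
    · simp only [hu, hw]; push_cast; ring
  have hushift : ∀ x, u (x + ω) = ρ * u x := fun x => by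
    simp only [hu]
    rw [(shift u₁ w₁ hu1 hw1 x).1, (shift u₂ w₂ hu2 hw2 x).1]
    simp only [← hA, hB]
    linear_combination -u₂ x * hdet - u₂ x * hρ2
  have hwshift : ∀ x, w (x + ω) = ρ * w x := fun x => by
    simp only [hw]
    rw [(shift u₁ w₁ hu1 hw1 x).2, (shift u₂ w₂ hu2 hw2 x).2]
    simp only [← hA, hB]
    linear_combination -w₂ x * hdet - w₂ x * hρ2
  -- with `z` also `z + ω` would be a zero
  have hune : ∀ z, u z ≠ 0 := by
    intro z hz
    have hwz := eq_zero_of_two_zeros hα hκ hpos huac hwac (show z < z + ω by linarith) hz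
      (by rw [hushift, hz, mul_zero])
    have := IsACWithDeriv.wronskian (q := fun _ => 1) ordConnected_univ
      (by simpa only [one_mul] using huac) hwac (by simpa only [one_mul] using hu2) hw2
      (x := z) (y := 0) trivial trivial
    have h2 : u z * w₂ z - w z * u₂ z = u 0 * w₂ 0 - w 0 * u₂ 0 := by exact_mod_cast this
    rw [hz, hwz, a2, b2] at h2
    simp only [hu, a1, a2] at h2
    refine hu2ne ω hω ?_
    rw [← hA]
    linarith
  refine ⟨fun x => w x / u x, fun x => ?_, ?_⟩
  · simp only [hushift, hwshift]
    rw [mul_div_mul_left _ _ hρ0]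
  · have hune' : ∀ x ∈ (univ : Set ℝ), (u x : ℂ) ≠ 0 := fun x _ => by exact_mod_cast hune x
    refine ((hwac.mul (huac.inv ordConnected_univ hune') ordConnected_univ).congr
      fun x _ => ?_).congr_deriv ordConnected_univ (Eventually.of_forall fun x _ => ?_)
    · push_cast; rw [div_eq_mul_inv]
    · have := hune' x trivial
      push_cast
      field_simp
      ring

end Riccati

/-! ### Existence of the Miura potential -/

theorem IsUnifLocL2.of_periodic {φ : ℝ → ℝ} {ω : ℝ} (hω : 0 < ω) (hφ : Function.Periodic φ ω)
    (hm : ∀ a b, MemLp φ 2 (volume.restrict (Icc a b))) : IsUnifLocL2 φ := by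
  obtain ⟨N, hN⟩ := exists_nat_ge (1 / ω)
  rw [div_le_iff₀ hω] at hN
  have hsq : ∀ a b, IntervalIntegrable (fun x => φ x ^ 2) volume a b := fun a b => by
    rw [intervalIntegrable_iff]
    refine IntegrableOn.mono_set (t := Icc (min a b) (max a b)) ?_ Ioc_subset_Icc_self
    exact (memLp_two_iff_integrable_sq (hm _ _).1).1 (hm _ _)
  have hper : Function.Periodic (fun x => φ x ^ 2) (N * ω) := by
    intro x
    simp only [hφ.nat_mul N x]
  refine ⟨hm, ∫ x in (0 : ℝ)..(0 + N * ω), φ x ^ 2, fun a => ?_⟩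
  rw [← hper.intervalIntegral_add_eq a 0, integral_Icc_eq_integral_Ioc,
    ← intervalIntegral.integral_of_le (by linarith)]
  exact intervalIntegral.integral_mono_interval le_rfl (by linarith) (by linarith)
    (Eventually.of_forall fun x => sq_nonneg _) (hsq _ _)

theorem isH1Compact_test (f : 𝓓((⊤ : Opens ℝ), ℝ)) :
    IsH1Compact (fun x => f x) (deriv fun x => f x) := by
  have hb : ContDiff ℝ 1 (fun x => f x) := f.contDiff.of_le (by simp)
  have hd : Continuous (deriv fun x => f x) := hb.continuous_deriv le_rfl
  have hc : HasCompactSupport (fun x => f x) := f.hasCompactSupport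
  refine ⟨IsACWithDeriv.of_hasDerivAt (fun x => ?_) (Complex.continuous_ofReal.comp hd) _,
    hd.memLp_of_hasCompactSupport hc.deriv, ?_⟩
  · exact ((hb.differentiable one_ne_zero x).hasDerivAt).ofReal_comp
  · obtain ⟨R, -, hR⟩ := hc.exists_abs_le
    obtain ⟨R', -, hR'⟩ := hc.deriv.exists_abs_le
    exact ⟨max R R', fun x hx => ⟨hR x ((le_max_left _ _).trans hx),
      hR' x ((le_max_right _ _).trans hx)⟩⟩

theorem IsH1Compact.integrable_mul_left {h k g : ℝ → ℝ} (H : IsH1Compact h k)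
    (hg : LocallyIntegrable g volume) : Integrable fun x => g x * h x := by
  have := hg.integrable_smul_left_of_hasCompactSupport H.continuous H.hasCompactSupport
  simpa only [smul_eq_mul, mul_comm] using this

theorem integrable_mul_deriv_test {g : ℝ → ℝ} (hg : LocallyIntegrable g volume)
    (f : 𝓓((⊤ : Opens ℝ), ℝ)) : Integrable fun x => g x * deriv (fun y => f y) x := by
  have hb : ContDiff ℝ 1 (fun x => f x) := f.contDiff.of_le (by simp)
  have hd : Continuous (deriv fun x => f x) := hb.continuous_deriv le_rfl
  have hc : HasCompactSupport (fun x => f x) := f.hasCompactSupport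
  have := hg.integrable_smul_left_of_hasCompactSupport hd hc.deriv
  simpa only [smul_eq_mul, mul_comm] using this

theorem locallyIntegrable_of_memLp {α : ℝ → ℝ} (hα : ∀ a b, MemLp α 2 (volume.restrict (Icc a b))) :
    LocallyIntegrable α volume ∧ LocallyIntegrable (fun x => α x ^ 2) volume := by
  constructor <;> intro x <;>
    refine ⟨Icc (x - 1) (x + 1), Icc_mem_nhds (by linarith) (by linarith), ?_⟩
  · exact (hα _ _).integrable (by norm_num)
  · exact (memLp_two_iff_integrable_sq (hα _ _).1).1 (hα _ _)

/-- A solution `r` of the Riccati equation provides the Miura potential `-α - r`. -/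
theorem IsMiura.of_riccati {q : RealDistribution} {α κ r : ℝ → ℝ} {C : ℝ}
    (hα : ∀ a b, MemLp α 2 (volume.restrict (Icc a b))) (hκ : LocallyIntegrable κ volume)
    (hr : IsACWithDeriv univ (fun x => (r x : ℂ))
      (fun x => ((κ x - 2 * α x * r x - r x ^ 2 : ℝ) : ℂ)))
    (hq : ∀ f : 𝓓((⊤ : Opens ℝ), ℝ), q f = (∫ x, (κ x + α x ^ 2 - C) * f x) -
      ∫ x, α x * deriv (fun y => f y) x) : IsMiura q (fun x => -α x - r x) C := by
  intro f
  have H := isH1Compact_test f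
  obtain ⟨R, hR⟩ := H.bounded
  have hrc : Continuous r := by
    have := Complex.continuous_re.comp hr.continuous
    simpa [Function.comp_def] using this
  obtain ⟨lα, lα2⟩ := locallyIntegrable_of_memLp hα
  have lr := hrc.locallyIntegrable (μ := volume)
  have lαr : LocallyIntegrable (fun x => α x * r x) volume := by
    intro x
    refine ⟨Icc (x - 1) (x + 1), Icc_mem_nhds (by linarith) (by linarith), ?_⟩
    exact (lα.integrableOn_isCompact isCompact_Icc).mul_continuousOn hrc.continuousOn isCompact_Icc
  have lr' : LocallyIntegrable (fun x => κ x - 2 * α x * r x - r x ^ 2) volume := by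
    have h1 := (hκ.sub (lαr.smul (2 : ℝ))).sub ((hrc.pow 2).locallyIntegrable (μ := volume))
    refine h1.congr (Eventually.of_forall fun x => ?_)
    simp only [Pi.sub_apply, Pi.smul_apply, smul_eq_mul, Pi.pow_apply]
    ring
  have e := hr.integral_mul_compact H.ac (R := R)
    (fun x hx => by rw [(hR x hx).1]; simp) (fun x hx => by rw [(hR x hx).2]; simp)
  have e1 : ∫ x, r x * deriv (fun y => f y) x =
      - ∫ x, (κ x - 2 * α x * r x - r x ^ 2) * f x := by
    have c1 : ∫ x, (r x : ℂ) * (deriv (fun y => f y) x : ℝ) =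
        ((∫ x, r x * deriv (fun y => f y) x : ℝ) : ℂ) := by
      rw [← integral_complex_ofReal]; push_cast; rfl
    have c2 : ∫ x, ((κ x - 2 * α x * r x - r x ^ 2 : ℝ) : ℂ) * (f x : ℝ) =
        ((∫ x, (κ x - 2 * α x * r x - r x ^ 2) * f x : ℝ) : ℂ) := by
      rw [← integral_complex_ofReal]; push_cast; rfl
    rw [c1, c2] at e
    exact_mod_cast e
  have i1 := H.integrable_mul_left hκ
  have i2 := H.integrable_mul_left lα2
  have i3 := H.integrable_mul_left lr'
  have i4 : Integrable fun x => f x := by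
    simpa using H.integrable_mul_left (continuous_const (y := (1 : ℝ))).locallyIntegrable
  have i12 : Integrable fun x => κ x * f x + α x ^ 2 * f x := i1.add i2
  have j1 := integrable_mul_deriv_test lα f
  have j1n : Integrable fun x => -(α x * deriv (fun y => f y) x) := j1.neg
  have j2 := integrable_mul_deriv_test lr f
  rw [hq f]
  have e2 : ∫ x, (κ x + α x ^ 2 - C) * f x = (∫ x, κ x * f x) + (∫ x, α x ^ 2 * f x) -
      C * ∫ x, f x := by
    rw [← integral_add i1 i2, ← integral_const_mul, ← integral_sub i12 (i4.const_mul C)]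
    refine integral_congr_ae (Eventually.of_forall fun x => ?_)
    simp only
    ring
  have e3 : ∫ x, (-α x - r x) * deriv (fun y => f y) x =
      - (∫ x, α x * deriv (fun y => f y) x) - ∫ x, r x * deriv (fun y => f y) x := by
    rw [← integral_neg, ← integral_sub j1n j2]
    refine integral_congr_ae (Eventually.of_forall fun x => ?_)
    simp only
    ring
  have e4 : ∫ x, (-α x - r x) ^ 2 * f x = (∫ x, κ x * f x) + (∫ x, α x ^ 2 * f x) -
      ∫ x, (κ x - 2 * α x * r x - r x ^ 2) * f x := by
    rw [← integral_add i1 i2, ← integral_sub i12 i3]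
    refine integral_congr_ae (Eventually.of_forall fun x => ?_)
    simp only
    ring
  rw [e2, e3, e4, e1]
  ring

/-- A compactly supported function in `H¹`, as an element of the complex `L²` space. -/
theorem IsH1Compact.exists_hasL2Deriv {h k : ℝ → ℝ} (H : IsH1Compact h k) :
    ∃ f d : L2Line, HasL2Deriv f d ∧ (∀ᵐ x, f x = h x) ∧ ∀ᵐ x, d x = k x := by
  have h1 : MemLp (fun x => (h x : ℂ)) 2 volume := H.memLp_two.ofReal
  have h2 : MemLp (fun x => (k x : ℂ)) 2 volume := H.memLp.ofReal
  refine ⟨h1.toLp, h2.toLp, ⟨fun x => (h x : ℂ), ?_, h1.coeFn_toLp⟩, h1.coeFn_toLp,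
    h2.coeFn_toLp⟩
  refine H.ac.congr_deriv ordConnected_univ ?_
  filter_upwards [h2.coeFn_toLp] with x hx _
  exact hx.symm

theorem integral_re_inner (f g : L2Line) :
    ∫ x, (inner ℂ (f x) (g x)).re = (inner ℂ f g).re := by
  rw [L2.inner_def]
  exact integral_re (L2.integrable_inner (𝕜 := ℂ) f g)

theorem re_inner_self (f : L2Line) : (inner ℂ f f).re = ‖f‖ ^ 2 := by
  have := inner_self_eq_norm_sq (𝕜 := ℂ) f
  simpa using this

/-- The form `(h', h') + (β + α')(h²)` is bounded from below. -/
theorem exists_form_nonneg {α β : ℝ → ℝ} (hα : IsUnifLocL2 α) (hβ : IsUnifLocL2 β) :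
    ∃ C : ℝ, ∀ h k, IsH1Compact h k →
      0 ≤ ∫ x, ((k x - α x * h x) * (k x - α x * h x) + (β x - α x ^ 2 + C) * (h x * h x)) := by
  obtain ⟨C₁, hC₁, h1⟩ := hα.exists_mul (show (0 : ℝ) < 1 / 16 by norm_num)
  obtain ⟨C₂, hC₂, h2⟩ := hβ.exists_mul one_pos
  refine ⟨4 * C₁ + C₂ + 1, fun h k H => ?_⟩
  obtain ⟨f, d, hfd, hf, hd⟩ := H.exists_hasL2Deriv
  obtain ⟨m, hm, hm2⟩ := h1 f d hfd
  obtain ⟨b, hb, hb2⟩ := h2 f d hfd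
  have e : ∫ x, ((k x - α x * h x) * (k x - α x * h x) +
      (β x - α x ^ 2 + (4 * C₁ + C₂ + 1)) * (h x * h x)) =
      ‖d - m‖ ^ 2 - ‖m‖ ^ 2 + (inner ℂ f b).re + (4 * C₁ + C₂ + 1) * ‖f‖ ^ 2 := by
    rw [← re_inner_self, ← re_inner_self, ← re_inner_self, ← integral_re_inner,
      ← integral_re_inner, ← integral_re_inner, ← integral_re_inner, ← integral_const_mul]
    have i : ∀ f g : L2Line, Integrable fun x => (inner ℂ (f x) (g x)).re :=
      fun f g => Integrable.re (L2.integrable_inner (𝕜 := ℂ) f g)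
    have i1 : Integrable fun x => (inner ℂ ((d - m) x) ((d - m) x)).re -
        (inner ℂ (m x) (m x)).re := (i _ _).sub (i _ _)
    have i2 : Integrable fun x => (inner ℂ ((d - m) x) ((d - m) x)).re -
        (inner ℂ (m x) (m x)).re + (inner ℂ (f x) (b x)).re := i1.add (i _ _)
    rw [← integral_sub (i _ _) (i _ _), ← integral_add i1 (i _ _),
      ← integral_add i2 ((i _ _).const_mul _)]
    refine integral_congr_ae ?_
    filter_upwards [hf, hd, hm, hb, Lp.coeFn_sub d m] with x e1 e2 e3 e4 e5
    rw [e5, Pi.sub_apply, e2, e3, e4, e1]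
    simp only [RCLike.inner_apply, map_sub, map_mul, Complex.conj_ofReal]
    norm_cast
    ring
  rw [e]
  have n1 : ‖d‖ - ‖m‖ ≤ ‖d - m‖ := norm_sub_norm_le _ _
  have n2 : (‖d‖ - ‖m‖) ^ 2 ≤ ‖d - m‖ ^ 2 := by
    rw [sq_le_sq, abs_of_nonneg (norm_nonneg (d - m))]
    exact abs_norm_sub_norm_le _ _
  have n3 : -(‖f‖ * ‖b‖) ≤ (inner ℂ f b).re := by
    have := (Complex.abs_re_le_norm (inner ℂ f b)).trans (norm_inner_le_norm f b)
    exact (abs_le.1 this).1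
  nlinarith [sq_nonneg (‖d‖ / 2 - 2 * ‖m‖), sq_nonneg (‖b‖ / 2 - ‖f‖), norm_nonneg f,
    sq_nonneg ‖f‖, mul_nonneg hC₂ (sq_nonneg ‖f‖), mul_nonneg hC₁ (sq_nonneg ‖f‖)]

/-- The form of the nonnegative operator `A* A - C`, written with the coefficients `-φ` and `-C` of the
associated first-order system, is nonnegative on real compactly supported functions in `H¹`. -/
theorem form_nonneg_of_isNonnegOp {q : RealDistribution} {φ : ℝ → ℝ} {C : ℝ} (hφ : IsUnifLocL2 φ)
    (hq : IsMiura q φ C) (hT : IsNonnegOp (schrodingerOp q)) {h k : ℝ → ℝ} (H : IsH1Compact h k) :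
    0 ≤ ∫ x, ((k x - -φ x * h x) * (k x - -φ x * h x) + -C * (h x * h x)) := by
  obtain ⟨f, d, hfd, hf, hd⟩ := H.exists_hasL2Deriv
  obtain ⟨a, ha⟩ := hφ.exists_mem_lineGraph hfd
  have hle := mul_norm_sq_le_of_isNonnegOp hφ hq hT ha
  obtain ⟨d', hfd', ha'⟩ := mem_lineGraph_iff.1 ha
  have hdd : d' = d := by
    have z1 : (f, d) ∈ lineGraph fun _ => 0 :=
      mem_lineGraph_iff.2 ⟨d, hfd, Eventually.of_forall fun x => by simp⟩
    have z2 : (f, d') ∈ lineGraph fun _ => 0 :=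
      mem_lineGraph_iff.2 ⟨d', hfd', Eventually.of_forall fun x => by simp⟩
    exact sub_eq_zero.1 (lineGraph_functional _ ((lineGraph _).sub_mem z2 z1) (sub_self _))
  subst hdd
  have e : ∫ x, ((k x - -φ x * h x) * (k x - -φ x * h x) + -C * (h x * h x)) =
      ‖a‖ ^ 2 - C * ‖f‖ ^ 2 := by
    rw [← re_inner_self, ← re_inner_self, ← integral_re_inner,
      ← integral_re_inner, ← integral_const_mul]
    have i : ∀ f g : L2Line, Integrable fun x => (inner ℂ (f x) (g x)).re :=
      fun f g => Integrable.re (L2.integrable_inner (𝕜 := ℂ) f g)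
    rw [← integral_sub (i _ _) ((i _ _).const_mul _)]
    refine integral_congr_ae ?_
    filter_upwards [hf, hd, ha'] with x e1 e2 e3
    rw [e3, e2, e1]
    simp only [RCLike.inner_apply, map_add, map_mul, Complex.conj_ofReal]
    norm_cast
    ring
  rw [e]
  exact sub_nonneg.2 hle

/-- If `q = β + α'` with periodic `α, β ∈ L²_loc` and the operator is nonnegative, then a periodic
Miura potential exists. -/
theorem exists_isPeriodicMiura_of_repr {q : RealDistribution} {α β : ℝ → ℝ} {ω : ℝ} (hω : 0 < ω)
    (hα : ∀ a b, MemLp α 2 (volume.restrict (Icc a b)))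
    (hβ : ∀ a b, MemLp β 2 (volume.restrict (Icc a b)))
    (pα : Function.Periodic α ω) (pβ : Function.Periodic β ω)
    (hq : ∀ f : 𝓓((⊤ : Opens ℝ), ℝ), q f = (∫ x, β x * f x) - ∫ x, α x * deriv (fun y => f y) x)
    (hT : IsNonnegOp (schrodingerOp q)) : ∃ φ, IsPeriodicMiura ω q φ := by
  have cont : ∀ {r v : ℝ → ℝ}, IsACWithDeriv univ (fun x => (r x : ℂ)) (fun x => (v x : ℂ)) →
      Continuous r := fun hr => by
    have := Complex.continuous_re.comp hr.continuous
    simpa [Function.comp_def] using this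
  have memLp : ∀ {α r : ℝ → ℝ}, (∀ a b, MemLp α 2 (volume.restrict (Icc a b))) → Continuous r →
      ∀ a b, MemLp (fun x => -α x - r x) 2 (volume.restrict (Icc a b)) := by
    intro α r hα hr a b
    obtain ⟨M, hM⟩ := (isCompact_Icc (a := a) (b := b)).exists_bound_of_continuousOn
      hr.continuousOn
    refine (hα a b).neg.sub (MemLp.of_bound hr.aestronglyMeasurable M ?_)
    filter_upwards [ae_restrict_mem measurableSet_Icc] with t ht
    exact hM t ht
  have locB := (locallyIntegrable_of_memLp hβ).1
  -- the shifted operator has a positive form and therefore a Miura potential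
  obtain ⟨C, hC⟩ := exists_form_nonneg (.of_periodic hω pα hα) (.of_periodic hω pβ hβ)
  have hκ : LocallyIntegrable (fun x => β x - α x ^ 2 + C) volume :=
    (locB.sub (locallyIntegrable_of_memLp hα).2).add continuous_const.locallyIntegrable
  obtain ⟨r, pr, hr⟩ := exists_periodic_riccati hω hα hκ pα
    (fun x => by simp only [pα x, pβ x]) hC
  have hM := IsMiura.of_riccati (q := q) (C := C) hα hκ hr (fun f => by
    rw [hq f]; congr 2; ext x; ring)
  have hφ := memLp hα (cont hr)
  set φ : ℝ → ℝ := fun x => -α x - r x with hφdef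
  have pφ : Function.Periodic φ ω := fun x => by simp only [hφdef, pα x, pr x]
  -- hence the positivity of the operator implies that of its form
  have hpos := fun h k (H : IsH1Compact h k) =>
    form_nonneg_of_isNonnegOp (.of_periodic hω pφ hφ) hM hT H
  have hκ' : LocallyIntegrable (fun _ : ℝ => -C) volume := continuous_const.locallyIntegrable
  have hφn : ∀ a b, MemLp (fun x => - φ x) 2 (volume.restrict (Icc a b)) := fun a b =>
    (hφ a b).neg
  obtain ⟨r', pr', hr'⟩ := exists_periodic_riccati hω hφn hκ' (fun x => by simp only [pφ x])
    (fun x => rfl) hpos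
  have hlφ := locallyIntegrable_of_memLp hφ
  have hM' := IsMiura.of_riccati (q := q) (C := 0) hφn hκ' hr' (fun f => by
    have H := isH1Compact_test f
    have i1 := H.integrable_mul_left hlφ.2
    have i2 : Integrable fun x => C * f x :=
      H.integrable_mul_left (g := fun _ => C) continuous_const.locallyIntegrable
    have e : ∫ x, (-C + (- φ x) ^ 2 - 0) * f x = (∫ x, φ x ^ 2 * f x) - ∫ x, C * f x := by
      rw [← integral_sub i1 i2]
      refine integral_congr_ae (Eventually.of_forall fun x => ?_)
      simp only; ring
    rw [hM f, e, integral_const_mul]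
    simp only [neg_mul, integral_neg]
    ring)
  have hφ' := memLp hφn (cont hr')
  have pφ' : Function.Periodic (fun x => - -φ x - r' x) ω := fun x => by simp only [pφ x, pr' x]
  refine ⟨_, hφ', (IsUnifLocL2.of_periodic hω pφ' hφ').locUnif, Eventually.of_forall pφ',
    fun f => ?_⟩
  rw [hM' f, zero_mul, sub_zero]

/-! ### Periodic distributions of order `H⁻¹` -/

/-- A functional bounded by the norm of a linear map into a Hilbert space is represented by a
vector. -/
theorem exists_inner_eq_of_bound {V H : Type*} [AddCommGroup V] [Module ℝ V] [NormedAddCommGroup H]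
    [InnerProductSpace ℝ H] [CompleteSpace H] (J : V →ₗ[ℝ] H) (ℓ : V →ₗ[ℝ] ℝ) {C : ℝ}
    (hC : ∀ v, |ℓ v| ≤ C * ‖J v‖) : ∃ w : H, ∀ v, ℓ v = inner ℝ w (J v) := by
  obtain ⟨g, hg⟩ := J.rangeRestrict.exists_rightInverse_of_surjective J.range_rangeRestrict
  have hg' : ∀ y : LinearMap.range J, J (g y) = y := fun y => by
    have := LinearMap.congr_fun hg y
    exact congrArg Subtype.val this
  have hℓ : ∀ v, ℓ (g (J.rangeRestrict v)) = ℓ v := by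
    intro v
    have h1 := hC (g (J.rangeRestrict v) - v)
    have h2 : J (g (J.rangeRestrict v)) = J v := hg' _
    rw [map_sub J, h2, sub_self, norm_zero, mul_zero, map_sub] at h1
    exact sub_eq_zero.1 (abs_nonpos_iff.1 h1)
  let L : LinearMap.range J →L[ℝ] ℝ := (ℓ ∘ₗ g).mkContinuous C fun y => by
    have := hC (g y)
    rw [hg'] at this
    exact this
  obtain ⟨M, hM, -⟩ := exists_extension_norm_eq (LinearMap.range J) L
  refine ⟨(InnerProductSpace.toDual ℝ H).symm M, fun v => ?_⟩
  rw [InnerProductSpace.toDual_symm_apply, ← hℓ]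
  exact (hM (J.rangeRestrict v)).symm

/-- The product of two real test functions. -/
def mulTestR (ψ f : 𝓓((⊤ : Opens ℝ), ℝ)) : 𝓓((⊤ : Opens ℝ), ℝ) where
  toFun x := ψ x * f x
  contDiff' := ψ.contDiff.mul f.contDiff
  hasCompactSupport' := f.hasCompactSupport.mul_left
  tsupport_subset' := fun _ _ => trivial

/-- The translate `x ↦ f (x + c)` of a real test function. -/
def shiftTestR (c : ℝ) (f : 𝓓((⊤ : Opens ℝ), ℝ)) : 𝓓((⊤ : Opens ℝ), ℝ) where
  toFun x := f (x + c)
  contDiff' := f.contDiff.comp (contDiff_id.add contDiff_const)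
  hasCompactSupport' := f.hasCompactSupport.comp_homeomorph (Homeomorph.addRight c)
  tsupport_subset' := fun _ _ => trivial

theorem IsPeriodicDistribution.shift {ω : ℝ} {q : RealDistribution}
    (h : IsPeriodicDistribution ω q) (n : ℤ) (f : 𝓓((⊤ : Opens ℝ), ℝ)) :
    q (shiftTestR (n * ω) f) = q f := by
  have hstep : ∀ n : ℤ, q (shiftTestR ((n + 1 : ℤ) * ω) f) = q (shiftTestR (n * ω) f) := by
    intro n
    refine (h _ _ fun x => ?_).symm
    change f (x + n * ω) = f (x - ω + (n + 1 : ℤ) * ω)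
    congr 1
    push_cast
    ring
  induction n using Int.induction_on with
  | zero =>
    congr 1
    ext x
    change f (x + (0 : ℤ) * ω) = f x
    simp
  | succ n ih => rw [hstep, ih]
  | pred n ih =>
    rw [← ih, ← hstep (-n - 1)]
    simp

theorem hasDerivAt_testR (f : 𝓓((⊤ : Opens ℝ), ℝ)) (x : ℝ) :
    HasDerivAt (fun y => f y) (deriv (fun y => f y) x) x :=
  (f.contDiff.differentiable (by simp) x).hasDerivAt

theorem memLp_testR (f : 𝓓((⊤ : Opens ℝ), ℝ)) : MemLp (fun x => f x) 2 volume :=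
  (isH1Compact_test f).memLp_two

theorem memLp_deriv_testR (f : 𝓓((⊤ : Opens ℝ), ℝ)) :
    MemLp (fun x => deriv (fun y => f y) x) 2 volume :=
  (isH1Compact_test f).memLp

/-- The embedding `f ↦ (f, f')` of the test functions into `L² ⊕ L²`. -/
def sobolevMap : 𝓓((⊤ : Opens ℝ), ℝ) →ₗ[ℝ]
    WithLp 2 (Lp ℝ 2 (volume : Measure ℝ) × Lp ℝ 2 (volume : Measure ℝ)) where
  toFun f := WithLp.toLp 2 ((memLp_testR f).toLp, (memLp_deriv_testR f).toLp)
  map_add' f g := by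
    have e : (fun x => deriv (fun y => (f + g) y) x) =
        (fun x => deriv (fun y => f y) x) + fun x => deriv (fun y => g y) x := by
      funext x
      exact ((hasDerivAt_testR f x).add (hasDerivAt_testR g x)).deriv
    have e1 : (memLp_deriv_testR (f + g)).toLp = (memLp_deriv_testR f).toLp +
        (memLp_deriv_testR g).toLp := by
      rw [← MemLp.toLp_add]
      exact MemLp.toLp_congr _ _ (Eventually.of_forall fun x => congrFun e x)
    rw [e1]
    rfl
  map_smul' c f := by
    have e1 : (memLp_deriv_testR (c • f)).toLp = c • (memLp_deriv_testR f).toLp := by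
      rw [← MemLp.toLp_const_smul]
      exact MemLp.toLp_congr _ _ (Eventually.of_forall fun x =>
        ((hasDerivAt_testR f x).const_smul c).deriv)
    rw [e1]
    rfl

theorem norm_sobolevMap (f : 𝓓((⊤ : Opens ℝ), ℝ)) : ‖sobolevMap f‖ =
    Real.sqrt ((∫ x, (f x) ^ 2) + ∫ x, (deriv (fun y => f y) x) ^ 2) := by
  have e : ∀ {g : ℝ → ℝ} (hg : MemLp g 2 volume), ‖hg.toLp‖ ^ 2 = ∫ x, g x ^ 2 := by
    intro g hg
    rw [← real_inner_self_eq_norm_sq, L2.inner_def]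
    refine integral_congr_ae ?_
    filter_upwards [hg.coeFn_toLp] with x hx
    rw [hx, real_inner_self_eq_norm_sq, Real.norm_eq_abs, sq_abs]
  rw [WithLp.prod_norm_eq_of_L2]
  congr 2
  · exact e (memLp_testR f)
  · exact e (memLp_deriv_testR f)

/-- A distribution in `H⁻¹_loc`, multiplied by a test function, is of the form `β - α'` with square
integrable `α` and `β`. -/
theorem MemHNegOneLoc.exists_repr {q : RealDistribution} (hq : MemHNegOneLoc q)
    (ψ : 𝓓((⊤ : Opens ℝ), ℝ)) : ∃ α β : ℝ → ℝ, MemLp α 2 volume ∧ MemLp β 2 volume ∧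
      ∀ f : 𝓓((⊤ : Opens ℝ), ℝ), q (mulTestR ψ f) =
        (∫ x, β x * f x) + ∫ x, α x * deriv (fun y => f y) x := by
  obtain ⟨C, hC⟩ := hq ψ
  let ℓ : 𝓓((⊤ : Opens ℝ), ℝ) →ₗ[ℝ] ℝ :=
    { toFun := fun f => q (mulTestR ψ f)
      map_add' := fun f g => by
        rw [← map_add]; congr 1; ext x; exact mul_add _ _ _
      map_smul' := fun c f => by
        rw [RingHom.id_apply, ← map_smul]; congr 1; ext x; exact mul_left_comm _ _ _ }
  obtain ⟨w, hw⟩ := exists_inner_eq_of_bound sobolevMap ℓ (C := C) fun f => by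
    rw [norm_sobolevMap]
    exact hC f _ fun x => rfl
  refine ⟨w.snd, w.fst, Lp.memLp _, Lp.memLp _, fun f => ?_⟩
  refine (hw f).trans ?_
  rw [WithLp.prod_inner_apply]
  congr 1
  · rw [L2.inner_def]
    refine integral_congr_ae ?_
    filter_upwards [(memLp_testR f).coeFn_toLp] with x hx
    refine (congrArg (inner ℝ (w.fst x)) hx).trans ?_
    rw [RCLike.inner_apply, conj_trivial, mul_comm]
  · rw [L2.inner_def]
    refine integral_congr_ae ?_
    filter_upwards [(memLp_deriv_testR f).coeFn_toLp] with x hx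
    refine (congrArg (inner ℝ (w.snd x)) hx).trans ?_
    rw [RCLike.inner_apply, conj_trivial, mul_comm]

/-- The representing functions can be chosen with bounded support. -/
theorem MemHNegOneLoc.exists_repr_compact {q : RealDistribution} (hq : MemHNegOneLoc q)
    (ψ : 𝓓((⊤ : Opens ℝ), ℝ)) : ∃ α β : ℝ → ℝ, MemLp α 2 volume ∧ MemLp β 2 volume ∧
      (∃ R, ∀ x, R ≤ |x| → α x = 0 ∧ β x = 0) ∧
      ∀ f : 𝓓((⊤ : Opens ℝ), ℝ), q (mulTestR ψ f) =
        (∫ x, β x * f x) + ∫ x, α x * deriv (fun y => f y) x := by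
  obtain ⟨α, β, hα, hβ, h⟩ := hq.exists_repr ψ
  obtain ⟨R, hR0, hR⟩ := (show HasCompactSupport (fun x => ψ x) from ψ.hasCompactSupport).exists_abs_le
  let b : ContDiffBump (0 : ℝ) := ⟨R, R + 1, hR0, by linarith⟩
  let χ : 𝓓((⊤ : Opens ℝ), ℝ) := ⟨b, b.contDiff, b.hasCompactSupport, fun _ _ => trivial⟩
  have H := isH1Compact_test χ
  have hχ : ∀ x, ψ x = ψ x * χ x := by
    intro x
    rcases le_or_gt R |x| with hx | hx
    · rw [hR x hx, zero_mul]
    · have : χ x = 1 := b.one_of_mem_closedBall (by simpa [b] using hx.le)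
      rw [this, mul_one]
  have ht : ∀ g : ℝ → ℝ, Continuous g → HasCompactSupport g → MemLp g ⊤ volume := fun g h1 h2 =>
    h1.memLp_top_of_hasCompactSupport h2 _
  have hd : Continuous (deriv fun x => χ x) :=
    (χ.contDiff.of_le (by simp) : ContDiff ℝ 1 fun x => χ x).continuous_deriv le_rfl
  have m1 : MemLp (fun x => α x * χ x) 2 volume :=
    (ht _ H.continuous H.hasCompactSupport).mul hα
  have m2 : MemLp (fun x => β x * χ x) 2 volume :=
    (ht _ H.continuous H.hasCompactSupport).mul hβ
  have m3 : MemLp (fun x => α x * deriv (fun y => χ y) x) 2 volume :=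
    (ht _ hd H.hasCompactSupport.deriv).mul hα
  obtain ⟨R', hR'⟩ := H.bounded
  refine ⟨fun x => α x * χ x, fun x => β x * χ x + α x * deriv (fun y => χ y) x, m1, m2.add m3,
    ⟨R', fun x hx => ?_⟩, fun f => ?_⟩
  · simp only [(hR' x hx).1, (hR' x hx).2]; simp
  · have e : mulTestR ψ f = mulTestR ψ (mulTestR χ f) := by
      ext x
      change ψ x * f x = ψ x * (χ x * f x)
      rw [← mul_assoc, ← hχ x]
    have hder : ∀ x, deriv (fun y => mulTestR χ f y) x =
        deriv (fun y => χ y) x * f x + χ x * deriv (fun y => f y) x := fun x =>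
      ((hasDerivAt_testR χ x).mul (hasDerivAt_testR f x)).deriv
    have i1 : Integrable fun x => β x * χ x * f x := m2.integrable_mul (memLp_testR f)
    have i2 : Integrable fun x => α x * deriv (fun y => χ y) x * f x :=
      m3.integrable_mul (memLp_testR f)
    have i3 : Integrable fun x => α x * χ x * deriv (fun y => f y) x :=
      m1.integrable_mul (memLp_deriv_testR f)
    rw [e, h]
    simp only [hder]
    have e1 : ∫ x, β x * mulTestR χ f x = ∫ x, β x * χ x * f x :=
      integral_congr_ae (Eventually.of_forall fun x => (mul_assoc _ _ _).symm)
    have e2 : ∫ x, α x * (deriv (fun y => χ y) x * f x + χ x * deriv (fun y => f y) x) =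
        (∫ x, α x * deriv (fun y => χ y) x * f x) + ∫ x, α x * χ x * deriv (fun y => f y) x := by
      rw [← integral_add i2 i3]
      refine integral_congr_ae (Eventually.of_forall fun x => ?_)
      simp only; ring
    have e3 : ∫ x, (β x * χ x + α x * deriv (fun y => χ y) x) * f x =
        (∫ x, β x * χ x * f x) + ∫ x, α x * deriv (fun y => χ y) x * f x := by
      rw [← integral_add i1 i2]
      refine integral_congr_ae (Eventually.of_forall fun x => ?_)
      simp only; ring
    rw [e1, e2, e3]
    ring

/-- The periodization of a function with bounded support. -/
def periodization (ω : ℝ) (α : ℝ → ℝ) (x : ℝ) : ℝ := ∑' n : ℤ, α (x + n * ω)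

theorem periodic_periodization (ω : ℝ) (α : ℝ → ℝ) :
    Function.Periodic (periodization ω α) ω := by
  intro x
  rw [periodization, periodization, ← (Equiv.addRight (1 : ℤ)).tsum_eq fun n : ℤ => α (x + n * ω)]
  refine tsum_congr fun n => ?_
  congr 1
  simp only [Equiv.coe_addRight]
  push_cast
  ring

theorem periodization_eq_sum {ω : ℝ} (hω : 0 < ω) {α : ℝ → ℝ} {R : ℝ}
    (hα : ∀ x, R ≤ |x| → α x = 0) {L : ℝ} {N : ℕ} (hN : L + R ≤ N * ω) {x : ℝ} (hx : |x| ≤ L) :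
    periodization ω α x = ∑ i ∈ Finset.range (2 * N + 1), α (x + (i - N : ℝ) * ω) := by
  have hinj : ∀ i ∈ Finset.range (2 * N + 1), ∀ j ∈ Finset.range (2 * N + 1),
      (i : ℤ) - N = j - N → i = j := fun i _ j _ h => by omega
  have h1 : periodization ω α x = ∑ n ∈ (Finset.range (2 * N + 1)).image fun i : ℕ => (i : ℤ) - N,
      α (x + n * ω) := by
    refine tsum_eq_sum fun n hn => hα _ ?_
    have hn' : (N : ℝ) ≤ |(n : ℝ)| := by
      by_contra hlt
      push Not at hlt
      have h2 : |n| < N := by exact_mod_cast hlt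
      rw [abs_lt] at h2
      refine hn (Finset.mem_image.2 ⟨(n + N).toNat, Finset.mem_range.2 (by omega), by omega⟩)
    have h3 : |(n : ℝ) * ω| - |x| ≤ |x + n * ω| := by
      have := abs_sub_abs_le_abs_sub ((n : ℝ) * ω) (-x)
      rw [abs_neg, sub_neg_eq_add, add_comm ((n : ℝ) * ω)] at this
      exact this
    rw [abs_mul, abs_of_pos hω] at h3
    nlinarith
  rw [h1, Finset.sum_image hinj]
  refine Finset.sum_congr rfl fun i _ => ?_
  push_cast
  rfl

theorem memLp_periodization {ω : ℝ} (hω : 0 < ω) {α : ℝ → ℝ} {R : ℝ}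
    (hα : ∀ x, R ≤ |x| → α x = 0) (hm : MemLp α 2 volume) (a b : ℝ) :
    MemLp (periodization ω α) 2 (volume.restrict (Icc a b)) := by
  obtain ⟨N, hN⟩ := exists_nat_ge ((max |a| |b| + R) / ω)
  rw [div_le_iff₀ hω] at hN
  have h1 : MemLp (fun x => ∑ i ∈ Finset.range (2 * N + 1), α (x + (i - N : ℝ) * ω)) 2
      (volume.restrict (Icc a b)) :=
    memLp_finsetSum _ fun i _ =>
      (hm.comp_measurePreserving (measurePreserving_add_right volume _)).restrict _
  refine h1.ae_eq ?_
  filter_upwards [ae_restrict_mem measurableSet_Icc] with x hx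
  exact (periodization_eq_sum hω hα hN (abs_le_max_abs_abs hx.1 hx.2)).symm

/-- A test function whose translates form a partition of unity. -/
theorem exists_partition {ω : ℝ} (hω : 0 < ω) : ∃ ψ : 𝓓((⊤ : Opens ℝ), ℝ), ∀ (N : ℕ) (x : ℝ),
    |x| ≤ N * ω → ∑ i ∈ Finset.range (2 * N + 1), ψ (x + (i - N : ℝ) * ω) = 1 := by
  let g : ℝ → ℝ := fun x => Real.smoothTransition (x / ω + 1) - Real.smoothTransition (x / ω)
  have hg : ContDiff ℝ ((⊤ : ℕ∞) : WithTop ℕ∞) g :=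
    (Real.smoothTransition.contDiff.comp ((contDiff_id.div_const ω).add contDiff_const)).sub
      (Real.smoothTransition.contDiff.comp (contDiff_id.div_const ω))
  have hgc : HasCompactSupport g := by
    refine HasCompactSupport.of_support_subset_isCompact (isCompact_Icc (a := -ω) (b := ω)) ?_
    intro x hx
    by_contra hn
    refine hx ?_
    rw [mem_Icc, not_and_or, not_le, not_le] at hn
    simp only [g]
    rcases hn with h | h
    · have h1 : x / ω + 1 ≤ 0 := by
        have : x / ω ≤ -1 := by rw [div_le_iff₀ hω]; linarith
        linarith
      rw [Real.smoothTransition.zero_of_nonpos h1,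
        Real.smoothTransition.zero_of_nonpos (by linarith), sub_zero]
    · have h1 : 1 ≤ x / ω := by rw [le_div_iff₀ hω]; linarith
      rw [Real.smoothTransition.one_of_one_le h1,
        Real.smoothTransition.one_of_one_le (by linarith), sub_self]
  refine ⟨⟨g, hg, hgc, fun _ _ => trivial⟩, fun N x hx => ?_⟩
  change ∑ i ∈ Finset.range (2 * N + 1), g (x + (i - N : ℝ) * ω) = 1
  have e : ∀ i : ℕ, g (x + (i - N : ℝ) * ω) =
      Real.smoothTransition (x / ω - N + (i + 1 : ℕ)) - Real.smoothTransition (x / ω - N + i) := by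
    intro i
    simp only [g]
    have : (x + (i - N : ℝ) * ω) / ω = x / ω - N + i := by field_simp; ring
    rw [this]
    push_cast
    ring_nf
  have hx' : |x / ω| ≤ N := by rw [abs_div, abs_of_pos hω, div_le_iff₀ hω]; exact hx
  rw [Finset.sum_congr rfl fun i _ => e i,
    Finset.sum_range_sub fun i : ℕ => Real.smoothTransition (x / ω - N + i)]
  have h2 := abs_le.1 hx'
  rw [Real.smoothTransition.one_of_one_le (by push_cast; linarith),
    Real.smoothTransition.zero_of_nonpos (by push_cast; linarith), sub_zero]

/-- A periodic distribution in `H⁻¹_loc` is of the form `β - α'` with periodic, locally square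
integrable functions `α` and `β`. -/
theorem MemHNegOneLoc.exists_periodic_repr {ω : ℝ} (hω : 0 < ω) {q : RealDistribution}
    (hq : MemHNegOneLoc q) (hper : IsPeriodicDistribution ω q) : ∃ α β : ℝ → ℝ,
      (∀ a b, MemLp α 2 (volume.restrict (Icc a b))) ∧
      (∀ a b, MemLp β 2 (volume.restrict (Icc a b))) ∧
      Function.Periodic α ω ∧ Function.Periodic β ω ∧
      ∀ f : 𝓓((⊤ : Opens ℝ), ℝ), q f =
        (∫ x, β x * f x) + ∫ x, α x * deriv (fun y => f y) x := by
  obtain ⟨ψ, hψ⟩ := exists_partition hω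
  obtain ⟨α, β, hα, hβ, ⟨R, hR⟩, hrep⟩ := hq.exists_repr_compact ψ
  refine ⟨periodization ω α, periodization ω β,
    memLp_periodization hω (fun x hx => (hR x hx).1) hα,
    memLp_periodization hω (fun x hx => (hR x hx).2) hβ, periodic_periodization ω α,
    periodic_periodization ω β, fun f => ?_⟩
  have H := isH1Compact_test f
  obtain ⟨L, hL⟩ := H.bounded
  obtain ⟨N, hN⟩ := exists_nat_ge ((max L 0 + max R 0) / ω)
  rw [div_le_iff₀ hω] at hN
  have hN1 : max L 0 + R ≤ N * ω := (by gcongr; exact le_max_left _ _ :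
    max L 0 + R ≤ max L 0 + max R 0).trans hN
  have hN2 : max L 0 ≤ N * ω := (le_add_of_nonneg_right (le_max_right _ _)).trans hN
  -- `f` is the sum of the translates of `ψ` times translates of `f`
  have hsum : f = ∑ i ∈ Finset.range (2 * N + 1), shiftTestR (((i - N : ℤ) : ℝ) * ω)
      (mulTestR ψ (shiftTestR (-(((i - N : ℤ) : ℝ) * ω)) f)) := by
    ext x
    let ev : 𝓓((⊤ : Opens ℝ), ℝ) →+ ℝ :=
      { toFun := fun g => g x, map_zero' := rfl, map_add' := fun _ _ => rfl }
    refine Eq.trans ?_ (map_sum ev _ _).symm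
    change f x = ∑ i ∈ Finset.range (2 * N + 1), shiftTestR (((i - N : ℤ) : ℝ) * ω)
      (mulTestR ψ (shiftTestR (-(((i - N : ℤ) : ℝ) * ω)) f)) x
    have e : ∀ i : ℕ, shiftTestR (((i - N : ℤ) : ℝ) * ω)
        (mulTestR ψ (shiftTestR (-(((i - N : ℤ) : ℝ) * ω)) f)) x =
        ψ (x + (i - N : ℝ) * ω) * f x := by
      intro i
      change ψ (x + ((i - N : ℤ) : ℝ) * ω) * f (x + ((i - N : ℤ) : ℝ) * ω + -(((i - N : ℤ) : ℝ) * ω)) = _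
      rw [add_neg_cancel_right]
      push_cast
      rfl
    rw [Finset.sum_congr rfl fun i _ => e i, ← Finset.sum_mul]
    rcases le_or_gt L |x| with hx | hx
    · rw [show f x = 0 from (hL x hx).1, mul_zero]
    · rw [hψ N x (hx.le.trans ((le_max_left _ _).trans hN2)), one_mul]
  have hterm : ∀ i : ℕ, q (shiftTestR (((i - N : ℤ) : ℝ) * ω)
      (mulTestR ψ (shiftTestR (-(((i - N : ℤ) : ℝ) * ω)) f))) =
      (∫ x, β (x + (i - N : ℝ) * ω) * f x) +
        ∫ x, α (x + (i - N : ℝ) * ω) * deriv (fun y => f y) x := by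
    intro i
    rw [hper.shift, hrep]
    have hd : ∀ x, deriv (fun y => shiftTestR (-(((i - N : ℤ) : ℝ) * ω)) f y) x =
        deriv (fun y => f y) (x + -(((i - N : ℤ) : ℝ) * ω)) := fun x =>
      deriv_comp_add_const (fun y => f y) _ x
    simp only [hd]
    rw [← integral_add_right_eq_self (fun x => β x * _) (((i - N : ℤ) : ℝ) * ω),
      ← integral_add_right_eq_self (fun x => α x * _) (((i - N : ℤ) : ℝ) * ω)]
    simp only [add_neg_cancel_right]
    congr 1
    refine integral_congr_ae (Eventually.of_forall fun x => ?_)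
    · change β (x + ((i - N : ℤ) : ℝ) * ω) *
        f (x + ((i - N : ℤ) : ℝ) * ω + -(((i - N : ℤ) : ℝ) * ω)) = _
      rw [add_neg_cancel_right]
      push_cast
      rfl
    · push_cast
      rfl
  have hswap : ∀ {γ g : ℝ → ℝ}, MemLp γ 2 volume → (∀ x, R ≤ |x| → γ x = 0) → MemLp g 2 volume →
      (∀ x, L ≤ |x| → g x = 0) → ∫ x, periodization ω γ x * g x =
        ∑ i ∈ Finset.range (2 * N + 1), ∫ x, γ (x + (i - N : ℝ) * ω) * g x := by
    intro γ g hγ hγR hg hgL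
    have hi : ∀ i : ℕ, Integrable fun x => γ (x + (i - N : ℝ) * ω) * g x := fun i =>
      MemLp.integrable_mul (p := 2) (q := 2)
        (hγ.comp_measurePreserving (measurePreserving_add_right volume _)) hg
    rw [← integral_finsetSum _ fun i _ => hi i]
    refine integral_congr_ae (Eventually.of_forall fun x => ?_)
    simp only
    rw [← Finset.sum_mul]
    rcases le_or_gt L |x| with hx | hx
    · rw [hgL x hx, mul_zero, mul_zero]
    · rw [periodization_eq_sum hω hγR hN1 (hx.le.trans (le_max_left _ _))]
  rw [hswap hα (fun x hx => (hR x hx).1) H.memLp fun x hx => (hL x hx).2,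
    hswap hβ (fun x hx => (hR x hx).2) H.memLp_two fun x hx => (hL x hx).1,
    ← Finset.sum_add_distrib]
  conv_lhs => rw [hsum]
  rw [map_sum]
  exact Finset.sum_congr rfl fun i _ => hterm i

/-- Existence of a periodic Miura potential for a nonnegative operator. -/
theorem exists_isPeriodicMiura {ω : ℝ} (hω : 0 < ω) {q : RealDistribution} (hq : MemHNegOneLoc q)
    (hper : IsPeriodicDistribution ω q) (hT : IsNonnegOp (schrodingerOp q)) :
    ∃ φ, IsPeriodicMiura ω q φ := by
  obtain ⟨α, β, hα, hβ, pα, pβ, h⟩ := hq.exists_periodic_repr hω hper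
  refine exists_isPeriodicMiura_of_repr hω (α := fun x => - α x) (fun a b => (hα a b).neg) hβ
    (fun x => by simp only [pα x]) pβ (fun f => ?_) hT
  rw [h f]
  simp only [neg_mul, integral_neg, sub_neg_eq_add]

/-! ### The Floquet transform -/

section HilbertSums

variable {ι X E : Type*} [NormedAddCommGroup X] [InnerProductSpace ℂ X]
  [NormedAddCommGroup E] [InnerProductSpace ℂ E] [CompleteSpace E]

theorem isHilbertSum_of_forall_inner [CompleteSpace X] {V : ι → X →ₗᵢ[ℂ] E}
    (h1 : ∀ i j, i ≠ j → ∀ g h, inner ℂ (V i g) (V j h) = 0)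
    (h2 : ∀ f, (∀ i g, inner ℂ (V i g) f = 0) → f = 0) :
    IsHilbertSum ℂ (fun _ : ι => X) V := by
  refine IsHilbertSum.mk (fun i j hij g h => h1 i j hij g h) (top_le_iff.2 ?_)
  rw [Submodule.topologicalClosure_eq_top_iff, Submodule.eq_bot_iff]
  intro f hf
  refine h2 f fun i g => ?_
  exact (Submodule.mem_orthogonal _ _).1 hf _ (Submodule.mem_iSup_of_mem i ⟨g, rfl⟩)

theorem IsHilbertSum.inner_eq {V : ι → X →ₗᵢ[ℂ] E} (hV : IsHilbertSum ℂ (fun _ : ι => X) V)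
    (i : ι) (g : X) (f : E) : inner ℂ (V i g) f = inner ℂ g (hV.linearIsometryEquiv f i) := by
  classical
  refine Eq.trans ?_ (lp.inner_single_left (G := fun _ : ι => X) i g (hV.linearIsometryEquiv f))
  rw [← hV.linearIsometryEquiv_symm_apply_single,
    ← hV.linearIsometryEquiv.inner_map_map (hV.linearIsometryEquiv.symm _),
    LinearIsometryEquiv.apply_symm_apply]

end HilbertSums

/-- The isometry `(f, g) ↦ (v f, v g)` of Hilbert spaces. -/
def LinearIsometry.prodSelf {X E : Type*} [NormedAddCommGroup X] [InnerProductSpace ℂ X]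
    [NormedAddCommGroup E] [InnerProductSpace ℂ E] (v : X →ₗᵢ[ℂ] E) :
    WithLp 2 (X × X) →ₗᵢ[ℂ] WithLp 2 (E × E) where
  toLinearMap := (WithLp.linearEquiv 2 ℂ (E × E)).symm.toLinearMap ∘ₗ
    (v.toLinearMap.prodMap v.toLinearMap) ∘ₗ (WithLp.linearEquiv 2 ℂ (X × X)).toLinearMap
  norm_map' x := by
    rw [WithLp.prod_norm_eq_of_L2, WithLp.prod_norm_eq_of_L2]
    congr 2
    · congr 1
      exact v.norm_map x.fst
    · congr 1
      exact v.norm_map x.snd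

theorem LinearIsometry.inner_prodSelf {X E : Type*} [NormedAddCommGroup X] [InnerProductSpace ℂ X]
    [NormedAddCommGroup E] [InnerProductSpace ℂ E] (v : X →ₗᵢ[ℂ] E) (x : WithLp 2 (X × X))
    (y : WithLp 2 (E × E)) :
    inner ℂ (v.prodSelf x) y = inner ℂ (v x.fst) y.fst + inner ℂ (v x.snd) y.snd := rfl

/-- Extension by zero from `[0, ω]` to the line. -/
def cellExtend (ω : ℝ) : L2Cell ω →ₗᵢ[ℂ] L2Line where
  toFun g := MemLp.toLp ((Icc 0 ω).indicator g)
    ((memLp_indicator_iff_restrict measurableSet_Icc).2 (Lp.memLp g))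
  map_add' f g := by
    rw [← MemLp.toLp_add, MemLp.toLp_eq_toLp_iff]
    have h := (ae_restrict_iff' measurableSet_Icc).1 (Lp.coeFn_add f g)
    filter_upwards [h] with x hx
    rw [Pi.add_apply]
    by_cases hx0 : x ∈ Icc 0 ω
    · rw [indicator_of_mem hx0, indicator_of_mem hx0, indicator_of_mem hx0, hx hx0, Pi.add_apply]
    · rw [indicator_of_notMem hx0, indicator_of_notMem hx0, indicator_of_notMem hx0, add_zero]
  map_smul' c g := by
    rw [RingHom.id_apply, ← MemLp.toLp_const_smul, MemLp.toLp_eq_toLp_iff]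
    have h := (ae_restrict_iff' measurableSet_Icc).1 (Lp.coeFn_smul c g)
    filter_upwards [h] with x hx
    rw [Pi.smul_apply]
    by_cases hx0 : x ∈ Icc 0 ω
    · rw [indicator_of_mem hx0, indicator_of_mem hx0, hx hx0, Pi.smul_apply]
    · rw [indicator_of_notMem hx0, indicator_of_notMem hx0, smul_zero]
  norm_map' g := by
    change ‖MemLp.toLp ((Icc 0 ω).indicator g)
      ((memLp_indicator_iff_restrict measurableSet_Icc).2 (Lp.memLp g))‖ = _
    rw [Lp.norm_toLp, eLpNorm_indicator_eq_eLpNorm_restrict measurableSet_Icc, Lp.norm_def]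

theorem coeFn_cellExtend {ω : ℝ} (g : L2Cell ω) :
    ∀ᵐ x, cellExtend ω g x = (Icc 0 ω).indicator g x := by
  have h := (memLp_indicator_iff_restrict measurableSet_Icc).2 (Lp.memLp g)
  have e : cellExtend ω g = h.toLp := rfl
  rw [e]
  exact h.coeFn_toLp

/-- Extension by zero to the line, followed by translation by `n ω`. -/
def cellShift (ω : ℝ) (n : ℤ) : L2Cell ω →ₗᵢ[ℂ] L2Line :=
  (Lp.compMeasurePreservingₗᵢ ℂ (fun x : ℝ => x - n * ω)
    (measurePreserving_sub_right volume (n * ω))).comp (cellExtend ω)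

variable {ω : ℝ}

theorem coeFn_cellShift (n : ℤ) (g : L2Cell ω) :
    ∀ᵐ x, cellShift ω n g x = (Icc 0 ω).indicator g (x - n * ω) := by
  have h1 := Lp.coeFn_compMeasurePreserving (cellExtend ω g)
    (measurePreserving_sub_right volume (n * ω))
  have h2 := (measurePreserving_sub_right volume (n * ω)).quasiMeasurePreserving.ae
    (coeFn_cellExtend g)
  filter_upwards [h1, h2] with x hx1 hx2
  exact hx1.trans hx2

theorem ae_add_mul {p : ℝ → Prop} (h : ∀ᵐ x, p x) (c : ℝ) : ∀ᵐ x, p (x + c) :=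
  (measurePreserving_add_right volume c).quasiMeasurePreserving.ae h

/-- The part of `f` on the cell `[nω, (n+1)ω]`, translated to `[0, ω]`. -/
def cellPart (ω : ℝ) (n : ℤ) (f : L2Line) : L2Cell ω :=
  MemLp.toLp (fun x => f (x + n * ω))
    (((Lp.memLp f).comp_measurePreserving (measurePreserving_add_right volume (n * ω))).restrict _)

theorem coeFn_cellPart (n : ℤ) (f : L2Line) :
    ∀ᵐ x ∂(volume.restrict (Icc 0 ω)), cellPart ω n f x = f (x + n * ω) := MemLp.coeFn_toLp _

theorem inner_cellShift (n : ℤ) (g : L2Cell ω) (f : L2Line) :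
    inner ℂ (cellShift ω n g) f = inner ℂ g (cellPart ω n f) := by
  rw [L2.inner_def, L2.inner_def, ← integral_add_right_eq_self _ (n * ω : ℝ),
    ← integral_indicator measurableSet_Icc]
  refine integral_congr_ae ?_
  filter_upwards [ae_add_mul (coeFn_cellShift n g) (n * ω),
    (ae_restrict_iff' measurableSet_Icc).1 (coeFn_cellPart n f)] with x h1 h2
  rw [h1, add_sub_cancel_right]
  by_cases hx : x ∈ Icc 0 ω
  · rw [indicator_of_mem hx, indicator_of_mem hx, h2 hx]
  · rw [indicator_of_notMem hx, indicator_of_notMem hx, inner_zero_left]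

theorem cellPart_cellShift (hω : 0 < ω) {m n : ℤ} (h : m ≠ n) (g : L2Cell ω) :
    cellPart ω m (cellShift ω n g) = 0 := by
  rw [Lp.eq_zero_iff_ae_eq_zero]
  have h0 : ∀ᵐ x : ℝ, x ≠ 0 ∧ x ≠ ω := (volume.ae_ne 0).and (volume.ae_ne ω)
  filter_upwards [coeFn_cellPart m (cellShift ω n g),
    ae_restrict_of_ae (ae_add_mul (coeFn_cellShift n g) (m * ω)),
    ae_restrict_mem measurableSet_Icc, ae_restrict_of_ae h0] with x h1 h2 hx hx0
  rw [h1, h2, indicator_of_notMem, Pi.zero_apply]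
  rintro ⟨h3, h4⟩
  have hx1 : 0 < x := lt_of_le_of_ne hx.1 hx0.1.symm
  have hx2 : x < ω := lt_of_le_of_ne hx.2 hx0.2
  rcases lt_or_gt_of_ne h with h5 | h5
  · have : (m : ℝ) + 1 ≤ n := by exact_mod_cast h5
    nlinarith
  · have : (n : ℝ) + 1 ≤ m := by exact_mod_cast h5
    nlinarith

theorem eq_zero_of_cellPart (hω : 0 < ω) {f : L2Line} (h : ∀ n, cellPart ω n f = 0) : f = 0 := by
  rw [Lp.eq_zero_iff_ae_eq_zero]
  have h1 : ∀ n : ℤ, ∀ᵐ x, x - n * ω ∈ Icc 0 ω → f x = 0 := by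
    intro n
    have h2 : ∀ᵐ x ∂(volume.restrict (Icc 0 ω)), f (x + n * ω) = 0 := by
      filter_upwards [coeFn_cellPart n f, (Lp.eq_zero_iff_ae_eq_zero).1 (h n)] with x h1 h2
      rw [← h1, h2, Pi.zero_apply]
    have h3 := ae_add_mul ((ae_restrict_iff' measurableSet_Icc).1 h2) (-(n * ω))
    filter_upwards [h3] with x hx hxm
    have := hx hxm
    rwa [neg_add_cancel_right] at this
  filter_upwards [ae_all_iff.2 h1] with x hx
  refine hx ⌊x / ω⌋ ⟨?_, ?_⟩
  · have := mul_le_mul_of_nonneg_right (Int.floor_le (x / ω)) hω.le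
    rw [div_mul_cancel₀ _ hω.ne'] at this
    linarith
  · have := mul_le_mul_of_nonneg_right (Int.lt_floor_add_one (x / ω)).le hω.le
    rw [div_mul_cancel₀ _ hω.ne'] at this
    linarith

/-- The line is the disjoint union of the translates of the period cell, up to a null set. -/
theorem isHilbertSum_cellShift (hω : 0 < ω) :
    IsHilbertSum ℂ (fun _ : ℤ => WithLp 2 (L2Cell ω × L2Cell ω))
      (fun n => (cellShift ω n).prodSelf) := by
  refine isHilbertSum_of_forall_inner (fun m n hmn g h => ?_) fun f hf => ?_
  · rw [LinearIsometry.inner_prodSelf, inner_cellShift, inner_cellShift]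
    have h1 : ((cellShift ω n).prodSelf h).fst = cellShift ω n h.fst := rfl
    have h2 : ((cellShift ω n).prodSelf h).snd = cellShift ω n h.snd := rfl
    rw [h1, h2, cellPart_cellShift hω hmn, cellPart_cellShift hω hmn]
    simp
  · have key : ∀ n, cellPart ω n f.fst = 0 ∧ cellPart ω n f.snd = 0 := by
      intro n
      constructor
      · have := hf n (WithLp.toLp 2 (cellPart ω n f.fst, 0))
        rw [LinearIsometry.inner_prodSelf, inner_cellShift, inner_cellShift] at this
        simpa using this
      · have := hf n (WithLp.toLp 2 (0, cellPart ω n f.snd))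
        rw [LinearIsometry.inner_prodSelf, inner_cellShift, inner_cellShift] at this
        simpa using this
    have e1 : f.fst = 0 := eq_zero_of_cellPart hω fun n => (key n).1
    have e2 : f.snd = 0 := eq_zero_of_cellPart hω fun n => (key n).2
    exact WithLp.ofLp_injective 2 (Prod.ext e1 e2)

instance : IsProbabilityMeasure floquetMeasure where
  measure_univ := by
    rw [floquetMeasure, Measure.smul_apply, Measure.restrict_apply_univ, Real.volume_Icc,
      smul_eq_mul, ← ENNReal.ofReal_mul (by positivity), sub_zero,
      inv_mul_cancel₀ (by positivity), ENNReal.ofReal_one]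

section Fiber

variable {X : Type*} [NormedAddCommGroup X] [InnerProductSpace ℂ X]

theorem memLp_exp_smul (n : ℤ) (g : X) :
    MemLp (fun θ : ℝ => Complex.exp (-Complex.I * n * θ) • g) 2 floquetMeasure := by
  refine MemLp.of_bound (by fun_prop) ‖g‖ (Eventually.of_forall fun θ => ?_)
  have : -Complex.I * n * θ = ((-(n * θ) : ℝ) : ℂ) * Complex.I := by push_cast; ring
  rw [norm_smul, this, Complex.norm_exp_ofReal_mul_I, one_mul]

/-- The isometry `g ↦ e^{-inθ} g`. -/
def floquetMode (X : Type*) [NormedAddCommGroup X] [InnerProductSpace ℂ X] (n : ℤ) :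
    X →ₗᵢ[ℂ] Lp X 2 floquetMeasure where
  toFun g := (memLp_exp_smul n g).toLp
  map_add' f g := by
    rw [← MemLp.toLp_add, MemLp.toLp_eq_toLp_iff]
    exact Eventually.of_forall fun θ => smul_add _ _ _
  map_smul' c g := by
    rw [RingHom.id_apply, ← MemLp.toLp_const_smul, MemLp.toLp_eq_toLp_iff]
    exact Eventually.of_forall fun θ => smul_comm _ _ _
  norm_map' g := by
    change ‖(memLp_exp_smul n g).toLp‖ = ‖g‖
    set F := (memLp_exp_smul n g).toLp with hF
    have h1 : ‖F‖ₑ ^ 2 = ‖g‖ₑ ^ 2 := by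
      rw [Lp.enorm_sq_eq_lintegral]
      have : ∀ᵐ θ ∂floquetMeasure, ‖F θ‖ₑ ^ 2 = ‖g‖ₑ ^ 2 := by
        filter_upwards [(memLp_exp_smul n g).coeFn_toLp] with θ hθ
        have h2 : -Complex.I * n * θ = ((-(n * θ) : ℝ) : ℂ) * Complex.I := by push_cast; ring
        rw [hF, hθ, enorm_smul, ← ofReal_norm, h2, Complex.norm_exp_ofReal_mul_I, ENNReal.ofReal_one,
          one_mul]
      rw [lintegral_congr_ae this, lintegral_const, measure_univ, mul_one]
    rw [ofReal_sq_norm, ofReal_sq_norm, ENNReal.ofReal_eq_ofReal_iff (by positivity)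
      (by positivity)] at h1
    exact (pow_left_inj₀ (norm_nonneg _) (norm_nonneg _) two_ne_zero).1 h1

theorem coeFn_floquetMode (n : ℤ) (g : X) :
    ∀ᵐ θ ∂floquetMeasure, floquetMode X n g θ = Complex.exp (-Complex.I * n * θ) • g :=
  MemLp.coeFn_toLp (memLp_exp_smul n g)

theorem integral_floquetMeasure (f : ℝ → ℂ) :
    ∫ θ, f θ ∂floquetMeasure = (2 * Real.pi : ℝ)⁻¹ • ∫ θ in 0..(2 * Real.pi), f θ := by
  rw [floquetMeasure, integral_smul_measure, intervalIntegral.integral_of_le (by positivity),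
    integral_Icc_eq_integral_Ioc, ENNReal.toReal_ofReal (by positivity)]

theorem exp_conj_mul (m n : ℤ) (θ : ℝ) :
    starRingEnd ℂ (Complex.exp (-Complex.I * m * θ)) * Complex.exp (-Complex.I * n * θ) =
      Complex.exp ((Complex.I * (m - n)) * θ) := by
  rw [← Complex.exp_conj, ← Complex.exp_add]
  congr 1
  simp only [map_mul, map_neg, Complex.conj_I, Complex.conj_ofReal, map_intCast]
  ring

theorem inner_floquetMode {m n : ℤ} (h : m ≠ n) (f g : X) :
    inner ℂ (floquetMode X m f) (floquetMode X n g) = 0 := by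
  have h1 : ∀ᵐ θ ∂floquetMeasure, inner ℂ (floquetMode X m f θ) (floquetMode X n g θ) =
      Complex.exp ((Complex.I * (m - n)) * θ) * inner ℂ f g := by
    filter_upwards [coeFn_floquetMode m f, coeFn_floquetMode n g] with θ h1 h2
    rw [h1, h2, inner_smul_left, inner_smul_right, ← mul_assoc, exp_conj_mul]
  have h0 : Complex.I * (m - n) ≠ 0 :=
    mul_ne_zero Complex.I_ne_zero (sub_ne_zero.2 (Int.cast_injective.ne h))
  have h2 : Complex.exp (Complex.I * (m - n) * (2 * Real.pi : ℝ)) = 1 := by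
    rw [Complex.exp_eq_one_iff]
    exact ⟨m - n, by push_cast; ring⟩
  rw [L2.inner_def, integral_congr_ae h1, integral_mul_const, integral_floquetMeasure,
    integral_exp_mul_complex h0, h2]
  simp

/-- Completeness of the exponentials on `[0, 2π]`, from Parseval's identity for Fourier series. -/
theorem ae_eq_zero_of_forall_integral_exp {f : ℝ → ℂ} (hf : MemLp f 2 floquetMeasure)
    (h : ∀ n : ℤ, ∫ θ, Complex.exp (Complex.I * n * θ) * f θ ∂floquetMeasure = 0) :
    f =ᵐ[floquetMeasure] 0 := by
  have hπ : 0 < 2 * Real.pi := by positivity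
  have hc : ENNReal.ofReal (2 * Real.pi)⁻¹ ≠ 0 := by simp [Real.pi_pos]
  have h1 : MemLp f 2 (volume.restrict (Ioc 0 (2 * Real.pi))) := by
    rw [restrict_Ioc_eq_restrict_Icc]
    have h0 := hf.smul_measure (c := (ENNReal.ofReal (2 * Real.pi)⁻¹)⁻¹) (by simpa using hc)
    rwa [floquetMeasure, smul_smul, ENNReal.inv_mul_cancel hc ENNReal.ofReal_ne_top,
      one_smul] at h0
  have h2 := hasSum_sq_fourierCoeffOn hπ h1
  have h3 : ∀ n, fourierCoeffOn hπ f n = 0 := by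
    intro n
    have h4 := h (-n)
    rw [integral_floquetMeasure] at h4
    rw [fourierCoeffOn_eq_integral]
    simp only [fourier_coe_apply, smul_eq_mul, sub_zero] at h4 ⊢
    rw [← h4, one_div]
    congr 1
    refine intervalIntegral.integral_congr fun θ _ => ?_
    congr 2
    push_cast
    field_simp
  simp only [h3, norm_zero, ne_eq, two_ne_zero, not_false_eq_true, zero_pow] at h2
  have h4 : ∫ x in 0..(2 * Real.pi), ‖f x‖ ^ 2 = 0 := by
    have h5 := h2.unique hasSum_zero
    simpa [Real.pi_ne_zero] using h5
  rw [intervalIntegral.integral_of_le hπ.le,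
    integral_eq_zero_iff_of_nonneg (fun _ => by positivity) h1.integrable_norm_pow'] at h4
  have h6 : ∀ᵐ x ∂(volume.restrict (Ioc 0 (2 * Real.pi))), f x = 0 := by
    filter_upwards [h4] with x hx
    simpa using hx
  rw [restrict_Ioc_eq_restrict_Icc] at h6
  exact Measure.ae_smul_measure h6 _

/-- The Hilbert-space-valued Fourier series. -/
theorem isHilbertSum_floquetMode [CompleteSpace X] [SecondCountableTopology X] :
    IsHilbertSum ℂ (fun _ : ℤ => X) (floquetMode X) := by
  refine isHilbertSum_of_forall_inner (fun m n hmn g h => inner_floquetMode hmn g h) fun F hF => ?_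
  rw [Lp.eq_zero_iff_ae_eq_zero]
  refine ae_eq_zero_of_forall_inner (𝕜 := ℂ) fun g => ?_
  refine ae_eq_zero_of_forall_integral_exp ((Lp.memLp F).const_inner g) fun n => ?_
  rw [← hF n g, L2.inner_def]
  refine integral_congr_ae ?_
  filter_upwards [coeFn_floquetMode n g] with θ hθ
  rw [hθ, inner_smul_left, ← Complex.exp_conj]
  congr 2
  simp

end Fiber

/-! ### The direct integral decomposition of the Dirac operator -/

variable {ω : ℝ} {φ : ℝ → ℝ}

/-- Test functions are a core for `d/dx + φ`. -/
theorem IsUnifLocL2.exists_test_tendsto (h : IsUnifLocL2 φ) {f a : L2Line}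
    (hfa : (f, a) ∈ lineGraph φ) : ∃ (F : ℕ → TestC) (A : ℕ → L2Line),
      (∀ n, (testL2 (F n), A n) ∈ lineGraph φ ∧
        ∀ᵐ x, A n x = derivTest (F n) x + φ x * F n x) ∧
      Tendsto (fun n => testL2 (F n)) atTop (𝓝 f) ∧ Tendsto A atTop (𝓝 a) := by
  obtain ⟨d, hd, -⟩ := mem_lineGraph_iff.1 hfa
  obtain ⟨F, h1, h2⟩ := hd.exists_test
  choose A hA using fun n => h.exists_mul_test (F n)
  exact ⟨F, A, hA, h1, h.tendsto_of_hasL2Deriv (fun n => hasL2Deriv_test (F n)) hd h1 h2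
    (fun n => (hA n).1) hfa⟩

theorem floquetSum_eq_sum {f : ℝ → ℂ} {θ x : ℝ} {s : Finset ℤ}
    (h : ∀ n ∉ s, f (x + n * ω) = 0) :
    floquetSum ω f θ x = ∑ n ∈ s, Complex.exp (-Complex.I * n * θ) * f (x + n * ω) :=
  tsum_eq_sum fun n hn => by rw [h n hn, mul_zero]

theorem floquetSum_add_period (f : ℝ → ℂ) (θ x : ℝ) :
    floquetSum ω f θ (x + ω) = Complex.exp (Complex.I * θ) * floquetSum ω f θ x := by
  rw [floquetSum, floquetSum, ← tsum_mul_left, ← (Equiv.addRight (1 : ℤ)).tsum_eq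
    fun n : ℤ => Complex.exp (Complex.I * θ) * (Complex.exp (-Complex.I * n * θ) * f (x + n * ω))]
  refine tsum_congr fun n => ?_
  simp only [Equiv.coe_addRight]
  rw [← mul_assoc, ← Complex.exp_add]
  congr 2
  · push_cast; ring
  · push_cast; ring

/-- The cells that meet a given bounded set. -/
theorem exists_finset_cells (hω : 0 < ω) (R : ℝ) :
    ∃ s : Finset ℤ, ∀ n ∉ s, ∀ x ∈ Icc 0 ω, R < |x + n * ω| := by
  obtain ⟨N, hN⟩ := exists_nat_gt (R / ω + 1)
  refine ⟨Finset.Icc (-N) N, fun n hn x hx => ?_⟩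
  have h1 : R + ω < N * ω := by
    have := mul_lt_mul_of_pos_right hN hω
    rwa [add_mul, div_mul_cancel₀ _ hω.ne', one_mul] at this
  rw [Finset.mem_Icc, not_and_or, not_le, not_le] at hn
  rcases hn with hn | hn
  · have h2 : (n : ℝ) < -N := by exact_mod_cast hn
    have h3 := mul_lt_mul_of_pos_right h2 hω
    refine lt_of_lt_of_le ?_ (neg_le_abs _)
    linarith [hx.2]
  · have h2 : (N : ℝ) < n := by exact_mod_cast hn
    have h3 := mul_lt_mul_of_pos_right h2 hω
    refine lt_of_lt_of_le ?_ (le_abs_self _)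
    linarith [hx.1]

theorem hasDerivAt_floquet_sum (F : TestC) (θ : ℝ) (s : Finset ℤ) (x : ℝ) :
    HasDerivAt (fun x => ∑ n ∈ s, Complex.exp (-Complex.I * n * θ) * F (x + n * ω))
      (∑ n ∈ s, Complex.exp (-Complex.I * n * θ) * derivTest F (x + n * ω)) x := by
  refine HasDerivAt.fun_sum fun n _ => HasDerivAt.const_mul _ ?_
  exact HasDerivAt.comp_add_const x (n * ω) (hasDerivAt_test F (x + n * ω))

theorem periodic_int (hper : ∀ᵐ x, φ (x + ω) = φ x) (n : ℤ) : ∀ᵐ x, φ (x + n * ω) = φ x := by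
  induction n using Int.induction_on with
  | zero => simp
  | succ n ih =>
    filter_upwards [ae_add_mul ih ω, hper] with x h1 h2
    rw [← h2, ← h1]
    congr 1
    push_cast
    ring
  | pred n ih =>
    filter_upwards [ae_add_mul ih (-ω), ae_add_mul hper (-ω)] with x h1 h2
    rw [neg_add_cancel_right] at h2
    rw [h2, ← h1]
    congr 1
    push_cast
    ring

/-- The Floquet transform maps `d/dx + φ` on the line to `d/dx + φ` on the cell. -/
theorem mem_cellGraph_floquetSum (hω : 0 < ω) (hper : ∀ᵐ x, φ (x + ω) = φ x) {F : TestC}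
    {a : L2Line} (ha : ∀ᵐ x, a x = derivTest F x + φ x * F x) {θ : ℝ} {p r : L2Cell ω}
    (hp : ∀ᵐ x ∂(volume.restrict (Icc 0 ω)), p x = floquetSum ω (testL2 F) θ x)
    (hr : ∀ᵐ x ∂(volume.restrict (Icc 0 ω)), r x = floquetSum ω a θ x) :
    (p, r) ∈ cellGraph ω φ θ := by
  obtain ⟨R, hR, hF, hF'⟩ := exists_abs_le_test F
  obtain ⟨s, hs⟩ := exists_finset_cells hω R
  have e1 : ∀ x ∈ Icc 0 ω, floquetSum ω F θ x =
      ∑ n ∈ s, Complex.exp (-Complex.I * n * θ) * F (x + n * ω) := fun x hx =>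
    floquetSum_eq_sum fun n hn => hF _ (hs n hn x hx).le
  have hall : ∀ᵐ x, ∀ n : ℤ, testL2 F (x + n * ω) = F (x + n * ω) ∧ φ (x + n * ω) = φ x ∧
      a (x + n * ω) = derivTest F (x + n * ω) + φ (x + n * ω) * F (x + n * ω) :=
    ae_all_iff.2 fun n => (ae_add_mul (coeFn_testL2 F) _).and
      ((periodic_int hper n).and (ae_add_mul ha _))
  have hcont : Continuous fun x : ℝ =>
      ∑ n ∈ s, Complex.exp (-Complex.I * n * θ) * derivTest F (x + n * ω) := by
    refine continuous_finsetSum _ fun n _ => continuous_const.mul ?_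
    exact (derivTest F).continuous.comp (by fun_prop)
  have hac := IsACWithDeriv.of_hasDerivAt (hasDerivAt_floquet_sum (ω := ω) F θ s) hcont (Icc 0 ω)
  refine ⟨_, _, hac, ?_, ?_, ?_, ?_⟩
  · obtain ⟨C, hC⟩ := isCompact_Icc.exists_bound_of_continuousOn (hcont.continuousOn (s := Icc 0 ω))
    exact MemLp.of_bound hcont.aestronglyMeasurable C (ae_restrict_of_forall_mem measurableSet_Icc hC)
  · rw [← e1 0 ⟨le_rfl, hω.le⟩, ← e1 ω ⟨hω.le, le_rfl⟩]
    have := floquetSum_add_period (ω := ω) F θ 0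
    rwa [zero_add] at this
  · filter_upwards [hp, ae_restrict_of_ae hall, ae_restrict_mem measurableSet_Icc] with x h1 h2 hx
    rw [h1, ← e1 x hx]
    exact tsum_congr fun n => by rw [(h2 n).1]
  · filter_upwards [hr, ae_restrict_of_ae hall, ae_restrict_mem measurableSet_Icc] with x h1 h2 hx
    rw [h1, floquetSum_eq_sum (s := s), Finset.mul_sum, ← Finset.sum_add_distrib]
    · refine Finset.sum_congr rfl fun n _ => ?_
      rw [(h2 n).2.2, (h2 n).2.1]
      ring
    · intro n hn
      rw [(h2 n).2.2, hF _ (hs n hn x hx).le, hF' _ (hs n hn x hx).le]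
      ring

instance : SecondCountableTopology (L2Cell ω) :=
  haveI : Fact ((2 : ℝ≥0∞) ≠ ∞) := ⟨by simp⟩
  inferInstance

instance : SecondCountableTopology (WithLp 2 (L2Cell ω × L2Cell ω)) :=
  (WithLp.homeomorphProd 2 (L2Cell ω) (L2Cell ω)).secondCountableTopology

/-- The Floquet transform on pairs of functions. -/
def floquetEquiv (hω : 0 < ω) : WithLp 2 (L2Line × L2Line) ≃ₗᵢ[ℂ]
    Lp (WithLp 2 (L2Cell ω × L2Cell ω)) 2 floquetMeasure :=
  (isHilbertSum_cellShift hω).linearIsometryEquiv.trans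
    isHilbertSum_floquetMode.linearIsometryEquiv.symm

theorem hasSum_floquetEquiv (hω : 0 < ω) (f : WithLp 2 (L2Line × L2Line)) :
    HasSum (fun n : ℤ => floquetMode _ n
      (WithLp.toLp 2 (cellPart ω n f.fst, cellPart ω n f.snd))) (floquetEquiv hω f) := by
  have h := isHilbertSum_floquetMode.hasSum_linearIsometryEquiv_symm
    ((isHilbertSum_cellShift hω).linearIsometryEquiv f)
  have hc : ∀ n : ℤ, (isHilbertSum_cellShift hω).linearIsometryEquiv f n =
      WithLp.toLp 2 (cellPart ω n f.fst, cellPart ω n f.snd) := by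
    intro n
    refine ext_inner_left ℂ fun g => ?_
    rw [← (isHilbertSum_cellShift hω).inner_eq, LinearIsometry.inner_prodSelf, inner_cellShift,
      inner_cellShift]
    rfl
  simp only [hc] at h
  exact h

/-- For a function of bounded support the Fourier series in the definition of the transform is finite. -/
theorem isFloquetTransform_floquetEquiv (hω : 0 < ω) : IsFloquetTransform ω (floquetEquiv hω) := by
  rintro f ⟨R, hR⟩
  obtain ⟨s, hs⟩ := exists_finset_cells hω R
  have hall : ∀ᵐ x, ∀ n : ℤ, R < |x + n * ω| → f.fst (x + n * ω) = 0 ∧ f.snd (x + n * ω) = 0 :=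
    ae_all_iff.2 fun n => ae_add_mul hR (n * ω)
  have h0 : ∀ n ∉ s, floquetMode _ n
      (WithLp.toLp 2 (cellPart ω n f.fst, cellPart ω n f.snd)) = 0 := by
    intro n hn
    have e1 : cellPart ω n f.fst = 0 := by
      rw [Lp.eq_zero_iff_ae_eq_zero]
      filter_upwards [coeFn_cellPart n f.fst, ae_restrict_of_ae hall,
        ae_restrict_mem measurableSet_Icc] with x h1 h2 hx
      rw [h1, (h2 n (hs n hn x hx)).1, Pi.zero_apply]
    have e2 : cellPart ω n f.snd = 0 := by
      rw [Lp.eq_zero_iff_ae_eq_zero]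
      filter_upwards [coeFn_cellPart n f.snd, ae_restrict_of_ae hall,
        ae_restrict_mem measurableSet_Icc] with x h1 h2 hx
      rw [h1, (h2 n (hs n hn x hx)).2, Pi.zero_apply]
    rw [e1, e2]
    exact map_zero _
  have hsum := (hasSum_floquetEquiv hω f).unique (hasSum_sum_of_ne_finset_zero h0)
  rw [hsum]
  have hmode : ∀ᵐ θ ∂floquetMeasure, ∀ n : ℤ, floquetMode _ n
      (WithLp.toLp 2 (cellPart ω n f.fst, cellPart ω n f.snd)) θ =
      Complex.exp (-Complex.I * n * θ) •
        WithLp.toLp 2 (cellPart ω n f.fst, cellPart ω n f.snd) :=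
    ae_all_iff.2 fun n => coeFn_floquetMode n _
  filter_upwards [Lp.coeFn_finsetSum s (fun n : ℤ => floquetMode _ n
    (WithLp.toLp 2 (cellPart ω n f.fst, cellPart ω n f.snd))), hmode] with θ h1 h2
  rw [h1, Finset.sum_apply, Finset.sum_congr rfl fun n _ => h2 n]
  have e1 : (∑ n ∈ s, Complex.exp (-Complex.I * n * θ) •
        WithLp.toLp 2 (cellPart ω n f.fst, cellPart ω n f.snd)).fst =
      ∑ n ∈ s, Complex.exp (-Complex.I * n * θ) • cellPart ω n f.fst :=
    map_sum ((LinearMap.fst ℂ (L2Cell ω) (L2Cell ω)) ∘ₗ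
      (WithLp.linearEquiv 2 ℂ (L2Cell ω × L2Cell ω)).toLinearMap) _ _
  have e2 : (∑ n ∈ s, Complex.exp (-Complex.I * n * θ) •
        WithLp.toLp 2 (cellPart ω n f.fst, cellPart ω n f.snd)).snd =
      ∑ n ∈ s, Complex.exp (-Complex.I * n * θ) • cellPart ω n f.snd :=
    map_sum ((LinearMap.snd ℂ (L2Cell ω) (L2Cell ω)) ∘ₗ
      (WithLp.linearEquiv 2 ℂ (L2Cell ω × L2Cell ω)).toLinearMap) _ _
  rw [e1, e2]
  have key : ∀ g : L2Line, ∀ᵐ x ∂(volume.restrict (Icc 0 ω)),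
      (∑ n ∈ s, Complex.exp (-Complex.I * n * θ) • cellPart ω n g : L2Cell ω) x =
        ∑ n ∈ s, Complex.exp (-Complex.I * n * θ) * g (x + n * ω) := by
    intro g
    have h3 : ∀ᵐ x ∂(volume.restrict (Icc 0 ω)), ∀ n : ℤ,
        (Complex.exp (-Complex.I * n * θ) • cellPart ω n g : L2Cell ω) x =
          Complex.exp (-Complex.I * n * θ) * g (x + n * ω) := by
      refine ae_all_iff.2 fun n => ?_
      filter_upwards [coeFn_cellPart n g,
        Lp.coeFn_smul (Complex.exp (-Complex.I * n * θ)) (cellPart ω n g)] with x h4 h5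
      rw [h5, Pi.smul_apply, h4, smul_eq_mul]
    filter_upwards [Lp.coeFn_finsetSum s fun n : ℤ =>
      Complex.exp (-Complex.I * n * θ) • cellPart ω n g, h3] with x h4 h5
    rw [h4, Finset.sum_apply]
    exact Finset.sum_congr rfl fun n _ => h5 n
  filter_upwards [key f.fst, key f.snd, ae_restrict_of_ae hall,
    ae_restrict_mem measurableSet_Icc] with x h4 h5 h6 hx
  rw [h4, h5, floquetSum_eq_sum fun n hn => (h6 n (hs n hn x hx)).1,
    floquetSum_eq_sum fun n hn => (h6 n (hs n hn x hx)).2]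
  exact ⟨rfl, rfl⟩

/-- The fiberwise relation is the graph of an operator since each fiber is. -/
theorem graph_directIntegral {X Y : Type*} [NormedAddCommGroup X] [InnerProductSpace ℂ X]
    [MeasurableSpace Y] (μ : Measure Y) (H : Y → X →ₗ.[ℂ] X) :
    (directIntegral μ H).graph = directIntegralGraph μ H := by
  refine Submodule.toLinearPMap_graph_eq _ ?_
  rintro ⟨x, y⟩ (hxy : ∀ᵐ t ∂μ, (x t, y t) ∈ (H t).graph) (hx : x = 0)
  change y = 0
  rw [Lp.eq_zero_iff_ae_eq_zero] at hx ⊢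
  filter_upwards [hxy, hx] with t h1 h2
  exact (H t).graph_fst_eq_zero_snd h1 h2

/-- A direct integral of closed operators is closed: an `L²`-convergent sequence has a subsequence
that converges almost everywhere. -/
theorem mem_directIntegralGraph_of_tendsto {X Y : Type*} [NormedAddCommGroup X]
    [InnerProductSpace ℂ X] [MeasurableSpace Y] {μ : Measure Y} {H : Y → X →ₗ.[ℂ] X}
    (hH : ∀ᵐ t ∂μ, IsClosed ((H t).graph : Set (X × X))) {F G : ℕ → Lp X 2 μ} {f g : Lp X 2 μ}
    (hF : Tendsto F atTop (𝓝 f)) (hG : Tendsto G atTop (𝓝 g))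
    (h : ∀ n, (F n, G n) ∈ directIntegralGraph μ H) : (f, g) ∈ directIntegralGraph μ H := by
  obtain ⟨n₁, hn₁, h₁⟩ := (tendstoInMeasure_of_tendsto_Lp hF).exists_seq_tendsto_ae
  obtain ⟨n₂, hn₂, h₂⟩ := (tendstoInMeasure_of_tendsto_Lp
    (hG.comp hn₁.tendsto_atTop)).exists_seq_tendsto_ae
  change ∀ᵐ t ∂μ, (f t, g t) ∈ (H t).graph
  have hall : ∀ᵐ t ∂μ, ∀ n, (F n t, G n t) ∈ (H t).graph := ae_all_iff.2 h
  filter_upwards [hH, h₁, h₂, hall] with t hc e1 e2 e3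
  exact hc.mem_of_tendsto ((e1.comp hn₂.tendsto_atTop).prodMk_nhds e2)
    (Eventually.of_forall fun n => e3 _)

theorem testL2_ae_eq_zero {F : TestC} {a : L2Line} (ha : ∀ᵐ x, a x = derivTest F x + φ x * F x) :
    ∃ R : ℝ, ∀ᵐ x, R < |x| → testL2 F x = 0 ∧ a x = 0 := by
  obtain ⟨R, -, h1, h2⟩ := exists_abs_le_test F
  refine ⟨R, ?_⟩
  filter_upwards [ha, coeFn_testL2 F] with x e1 e2 hx
  rw [e1, e2, h1 x hx.le, h2 x hx.le]
  simp

/-- The Floquet transform decomposes the Dirac operator. By density of the test functions, where the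
transform is a finite sum, and closedness of the fibers it maps the graph of `D` into the direct
integral; the two agree because the former is self-adjoint and the latter is symmetric. -/
theorem intertwines_floquetEquiv (hω : 0 < ω) (hφ : IsUnifLocL2 φ)
    (hper : ∀ᵐ x, φ (x + ω) = φ x) :
    Intertwines (floquetEquiv hω) (diracOp φ)
      (directIntegral floquetMeasure (diracFiber ω φ)) := by
  have hself : IsSelfAdjoint (diracOp φ) := by
    rw [hφ.diracOp_eq]
    exact hφ.isAdjointPair.isSelfAdjoint_offDiagOp
  have hfib : ∀ θ, IsSelfAdjoint (diracFiber ω φ θ) :=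
    isSelfAdjoint_diracFiber hω (hφ.memLp 0 ω)
  have hV := isFloquetTransform_floquetEquiv hω
  have hper' : ∀ᵐ x, -φ (x + ω) = -φ x := hper.mono fun x hx => by rw [hx]
  have hforward : ∀ f h, (f, h) ∈ (diracOp φ).graph →
      (floquetEquiv hω f, floquetEquiv hω h) ∈
        directIntegralGraph floquetMeasure (diracFiber ω φ) := by
    intro f h hfh
    rw [hφ.diracOp_eq, mem_graph_offDiagOp, mem_graph_neg, graph_lineOp, graph_lineOp] at hfh
    obtain ⟨F₁, A₁, hA₁, hF₁, hl₁⟩ := hφ.exists_test_tendsto hfh.1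
    obtain ⟨F₂, A₂, hA₂, hF₂, hl₂⟩ := hφ.neg.exists_test_tendsto hfh.2
    have hcont : Continuous fun p : L2Line × L2Line => floquetEquiv hω (WithLp.toLp 2 p) :=
      (floquetEquiv hω).continuous.comp (WithLp.prod_continuous_toLp 2 _ _)
    have t1 : Tendsto (fun n => floquetEquiv hω (WithLp.toLp 2 (testL2 (F₁ n), testL2 (F₂ n))))
        atTop (𝓝 (floquetEquiv hω f)) := (hcont.tendsto _).comp (hF₁.prodMk_nhds hF₂)
    have t2 : Tendsto (fun n => floquetEquiv hω (WithLp.toLp 2 (-A₂ n, A₁ n)))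
        atTop (𝓝 (floquetEquiv hω h)) := by
      have hl₃ := hl₂.neg
      rw [neg_neg] at hl₃
      exact (hcont.tendsto _).comp (hl₃.prodMk_nhds hl₁)
    refine mem_directIntegralGraph_of_tendsto
      (Eventually.of_forall fun θ => ?_) t1 t2 fun n => ?_
    · exact (hfib θ).isClosed
    · obtain ⟨R₁, hR₁⟩ := testL2_ae_eq_zero (hA₁ n).2
      have hA₂' := (hA₂ n).2
      obtain ⟨R₂, hR₂⟩ := testL2_ae_eq_zero (φ := fun x => -φ x) hA₂'
      have b1 := hV (WithLp.toLp 2 (testL2 (F₁ n), testL2 (F₂ n))) ⟨max R₁ R₂, by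
        filter_upwards [hR₁, hR₂] with x e1 e2 hx
        exact ⟨(e1 ((le_max_left _ _).trans_lt hx)).1, (e2 ((le_max_right _ _).trans_lt hx)).1⟩⟩
      have b2 := hV (WithLp.toLp 2 (A₂ n, A₁ n)) ⟨max R₁ R₂, by
        filter_upwards [hR₁, hR₂] with x e1 e2 hx
        exact ⟨(e2 ((le_max_right _ _).trans_lt hx)).2, (e1 ((le_max_left _ _).trans_lt hx)).2⟩⟩
      have b3 := hV (WithLp.toLp 2 (-A₂ n, A₁ n)) ⟨max R₁ R₂, by
        filter_upwards [hR₁, hR₂, Lp.coeFn_neg (A₂ n)] with x e1 e2 e3 hx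
        refine ⟨?_, (e1 ((le_max_left _ _).trans_lt hx)).2⟩
        exact e3.trans (by rw [Pi.neg_apply, (e2 ((le_max_right _ _).trans_lt hx)).2, neg_zero])⟩
      change ∀ᵐ θ ∂floquetMeasure, _ ∈ _
      have hall : ∀ᵐ x, ∀ m : ℤ, (-A₂ n : L2Line) (x + m * ω) = -A₂ n (x + m * ω) :=
        ae_all_iff.2 fun m => ae_add_mul (Lp.coeFn_neg (A₂ n)) _
      filter_upwards [b1, b3] with θ c1 c3
      rw [diracFiber_eq hω (hφ.memLp 0 ω), mem_graph_offDiagOp, mem_graph_neg, graph_cellOp hω,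
        graph_cellOp hω]
      refine ⟨mem_cellGraph_floquetSum hω hper (hA₁ n).2 (c1.mono fun x hx => hx.1)
        (c3.mono fun x hx => hx.2), mem_cellGraph_floquetSum hω hper' hA₂'
        (c1.mono fun x hx => hx.2) ?_⟩
      filter_upwards [c3, ae_restrict_of_ae hall, Lp.coeFn_neg
        (floquetEquiv hω (WithLp.toLp 2 (-A₂ n, A₁ n)) θ).fst] with x e1 e2 e3
      rw [e3, Pi.neg_apply, e1.1, floquetSum, floquetSum, ← tsum_neg]
      exact tsum_congr fun m => by
        rw [show (WithLp.toLp 2 (-A₂ n, A₁ n)).fst (x + m * ω) = -A₂ n (x + m * ω) from e2 m]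
        ring
  intro f h
  rw [graph_directIntegral]
  refine ⟨hforward f h, fun hfh => hself.mem_graph_of_forall_inner fun g k hgk => ?_⟩
  rw [← (floquetEquiv hω).inner_map_map k f, ← (floquetEquiv hω).inner_map_map g h,
    L2.inner_def, L2.inner_def]
  refine integral_congr_ae ?_
  filter_upwards [hforward g k hgk, hfh] with θ h1 h2
  exact (hfib θ).inner_eq h1 h2

/-! ### Bloch solutions -/

/-- On `I`, the pair `(u, v)` solves `A u = s v`, `A* v = s u`, that is `u' = -φ u + s v`,
`v' = φ v - s u`. -/
def IsDiracSolution (I : Set ℝ) (φ : ℝ → ℝ) (s : ℝ) (u v : ℝ → ℂ) : Prop :=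
  IsACWithDeriv I u (fun x => (-φ x : ℂ) * u x + s * v x) ∧
    IsACWithDeriv I v (fun x => (-s : ℂ) * u x - (-φ x : ℂ) * v x)

/-- The real solutions of `A u = s v`, `A* v = s u` with initial values `(1, 0)` and `(0, 1)` at
`0`, jointly continuous in the spectral parameter `s` and the variable `x`. -/
structure FundamentalSystem (φ : ℝ → ℝ) where
  (u₁ v₁ u₂ v₂ : ℝ → ℝ → ℝ)
  cont_u₁ : Continuous fun p : ℝ × ℝ => u₁ p.1 p.2
  cont_v₁ : Continuous fun p : ℝ × ℝ => v₁ p.1 p.2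
  cont_u₂ : Continuous fun p : ℝ × ℝ => u₂ p.1 p.2
  cont_v₂ : Continuous fun p : ℝ × ℝ => v₂ p.1 p.2
  init_u₁ : ∀ s, u₁ s 0 = 1
  init_v₁ : ∀ s, v₁ s 0 = 0
  init_u₂ : ∀ s, u₂ s 0 = 0
  init_v₂ : ∀ s, v₂ s 0 = 1
  sol₁ : ∀ s, IsDiracSolution univ φ s (fun x => u₁ s x) (fun x => v₁ s x)
  sol₂ : ∀ s, IsDiracSolution univ φ s (fun x => u₂ s x) (fun x => v₂ s x)

variable {φ : ℝ → ℝ} {ω : ℝ}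

/-- The substitution `u = e^{-P} y`, `v = e^{P} z` with `P' = φ` removes the potential from the
diagonal, so that the spectral parameter becomes an overall factor of the system for `(y, z)`. -/
theorem exists_dirac_solution (hφ : ∀ p q, IntervalIntegrable φ volume p q) (c d : ℝ) :
    ∃ u v : ℝ → ℝ → ℝ, Continuous (fun p : ℝ × ℝ => u p.1 p.2) ∧
      Continuous (fun p : ℝ × ℝ => v p.1 p.2) ∧ (∀ s, u s 0 = c) ∧ (∀ s, v s 0 = d) ∧
      ∀ s : ℝ, IsDiracSolution univ φ s (fun x => u s x) (fun x => v s x) := by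
  set P : ℝ → ℝ := fun x => ∫ t in (0 : ℝ)..x, φ t with hP
  have hPac : IsACWithDeriv univ (fun x => (P x : ℂ)) (fun x => (φ x : ℂ)) := by
    have := IsACWithDeriv.primitive (fun p q => intervalIntegrable_complex_ofReal (hφ p q)) 0 univ
    simpa only [intervalIntegral.integral_ofReal] using this
  have hPc : Continuous P := by
    have := Complex.continuous_re.comp hPac.continuous
    simpa [Function.comp_def] using this
  have hE : Continuous fun x => Real.exp (P x) := Real.continuous_exp.comp hPc
  have hE' : Continuous fun x => Real.exp (-P x) := Real.continuous_exp.comp hPc.neg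
  obtain ⟨y, z, hy, hz, hy0, hz0, hsol⟩ := exists_planar_solution
    (a := fun _ => 0) (b := fun x => Real.exp (P x) * Real.exp (P x))
    (c := fun x => -(Real.exp (-P x) * Real.exp (-P x))) (d := fun _ => 0)
    (fun p q => by simp) (fun p q => (hE.mul hE).intervalIntegrable p q)
    (fun p q => (hE'.mul hE').neg.intervalIntegrable p q) (fun p q => by simp) c d
  have hP0 : P 0 = 0 := by simp [hP]
  refine ⟨fun s x => Real.exp (-P x) * y s x, fun s x => Real.exp (P x) * z s x,
    (hE'.comp continuous_snd).mul hy, (hE.comp continuous_snd).mul hz,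
    fun s => by simp [hP0, hy0], fun s => by simp [hP0, hz0], fun s => ⟨?_, ?_⟩⟩
  · have h1 := ((hPac.neg.exp ordConnected_univ).mul (hsol s).1 ordConnected_univ)
    have h2 := h1.congr (w := fun x => ((Real.exp (-P x) * y s x : ℝ) : ℂ))
      (fun x _ => by push_cast; rfl)
    refine h2.congr_deriv ordConnected_univ (Eventually.of_forall fun x _ => ?_)
    have e : Complex.exp (-(P x : ℂ)) * Complex.exp (P x : ℂ) = 1 := by
      rw [← Complex.exp_add, neg_add_cancel, Complex.exp_zero]
    push_cast
    linear_combination ((s : ℂ) * Complex.exp (P x) * z s x) * e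
  · have h1 := ((hPac.exp ordConnected_univ).mul (hsol s).2 ordConnected_univ)
    have h2 := h1.congr (w := fun x => ((Real.exp (P x) * z s x : ℝ) : ℂ))
      (fun x _ => by push_cast; rfl)
    refine h2.congr_deriv ordConnected_univ (Eventually.of_forall fun x _ => ?_)
    have e : Complex.exp (-(P x : ℂ)) * Complex.exp (P x : ℂ) = 1 := by
      rw [← Complex.exp_add, neg_add_cancel, Complex.exp_zero]
    push_cast
    linear_combination (-(s : ℂ) * Complex.exp (-P x) * y s x) * e

theorem nonempty_fundamentalSystem (hφ : ∀ p q, IntervalIntegrable φ volume p q) :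
    Nonempty (FundamentalSystem φ) := by
  obtain ⟨u₁, v₁, h1, h2, h3, h4, h5⟩ := exists_dirac_solution hφ 1 0
  obtain ⟨u₂, v₂, k1, k2, k3, k4, k5⟩ := exists_dirac_solution hφ 0 1
  exact ⟨⟨u₁, v₁, u₂, v₂, h1, h2, k1, k2, h3, h4, k3, k4, h5, k5⟩⟩

namespace IsDiracSolution

variable {I : Set ℝ} {s t : ℝ} {u v f g : ℝ → ℂ}

theorem combination (hI : I.OrdConnected) (h : IsDiracSolution I φ s u v)
    (h' : IsDiracSolution I φ s f g) (c d : ℂ) :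
    IsDiracSolution I φ s (fun x => c * u x + d * f x) (fun x => c * v x + d * g x) :=
  ⟨((h.1.smul c).add (h'.1.smul d)).congr_deriv hI (Eventually.of_forall fun x _ => by ring),
    ((h.2.smul c).add (h'.2.smul d)).congr_deriv hI (Eventually.of_forall fun x _ => by ring)⟩

/-- Green's formula. -/
theorem green (hI : I.OrdConnected) (h : IsDiracSolution I φ s u v)
    (h' : IsDiracSolution I φ t f g) :
    IsACWithDeriv I (fun x => starRingEnd ℂ (u x) * g x - starRingEnd ℂ (v x) * f x)
      (fun x => (s - t) * (starRingEnd ℂ (v x) * g x + starRingEnd ℂ (u x) * f x)) := by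
  refine ((h.1.conj.mul h'.2 hI).sub (h.2.conj.mul h'.1 hI)).congr_deriv hI
    (Eventually.of_forall fun x _ => ?_)
  simp only [map_add, map_sub, map_mul, map_neg, Complex.conj_ofReal]
  ring

end IsDiracSolution

namespace FundamentalSystem

variable (Φ : FundamentalSystem φ)

theorem eq_combination {I : Set ℝ} (hI : I.OrdConnected) (h0 : (0 : ℝ) ∈ I) {s : ℝ} {f g : ℝ → ℂ}
    (h : IsDiracSolution I φ s f g) {x : ℝ} (hx : x ∈ I) :
    f x = f 0 * Φ.u₁ s x + g 0 * Φ.u₂ s x ∧ g x = f 0 * Φ.v₁ s x + g 0 * Φ.v₂ s x :=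
  IsACWithDeriv.eq_combination hI ((Φ.sol₁ s).1.mono (subset_univ _))
    ((Φ.sol₁ s).2.mono (subset_univ _)) ((Φ.sol₂ s).1.mono (subset_univ _))
    ((Φ.sol₂ s).2.mono (subset_univ _)) h.1 h.2 h0
    (by simp [Φ.init_u₁]) (by simp [Φ.init_v₁]) (by simp [Φ.init_u₂]) (by simp [Φ.init_v₂]) hx

theorem det_eq_one (s x : ℝ) : Φ.u₁ s x * Φ.v₂ s x - Φ.v₁ s x * Φ.u₂ s x = 1 := by
  have h := IsACWithDeriv.wronskian ordConnected_univ (Φ.sol₁ s).1 (Φ.sol₁ s).2 (Φ.sol₂ s).1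
    (Φ.sol₂ s).2 (mem_univ x) (mem_univ 0)
  simp only [Φ.init_u₁, Φ.init_v₁, Φ.init_u₂, Φ.init_v₂] at h
  norm_num at h
  exact_mod_cast h

theorem neg_param (s x : ℝ) : Φ.u₁ (-s) x = Φ.u₁ s x ∧ Φ.v₁ (-s) x = -Φ.v₁ s x ∧
    Φ.u₂ (-s) x = -Φ.u₂ s x ∧ Φ.v₂ (-s) x = Φ.v₂ s x := by
  have key : ∀ u v : ℝ → ℂ, IsDiracSolution univ φ s u v →
      IsDiracSolution univ φ (-s) u (fun x => -v x) := by
    intro u v h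
    refine ⟨h.1.congr_deriv ordConnected_univ (Eventually.of_forall fun x _ => ?_),
      h.2.neg.congr_deriv ordConnected_univ (Eventually.of_forall fun x _ => ?_)⟩
    · push_cast; ring
    · push_cast; ring
  have h1 := Φ.eq_combination ordConnected_univ trivial (key _ _ (Φ.sol₁ s)) (mem_univ x)
  have h2 := Φ.eq_combination ordConnected_univ trivial (key _ _ (Φ.sol₂ s)) (mem_univ x)
  simp only [Φ.init_u₁, Φ.init_v₁, Φ.init_u₂, Φ.init_v₂] at h1 h2
  norm_num at h1 h2
  refine ⟨by exact_mod_cast h1.1.symm, ?_, ?_, ?_⟩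
  · have : Φ.v₁ (-s) x = -Φ.v₁ s x := by exact_mod_cast h1.2.symm
    exact this
  · have : Φ.u₂ s x = -Φ.u₂ (-s) x := by exact_mod_cast h2.1
    rw [this, neg_neg]
  · exact_mod_cast h2.2.symm

/-- The discriminant (Lyapunov function), the trace of the monodromy matrix. -/
def disc (ω s : ℝ) : ℝ := Φ.u₁ s ω + Φ.v₂ s ω

/-- The quasi-momentum `θ` with `2 cos θ` equal to the discriminant; junk if the discriminant is
not in `[-2, 2]`. -/
def quasi (ω s : ℝ) : ℝ := Real.arccos (Φ.disc ω s / 2)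

/-- The first component of the Bloch solution with Floquet multiplier `e^{iτ}`. -/
def blochU (ω s τ x : ℝ) : ℂ :=
  Φ.u₂ s ω * Φ.u₁ s x + (Complex.exp (Complex.I * τ) - Φ.u₁ s ω) * Φ.u₂ s x

/-- The second component of the Bloch solution with Floquet multiplier `e^{iτ}`. -/
def blochV (ω s τ x : ℝ) : ℂ :=
  Φ.u₂ s ω * Φ.v₁ s x + (Complex.exp (Complex.I * τ) - Φ.u₁ s ω) * Φ.v₂ s x

theorem disc_neg (s : ℝ) : Φ.disc ω (-s) = Φ.disc ω s := by
  rw [disc, disc, (Φ.neg_param s ω).1, (Φ.neg_param s ω).2.2.2]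

theorem continuous_slice {f : ℝ → ℝ → ℝ} (hf : Continuous fun p : ℝ × ℝ => f p.1 p.2) (x : ℝ) :
    Continuous fun s => f s x := hf.comp (continuous_id.prodMk continuous_const)

theorem continuous_disc (ω : ℝ) : Continuous (Φ.disc ω) :=
  (continuous_slice Φ.cont_u₁ ω).add (continuous_slice Φ.cont_v₂ ω)

theorem continuous_quasi (ω : ℝ) : Continuous (Φ.quasi ω) :=
  Real.continuous_arccos.comp ((Φ.continuous_disc ω).div_const 2)

/-- Zero does not belong to the interior of the spectral bands. -/
theorem two_le_abs_disc_zero (ω : ℝ) : 2 ≤ |Φ.disc ω 0| := by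
  have h1 := ((Φ.sol₁ 0).1.mul (Φ.sol₂ 0).2 ordConnected_univ).congr_deriv
    (w := fun _ => 0) ordConnected_univ (Eventually.of_forall fun x _ => by push_cast; ring)
  have h2 := h1.eq_of_deriv_zero (mem_univ ω) (mem_univ 0)
  simp only [Φ.init_u₁, Φ.init_v₂] at h2
  rw [Complex.ofReal_one, mul_one] at h2
  have h3 : Φ.u₁ 0 ω * Φ.v₂ 0 ω = 1 := by exact_mod_cast h2
  rw [disc]
  by_contra hc
  obtain ⟨h4, h5⟩ := abs_lt.1 (not_le.1 hc)
  nlinarith [sq_nonneg (Φ.u₁ 0 ω - Φ.v₂ 0 ω)]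

theorem isDiracSolution_bloch (s τ : ℝ) :
    IsDiracSolution univ φ s (Φ.blochU ω s τ) (Φ.blochV ω s τ) :=
  (Φ.sol₁ s).combination ordConnected_univ (Φ.sol₂ s) _ _

theorem blochU_zero (s τ : ℝ) : Φ.blochU ω s τ 0 = Φ.u₂ s ω := by
  simp [blochU, Φ.init_u₁, Φ.init_u₂]

theorem blochV_zero (s τ : ℝ) :
    Φ.blochV ω s τ 0 = Complex.exp (Complex.I * τ) - Φ.u₁ s ω := by
  simp [blochV, Φ.init_v₁, Φ.init_v₂]

theorem exp_eq (τ : ℝ) :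
    Complex.exp (Complex.I * τ) = (Real.cos τ : ℂ) + (Real.sin τ : ℂ) * Complex.I := by
  rw [mul_comm, Complex.exp_mul_I]
  push_cast
  rfl

theorem blochU_period (s τ : ℝ) :
    Φ.blochU ω s τ ω = Complex.exp (Complex.I * τ) * Φ.blochU ω s τ 0 := by
  rw [blochU_zero, blochU]
  ring

theorem exp_sq_eq {d τ : ℝ} (h : d = 2 * Real.cos τ) :
    Complex.exp (Complex.I * τ) ^ 2 = d * Complex.exp (Complex.I * τ) - 1 := by
  have h1 : (Real.cos τ : ℂ) ^ 2 + (Real.sin τ : ℂ) ^ 2 = 1 := by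
    exact_mod_cast Real.cos_sq_add_sin_sq τ
  rw [exp_eq, h]
  push_cast at h1 ⊢
  linear_combination (Complex.sin τ ^ 2) * Complex.I_sq - h1

theorem blochV_period {s τ : ℝ} (h : Φ.disc ω s = 2 * Real.cos τ) :
    Φ.blochV ω s τ ω = Complex.exp (Complex.I * τ) * Φ.blochV ω s τ 0 := by
  have h1 := exp_sq_eq h
  have h2 : (Φ.u₁ s ω : ℂ) * Φ.v₂ s ω - Φ.v₁ s ω * Φ.u₂ s ω = 1 := by
    exact_mod_cast Φ.det_eq_one s ω
  rw [disc] at h1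
  rw [blochV_zero, blochV]
  push_cast at h1
  linear_combination -h1 - h2

theorem u₂_ne_zero {s τ : ℝ} (h : Φ.disc ω s = 2 * Real.cos τ) (hτ : Real.sin τ ≠ 0) :
    Φ.u₂ s ω ≠ 0 := by
  intro h0
  have h1 := Φ.det_eq_one s ω
  rw [h0, mul_zero, sub_zero] at h1
  rw [disc] at h
  have h2 := Real.cos_sq_add_sin_sq τ
  have h3 : 0 < Real.sin τ ^ 2 := by positivity
  have h4 : (Φ.u₁ s ω + Φ.v₂ s ω) ^ 2 = 4 * Real.cos τ ^ 2 := by rw [h]; ring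
  nlinarith [sq_nonneg (Φ.u₁ s ω - Φ.v₂ s ω)]

theorem continuous_blochU {X : Type*} [TopologicalSpace X] {s τ x : X → ℝ} (hs : Continuous s)
    (hτ : Continuous τ) (hx : Continuous x) : Continuous fun z => Φ.blochU ω (s z) (τ z) (x z) := by
  have h1 := Φ.cont_u₁.comp (hs.prodMk hx)
  have h2 := Φ.cont_u₂.comp (hs.prodMk hx)
  have h3 := Φ.cont_u₂.comp (hs.prodMk (continuous_const (y := ω)))
  have h4 := Φ.cont_u₁.comp (hs.prodMk (continuous_const (y := ω)))
  simp only [Function.comp_def] at h1 h2 h3 h4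
  unfold blochU
  fun_prop

theorem continuous_blochV {X : Type*} [TopologicalSpace X] {s τ x : X → ℝ} (hs : Continuous s)
    (hτ : Continuous τ) (hx : Continuous x) : Continuous fun z => Φ.blochV ω (s z) (τ z) (x z) := by
  have h1 := Φ.cont_v₁.comp (hs.prodMk hx)
  have h2 := Φ.cont_v₂.comp (hs.prodMk hx)
  have h3 := Φ.cont_u₂.comp (hs.prodMk (continuous_const (y := ω)))
  have h4 := Φ.cont_u₁.comp (hs.prodMk (continuous_const (y := ω)))
  simp only [Function.comp_def] at h1 h2 h3 h4
  unfold blochV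
  fun_prop

end FundamentalSystem

/-! ### The quasi-momentum and the completeness of the Bloch solutions -/

namespace FundamentalSystem

variable {φ : ℝ → ℝ} {ω : ℝ} (Φ : FundamentalSystem φ)

theorem disc_eq_two_mul_cos_quasi {s : ℝ} (h : |Φ.disc ω s| ≤ 2) :
    Φ.disc ω s = 2 * Real.cos (Φ.quasi ω s) := by
  obtain ⟨h1, h2⟩ := abs_le.1 h
  rw [quasi, Real.cos_arccos (by linarith) (by linarith)]
  ring

theorem quasi_mem_Ioo_iff {s : ℝ} : Φ.quasi ω s ∈ Ioo 0 Real.pi ↔ |Φ.disc ω s| < 2 := by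
  have h0 : Real.arccos (Φ.disc ω s / 2) < Real.pi ↔ -1 < Φ.disc ω s / 2 := by
    rw [(Real.arccos_le_pi _).lt_iff_ne, Ne, Real.arccos_eq_pi, not_le]
  rw [quasi, mem_Ioo, Real.arccos_pos, h0, abs_lt]
  constructor
  · rintro ⟨h1, h2⟩
    constructor <;> linarith
  · rintro ⟨h1, h2⟩
    constructor <;> linarith

theorem re_exp (τ : ℝ) : (Complex.exp (Complex.I * τ)).re = Real.cos τ := by
  rw [exp_eq]
  simp only [Complex.add_re, Complex.mul_re, Complex.ofReal_re, Complex.ofReal_im, Complex.I_re,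
    Complex.I_im]
  ring

theorem im_exp (τ : ℝ) : (Complex.exp (Complex.I * τ)).im = Real.sin τ := by
  rw [exp_eq]
  simp only [Complex.add_im, Complex.mul_im, Complex.ofReal_re, Complex.ofReal_im, Complex.I_re,
    Complex.I_im]
  ring

theorem disc_eq_of_quasi_eq {s τ : ℝ} (hτ : τ ∈ Ioo 0 Real.pi) (h : Φ.quasi ω s = τ) :
    Φ.disc ω s = 2 * Real.cos τ := by
  rw [← h] at hτ ⊢
  exact Φ.disc_eq_two_mul_cos_quasi (Φ.quasi_mem_Ioo_iff.1 hτ).le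

theorem quasi_eq_of_disc_eq {s τ : ℝ} (hτ : τ ∈ Icc 0 Real.pi) (h : Φ.disc ω s = 2 * Real.cos τ) :
    Φ.quasi ω s = τ := by
  rw [quasi, h, mul_div_cancel_left₀ _ two_ne_zero, Real.arccos_cos hτ.1 hτ.2]

/-- Where the discriminant lies in `(-2, 2)` the quasi-momentum has a nonzero derivative: Green's
formula for the Bloch solutions at `s` and at `t → s` expresses the derivative of `e^{iθ}` by the
squared norm of the Bloch solution over the period cell. -/
theorem exists_hasDerivAt_quasi (hω : 0 < ω) {s : ℝ} (hs : Φ.quasi ω s ∈ Ioo 0 Real.pi) :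
    ∃ D : ℝ, D ≠ 0 ∧ HasDerivAt (Φ.quasi ω) D s := by
  set θ := Φ.quasi ω with hθ
  have hθc : Continuous θ := Φ.continuous_quasi ω
  set g : ℝ → ℂ := fun t => Complex.exp (Complex.I * θ t) with hg
  have hgc : Continuous g := by fun_prop
  set U : ℝ → ℝ → ℂ := fun t x => Φ.blochU ω t (θ t) x with hU
  set V : ℝ → ℝ → ℂ := fun t x => Φ.blochV ω t (θ t) x with hV
  set W : ℝ → ℂ := fun t =>
    starRingEnd ℂ (U s 0) * V t 0 - starRingEnd ℂ (V s 0) * U t 0 with hW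
  set J : ℝ → ℂ := fun t => ∫ x in (0 : ℝ)..ω,
    (starRingEnd ℂ (V s x) * V t x + starRingEnd ℂ (U s x) * U t x) with hJ
  have hUc : Continuous fun p : ℝ × ℝ => U p.1 p.2 :=
    Φ.continuous_blochU continuous_fst (hθc.comp continuous_fst) continuous_snd
  have hVc : Continuous fun p : ℝ × ℝ => V p.1 p.2 :=
    Φ.continuous_blochV continuous_fst (hθc.comp continuous_fst) continuous_snd
  have hUs : Continuous (U s) := hUc.comp (continuous_const.prodMk continuous_id)
  have hVs : Continuous (V s) := hVc.comp (continuous_const.prodMk continuous_id)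
  have hWc : Continuous W := by
    have h1 : Continuous fun t => U t 0 := hUc.comp (continuous_id.prodMk continuous_const)
    have h2 : Continuous fun t => V t 0 := hVc.comp (continuous_id.prodMk continuous_const)
    exact (continuous_const.mul h2).sub (continuous_const.mul h1)
  have hJc : Continuous J := by
    refine intervalIntegral.continuous_parametric_intervalIntegral_of_continuous' ?_ 0 ω
    have h1 : Continuous fun p : ℝ × ℝ => starRingEnd ℂ (V s p.2) :=
      Complex.continuous_conj.comp (hVs.comp continuous_snd)
    have h2 : Continuous fun p : ℝ × ℝ => starRingEnd ℂ (U s p.2) :=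
      Complex.continuous_conj.comp (hUs.comp continuous_snd)
    exact (h1.mul hVc).add (h2.mul hUc)
  have hsin : 0 < Real.sin (θ s) := Real.sin_pos_of_mem_Ioo hs
  have hdisc := Φ.disc_eq_of_quasi_eq hs rfl
  have hu2 := Φ.u₂_ne_zero hdisc hsin.ne'
  -- the value of the boundary term on the diagonal
  have hWs : W s = 2 * Complex.I * (Φ.u₂ s ω * Real.sin (θ s) : ℝ) := by
    simp only [hW, hU, hV, blochU_zero, blochV_zero, exp_eq, map_sub, map_add, map_mul,
      Complex.conj_ofReal, Complex.conj_I]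
    push_cast
    ring
  have hWs0 : W s ≠ 0 := by
    rw [hWs]
    exact mul_ne_zero (mul_ne_zero two_ne_zero Complex.I_ne_zero)
      (Complex.ofReal_ne_zero.2 (mul_ne_zero hu2 hsin.ne'))
  set i : ℝ := ∫ x in (0 : ℝ)..ω, (‖V s x‖ ^ 2 + ‖U s x‖ ^ 2) with hi
  have hJs : J s = (i : ℂ) := by
    rw [hi, ← intervalIntegral.integral_ofReal]
    refine intervalIntegral.integral_congr fun x _ => ?_
    simp only [Complex.conj_mul']
    push_cast
    rfl
  have hipos : 0 < i := by
    have h1 : Continuous fun x => ‖V s x‖ ^ 2 + ‖U s x‖ ^ 2 := by fun_prop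
    refine intervalIntegral.integral_pos hω h1.continuousOn (fun x _ => by positivity)
      ⟨0, ⟨le_rfl, hω.le⟩, ?_⟩
    have : ‖U s 0‖ ≠ 0 := by
      simp only [hU, blochU_zero, norm_ne_zero_iff]
      exact Complex.ofReal_ne_zero.2 hu2
    positivity
  have hgs : g s * starRingEnd ℂ (g s) = 1 := by
    rw [Complex.mul_conj', hg]
    simp [mul_comm Complex.I, Complex.norm_exp_ofReal_mul_I]
  have hnear : ∀ᶠ t in 𝓝 s, |Φ.disc ω t| < 2 :=
    ((Φ.continuous_disc ω).abs.tendsto s).eventually_lt_const (Φ.quasi_mem_Ioo_iff.1 hs)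
  have hgreen : ∀ t, |Φ.disc ω t| < 2 → (g t - g s) * W t = g s * (s - t) * J t := by
    intro t ht
    have h1 := (((Φ.isDiracSolution_bloch (ω := ω) s (θ s)).green ordConnected_univ
      (Φ.isDiracSolution_bloch (ω := ω) t (θ t))) 0 trivial ω trivial).2
    rw [intervalIntegral.integral_const_mul] at h1
    simp only at h1
    rw [Φ.blochU_period s, Φ.blochU_period t,
      Φ.blochV_period hdisc, Φ.blochV_period (Φ.disc_eq_two_mul_cos_quasi ht.le)] at h1
    simp only [map_mul] at h1
    simp only [hW, hJ, hU, hV]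
    change starRingEnd ℂ (g s) * _ * (g t * _) - starRingEnd ℂ (g s) * _ * (g t * _) - _ = _ at h1
    linear_combination (g s) * h1 - (g t) * (starRingEnd ℂ (Φ.blochU ω s (θ s) 0) *
      Φ.blochV ω t (θ t) 0 - starRingEnd ℂ (Φ.blochV ω s (θ s) 0) * Φ.blochU ω t (θ t) 0) * hgs
  -- divide Green's formula by `t - s` and let `t → s`
  have hder : HasDerivAt g (-(g s * J s / W s)) s := by
    rw [hasDerivAt_iff_tendsto_slope]
    have hlim : Tendsto (fun t => -(g s * J t / W t)) (𝓝[≠] s) (𝓝 (-(g s * J s / W s))) := by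
      have h1 : ContinuousAt (fun t => -(g s * J t / W t)) s :=
        ((continuousAt_const.mul hJc.continuousAt).div hWc.continuousAt hWs0).neg
      exact h1.tendsto.mono_left nhdsWithin_le_nhds
    refine hlim.congr' ?_
    have hW0 : ∀ᶠ t in 𝓝 s, W t ≠ 0 := hWc.continuousAt.eventually_ne hWs0
    filter_upwards [nhdsWithin_le_nhds hnear, nhdsWithin_le_nhds hW0, self_mem_nhdsWithin]
      with t h1 h2 h3
    have h4 : ((t - s : ℝ) : ℂ) ≠ 0 := Complex.ofReal_ne_zero.2 (sub_ne_zero.2 h3)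
    have h5 := hgreen t h1
    rw [slope, vsub_eq_sub, Complex.real_smul, Complex.ofReal_inv]
    push_cast at h4 ⊢
    field_simp
    linear_combination -h5
  have hre := (Complex.reCLM.hasFDerivAt.comp_hasDerivAt s hder).const_mul 2
  have hval : 2 * Complex.reCLM (-(g s * J s / W s)) = -(i / Φ.u₂ s ω) := by
    have e : -(g s * J s / W s) = ((i / (2 * Φ.u₂ s ω * Real.sin (θ s)) : ℝ) : ℂ) *
        (Complex.I * g s) := by
      rw [hJs, hWs]
      have hu2' : (Φ.u₂ s ω : ℂ) ≠ 0 := Complex.ofReal_ne_zero.2 hu2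
      have hsin' : (Real.sin (θ s) : ℂ) ≠ 0 := Complex.ofReal_ne_zero.2 hsin.ne'
      push_cast at hsin' ⊢
      field_simp
      rw [Complex.I_sq]
      ring
    rw [Complex.reCLM_apply, e, Complex.re_ofReal_mul, Complex.mul_re, Complex.I_re, Complex.I_im,
      im_exp]
    have := hsin.ne'
    field_simp
    ring
  rw [hval] at hre
  have hd : HasDerivAt (Φ.disc ω) (-(i / Φ.u₂ s ω)) s := by
    refine hre.congr_of_eventuallyEq ?_
    filter_upwards [hnear] with t ht
    rw [Φ.disc_eq_two_mul_cos_quasi ht.le]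
    rw [Function.comp_apply, Complex.reCLM_apply, re_exp]
  obtain ⟨h1, h2⟩ := abs_lt.1 (Φ.quasi_mem_Ioo_iff.1 hs)
  have hacos := (Real.hasDerivAt_arccos (x := Φ.disc ω s / 2) (by linarith) (by linarith)).comp s
    (hd.div_const 2)
  refine ⟨_, ?_, hacos⟩
  have h3 : 0 < 1 - (Φ.disc ω s / 2) ^ 2 := by nlinarith
  have h4 := Real.sqrt_pos.2 h3
  have : i / Φ.u₂ s ω ≠ 0 := div_ne_zero hipos.ne' hu2
  refine mul_ne_zero (neg_ne_zero.2 (by positivity)) (div_ne_zero (neg_ne_zero.2 this) two_ne_zero)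

theorem memLp_cell {f : ℝ → ℂ} (hf : Continuous f) :
    MemLp f 2 (volume.restrict (Icc 0 ω)) := by
  obtain ⟨C, hC⟩ := isCompact_Icc.exists_bound_of_continuousOn (hf.continuousOn (s := Icc 0 ω))
  exact MemLp.of_bound hf.aestronglyMeasurable C (ae_restrict_of_forall_mem measurableSet_Icc hC)

theorem continuous_blochU_slice (s τ : ℝ) : Continuous (Φ.blochU ω s τ) :=
  Φ.continuous_blochU continuous_const continuous_const continuous_id

theorem continuous_blochV_slice (s τ : ℝ) : Continuous (Φ.blochV ω s τ) :=
  Φ.continuous_blochV continuous_const continuous_const continuous_id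

/-- The first component of the Bloch solution on the period cell. -/
def cellU (ω s τ : ℝ) : L2Cell ω := (memLp_cell (Φ.continuous_blochU_slice (ω := ω) s τ)).toLp

/-- The second component of the Bloch solution on the period cell. -/
def cellV (ω s τ : ℝ) : L2Cell ω := (memLp_cell (Φ.continuous_blochV_slice (ω := ω) s τ)).toLp

theorem coeFn_cellU (s τ : ℝ) :
    ∀ᵐ x ∂(volume.restrict (Icc 0 ω)), Φ.cellU ω s τ x = Φ.blochU ω s τ x :=
  (memLp_cell (Φ.continuous_blochU_slice (ω := ω) s τ)).coeFn_toLp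

theorem coeFn_cellV (s τ : ℝ) :
    ∀ᵐ x ∂(volume.restrict (Icc 0 ω)), Φ.cellV ω s τ x = Φ.blochV ω s τ x :=
  (memLp_cell (Φ.continuous_blochV_slice (ω := ω) s τ)).coeFn_toLp

theorem memLp_potential_mul (hφ : MemLp φ 2 (volume.restrict (Icc 0 ω))) {f : ℝ → ℂ}
    (hf : Continuous f) : MemLp (fun x => (φ x : ℂ) * f x) 2 (volume.restrict (Icc 0 ω)) := by
  obtain ⟨C, hC⟩ := isCompact_Icc.exists_bound_of_continuousOn (hf.continuousOn (s := Icc 0 ω))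
  refine hφ.of_le_mul (c := C) (hφ.ofReal.aestronglyMeasurable.mul hf.aestronglyMeasurable)
    (ae_restrict_of_forall_mem measurableSet_Icc fun x hx => ?_)
  rw [norm_mul, Complex.norm_real, mul_comm]
  exact mul_le_mul_of_nonneg_right (hC x hx) (norm_nonneg _)

theorem cellU_mem_cellGraph (hφ : MemLp φ 2 (volume.restrict (Icc 0 ω))) (s τ : ℝ) :
    (Φ.cellU ω s τ, (s : ℂ) • Φ.cellV ω s τ) ∈ cellGraph ω φ τ := by
  refine ⟨_, _, (Φ.isDiracSolution_bloch s τ).1.mono (subset_univ _), ?_, Φ.blochU_period s τ,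
    Φ.coeFn_cellU s τ, ?_⟩
  · have h1 := (memLp_potential_mul hφ (Φ.continuous_blochU_slice (ω := ω) s τ)).neg.add
      ((memLp_cell (ω := ω) (Φ.continuous_blochV_slice (ω := ω) s τ)).const_mul (s : ℂ))
    refine (memLp_congr_ae (Eventually.of_forall fun x => ?_)).1 h1
    simp
  · filter_upwards [Φ.coeFn_cellV s τ, Lp.coeFn_smul (s : ℂ) (Φ.cellV ω s τ)] with x h1 h2
    rw [h2, Pi.smul_apply, h1, smul_eq_mul]
    ring

theorem cellV_mem_cellGraph (hφ : MemLp φ 2 (volume.restrict (Icc 0 ω))) {s τ : ℝ}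
    (h : Φ.disc ω s = 2 * Real.cos τ) :
    (Φ.cellV ω s τ, (-s : ℂ) • Φ.cellU ω s τ) ∈ cellGraph ω (fun x => -φ x) τ := by
  refine ⟨_, _, (Φ.isDiracSolution_bloch s τ).2.mono (subset_univ _), ?_, Φ.blochV_period h,
    Φ.coeFn_cellV s τ, ?_⟩
  · have h1 := ((memLp_cell (ω := ω) (Φ.continuous_blochU_slice (ω := ω) s τ)).const_mul
      (-s : ℂ)).add (memLp_potential_mul hφ (Φ.continuous_blochV_slice (ω := ω) s τ))
    refine (memLp_congr_ae (Eventually.of_forall fun x => ?_)).1 h1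
    simp
  · filter_upwards [Φ.coeFn_cellU s τ, Lp.coeFn_smul (-s : ℂ) (Φ.cellU ω s τ)] with x h1 h2
    rw [h2, Pi.smul_apply, h1, smul_eq_mul]
    push_cast
    ring

theorem cellU_ne_zero (hω : 0 < ω) {s τ : ℝ} (h : Φ.disc ω s = 2 * Real.cos τ)
    (hτ : Real.sin τ ≠ 0) : Φ.cellU ω s τ ≠ 0 := by
  intro h0
  have h1 : ∀ᵐ x ∂(volume.restrict (Icc 0 ω)), Φ.blochU ω s τ x = 0 := by
    filter_upwards [Φ.coeFn_cellU s τ, (Lp.eq_zero_iff_ae_eq_zero).1 h0] with x h1 h2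
    rw [← h1, h2, Pi.zero_apply]
  have h2 := Measure.eqOn_Icc_of_ae_eq volume hω.ne h1
    (Φ.continuous_blochU_slice s τ).continuousOn (continuousOn_const (c := (0 : ℂ)))
    ⟨le_rfl, hω.le⟩
  rw [blochU_zero] at h2
  exact Φ.u₂_ne_zero h hτ (Complex.ofReal_eq_zero.1 h2)

theorem inner_cell (hω : 0 < ω) (hφ : MemLp φ 2 (volume.restrict (Icc 0 ω))) {s t τ : ℝ}
    (ht : Φ.disc ω t = 2 * Real.cos τ) :
    s * inner ℂ (Φ.cellV ω s τ) (Φ.cellV ω t τ) = t * inner ℂ (Φ.cellU ω s τ) (Φ.cellU ω t τ) := by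
  have h := inner_cellGraph hω (Φ.cellU_mem_cellGraph hφ s τ) (Φ.cellV_mem_cellGraph hφ ht)
  rw [inner_smul_left, inner_smul_right, Complex.conj_ofReal] at h
  rw [h]
  ring

/-- A solution on the period cell with the multiplier `e^{iτ}` is a Bloch solution. -/
theorem exists_eq_smul_cellU (hω : 0 < ω) {s τ : ℝ} (hτ : Real.sin τ ≠ 0) {f g : ℝ → ℂ}
    {x : L2Cell ω}
    (h : IsDiracSolution (Icc 0 ω) φ s f g)
    (hf : f ω = Complex.exp (Complex.I * τ) * f 0) (hg : g ω = Complex.exp (Complex.I * τ) * g 0)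
    (hx : ∀ᵐ t ∂(volume.restrict (Icc 0 ω)), x t = f t) (hx0 : x ≠ 0) :
    Φ.disc ω s = 2 * Real.cos τ ∧ ∃ c : ℂ, x = c • Φ.cellU ω s τ := by
  have h0 : (0 : ℝ) ∈ Icc 0 ω := ⟨le_rfl, hω.le⟩
  have h1 : ω ∈ Icc 0 ω := ⟨hω.le, le_rfl⟩
  have hcomb := fun t (ht : t ∈ Icc 0 ω) => Φ.eq_combination ordConnected_Icc h0 h ht
  have e1 := (hcomb ω h1).1
  have e2 := (hcomb ω h1).2
  rw [hf] at e1
  rw [hg] at e2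
  set e := Complex.exp (Complex.I * τ) with he
  have hdet : (Φ.u₁ s ω : ℂ) * Φ.v₂ s ω - Φ.v₁ s ω * Φ.u₂ s ω = 1 := by
    exact_mod_cast Φ.det_eq_one s ω
  have hnz : ¬ (f 0 = 0 ∧ g 0 = 0) := by
    rintro ⟨hf0, hg0⟩
    refine hx0 ((Lp.eq_zero_iff_ae_eq_zero).2 ?_)
    filter_upwards [hx, ae_restrict_mem measurableSet_Icc] with t ht htm
    rw [ht, (hcomb t htm).1, hf0, hg0]
    simp
  -- the characteristic equation of the monodromy matrix
  have hchar : e ^ 2 = (Φ.disc ω s : ℂ) * e - 1 := by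
    rw [disc]
    push_cast
    by_cases hf0 : f 0 = 0
    · have hg0 : g 0 ≠ 0 := fun hg0 => hnz ⟨hf0, hg0⟩
      refine mul_right_cancel₀ hg0 ?_
      linear_combination (e - Φ.u₁ s ω) * e2 + (Φ.v₁ s ω : ℂ) * e1 - g 0 * hdet
    · refine mul_right_cancel₀ hf0 ?_
      linear_combination (e - Φ.v₂ s ω) * e1 + (Φ.u₂ s ω : ℂ) * e2 - f 0 * hdet
  have hdisc : Φ.disc ω s = 2 * Real.cos τ := by
    have h2 := exp_sq_eq (d := 2 * Real.cos τ) (τ := τ) rfl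
    rw [← he] at h2
    have h3 : (Φ.disc ω s : ℂ) * e = ((2 * Real.cos τ : ℝ) : ℂ) * e := by
      linear_combination h2 - hchar
    exact_mod_cast mul_right_cancel₀ (Complex.exp_ne_zero _) h3
  refine ⟨hdisc, f 0 / Φ.u₂ s ω, ?_⟩
  have hu2 : (Φ.u₂ s ω : ℂ) ≠ 0 := Complex.ofReal_ne_zero.2 (Φ.u₂_ne_zero hdisc hτ)
  refine Lp.ext ?_
  filter_upwards [hx, ae_restrict_mem measurableSet_Icc, Φ.coeFn_cellU s τ,
    Lp.coeFn_smul (f 0 / Φ.u₂ s ω : ℂ) (Φ.cellU ω s τ)] with t k1 k2 k3 k4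
  rw [k1, k4, Pi.smul_apply, k3, (hcomb t k2).1, smul_eq_mul, blochU, ← he]
  field_simp
  linear_combination (-(Φ.u₂ s t : ℂ)) * e1

theorem exp_add_ne_one {τ : ℝ} (hτ : Real.sin τ ≠ 0) (r : ℝ) :
    Complex.exp (Complex.I * τ + (r : ℂ)) ≠ 1 := by
  intro h
  obtain ⟨n, hn⟩ := Complex.exp_eq_one_iff.1 h
  have h1 := congrArg Complex.im hn
  simp at h1
  apply hτ
  rw [h1, ← mul_assoc]
  have := Real.sin_int_mul_pi (n * 2)
  push_cast at this
  exact this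

/-- The Bloch solutions with a given multiplier are complete in `L²([0, ω])`: they are the
eigenvectors of the compact operator `(A_τ* A_τ)⁻¹`. -/
theorem eq_zero_of_inner_cellU (hω : 0 < ω) (hφ : MemLp φ 2 (volume.restrict (Icc 0 ω))) {τ : ℝ}
    (hτ : Real.sin τ ≠ 0) {g : L2Cell ω}
    (hg : ∀ s, 0 < s → Φ.disc ω s = 2 * Real.cos τ → inner ℂ (Φ.cellU ω s τ) g = 0) : g = 0 := by
  obtain ⟨K, hKc, hK⟩ := exists_compact_inverse (θ := τ) hω hφ (exp_add_ne_one hτ _)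
  obtain ⟨L, -, hL⟩ := exists_compact_inverse (θ := τ) hω hφ.neg (exp_add_ne_one hτ _)
  have hadj : ∀ x y, inner ℂ (K x) y = - inner ℂ x (L y) := fun x y => by
    rw [inner_cellGraph hω (hK x) (hL y), neg_neg]
  set T : L2Cell ω →L[ℂ] L2Cell ω := -(K.comp L) with hT
  have hTapp : ∀ x, T x = -K (L x) := fun x => rfl
  have hTc : IsCompactOperator T := by
    have := (hKc.comp_clm L).neg
    exact this
  have hTs : (T : L2Cell ω →ₗ[ℂ] L2Cell ω).IsSymmetric := by
    intro x y
    have h1 : inner ℂ (K (L x)) y = - inner ℂ (L x) (L y) := hadj _ _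
    have h2 : inner ℂ (K (L y)) x = - inner ℂ (L y) (L x) := hadj _ _
    change inner ℂ (T x) y = inner ℂ x (T y)
    rw [hTapp, hTapp, inner_neg_left, inner_neg_right, h1, ← inner_conj_symm x, h2, map_neg,
      inner_conj_symm]
  have hspec := ContinuousLinearMap.orthogonalComplement_iSup_eigenspaces_eq_bot hTc hTs
  have hmem : g ∈ (⨆ μ : ℂ, Module.End.eigenspace (T : Module.End ℂ (L2Cell ω)) μ)ᗮ := by
    rw [← Submodule.iInf_orthogonal, Submodule.mem_iInf]
    intro μ
    rw [Submodule.mem_orthogonal]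
    intro x hx
    have hTx : T x = μ • x := Module.End.mem_eigenspace_iff.1 hx
    by_cases hx0 : x = 0
    · rw [hx0, inner_zero_left]
    have hLx : L x ≠ 0 := by
      intro h0
      have := cellGraph_functional hω _ (hL x) h0
      exact hx0 this
    -- the eigenvalue is `1 / s²`
    have hμ : μ * inner ℂ x x = inner ℂ (L x) (L x) := by
      have h1 := hadj (L x) x
      have h2 : K (L x) = -(μ • x) := by rw [← hTx, hTapp, neg_neg]
      have hμr : starRingEnd ℂ μ = μ := hTs.conj_eigenvalue_eq_self
        (Module.End.hasEigenvalue_of_hasEigenvector ⟨hx, hx0⟩)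
      rw [h2, inner_neg_left, inner_smul_left, hμr] at h1
      linear_combination -h1
    rw [inner_self_eq_norm_sq_to_K, inner_self_eq_norm_sq_to_K] at hμ
    have hxn : (‖x‖ : ℝ) ≠ 0 := norm_ne_zero_iff.2 hx0
    have hμ' : μ = ((‖L x‖ ^ 2 / ‖x‖ ^ 2 : ℝ) : ℂ) := by
      have hxn' : ((‖x‖ : ℝ) : ℂ) ≠ 0 := Complex.ofReal_ne_zero.2 hxn
      push_cast
      rw [eq_div_iff (pow_ne_zero 2 hxn')]
      exact hμ
    set s : ℝ := ‖x‖ / ‖L x‖ with hs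
    have hs0 : 0 < s := div_pos (norm_pos_iff.2 hx0) (norm_pos_iff.2 hLx)
    have hμs : (s : ℂ) * s * μ = 1 := by
      rw [hμ', hs]
      have : (‖L x‖ : ℝ) ≠ 0 := norm_ne_zero_iff.2 hLx
      norm_cast
      field_simp
    have hgr1 : (x, (s : ℂ) • ((-s : ℂ) • L x)) ∈ cellGraph ω φ τ := by
      have h1 := (cellGraph ω φ τ).smul_mem ((s : ℂ) * (-s)) (hK (L x))
      have h2 : ((s : ℂ) * (-s)) • K (L x) = x := by
        have : K (L x) = -(μ • x) := by rw [← hTx, hTapp, neg_neg]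
        rw [this, smul_neg, smul_smul, ← neg_smul]
        have e : -((s : ℂ) * -s * μ) = 1 := by linear_combination hμs
        rw [e, one_smul]
      rw [Prod.smul_mk, h2, ← smul_smul] at h1
      exact h1
    have hgr2 : ((-s : ℂ) • L x, (-s : ℂ) • x) ∈ cellGraph ω (fun y => -φ y) τ :=
      (cellGraph ω (fun y => -φ y) τ).smul_mem (-s : ℂ) (hL x)
    obtain ⟨u, v, hu, -, hbu, hxu, hxv⟩ := hgr1
    obtain ⟨a, b, ha, -, hba, hya, hyb⟩ := hgr2
    simp only at hxu hxv hya hyb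
    have hall : ∀ᵐ t ∂(volume.restrict (Icc 0 ω)), v t = (-φ t : ℂ) * u t + s * a t ∧
        b t = (-s : ℂ) * u t - (-φ t : ℂ) * a t := by
      filter_upwards [hxu, hxv, hya, hyb, Lp.coeFn_smul (s : ℂ) ((-s : ℂ) • L x),
        Lp.coeFn_smul (-s : ℂ) x] with t k1 k2 k3 k4 k5 k6
      rw [k5, Pi.smul_apply, k3, smul_eq_mul] at k2
      rw [k6, Pi.smul_apply, k1, smul_eq_mul] at k4
      push_cast at k4
      constructor
      · linear_combination -k2
      · linear_combination -k4
    rw [ae_restrict_iff' measurableSet_Icc] at hall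
    have hsol : IsDiracSolution (Icc 0 ω) φ s u a :=
      ⟨hu.congr_deriv ordConnected_Icc (hall.mono fun t ht hm => (ht hm).1),
        ha.congr_deriv ordConnected_Icc (hall.mono fun t ht hm => (ht hm).2)⟩
    obtain ⟨hd, c, hc⟩ := Φ.exists_eq_smul_cellU hω hτ hsol hbu hba hxu hx0
    rw [hc, inner_smul_left, hg s hs0 hd, mul_zero]
  rw [hspec] at hmem
  exact (Submodule.mem_bot ℂ).1 hmem

/-- Completeness of the second components, by duality from that of the first. -/
theorem eq_zero_of_inner_cellV (hω : 0 < ω) (hφ : MemLp φ 2 (volume.restrict (Icc 0 ω))) {τ : ℝ}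
    (hτ : Real.sin τ ≠ 0) {g : L2Cell ω}
    (hg : ∀ s, 0 < s → Φ.disc ω s = 2 * Real.cos τ → inner ℂ (Φ.cellV ω s τ) g = 0) : g = 0 := by
  obtain ⟨K, -, hK⟩ := exists_compact_inverse (θ := τ) hω hφ (exp_add_ne_one hτ _)
  have h0 : K g = 0 := by
    refine Φ.eq_zero_of_inner_cellU hω hφ hτ fun s hs hd => ?_
    have h1 := inner_cellGraph hω (hK g) (Φ.cellV_mem_cellGraph hφ hd)
    rw [inner_smul_right, ← inner_conj_symm, hg s hs hd, map_zero] at h1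
    have hs' : (s : ℂ) ≠ 0 := Complex.ofReal_ne_zero.2 hs.ne'
    have h2 : (s : ℂ) * inner ℂ (K g) (Φ.cellU ω s τ) = 0 := by linear_combination -h1
    rw [← inner_conj_symm, (mul_eq_zero.1 h2).resolve_left hs', map_zero]
  exact cellGraph_functional hω _ (hK g) h0

end FundamentalSystem

/-! ### The spectral bands -/

section Bands

variable {θ : ℝ → ℝ}

/-- Rolle's theorem: the quasi-momentum takes no value twice within one band. -/
theorem not_forall_mem_of_hasDerivAt (hc : Continuous θ)
    (hd : ∀ s, θ s ∈ Ioo 0 Real.pi → ∃ D : ℝ, D ≠ 0 ∧ HasDerivAt θ D s) {x y : ℝ} (hxy : x < y)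
    (h : θ x = θ y) : ¬ ∀ s ∈ Ioo x y, θ s ∈ Ioo 0 Real.pi := by
  intro hB
  choose! D hD hD' using hd
  obtain ⟨c, hc, hc0⟩ := exists_hasDerivAt_eq_zero hxy hc.continuousOn h
    fun s hs => hD' s (hB s hs)
  exact hD c (hB c hc) hc0

/-- The level set of a regular value has no accumulation point. -/
theorem finite_level_set (hc : Continuous θ)
    (hd : ∀ s, θ s ∈ Ioo 0 Real.pi → ∃ D : ℝ, D ≠ 0 ∧ HasDerivAt θ D s) (R : ℝ) :
    ({s | 0 < s ∧ θ s = Real.pi / 2} ∩ Iic R).Finite := by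
  by_contra hinf
  have hsub : {s | 0 < s ∧ θ s = Real.pi / 2} ∩ Iic R ⊆ Icc 0 R := fun s hs => ⟨hs.1.1.le, hs.2⟩
  obtain ⟨x, -, hx⟩ := Set.Infinite.exists_accPt_of_subset_isCompact hinf isCompact_Icc hsub
  have hcl : IsClosed {s | θ s = Real.pi / 2} := isClosed_eq hc continuous_const
  have hxm : θ x = Real.pi / 2 := by
    have h1 : x ∈ closure {s | θ s = Real.pi / 2} :=
      closure_mono (fun s hs => hs.1.2) (mem_closure_iff_clusterPt.2 hx.clusterPt)
    rwa [hcl.closure_eq] at h1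
  have hpi := Real.pi_pos
  obtain ⟨D, hD, hD'⟩ := hd x (by rw [hxm]; constructor <;> linarith)
  have h1 := hD'.eventually_ne (c := Real.pi / 2) hD
  obtain ⟨y, hy1, hy2⟩ := ((accPt_iff_frequently.1 hx).and_eventually
    (eventually_nhdsWithin_iff.1 h1)).exists
  exact hy2 hy1.1 hy1.2.1.2

/-- The bands of a quasi-momentum: the components of `{θ ∈ (0, π)}` in the half line are intervals
that `θ` maps bijectively to `(0, π)`, ordered like `ℕ`. -/
theorem exists_bands (hc : Continuous θ) (hr : ∀ s, θ s ∈ Icc 0 Real.pi)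
    (h0 : θ 0 ∉ Ioo 0 Real.pi)
    (hd : ∀ s, θ s ∈ Ioo 0 Real.pi → ∃ D : ℝ, D ≠ 0 ∧ HasDerivAt θ D s)
    (hinf : {s | 0 < s ∧ θ s = Real.pi / 2}.Infinite) :
    ∃ a b : ℕ → ℝ, (∀ n, 0 ≤ a n ∧ a n < b n ∧ b n ≤ a (n + 1)) ∧ Tendsto a atTop atTop ∧
      (∀ n, BijOn θ (Ioo (a n) (b n)) (Ioo 0 Real.pi)) ∧
      ∀ s, 0 < s → θ s ∈ Ioo 0 Real.pi → ∃ n, s ∈ Ioo (a n) (b n) := by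
  set Z := {s | 0 < s ∧ θ s = Real.pi / 2} with hZ
  set N := {s | θ s ∉ Ioo 0 Real.pi} with hN
  have hpi := Real.pi_pos
  have hNc : IsClosed N := (isOpen_Ioo.preimage hc).isClosed_compl
  have hZN : ∀ s ∈ Z, s ∉ N := fun s hs h => h (by rw [hs.2]; constructor <;> linarith)
  have hNval : ∀ s ∈ N, θ s = 0 ∨ θ s = Real.pi := by
    intro s hs
    by_contra hcon
    push Not at hcon
    exact hs ⟨lt_of_le_of_ne (hr s).1 hcon.1.symm, lt_of_le_of_ne (hr s).2 hcon.2⟩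
  have hrolle : ∀ x y, x < y → θ x = θ y → ∃ s ∈ Ioo x y, s ∈ N := by
    intro x y hxy h
    by_contra hcon
    push Not at hcon
    exact not_forall_mem_of_hasDerivAt hc hd hxy h fun s hs => not_not.1 (hcon s hs)
  -- successive elements of `Z`
  have hnext : ∀ x : ℝ, ∃ z ∈ Z, x < z ∧ ∀ w ∈ Z, x < w → z ≤ w := by
    intro x
    have h1 : ∃ y ∈ Z, x < y := by
      by_contra hcon
      push Not at hcon
      exact hinf ((finite_level_set hc hd x).subset fun s hs => ⟨hs, hcon s hs⟩)
    obtain ⟨y, hy, hxy⟩ := h1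
    have hfin : (Z ∩ Ioc x y).Finite :=
      (finite_level_set hc hd y).subset fun s hs => ⟨hs.1, hs.2.2⟩
    obtain ⟨z, hz, hz'⟩ := exists_min_image _ id hfin ⟨y, hy, hxy, le_rfl⟩
    refine ⟨z, hz.1, hz.2.1, fun w hw hxw => ?_⟩
    rcases le_total w y with h | h
    · exact hz' w ⟨hw, hxw, h⟩
    · exact hz.2.2.trans h
  choose nx hnxZ hnxlt hnxle using hnext
  set z : ℕ → ℝ := fun n => nx^[n + 1] 0 with hz
  have hz0 : z 0 = nx 0 := rfl
  have hzs : ∀ n, z (n + 1) = nx (z n) := fun n => Function.iterate_succ_apply' nx (n + 1) 0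
  have hzZ : ∀ n, z n ∈ Z := by
    intro n
    cases n with
    | zero => exact hnxZ 0
    | succ n => rw [hzs]; exact hnxZ _
  have hzmono : StrictMono z := strictMono_nat_of_lt_succ fun n => by rw [hzs]; exact hnxlt _
  have hztop : Tendsto z atTop atTop := by
    refine tendsto_atTop_atTop_of_monotone hzmono.monotone fun R => ?_
    by_contra hcon
    push Not at hcon
    exact (infinite_range_of_injective hzmono.injective)
      ((finite_level_set hc hd R).subset fun s ⟨n, hn⟩ => hn ▸ ⟨hzZ n, (hcon n).le⟩)
  have hzsurj : ∀ w ∈ Z, ∃ n, z n = w := by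
    intro w hw
    have hex : ∃ n, w ≤ z n := (hztop.eventually_ge_atTop w).exists
    classical
    refine ⟨Nat.find hex, le_antisymm ?_ (Nat.find_spec hex)⟩
    cases hn : Nat.find hex with
    | zero => rw [hz0]; exact hnxle 0 w hw hw.1
    | succ m =>
      rw [hzs]
      exact hnxle _ w hw (not_le.1 (Nat.find_min hex (by omega)))
  -- the endpoints of the band around the `n`-th element of `Z`
  have hleft : ∀ n, ∃ a, IsGreatest (N ∩ Icc 0 (z n)) a := fun n =>
    (isCompact_Icc.inter_left hNc).exists_isGreatest ⟨0, h0, le_rfl, (hzZ n).1.le⟩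
  have hright : ∀ n, ∃ b, IsLeast (N ∩ Icc (z n) (z (n + 1))) b := by
    intro n
    obtain ⟨s, hs, hsN⟩ := hrolle (z n) (z (n + 1)) (hzmono n.lt_succ_self)
      ((hzZ n).2.trans (hzZ (n + 1)).2.symm)
    exact (isCompact_Icc.inter_left hNc).exists_isLeast ⟨s, hsN, hs.1.le, hs.2.le⟩
  choose a ha using hleft
  choose b hb using hright
  have haz : ∀ n, a n < z n := fun n => lt_of_le_of_ne (ha n).1.2.2 fun h =>
    hZN _ (hzZ n) (h ▸ (ha n).1.1)
  have hzb : ∀ n, z n < b n := fun n => lt_of_le_of_ne (hb n).1.2.1 fun h =>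
    hZN _ (hzZ n) (h.symm ▸ (hb n).1.1)
  have hba : ∀ n, b n ≤ a (n + 1) := fun n =>
    (ha (n + 1)).2 ⟨(hb n).1.1, (hzZ n).1.le.trans (hzb n).le, (hb n).1.2.2⟩
  have hin : ∀ n, ∀ s ∈ Ioo (a n) (b n), θ s ∈ Ioo 0 Real.pi := by
    intro n s hs
    by_contra hsN
    rcases le_total s (z n) with h | h
    · exact absurd ((ha n).2 ⟨hsN, (ha n).1.2.1.trans hs.1.le, h⟩) (not_le.2 hs.1)
    · exact absurd ((hb n).2 ⟨hsN, h, hs.2.le.trans (hb n).1.2.2⟩) (not_le.2 hs.2)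
  have hivt : ∀ x y, x < y → x ∈ N → y ∈ N → (∀ s ∈ Ioo x y, θ s ∈ Ioo 0 Real.pi) →
      Ioo 0 Real.pi ⊆ θ '' Ioo x y := by
    intro x y hxy hx hy hB
    have hne : θ x ≠ θ y := fun h => not_forall_mem_of_hasDerivAt hc hd hxy h hB
    rcases hNval x hx with h1 | h1 <;> rcases hNval y hy with h2 | h2
    · exact absurd (h1.trans h2.symm) hne
    · have := intermediate_value_Ioo hxy.le (f := θ) hc.continuousOn
      rwa [h1, h2] at this
    · have := intermediate_value_Ioo' hxy.le (f := θ) hc.continuousOn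
      rwa [h1, h2] at this
    · exact absurd (h1.trans h2.symm) hne
  refine ⟨a, b, fun n => ⟨(ha n).1.2.1, (haz n).trans (hzb n), hba n⟩, ?_, fun n => ⟨hin n, ?_, ?_⟩,
    ?_⟩
  · rw [← tendsto_add_atTop_iff_nat 1]
    exact tendsto_atTop_mono (fun n => (hzb n).le.trans (hba n)) hztop
  · intro x hx y hy hxy
    by_contra hne
    rcases lt_or_gt_of_ne hne with h | h
    · exact not_forall_mem_of_hasDerivAt hc hd h hxy fun s hs =>
        hin n s ⟨hx.1.trans hs.1, hs.2.trans hy.2⟩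
    · exact not_forall_mem_of_hasDerivAt hc hd h hxy.symm fun s hs =>
        hin n s ⟨hy.1.trans hs.1, hs.2.trans hx.2⟩
  · exact hivt _ _ ((haz n).trans (hzb n)) (ha n).1.1 (hb n).1.1 (hin n)
  · intro s hs hsB
    have hsN : s ∉ N := fun h => h hsB
    obtain ⟨n, hn⟩ := (hztop.eventually_ge_atTop s).exists
    by_cases hemp : (N ∩ Icc s (z n)).Nonempty
    · -- the component of `s` contains some `z m`
      obtain ⟨β, hβ⟩ := (isCompact_Icc.inter_left hNc).exists_isLeast hemp
      obtain ⟨α, hα⟩ : ∃ α, IsGreatest (N ∩ Icc 0 s) α :=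
        (isCompact_Icc.inter_left hNc).exists_isGreatest ⟨0, h0, le_rfl, hs.le⟩
      have hαs : α < s := lt_of_le_of_ne hα.1.2.2 fun h => hsN (h ▸ hα.1.1)
      have hsβ : s < β := lt_of_le_of_ne hβ.1.2.1 fun h => hsN (h.symm ▸ hβ.1.1)
      have hB : ∀ t ∈ Ioo α β, θ t ∈ Ioo 0 Real.pi := by
        intro t ht
        by_contra htN
        rcases le_total t s with h | h
        · exact absurd (hα.2 ⟨htN, hα.1.2.1.trans ht.1.le, h⟩) (not_le.2 ht.1)
        · exact absurd (hβ.2 ⟨htN, h, ht.2.le.trans hβ.1.2.2⟩) (not_le.2 ht.2)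
      obtain ⟨w, hw, hwθ⟩ := hivt α β (hαs.trans hsβ) hα.1.1 hβ.1.1 hB
        (show Real.pi / 2 ∈ Ioo 0 Real.pi by constructor <;> linarith)
      obtain ⟨m, hm⟩ := hzsurj w ⟨hα.1.2.1.trans_lt hw.1, hwθ⟩
      refine ⟨m, ?_, ?_⟩
      · by_contra hcon
        have h1 : a m < β := (haz m).trans (hm ▸ hw.2)
        exact absurd (hβ.2 ⟨(ha m).1.1, not_lt.1 hcon, h1.le.trans hβ.1.2.2⟩) (not_le.2 h1)
      · by_contra hcon
        have h1 : α < b m := (hm ▸ hw.1 : α < z m).trans (hzb m)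
        exact absurd (hα.2 ⟨(hb m).1.1, hα.1.2.1.trans h1.le, not_lt.1 hcon⟩) (not_le.2 h1)
    · refine ⟨n, ?_, hn.trans_lt (hzb n)⟩
      by_contra hcon
      exact hemp ⟨a n, (ha n).1.1, not_lt.1 hcon, (haz n).le⟩

end Bands

namespace FundamentalSystem

variable {φ : ℝ → ℝ} {ω : ℝ} (Φ : FundamentalSystem φ)

/-- The continuous elements of `L²([0, ω])`. -/
def continuousCell (ω : ℝ) : Submodule ℂ (L2Cell ω) where
  carrier := {f | ∃ u : ℝ → ℂ, Continuous u ∧ ∀ᵐ x ∂(volume.restrict (Icc 0 ω)), f x = u x}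
  zero_mem' := ⟨0, continuous_zero, Lp.coeFn_zero ℂ 2 _⟩
  add_mem' := by
    rintro f g ⟨u, hu, hfu⟩ ⟨v, hv, hgv⟩
    refine ⟨u + v, hu.add hv, ?_⟩
    filter_upwards [hfu, hgv, Lp.coeFn_add f g] with x h1 h2 h3
    rw [h3, Pi.add_apply, Pi.add_apply, h1, h2]
  smul_mem' := by
    rintro c f ⟨u, hu, hfu⟩
    refine ⟨c • u, hu.const_smul c, ?_⟩
    filter_upwards [hfu, Lp.coeFn_smul c f] with x h1 h2
    rw [h2, Pi.smul_apply, Pi.smul_apply, h1]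

/-- A jump function is not continuous. -/
theorem continuousCell_ne_top (hω : 0 < ω) : continuousCell ω ≠ ⊤ := by
  intro h
  have h1 := h.ge (Submodule.mem_top (x := indicatorConstLp 2
    (measurableSet_Icc (a := 0) (b := ω / 2)) (measure_ne_top _ _) (1 : ℂ)))
  obtain ⟨u, hu, hfu⟩ := h1
  have hae : ∀ᵐ x ∂(volume.restrict (Icc 0 ω)), (Icc 0 (ω / 2)).indicator (fun _ => (1 : ℂ)) x = u x := by
    filter_upwards [hfu, indicatorConstLp_coeFn (p := 2) (c := (1 : ℂ))
      (μ := volume.restrict (Icc 0 ω)) (hs := measurableSet_Icc (a := 0) (b := ω / 2))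
      (hμs := measure_ne_top _ _)] with x h1 h2
    rw [← h1, h2]
  have e1 : u (ω / 2) = 1 := by
    refine Measure.eqOn_Icc_of_ae_eq volume (a := 0) (b := ω / 2) (by linarith)
      (f := u) (g := fun _ => 1) ?_ hu.continuousOn continuousOn_const ⟨by linarith, le_rfl⟩
    have h2 := ae_restrict_of_ae_restrict_of_subset
      (Icc_subset_Icc_right (by linarith : ω / 2 ≤ ω)) hae
    filter_upwards [h2, ae_restrict_mem measurableSet_Icc] with x hx hxm
    rw [← hx, indicator_of_mem hxm]
  have e2 : u (ω / 2) = 0 := by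
    refine Measure.eqOn_Icc_of_ae_eq volume (a := ω / 2) (b := ω) (by linarith)
      (f := u) (g := fun _ => 0) ?_ hu.continuousOn continuousOn_const ⟨le_rfl, by linarith⟩
    have h2 := ae_restrict_of_ae_restrict_of_subset
      (Icc_subset_Icc_left (by linarith : 0 ≤ ω / 2)) hae
    filter_upwards [h2, ae_restrict_mem measurableSet_Icc,
      ae_restrict_of_ae (volume.ae_ne (ω / 2))] with x hx hxm hxne
    rw [← hx, indicator_of_notMem fun hm => hxne (le_antisymm hm.2 hxm.1)]
  exact one_ne_zero (e1.symm.trans e2)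

/-- There are infinitely many bands: otherwise finitely many of the continuous Bloch solutions would
span `L²([0, ω])`, by completeness. -/
theorem infinite_quasi (hω : 0 < ω) (hφ : MemLp φ 2 (volume.restrict (Icc 0 ω))) :
    {s | 0 < s ∧ Φ.quasi ω s = Real.pi / 2}.Infinite := by
  intro hfin
  have hpi := Real.pi_pos
  set K := Submodule.span ℂ ((fun s => Φ.cellU ω s (Real.pi / 2)) ''
    {s | 0 < s ∧ Φ.quasi ω s = Real.pi / 2}) with hK
  have : FiniteDimensional ℂ K := FiniteDimensional.span_of_finite ℂ (hfin.image _)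
  have htop : K = ⊤ := by
    rw [← Submodule.orthogonal_eq_bot_iff, Submodule.eq_bot_iff]
    intro g hg
    refine Φ.eq_zero_of_inner_cellU hω hφ (τ := Real.pi / 2) (by simp) fun s hs hd => ?_
    refine (Submodule.mem_orthogonal _ _).1 hg _ (Submodule.subset_span ⟨s, ⟨hs, ?_⟩, rfl⟩)
    exact Φ.quasi_eq_of_disc_eq ⟨by linarith, by linarith⟩ hd
  refine continuousCell_ne_top hω (top_le_iff.1 (htop ▸ ?_))
  rw [hK, Submodule.span_le]
  rintro _ ⟨s, -, rfl⟩
  exact ⟨_, Φ.continuous_blochU_slice s _, Φ.coeFn_cellU s _⟩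

theorem exists_quasi_bands (hω : 0 < ω) (hφ : MemLp φ 2 (volume.restrict (Icc 0 ω))) :
    ∃ a b : ℕ → ℝ, (∀ n, 0 ≤ a n ∧ a n < b n ∧ b n ≤ a (n + 1)) ∧ Tendsto a atTop atTop ∧
      (∀ n, BijOn (Φ.quasi ω) (Ioo (a n) (b n)) (Ioo 0 Real.pi)) ∧
      ∀ s, 0 < s → Φ.quasi ω s ∈ Ioo 0 Real.pi → ∃ n, s ∈ Ioo (a n) (b n) :=
  exists_bands (Φ.continuous_quasi ω) (fun _ => ⟨Real.arccos_nonneg _, Real.arccos_le_pi _⟩)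
    (fun h => (Φ.two_le_abs_disc_zero ω).not_gt (Φ.quasi_mem_Ioo_iff.1 h))
    (fun _ hs => Φ.exists_hasDerivAt_quasi hω hs) (Φ.infinite_quasi hω hφ)

end FundamentalSystem

/-! ### Diagonalization of a direct integral with monotone band functions -/

/-- The two halves `(0, π)` and `(π, 2π)` of the interval of quasi-momenta. -/
def halfPeriod (j : Fin 2) : Set ℝ := Ioo (j * Real.pi) ((j + 1) * Real.pi)

theorem measurableSet_halfPeriod (j : Fin 2) : MeasurableSet (halfPeriod j) := measurableSet_Ioo

theorem notMem_halfPeriod {j k : Fin 2} (hjk : j ≠ k) {τ : ℝ} (h : τ ∈ halfPeriod j) :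
    τ ∉ halfPeriod k := by
  fin_cases j <;> fin_cases k <;> simp [halfPeriod] at hjk h ⊢
  · intro h1; linarith
  · intro h1; linarith

theorem lintegral_floquetMeasure (f : ℝ → ℝ≥0∞) : ∫⁻ τ, f τ ∂floquetMeasure =
    ∑ j, ENNReal.ofReal (2 * Real.pi)⁻¹ * ∫⁻ τ in halfPeriod j, f τ := by
  have hpi := Real.pi_pos
  rw [floquetMeasure, lintegral_smul_measure, smul_eq_mul, ← Finset.mul_sum, Fin.sum_univ_two,
    ← restrict_Ioc_eq_restrict_Icc, ← Ioc_union_Ioc_eq_Ioc hpi.le (by linarith : Real.pi ≤ 2 * Real.pi),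
    lintegral_union measurableSet_Ioc (Set.disjoint_left.2 fun x h1 h2 => not_lt.2 h1.2 h2.1),
    ← restrict_Ioo_eq_restrict_Ioc, ← restrict_Ioo_eq_restrict_Ioc]
  simp [halfPeriod, one_add_one_eq_two]

theorem volume_restrict_halfPeriod_absolutelyContinuous (j : Fin 2) :
    volume.restrict (halfPeriod j) ≪ floquetMeasure := by
  refine Measure.AbsolutelyContinuous.mk fun N hN h0 => ?_
  rw [← lintegral_indicator_one hN, lintegral_floquetMeasure, Finset.sum_eq_zero_iff] at h0
  have h1 := (mul_eq_zero.1 (h0 j (Finset.mem_univ j))).resolve_left (by simp [Real.pi_pos])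
  rwa [lintegral_indicator_one hN] at h1

/-- Parseval's identity for a complete orthogonal family. -/
theorem tsum_enorm_inner_sq {ι X : Type*} [NormedAddCommGroup X] [InnerProductSpace ℂ X]
    [CompleteSpace X] {v : ι → X} (hv : Orthonormal ℂ v)
    (hv' : ∀ g, (∀ i, inner ℂ (v i) g = 0) → g = 0) (x : X) :
    ∑' i, ‖inner ℂ (v i) x‖ₑ ^ 2 = ‖x‖ₑ ^ 2 := by
  have hbot : (Submodule.span ℂ (range v))ᗮ = ⊥ := by
    rw [Submodule.eq_bot_iff]
    exact fun g hg => hv' g fun i =>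
      (Submodule.mem_orthogonal _ _).1 hg _ (Submodule.subset_span ⟨i, rfl⟩)
  have h1 := (HilbertBasis.mkOfOrthogonalEqBot hv hbot).hasSum_inner_mul_inner x x
  rw [HilbertBasis.coe_mkOfOrthogonalEqBot] at h1
  have h2 : HasSum (fun i => ‖inner ℂ (v i) x‖ ^ 2) (‖x‖ ^ 2) := by
    have h3 := Complex.hasSum_re h1
    have e : ∀ i, (inner ℂ x (v i) * inner ℂ (v i) x).re = ‖inner ℂ (v i) x‖ ^ 2 := by
      intro i
      rw [← inner_conj_symm x, Complex.conj_mul']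
      exact_mod_cast rfl
    simp only [e] at h3
    rw [inner_self_eq_norm_sq_to_K] at h3
    convert h3 using 1
    exact_mod_cast rfl
  simp only [ofReal_sq_norm]
  rw [← ENNReal.ofReal_tsum_of_nonneg (fun i => by positivity) h2.summable, h2.tsum_eq]

/-- Eigenvalue bands of a direct integral over the quasi-momentum `τ ∈ [0, 2π]`. Each of the
disjoint bands `(a i, b i)` is mapped by the quasi-momentum `θ j` bijectively to the `j`-th half
period; the eigenvectors `E j s` with `θ j s = τ`, one for each band, are a complete orthogonal
family. -/
structure BandSystem {ι X : Type*} [NormedAddCommGroup X] [InnerProductSpace ℂ X]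
    (a b : ι → ℝ) (θ : Fin 2 → ℝ → ℝ) (E : Fin 2 → ℝ → X) : Prop where
  disjoint : Pairwise (Function.onFun Disjoint fun i => Ioo (a i) (b i))
  continuous_theta : ∀ j, Continuous (θ j)
  bijOn : ∀ j i, BijOn (θ j) (Ioo (a i) (b i)) (halfPeriod j)
  exists_deriv : ∀ j i, ∀ s ∈ Ioo (a i) (b i), ∃ D : ℝ, D ≠ 0 ∧ HasDerivAt (θ j) D s
  continuous_vec : ∀ j, Continuous (E j)
  ne_zero : ∀ j i, ∀ s ∈ Ioo (a i) (b i), E j s ≠ 0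
  orthogonal : ∀ j i k, i ≠ k → ∀ s ∈ Ioo (a i) (b i), ∀ t ∈ Ioo (a k) (b k), θ j s = θ j t →
    inner ℂ (E j s) (E j t) = 0
  total : ∀ j, ∀ τ ∈ halfPeriod j, ∀ g : X,
    (∀ i, ∀ s ∈ Ioo (a i) (b i), θ j s = τ → inner ℂ (E j s) g = 0) → g = 0

namespace BandSystem

variable {ι X : Type*} [NormedAddCommGroup X] [InnerProductSpace ℂ X]
  {a b : ι → ℝ} {θ : Fin 2 → ℝ → ℝ} {E : Fin 2 → ℝ → X}

/-- The normalized eigenvectors. -/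
def unit (E : Fin 2 → ℝ → X) (j : Fin 2) (s : ℝ) : X := ((‖E j s‖⁻¹ : ℝ) : ℂ) • E j s

/-- The generalized Fourier coefficient at the spectral parameter `s`. -/
def coef (θ : Fin 2 → ℝ → ℝ) (E : Fin 2 → ℝ → X) (j : Fin 2) (F : ℝ → X) (s : ℝ) : ℂ :=
  (Real.sqrt (|deriv (θ j) s| * (2 * Real.pi)⁻¹) : ℂ) * inner ℂ (unit E j s) (F (θ j s))

theorem hasDerivAt (h : BandSystem a b θ E) (j : Fin 2) {i : ι} {s : ℝ}
    (hs : s ∈ Ioo (a i) (b i)) : HasDerivAt (θ j) (deriv (θ j) s) s ∧ deriv (θ j) s ≠ 0 := by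
  obtain ⟨D, hD, hD'⟩ := h.exists_deriv j i s hs
  rw [hD'.deriv]
  exact ⟨hD', hD⟩

theorem lintegral_halfPeriod (h : BandSystem a b θ E) (j : Fin 2) (i : ι) (g : ℝ → ℝ≥0∞) :
    ∫⁻ τ in halfPeriod j, g τ =
      ∫⁻ s in Ioo (a i) (b i), ENNReal.ofReal |deriv (θ j) s| * g (θ j s) := by
  rw [← (h.bijOn j i).image_eq]
  exact lintegral_image_eq_lintegral_abs_deriv_mul measurableSet_Ioo
    (fun s hs => (h.hasDerivAt j hs).1.hasDerivWithinAt) (h.bijOn j i).injOn g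

theorem exists_measurable_inverse (h : BandSystem a b θ E) (j : Fin 2) (i : ι) :
    ∃ σ : ℝ → ℝ, Measurable σ ∧ ∀ s ∈ Ioo (a i) (b i), σ (θ j s) = s := by
  have h1 := (h.continuous_theta j).continuousOn.measurableEmbedding
    (measurableSet_Ioo (a := a i) (b := b i)) (h.bijOn j i).injOn
  obtain ⟨σ, hσ, hσ'⟩ := h1.exists_measurable_extend (g := Subtype.val) measurable_subtype_coe
    fun _ => ⟨0⟩
  exact ⟨σ, hσ, fun s hs => congrFun hσ' ⟨s, hs⟩⟩

theorem norm_unit (h : BandSystem a b θ E) (j : Fin 2) {i : ι} {s : ℝ}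
    (hs : s ∈ Ioo (a i) (b i)) : ‖unit E j s‖ = 1 := by
  have h1 := norm_ne_zero_iff.2 (h.ne_zero j i s hs)
  rw [unit, norm_smul, Complex.norm_real, norm_inv, norm_norm, inv_mul_cancel₀ h1]

theorem inner_unit (h : BandSystem a b θ E) (j : Fin 2) {i k : ι} (hik : i ≠ k) {s t : ℝ}
    (hs : s ∈ Ioo (a i) (b i)) (ht : t ∈ Ioo (a k) (b k)) (hst : θ j s = θ j t) :
    inner ℂ (unit E j s) (unit E j t) = 0 := by
  rw [unit, unit, inner_smul_left, inner_smul_right, h.orthogonal j i k hik s hs t ht hst,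
    mul_zero, mul_zero]

theorem parseval [CompleteSpace X] (h : BandSystem a b θ E) (j : Fin 2) {τ : ℝ}
    (hτ : τ ∈ halfPeriod j) {s : ι → ℝ} (hs : ∀ i, s i ∈ Ioo (a i) (b i))
    (hsτ : ∀ i, θ j (s i) = τ) (x : X) :
    ∑' i, ‖inner ℂ (unit E j (s i)) x‖ₑ ^ 2 = ‖x‖ₑ ^ 2 := by
  refine tsum_enorm_inner_sq ⟨fun i => h.norm_unit j (hs i), fun i k hik =>
    h.inner_unit j hik (hs i) (hs k) ((hsτ i).trans (hsτ k).symm)⟩ (fun g hg => ?_) x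
  refine h.total j τ hτ g fun i t ht htτ => ?_
  have e : t = s i := (h.bijOn j i).injOn ht (hs i) (htτ.trans (hsτ i).symm)
  have h1 := hg i
  rw [unit, inner_smul_left, mul_eq_zero] at h1
  rw [e]
  refine h1.resolve_left ?_
  simpa using h.ne_zero j i _ (hs i)

theorem ae_comp [Countable ι] (h : BandSystem a b θ E) (j : Fin 2) {p : ℝ → Prop}
    (hp : ∀ᵐ τ ∂(volume.restrict (halfPeriod j)), p τ) :
    ∀ᵐ s ∂(volume.restrict (⋃ i, Ioo (a i) (b i))), p (θ j s) := by
  rw [ae_restrict_iUnion_iff]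
  intro i
  set N := toMeasurable (volume.restrict (halfPeriod j)) {τ | ¬ p τ} with hN
  have hNm : MeasurableSet N := measurableSet_toMeasurable _ _
  have h0 : ∫⁻ τ in halfPeriod j, N.indicator 1 τ = 0 := by
    rw [lintegral_indicator_one hNm, hN, measure_toMeasurable]
    exact hp
  rw [h.lintegral_halfPeriod j i, lintegral_eq_zero_iff] at h0
  · filter_upwards [h0, ae_restrict_mem measurableSet_Ioo] with s hs hsI
    by_contra hps
    have h1 : θ j s ∈ N := subset_toMeasurable _ _ hps
    have h2 : ENNReal.ofReal |deriv (θ j) s| * N.indicator 1 (θ j s) = 0 := hs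
    rw [indicator_of_mem h1, Pi.one_apply, mul_one, ENNReal.ofReal_eq_zero] at h2
    exact (h.hasDerivAt j hsI).2 (abs_nonpos_iff.1 h2)
  · exact (measurable_deriv _).abs.ennreal_ofReal.mul
      ((measurable_one.indicator hNm).comp (h.continuous_theta j).measurable)

theorem stronglyMeasurable_unit (h : BandSystem a b θ E) (j : Fin 2) :
    StronglyMeasurable (unit E j) :=
  (Complex.measurable_ofReal.comp
    (h.continuous_vec j).norm.measurable.inv).stronglyMeasurable.smul
      (h.continuous_vec j).stronglyMeasurable

theorem stronglyMeasurable_coef (h : BandSystem a b θ E) (j : Fin 2) {F : ℝ → X}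
    (hF : StronglyMeasurable F) : StronglyMeasurable (coef θ E j F) := by
  refine StronglyMeasurable.mul (Measurable.stronglyMeasurable ?_)
    ((h.stronglyMeasurable_unit j).inner (hF.comp_measurable (h.continuous_theta j).measurable))
  exact Complex.measurable_ofReal.comp (((measurable_deriv _).abs.mul_const _).sqrt)

theorem enorm_coef_sq (j : Fin 2) (F : ℝ → X) (s : ℝ) :
    ‖coef θ E j F s‖ₑ ^ 2 = ENNReal.ofReal (2 * Real.pi)⁻¹ *
      (ENNReal.ofReal |deriv (θ j) s| * ‖inner ℂ (unit E j s) (F (θ j s))‖ₑ ^ 2) := by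
  rw [coef, enorm_mul, mul_pow, ofReal_sq_norm, Complex.norm_real, Real.norm_of_nonneg
    (Real.sqrt_nonneg _), Real.sq_sqrt (by positivity), ENNReal.ofReal_mul (abs_nonneg _),
    mul_comm (ENNReal.ofReal _) (ENNReal.ofReal (2 * Real.pi)⁻¹), mul_assoc]

/-- The generalized Fourier coefficients of one half period are square integrable over the bands,
by Parseval's identity in each fiber and the change of variables `τ = θ j s`. -/
theorem lintegral_coef [CompleteSpace X] [Countable ι] (h : BandSystem a b θ E) (j : Fin 2) {F : ℝ → X}
    (hF : StronglyMeasurable F) :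
    ∫⁻ s in ⋃ i, Ioo (a i) (b i), ‖coef θ E j F s‖ₑ ^ 2 =
      ENNReal.ofReal (2 * Real.pi)⁻¹ * ∫⁻ τ in halfPeriod j, ‖F τ‖ₑ ^ 2 := by
  choose σ hσ hσ' using h.exists_measurable_inverse j
  rw [lintegral_iUnion (fun _ => measurableSet_Ioo) h.disjoint]
  have h1 : ∀ i, ∫⁻ s in Ioo (a i) (b i), ‖coef θ E j F s‖ₑ ^ 2 =
      ENNReal.ofReal (2 * Real.pi)⁻¹ *
        ∫⁻ τ in halfPeriod j, ‖inner ℂ (unit E j (σ i τ)) (F τ)‖ₑ ^ 2 := by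
    intro i
    rw [h.lintegral_halfPeriod j i, ← lintegral_const_mul' _ _ ENNReal.ofReal_ne_top]
    refine setLIntegral_congr_fun measurableSet_Ioo fun s hs => ?_
    rw [enorm_coef_sq, hσ' i s hs]
  simp only [h1]
  rw [ENNReal.tsum_mul_left, ← lintegral_tsum]
  · congr 1
    refine setLIntegral_congr_fun (measurableSet_halfPeriod j) fun τ hτ => ?_
    have h2 : ∀ i, σ i τ ∈ Ioo (a i) (b i) ∧ θ j (σ i τ) = τ := by
      intro i
      obtain ⟨s, hs, rfl⟩ := (h.bijOn j i).surjOn hτ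
      rw [hσ' i s hs]
      exact ⟨hs, rfl⟩
    exact h.parseval j hτ (fun i => (h2 i).1) (fun i => (h2 i).2) (F τ)
  · intro i
    exact (((h.stronglyMeasurable_unit j).comp_measurable (hσ i)).inner hF).measurable.enorm.pow_const 2
      |>.aemeasurable

theorem enorm_euclidean_sq (v : EuclideanSpace ℂ (Fin 2)) : ‖v‖ₑ ^ 2 = ∑ j, ‖v j‖ₑ ^ 2 := by
  simp only [ofReal_sq_norm]
  rw [EuclideanSpace.norm_sq_eq, ENNReal.ofReal_sum_of_nonneg fun _ _ => by positivity]

/-- The vector of generalized Fourier coefficients. -/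
def coefVec (θ : Fin 2 → ℝ → ℝ) (E : Fin 2 → ℝ → X) (F : ℝ → X) (s : ℝ) :
    EuclideanSpace ℂ (Fin 2) := WithLp.toLp 2 fun j => coef θ E j F s

theorem stronglyMeasurable_coefVec (h : BandSystem a b θ E) {F : ℝ → X}
    (hF : StronglyMeasurable F) : StronglyMeasurable (coefVec θ E F) :=
  ((WithLp.measurable_toLp 2 _).comp (measurable_pi_iff.2 fun j =>
    (h.stronglyMeasurable_coef j hF).measurable)).stronglyMeasurable

theorem lintegral_coefVec [CompleteSpace X] [Countable ι] (h : BandSystem a b θ E) {F : ℝ → X}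
    (hF : StronglyMeasurable F) :
    ∫⁻ s in ⋃ i, Ioo (a i) (b i), ‖coefVec θ E F s‖ₑ ^ 2 = ∫⁻ τ, ‖F τ‖ₑ ^ 2 ∂floquetMeasure := by
  simp only [enorm_euclidean_sq, coefVec]
  rw [lintegral_floquetMeasure, lintegral_finsetSum]
  · exact Finset.sum_congr rfl fun j _ => h.lintegral_coef j hF
  · intro j _
    exact (h.stronglyMeasurable_coef j hF).measurable.enorm.pow_const 2

theorem memLp_coefVec [CompleteSpace X] [Countable ι] (h : BandSystem a b θ E) (F : Lp X 2 floquetMeasure) :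
    MemLp (coefVec θ E F) 2 (volume.restrict (⋃ i, Ioo (a i) (b i))) := by
  have hF := Lp.stronglyMeasurable F
  rw [memLp_two_iff_lintegral
    (h.stronglyMeasurable_coefVec hF).aestronglyMeasurable,
    h.lintegral_coefVec hF, ← Lp.enorm_sq_eq_lintegral]
  exact ENNReal.pow_lt_top enorm_lt_top

theorem coefVec_congr [Countable ι] (h : BandSystem a b θ E) {F G : ℝ → X} (hFG : F =ᵐ[floquetMeasure] G) :
    coefVec θ E F =ᵐ[volume.restrict (⋃ i, Ioo (a i) (b i))] coefVec θ E G := by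
  have h1 := ae_all_iff.2 fun j =>
    h.ae_comp j ((volume_restrict_halfPeriod_absolutelyContinuous j).ae_le hFG)
  filter_upwards [h1] with s hs
  simp only [coefVec, coef, hs]

/-- The spectral representation: the isometric transform into functions on the bands that takes a
section of the direct integral to its generalized Fourier coefficients. -/
def transform [CompleteSpace X] [Countable ι] (h : BandSystem a b θ E) : Lp X 2 floquetMeasure →ₗᵢ[ℂ]
    Lp (EuclideanSpace ℂ (Fin 2)) 2 (volume.restrict (⋃ i, Ioo (a i) (b i))) where
  toFun F := (h.memLp_coefVec F).toLp
  map_add' F G := by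
    rw [← MemLp.toLp_add, MemLp.toLp_eq_toLp_iff]
    refine (h.coefVec_congr (Lp.coeFn_add F G)).trans (Eventually.of_forall fun s => ?_)
    refine WithLp.ofLp_injective 2 (funext fun j => ?_)
    simp only [coefVec, coef, Pi.add_apply, inner_add_right, mul_add, PiLp.add_apply]
  map_smul' c F := by
    rw [RingHom.id_apply, ← MemLp.toLp_const_smul, MemLp.toLp_eq_toLp_iff]
    refine (h.coefVec_congr (Lp.coeFn_smul c F)).trans (Eventually.of_forall fun s => ?_)
    refine WithLp.ofLp_injective 2 (funext fun j => ?_)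
    simp only [coefVec, coef, Pi.smul_apply, inner_smul_right, PiLp.smul_apply, smul_eq_mul]
    ring
  norm_map' F := by
    have h1 : ‖(h.memLp_coefVec F).toLp‖ₑ ^ 2 = ‖F‖ₑ ^ 2 := by
      rw [Lp.enorm_sq_eq_lintegral, Lp.enorm_sq_eq_lintegral,
        ← h.lintegral_coefVec (Lp.stronglyMeasurable F)]
      refine lintegral_congr_ae ?_
      filter_upwards [(h.memLp_coefVec F).coeFn_toLp] with s hs
      rw [hs]
    rw [ofReal_sq_norm, ofReal_sq_norm, ENNReal.ofReal_eq_ofReal_iff (by positivity)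
      (by positivity)] at h1
    exact (pow_left_inj₀ (norm_nonneg _) (norm_nonneg _) two_ne_zero).1 h1

theorem coeFn_transform [CompleteSpace X] [Countable ι] (h : BandSystem a b θ E) (F : Lp X 2 floquetMeasure) :
    h.transform F =ᵐ[volume.restrict (⋃ i, Ioo (a i) (b i))] coefVec θ E F :=
  (h.memLp_coefVec F).coeFn_toLp

/-- The section of the direct integral that is carried by one band and one half period and has
prescribed Fourier coefficients there. -/
theorem exists_transform_eq [CompleteSpace X] [Countable ι] (h : BandSystem a b θ E) (j : Fin 2) (i : ι)
    (H : Lp (EuclideanSpace ℂ (Fin 2)) 2 (volume.restrict (⋃ i, Ioo (a i) (b i)))) :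
    ∃ F : Lp X 2 floquetMeasure, ∀ᵐ s ∂(volume.restrict (⋃ i, Ioo (a i) (b i))), ∀ k,
      h.transform F s k = if k = j ∧ s ∈ Ioo (a i) (b i) then H s k else 0 := by
  obtain ⟨σ, hσ, hσ'⟩ := h.exists_measurable_inverse j i
  have hHm := Lp.stronglyMeasurable H
  set κ : ℝ → ℝ := fun s => Real.sqrt (2 * Real.pi / |deriv (θ j) s|) with hκ
  have hκm : Measurable κ := (((measurable_deriv _).abs.const_div _).sqrt)
  set G : ℝ → X := fun s => ((κ s : ℂ) * H s j) • unit E j s with hG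
  have hGm : StronglyMeasurable G := by
    refine ((Complex.measurable_ofReal.comp hκm).stronglyMeasurable.mul ?_).smul
      (h.stronglyMeasurable_unit j)
    exact (PiLp.continuous_apply 2 _ j).comp_stronglyMeasurable hHm
  set F : ℝ → X := (halfPeriod j).indicator fun τ => G (σ τ) with hF
  have hFm : StronglyMeasurable F :=
    (hGm.comp_measurable hσ).indicator (measurableSet_halfPeriod j)
  have hFθ : ∀ s ∈ Ioo (a i) (b i), F (θ j s) = G s := fun s hs => by
    rw [hF, indicator_of_mem ((h.bijOn j i).mapsTo hs), hσ' s hs]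
  -- for `s` in the band, `|θ'| * κ ^ 2 = 2 * π`
  have hκd : ∀ s ∈ Ioo (a i) (b i), |deriv (θ j) s| * κ s ^ 2 = 2 * Real.pi := fun s hs => by
    have h1 := abs_ne_zero.2 (h.hasDerivAt j hs).2
    rw [hκ]
    simp only
    rw [Real.sq_sqrt (by positivity)]
    field_simp
  have hFL : MemLp F 2 floquetMeasure := by
    rw [memLp_two_iff_lintegral hFm.aestronglyMeasurable, lintegral_floquetMeasure]
    refine ENNReal.sum_lt_top.2 fun k _ => ENNReal.mul_lt_top ENNReal.ofReal_lt_top ?_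
    by_cases hk : k = j
    · rw [hk, h.lintegral_halfPeriod j i]
      calc _ = ∫⁻ s in Ioo (a i) (b i), ENNReal.ofReal (2 * Real.pi) * ‖H s j‖ₑ ^ 2 := by
            refine setLIntegral_congr_fun measurableSet_Ioo fun s hs => ?_
            simp only
            rw [hFθ s hs, ofReal_sq_norm, hG, norm_smul, h.norm_unit j hs, mul_one, norm_mul,
              Complex.norm_real, mul_pow, Real.norm_eq_abs, sq_abs, ← ENNReal.ofReal_mul (abs_nonneg _),
              ← mul_assoc, hκd s hs, ENNReal.ofReal_mul (by positivity), ofReal_sq_norm]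
        _ ≤ ∫⁻ s in ⋃ i, Ioo (a i) (b i), ENNReal.ofReal (2 * Real.pi) * ‖H s‖ₑ ^ 2 := by
            refine (lintegral_mono_set (subset_iUnion (fun i => Ioo (a i) (b i)) i)).trans
              (lintegral_mono fun s => ?_)
            rw [enorm_euclidean_sq (H s)]
            refine mul_le_mul_right ?_ _
            exact Finset.single_le_sum (f := fun j => ‖H s j‖ₑ ^ 2) (fun _ _ => zero_le)
              (Finset.mem_univ j)
        _ < ∞ := by
            rw [lintegral_const_mul' _ _ ENNReal.ofReal_ne_top, ← Lp.enorm_sq_eq_lintegral]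
            exact ENNReal.mul_lt_top ENNReal.ofReal_lt_top (ENNReal.pow_lt_top enorm_lt_top)
    · rw [setLIntegral_congr_fun (g := fun _ => 0) (measurableSet_halfPeriod k) fun τ hτ => by
        simp [hF, indicator_of_notMem (notMem_halfPeriod hk hτ)]]
      simp
  refine ⟨hFL.toLp, ?_⟩
  filter_upwards [(h.coeFn_transform hFL.toLp).trans (h.coefVec_congr hFL.coeFn_toLp),
    ae_restrict_mem (MeasurableSet.iUnion fun _ => measurableSet_Ioo)] with s hs hsU k
  rw [hs]
  change coef θ E k F s = _
  obtain ⟨m, hm⟩ := mem_iUnion.1 hsU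
  have hkm := (h.bijOn k m).mapsTo hm
  by_cases hk : k = j
  · subst hk
    by_cases him : m = i
    · subst him
      rw [if_pos ⟨rfl, hm⟩, coef, hFθ s hm, hG, inner_smul_right, inner_self_eq_norm_sq_to_K,
        h.norm_unit k hm]
      have h1 : Real.sqrt (|deriv (θ k) s| * (2 * Real.pi)⁻¹) * κ s = 1 := by
        rw [hκ]
        simp only
        rw [← Real.sqrt_mul (by positivity), Real.sqrt_eq_one]
        have h2 := abs_ne_zero.2 (h.hasDerivAt k hm).2
        have h3 := Real.pi_ne_zero
        field_simp
      have h2 : (Real.sqrt (|deriv (θ k) s| * (2 * Real.pi)⁻¹) : ℂ) * κ s = 1 := by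
        exact_mod_cast h1
      simp only [RCLike.ofReal_one, one_pow, mul_one]
      rw [← mul_assoc, h2, one_mul]
    · have hs' : s ∉ Ioo (a i) (b i) := fun hsi =>
        Set.disjoint_left.1 (h.disjoint him) hm hsi
      rw [if_neg fun hc => hs' hc.2]
      obtain ⟨t, ht, hts⟩ := (h.bijOn k i).surjOn hkm
      rw [coef, ← hts, hFθ t ht, hG, inner_smul_right, h.inner_unit k him hm ht hts.symm]
      simp
  · rw [if_neg fun hc => hk hc.1, coef, hF, indicator_of_notMem (notMem_halfPeriod hk hkm),
      inner_zero_right, mul_zero]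

/-- An element orthogonal to the range is orthogonal to the transforms of sections carried by one band
and one half period, hence vanishes there. -/
theorem surjective_transform [CompleteSpace X] [Countable ι] (h : BandSystem a b θ E) :
    Function.Surjective h.transform := by
  have hcl : IsClosed (LinearMap.range h.transform.toLinearMap :
      Set (Lp (EuclideanSpace ℂ (Fin 2)) 2 (volume.restrict (⋃ i, Ioo (a i) (b i))))) :=
    h.transform.isometry.isClosedEmbedding.isClosed_range
  have htop : LinearMap.range h.transform.toLinearMap = ⊤ := by
    rw [← hcl.submodule_topologicalClosure_eq, Submodule.topologicalClosure_eq_top_iff,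
      Submodule.eq_bot_iff]
    intro H hH
    have key : ∀ j i, ∀ᵐ s ∂(volume.restrict (⋃ i, Ioo (a i) (b i))),
        s ∈ Ioo (a i) (b i) → H s j = 0 := by
      intro j i
      obtain ⟨F, hF⟩ := h.exists_transform_eq j i H
      have h1 : inner ℂ (h.transform F) H = 0 := (Submodule.mem_orthogonal _ _).1 hH _ ⟨F, rfl⟩
      have h2 : inner ℂ (h.transform F) (h.transform F) = inner ℂ (h.transform F) H := by
        rw [L2.inner_def, L2.inner_def]
        refine integral_congr_ae ?_
        filter_upwards [hF] with s hs
        simp only [PiLp.inner_apply, hs]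
        refine Finset.sum_congr rfl fun k _ => ?_
        split_ifs with hc
        · rfl
        · simp
      rw [h1, inner_self_eq_zero (𝕜 := ℂ), Lp.eq_zero_iff_ae_eq_zero] at h2
      filter_upwards [hF, h2] with s h3 h4 hs
      have h5 := h3 j
      rw [if_pos ⟨rfl, hs⟩, h4] at h5
      exact h5.symm
    rw [Lp.eq_zero_iff_ae_eq_zero]
    filter_upwards [ae_all_iff.2 fun j => ae_all_iff.2 (key j),
      ae_restrict_mem (MeasurableSet.iUnion fun _ => measurableSet_Ioo)] with s hs hsU
    obtain ⟨i, hi⟩ := mem_iUnion.1 hsU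
    exact WithLp.ofLp_injective 2 (funext fun j => hs j i hi)
  exact LinearMap.range_eq_top.1 htop

/-- A self-adjoint operator whose direct integral decomposition has the eigenvectors of a band
system, with the spectral parameter as eigenvalue, is multiplication by the spectral parameter on
the bands, with multiplicity two. -/
theorem exists_intertwines [CompleteSpace X] [Countable ι] (h : BandSystem a b θ E) {𝓗 : Type*}
    [NormedAddCommGroup 𝓗] [InnerProductSpace ℂ 𝓗] [CompleteSpace 𝓗] {T : 𝓗 →ₗ.[ℂ] 𝓗}
    (hT : IsSelfAdjoint T) (V : 𝓗 ≃ₗᵢ[ℂ] Lp X 2 floquetMeasure)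
    (heig : ∀ f g, (f, g) ∈ T.graph → ∀ᵐ τ ∂floquetMeasure, ∀ j i, ∀ s ∈ Ioo (a i) (b i),
      θ j s = τ → inner ℂ (E j s) (V g τ) = s * inner ℂ (E j s) (V f τ)) :
    ∃ U : 𝓗 ≃ₗᵢ[ℂ] Lp (EuclideanSpace ℂ (Fin 2)) 2 (volume.restrict (⋃ i, Ioo (a i) (b i))),
      Intertwines U T (mulOp 2 (volume.restrict (⋃ i, Ioo (a i) (b i)))) := by
  set U := V.trans (LinearIsometryEquiv.ofSurjective h.transform h.surjective_transform) with hU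
  have hUapp : ∀ f, U f = h.transform (V f) := fun _ => rfl
  have hforward : ∀ f g, (f, g) ∈ T.graph →
      ∀ᵐ s ∂(volume.restrict (⋃ i, Ioo (a i) (b i))), U g s = (s : ℂ) • U f s := by
    intro f g hfg
    have h1 := ae_all_iff.2 fun j => h.ae_comp j
      ((volume_restrict_halfPeriod_absolutelyContinuous j).ae_le (heig f g hfg))
    rw [hUapp, hUapp]
    filter_upwards [h1, h.coeFn_transform (V f), h.coeFn_transform (V g),
      ae_restrict_mem (MeasurableSet.iUnion fun _ => measurableSet_Ioo)] with s e1 e2 e3 hsU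
    obtain ⟨i, hi⟩ := mem_iUnion.1 hsU
    rw [e2, e3]
    refine WithLp.ofLp_injective 2 (funext fun j => ?_)
    have e4 := e1 j j i s hi rfl
    change coef θ E j (V g) s = (s : ℂ) * coef θ E j (V f) s
    rw [coef, coef, unit, inner_smul_left, inner_smul_left, e4]
    ring
  refine ⟨U, fun f g => ⟨fun hfg => mem_graph_mulOp.2 (hforward f g hfg), fun hfg => ?_⟩⟩
  rw [mem_graph_mulOp] at hfg
  refine hT.mem_graph_of_forall_inner fun k l hkl => ?_
  rw [← U.inner_map_map l f, ← U.inner_map_map k g, L2.inner_def, L2.inner_def]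
  refine integral_congr_ae ?_
  filter_upwards [hforward k l hkl, hfg] with s e1 e2
  rw [e1, e2, inner_smul_left, inner_smul_right, Complex.conj_ofReal]

end BandSystem

/-! ### Unions of bands -/

section Bands

variable {ι : Type*} {a b : ι → ℝ}

theorem support_restrict_of_isOpen {U : Set ℝ} (hU : IsOpen U) :
    ((volume : Measure ℝ).restrict U).support = closure U := by
  ext x
  rw [Measure.mem_support_iff_forall, mem_closure_iff_nhds]
  constructor
  · intro h N hN
    have h1 := h N hN
    by_contra h0
    rw [Measure.restrict_apply' hU.measurableSet, not_nonempty_iff_eq_empty.1 h0,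
      measure_empty] at h1
    exact lt_irrefl _ h1
  · intro h N hN
    obtain ⟨W, hWN, hW, hxW⟩ := mem_nhds_iff.1 hN
    rw [Measure.restrict_apply' hU.measurableSet]
    exact ((hW.inter hU).measure_pos volume (h W (hW.mem_nhds hxW))).trans_le
      (measure_mono (inter_subset_inter_left _ hWN))

/-- A locally finite union of bands has the union of the closed bands as its closure. -/
theorem support_restrict_iUnion_Ioo (hab : ∀ n, a n < b n)
    (hfin : ∀ x y, {n | a n < y ∧ x < b n}.Finite) :
    ((volume : Measure ℝ).restrict (⋃ n, Ioo (a n) (b n))).support = ⋃ n, Icc (a n) (b n) := by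
  have hloc : LocallyFinite fun n => Ioo (a n) (b n) := by
    intro x
    refine ⟨Ioo (x - 1) (x + 1), Ioo_mem_nhds (by linarith) (by linarith),
      (hfin (x - 1) (x + 1)).subset ?_⟩
    rintro n ⟨y, h1, h2⟩
    exact ⟨h1.1.trans h2.2, h2.1.trans h1.2⟩
  rw [support_restrict_of_isOpen (isOpen_iUnion fun _ => isOpen_Ioo), hloc.closure_iUnion]
  exact iUnion_congr fun n => closure_Ioo (hab n).ne

theorem disjoint_bands [LinearOrder ι] [SuccOrder ι] (ha : Monotone a)
    (hb : ∀ n, b n ≤ a (Order.succ n)) :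
    Pairwise (Function.onFun Disjoint fun n => Ioo (a n) (b n)) :=
  ha.pairwise_disjoint_on_Ioo_succ.mono fun m n h =>
    h.mono (Ioo_subset_Ioo_right (hb m)) (Ioo_subset_Ioo_right (hb n))

theorem finite_bands_nat {a b : ℕ → ℝ} (ha : Tendsto a atTop atTop) (x y : ℝ) :
    {n | a n < y ∧ x < b n}.Finite := by
  have h1 : ∀ᶠ n in cofinite, ¬(a n < y ∧ x < b n) := by
    rw [Nat.cofinite_eq_atTop]
    filter_upwards [ha.eventually_ge_atTop y] with n hn h
    exact hn.not_gt h.1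
  simpa only [not_not] using eventually_cofinite.1 h1

theorem finite_bands_int {a b : ℤ → ℝ} (hb : ∀ n, b n ≤ a (n + 1)) (ha : Tendsto a atTop atTop)
    (ha' : Tendsto a atBot atBot) (x y : ℝ) : {n | a n < y ∧ x < b n}.Finite := by
  have h1 : ∀ᶠ n in cofinite, ¬(a n < y ∧ x < b n) := by
    rw [Int.cofinite_eq, eventually_sup]
    constructor
    · filter_upwards [(ha'.comp (tendsto_atBot_add_const_right _ 1 tendsto_id)).eventually_le_atBot
        x] with n hn h
      exact (h.2.trans_le (hb n)).not_ge hn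
    · filter_upwards [ha.eventually_ge_atTop y] with n hn h
      exact hn.not_gt h.1
  simpa only [not_not] using eventually_cofinite.1 h1

end Bands

/-- An operator that is multiplication by the independent variable on a locally finite union of
bands, with multiplicity two, has purely absolutely continuous spectrum, which is the closure of the
union. -/
theorem Intertwines.spectral_consequences {ι 𝓗 : Type*} [NormedAddCommGroup 𝓗]
    [InnerProductSpace ℂ 𝓗] [CompleteSpace 𝓗] {a b : ι → ℝ} (hab : ∀ n, a n < b n)
    (hfin : ∀ x y, {n | a n < y ∧ x < b n}.Finite) {T : 𝓗 →ₗ.[ℂ] 𝓗}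
    {U : 𝓗 ≃ₗᵢ[ℂ] Lp (EuclideanSpace ℂ (Fin 2)) 2 (volume.restrict (⋃ i, Ioo (a i) (b i)))}
    (hU : Intertwines U T (mulOp 2 (volume.restrict (⋃ i, Ioo (a i) (b i))))) :
    pointSpectrum T = ∅ ∧ scSpectrum T = ∅ ∧ IsPurelyAC T ∧ HasUniformMultiplicity T 2 ∧
      opSpectrum T = (fun t : ℝ => (t : ℂ)) '' ⋃ n, Icc (a n) (b n) := by
  have hμ : (volume : Measure ℝ).restrict (⋃ i, Ioo (a i) (b i)) ≪ volume :=
    Measure.absolutelyContinuous_of_le Measure.restrict_le_self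
  refine ⟨hU.pointSpectrum_eq_empty hμ, hU.scSpectrum_eq_empty hμ, hU.isPurelyAC hμ,
    ⟨_, inferInstance, U, hU⟩, ?_⟩
  rw [hU.opSpectrum_eq, support_restrict_iUnion_Ioo hab hfin]

/-! ### The Floquet transform of a single function -/

section LineFloquet

variable {ω : ℝ}

theorem isHilbertSum_cellShift_line (hω : 0 < ω) :
    IsHilbertSum ℂ (fun _ : ℤ => L2Cell ω) (cellShift ω) := by
  refine isHilbertSum_of_forall_inner (fun m n hmn g h => ?_) fun f hf => ?_
  · rw [inner_cellShift, cellPart_cellShift hω hmn, inner_zero_right]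
  · refine eq_zero_of_cellPart hω fun n => ext_inner_left ℂ fun g => ?_
    rw [← inner_cellShift, hf n g, inner_zero_right]

/-- The Floquet transform on `L²(ℝ)`. -/
def lineFloquetEquiv (hω : 0 < ω) : L2Line ≃ₗᵢ[ℂ] Lp (L2Cell ω) 2 floquetMeasure :=
  (isHilbertSum_cellShift_line hω).linearIsometryEquiv.trans
    isHilbertSum_floquetMode.linearIsometryEquiv.symm

theorem hasSum_lineFloquetEquiv (hω : 0 < ω) (f : L2Line) :
    HasSum (fun n : ℤ => floquetMode _ n (cellPart ω n f)) (lineFloquetEquiv hω f) := by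
  have h := isHilbertSum_floquetMode.hasSum_linearIsometryEquiv_symm
    ((isHilbertSum_cellShift_line hω).linearIsometryEquiv f)
  have hc : ∀ n : ℤ, (isHilbertSum_cellShift_line hω).linearIsometryEquiv f n =
      cellPart ω n f := by
    intro n
    refine ext_inner_left ℂ fun g => ?_
    rw [← (isHilbertSum_cellShift_line hω).inner_eq, inner_cellShift]
  simp only [hc] at h
  exact h

/-- Bounded operators on the fibers that intertwine the cell decompositions intertwine the Floquet
transforms. -/
theorem ae_map_floquetEquiv (hω : 0 < ω) (f : WithLp 2 (L2Line × L2Line)) (g : L2Line)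
    (P : WithLp 2 (L2Cell ω × L2Cell ω) →L[ℂ] L2Cell ω)
    (hP : ∀ n, P (WithLp.toLp 2 (cellPart ω n f.fst, cellPart ω n f.snd)) = cellPart ω n g) :
    ∀ᵐ τ ∂floquetMeasure, lineFloquetEquiv hω g τ = P (floquetEquiv hω f τ) := by
  have h1 := (hasSum_floquetEquiv hω f).mapL (P.compLpL 2 floquetMeasure)
  have e : ∀ n : ℤ, P.compLpL 2 floquetMeasure (floquetMode _ n
      (WithLp.toLp 2 (cellPart ω n f.fst, cellPart ω n f.snd))) =
        floquetMode _ n (cellPart ω n g) := by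
    intro n
    refine Lp.ext ?_
    filter_upwards [P.coeFn_compLpL (floquetMode _ n
      (WithLp.toLp 2 (cellPart ω n f.fst, cellPart ω n f.snd))), coeFn_floquetMode n
      (WithLp.toLp 2 (cellPart ω n f.fst, cellPart ω n f.snd)),
      coeFn_floquetMode n (cellPart ω n g)] with τ e1 e2 e3
    rw [e1, e2, e3, map_smul, hP]
  simp only [e] at h1
  rw [(hasSum_lineFloquetEquiv hω g).unique h1]
  exact P.coeFn_compLpL _

theorem ae_floquetEquiv (hω : 0 < ω) (f : WithLp 2 (L2Line × L2Line)) :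
    ∀ᵐ τ ∂floquetMeasure, (floquetEquiv hω f τ).fst = lineFloquetEquiv hω f.fst τ ∧
      (floquetEquiv hω f τ).snd = lineFloquetEquiv hω f.snd τ := by
  filter_upwards [ae_map_floquetEquiv hω f f.fst (WithLp.fstL 2 ℂ _ _) fun n => rfl,
    ae_map_floquetEquiv hω f f.snd (WithLp.sndL 2 ℂ _ _) fun n => rfl] with τ h1 h2
  exact ⟨h1.symm, h2.symm⟩

end LineFloquet

/-- A jointly continuous function defines a continuous curve in `L²([0, ω])`. -/
theorem continuous_toLp_cell {ω : ℝ} {f : ℝ → ℝ → ℂ} (hf : Continuous fun p : ℝ × ℝ => f p.1 p.2)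
    (hm : ∀ s, MemLp (f s) 2 (volume.restrict (Icc 0 ω))) :
    Continuous fun s => (hm s).toLp := by
  rw [continuous_iff_continuousAt]
  intro t
  rw [ContinuousAt, tendsto_iff_norm_sub_tendsto_zero]
  set M : ℝ := measureUnivNNReal (volume.restrict (Icc 0 ω)) ^ (2 : ℝ≥0∞).toReal⁻¹ with hM
  have hM0 : 0 ≤ M := by positivity
  rw [Metric.tendsto_nhds]
  intro ε hε
  obtain ⟨v, hv, hv'⟩ := isCompact_Icc.mem_uniformity_of_prod (k := Icc 0 ω) (s := univ) (q := t)
    (f := f) hf.continuousOn (mem_univ t) (Metric.dist_mem_uniformity (ε := ε / (M + 1))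
      (by positivity))
  rw [nhdsWithin_univ] at hv
  filter_upwards [hv] with s hs
  have h1 : ‖(hm s).toLp - (hm t).toLp‖ ≤ M * (ε / (M + 1)) := by
    refine Lp.norm_le_of_ae_bound (by positivity) ?_
    filter_upwards [Lp.coeFn_sub (hm s).toLp (hm t).toLp, (hm s).coeFn_toLp, (hm t).coeFn_toLp,
      ae_restrict_mem measurableSet_Icc] with x e1 e2 e3 hx
    rw [e1, Pi.sub_apply, e2, e3, ← dist_eq_norm]
    exact (hv' s hs x hx).le
  rw [dist_zero_right, norm_norm]
  refine h1.trans_lt ?_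
  rw [← mul_div_assoc, div_lt_iff₀ (by positivity)]
  nlinarith

/-! ### Spectral representation of the periodic operators -/

/-- The quasi-momentum in the `j`-th half period that is obtained from `κ ∈ (0, π)`. -/
def foldedMomentum (κ : ℝ → ℝ) (j : Fin 2) (s : ℝ) : ℝ := if j = 0 then κ s else 2 * Real.pi - κ s

section Folded

variable {κ : ℝ → ℝ} {j : Fin 2}

theorem foldedMomentum_zero (κ : ℝ → ℝ) : foldedMomentum κ 0 = κ := rfl

theorem continuous_foldedMomentum (h : Continuous κ) (j : Fin 2) :
    Continuous (foldedMomentum κ j) := by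
  fin_cases j
  · exact h
  · exact continuous_const.sub h

theorem cos_foldedMomentum (s : ℝ) : Real.cos (foldedMomentum κ j s) = Real.cos (κ s) := by
  fin_cases j <;> simp [foldedMomentum, Real.cos_two_pi_sub]

theorem bijOn_foldedMomentum {S : Set ℝ} (h : BijOn κ S (Ioo 0 Real.pi)) (j : Fin 2) :
    BijOn (foldedMomentum κ j) S (halfPeriod j) := by
  fin_cases j
  · simpa [halfPeriod, foldedMomentum_zero] using h
  · have h1 : BijOn (fun τ => 2 * Real.pi - τ) (Ioo 0 Real.pi) (halfPeriod 1) := by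
      refine ⟨fun τ hτ => ?_, fun τ _ τ' _ h => by simpa using h, fun τ hτ =>
        ⟨2 * Real.pi - τ, ?_, sub_sub_cancel _ _⟩⟩
      · simp only [halfPeriod, Fin.val_one, Nat.cast_one, mem_Ioo] at hτ ⊢
        constructor <;> linarith
      · simp only [halfPeriod, Fin.val_one, Nat.cast_one, mem_Ioo] at hτ ⊢
        constructor <;> linarith
    exact h1.comp h

theorem exists_hasDerivAt_foldedMomentum {s : ℝ} (h : ∃ D : ℝ, D ≠ 0 ∧ HasDerivAt κ D s)
    (j : Fin 2) : ∃ D : ℝ, D ≠ 0 ∧ HasDerivAt (foldedMomentum κ j) D s := by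
  obtain ⟨D, hD, hD'⟩ := h
  fin_cases j
  · exact ⟨D, hD, hD'⟩
  · exact ⟨-D, neg_ne_zero.2 hD, hD'.const_sub (2 * Real.pi)⟩

theorem sin_ne_zero_of_mem_halfPeriod {τ : ℝ} (h : τ ∈ halfPeriod j) : Real.sin τ ≠ 0 := by
  fin_cases j
  · simp only [halfPeriod, mem_Ioo] at h
    norm_num at h
    exact (Real.sin_pos_of_pos_of_lt_pi h.1 h.2).ne'
  · simp only [halfPeriod, mem_Ioo] at h
    norm_num at h
    have := Real.sin_pos_of_pos_of_lt_pi (x := τ - Real.pi) (by linarith) (by linarith)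
    rw [Real.sin_sub_pi] at this
    linarith

end Folded

namespace FundamentalSystem

variable {φ : ℝ → ℝ} {ω : ℝ} (Φ : FundamentalSystem φ) {j : Fin 2}

theorem disc_eq_foldedMomentum {s : ℝ} (h : Φ.quasi ω s ∈ Ioo 0 Real.pi) :
    Φ.disc ω s = 2 * Real.cos (foldedMomentum (Φ.quasi ω) j s) := by
  rw [cos_foldedMomentum]
  exact Φ.disc_eq_of_quasi_eq h rfl

/-- The points where the discriminant is `2 cos τ` lie in the bands and have quasi-momentum `τ`. -/
theorem foldedMomentum_eq {s τ : ℝ} (hτ : τ ∈ halfPeriod j) (h : Φ.disc ω s = 2 * Real.cos τ) :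
    Φ.quasi ω s ∈ Ioo 0 Real.pi ∧ foldedMomentum (Φ.quasi ω) j s = τ := by
  fin_cases j
  · have h1 : τ ∈ Ioo 0 Real.pi := by simpa [halfPeriod] using hτ
    have h2 := Φ.quasi_eq_of_disc_eq (Ioo_subset_Icc_self h1) h
    exact ⟨h2 ▸ h1, by simpa [foldedMomentum] using h2⟩
  · simp only [halfPeriod, Nat.cast_one, mem_Ioo] at hτ
    have h1 : 2 * Real.pi - τ ∈ Ioo 0 Real.pi := ⟨by linarith, by linarith⟩
    rw [← Real.cos_two_pi_sub] at h
    have h2 := Φ.quasi_eq_of_disc_eq (Ioo_subset_Icc_self h1) h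
    exact ⟨h2 ▸ h1, by simp [foldedMomentum, h2]⟩

theorem quasi_neg (s : ℝ) : Φ.quasi ω (-s) = Φ.quasi ω s := by rw [quasi, quasi, disc_neg]

theorem cellU_neg (s τ : ℝ) : Φ.cellU ω (-s) τ = -Φ.cellU ω s τ := by
  refine Lp.ext ?_
  filter_upwards [Φ.coeFn_cellU (-s) τ, Φ.coeFn_cellU s τ, Lp.coeFn_neg (Φ.cellU ω s τ)]
    with x e1 e2 e3
  rw [e1, e3, Pi.neg_apply, e2]
  simp only [blochU, (Φ.neg_param s _).1, (Φ.neg_param s _).2.2.1]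
  push_cast
  ring

theorem cellV_neg (s τ : ℝ) : Φ.cellV ω (-s) τ = Φ.cellV ω s τ := by
  refine Lp.ext ?_
  filter_upwards [Φ.coeFn_cellV (-s) τ, Φ.coeFn_cellV s τ] with x e1 e2
  rw [e1, e2]
  simp only [blochV, (Φ.neg_param s _).1, (Φ.neg_param s _).2.1, (Φ.neg_param s _).2.2.1,
    (Φ.neg_param s _).2.2.2]
  push_cast
  ring

theorem continuous_cellU {ρ τ : ℝ → ℝ} (hρ : Continuous ρ) (hτ : Continuous τ) :
    Continuous fun s => Φ.cellU ω (ρ s) (τ s) :=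
  continuous_toLp_cell (f := fun s x => Φ.blochU ω (ρ s) (τ s) x)
    (Φ.continuous_blochU (hρ.comp continuous_fst) (hτ.comp continuous_fst) continuous_snd) _

theorem continuous_cellV {ρ τ : ℝ → ℝ} (hρ : Continuous ρ) (hτ : Continuous τ) :
    Continuous fun s => Φ.cellV ω (ρ s) (τ s) :=
  continuous_toLp_cell (f := fun s x => Φ.blochV ω (ρ s) (τ s) x)
    (Φ.continuous_blochV (hρ.comp continuous_fst) (hτ.comp continuous_fst) continuous_snd) _

/-- Bloch solutions with the same Floquet multiplier and different spectral parameters are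
orthogonal, as pairs; their first components are orthogonal unless `s = -t`. -/
theorem inner_cellU_add_inner_cellV (hω : 0 < ω) (hφ : MemLp φ 2 (volume.restrict (Icc 0 ω)))
    {s t τ : ℝ} (hst : s ≠ t) (hs : Φ.disc ω s = 2 * Real.cos τ)
    (ht : Φ.disc ω t = 2 * Real.cos τ) :
    inner ℂ (Φ.cellU ω s τ) (Φ.cellU ω t τ) + inner ℂ (Φ.cellV ω s τ) (Φ.cellV ω t τ) = 0 ∧
      (s + t : ℂ) * inner ℂ (Φ.cellU ω s τ) (Φ.cellU ω t τ) = 0 := by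
  have h1 := Φ.inner_cell hω hφ (s := s) ht
  have h2 := congrArg (starRingEnd ℂ) (Φ.inner_cell hω hφ (s := t) hs)
  simp only [map_mul, Complex.conj_ofReal, inner_conj_symm] at h2
  have h3 : (s : ℂ) - t ≠ 0 := sub_ne_zero.2 (Complex.ofReal_injective.ne hst)
  have h4 : inner ℂ (Φ.cellU ω s τ) (Φ.cellU ω t τ) +
      inner ℂ (Φ.cellV ω s τ) (Φ.cellV ω t τ) = 0 :=
    (mul_eq_zero.1 (by linear_combination h1 - h2)).resolve_left h3
  have h5 : (s : ℂ) * (2 * inner ℂ (Φ.cellU ω s τ) (Φ.cellU ω t τ)) +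
      t * (2 * inner ℂ (Φ.cellU ω s τ) (Φ.cellU ω t τ)) = 0 := by
    linear_combination (s + t : ℂ) * h4 - h1 - h2
  exact ⟨h4, by linear_combination h5 / 2⟩

/-- The fibers of `D` are symmetric on the Bloch solutions, componentwise. -/
theorem inner_cell_graph (hω : 0 < ω) (hφ : MemLp φ 2 (volume.restrict (Icc 0 ω)))
    {s τ : ℝ} (hs : Φ.disc ω s = 2 * Real.cos τ) {f₁ f₂ h₁ h₂ : L2Cell ω}
    (h1 : (f₁, h₂) ∈ cellGraph ω φ τ) (h2 : (f₂, -h₁) ∈ cellGraph ω (fun x => -φ x) τ) :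
    inner ℂ (Φ.cellU ω s τ) h₁ = s * inner ℂ (Φ.cellV ω s τ) f₂ ∧
      inner ℂ (Φ.cellV ω s τ) h₂ = s * inner ℂ (Φ.cellU ω s τ) f₁ := by
  have e1 := inner_cellGraph hω (Φ.cellU_mem_cellGraph hφ s τ) h2
  have e2 := congrArg (starRingEnd ℂ) (inner_cellGraph hω h1 (Φ.cellV_mem_cellGraph hφ hs))
  rw [inner_smul_left, inner_neg_right, neg_neg, Complex.conj_ofReal] at e1
  rw [inner_smul_right, map_neg, map_mul, map_neg, Complex.conj_ofReal, inner_conj_symm,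
    inner_conj_symm] at e2
  exact ⟨e1.symm, by rw [e2]; ring⟩

/-- The Bloch solutions at `s` and `-s` are a band system for the Dirac operator. -/
theorem bandSystem_dirac (hω : 0 < ω) (hφ : MemLp φ 2 (volume.restrict (Icc 0 ω)))
    {ι : Type*} {a b : ι → ℝ}
    (hdisj : Pairwise (Function.onFun Disjoint fun i => Ioo (a i) (b i)))
    (hbij : ∀ i, BijOn (Φ.quasi ω) (Ioo (a i) (b i)) (Ioo 0 Real.pi))
    (hall : ∀ s, Φ.quasi ω s ∈ Ioo 0 Real.pi → ∃ i, s ∈ Ioo (a i) (b i)) :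
    BandSystem a b (foldedMomentum (Φ.quasi ω)) fun j s =>
      (WithLp.toLp 2 (Φ.cellU ω s (foldedMomentum (Φ.quasi ω) j s),
        Φ.cellV ω s (foldedMomentum (Φ.quasi ω) j s)) : WithLp 2 (L2Cell ω × L2Cell ω)) where
  disjoint := hdisj
  continuous_theta := continuous_foldedMomentum (Φ.continuous_quasi ω)
  bijOn j i := bijOn_foldedMomentum (hbij i) j
  exists_deriv j i s hs :=
    exists_hasDerivAt_foldedMomentum (Φ.exists_hasDerivAt_quasi hω ((hbij i).mapsTo hs)) j
  continuous_vec j := (WithLp.prod_continuous_toLp 2 _ _).comp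
    ((Φ.continuous_cellU continuous_id (continuous_foldedMomentum (Φ.continuous_quasi ω) j)).prodMk
      (Φ.continuous_cellV continuous_id (continuous_foldedMomentum (Φ.continuous_quasi ω) j)))
  ne_zero j i s hs h0 := by
    refine Φ.cellU_ne_zero hω (Φ.disc_eq_foldedMomentum (j := j) ((hbij i).mapsTo hs))
      (sin_ne_zero_of_mem_halfPeriod ((bijOn_foldedMomentum (hbij i) j).mapsTo hs)) ?_
    exact congrArg WithLp.fst h0
  orthogonal j i k hik s hs t ht hst := by
    have hst' : s ≠ t := by
      rintro rfl
      exact Set.disjoint_left.1 (hdisj hik) hs ht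
    have h1 := Φ.disc_eq_foldedMomentum (j := j) ((hbij i).mapsTo hs)
    have h2 := Φ.disc_eq_foldedMomentum (j := j) ((hbij k).mapsTo ht)
    rw [← hst] at h2 ⊢
    exact (Φ.inner_cellU_add_inner_cellV hω hφ hst' h1 h2).1
  total j τ hτ g hg := by
    have hsin := sin_ne_zero_of_mem_halfPeriod hτ
    have key : ∀ s, Φ.disc ω s = 2 * Real.cos τ →
        inner ℂ (Φ.cellU ω s τ) g.fst + inner ℂ (Φ.cellV ω s τ) g.snd = 0 := by
      intro s hs
      obtain ⟨h1, h2⟩ := Φ.foldedMomentum_eq hτ hs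
      obtain ⟨i, hi⟩ := hall s h1
      have h3 := hg i s hi h2
      rw [h2] at h3
      exact h3
    -- compare `s` with `-s`, which changes the sign of the first component only
    have key' : ∀ s, Φ.disc ω s = 2 * Real.cos τ →
        inner ℂ (Φ.cellU ω s τ) g.fst = 0 ∧ inner ℂ (Φ.cellV ω s τ) g.snd = 0 := by
      intro s hs
      have h1 := key s hs
      have h2 := key (-s) (by rw [disc_neg, hs])
      rw [cellU_neg, cellV_neg, inner_neg_left] at h2
      exact ⟨by linear_combination (h1 - h2) / 2, by linear_combination (h1 + h2) / 2⟩
    have e1 := Φ.eq_zero_of_inner_cellU hω hφ hsin fun s _ hs => (key' s hs).1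
    have e2 := Φ.eq_zero_of_inner_cellV hω hφ hsin fun s _ hs => (key' s hs).2
    exact WithLp.ofLp_injective 2 (Prod.ext e1 e2)

/-- The first components of the Bloch solutions at `√λ` are a band system for `A* A`. -/
theorem bandSystem_square (hω : 0 < ω) (hφ : MemLp φ 2 (volume.restrict (Icc 0 ω)))
    {ι : Type*} {a b : ι → ℝ}
    (hdisj : Pairwise (Function.onFun Disjoint fun i => Ioo (a i ^ 2) (b i ^ 2)))
    (hbij : ∀ i, BijOn (fun l => Φ.quasi ω √l) (Ioo (a i ^ 2) (b i ^ 2)) (Ioo 0 Real.pi))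
    (hall : ∀ s, 0 < s → Φ.quasi ω s ∈ Ioo 0 Real.pi → ∃ i, s ^ 2 ∈ Ioo (a i ^ 2) (b i ^ 2)) :
    BandSystem (fun i => a i ^ 2) (fun i => b i ^ 2) (foldedMomentum fun l => Φ.quasi ω √l)
      fun j l => Φ.cellU ω √l (foldedMomentum (Φ.quasi ω) j √l) where
  disjoint := hdisj
  continuous_theta :=
    continuous_foldedMomentum ((Φ.continuous_quasi ω).comp Real.continuous_sqrt)
  bijOn j i := bijOn_foldedMomentum (hbij i) j
  exists_deriv j i l hl := by
    refine exists_hasDerivAt_foldedMomentum ?_ j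
    have hl0 : 0 < l := (sq_nonneg _).trans_lt hl.1
    obtain ⟨D, hD, hD'⟩ := Φ.exists_hasDerivAt_quasi hω ((hbij i).mapsTo hl)
    exact ⟨D * (1 / (2 * √l)), mul_ne_zero hD (by positivity),
      hD'.comp l (Real.hasDerivAt_sqrt hl0.ne')⟩
  continuous_vec j := Φ.continuous_cellU Real.continuous_sqrt
    ((continuous_foldedMomentum (Φ.continuous_quasi ω) j).comp Real.continuous_sqrt)
  ne_zero j i l hl := Φ.cellU_ne_zero hω (Φ.disc_eq_foldedMomentum (j := j) ((hbij i).mapsTo hl))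
    (sin_ne_zero_of_mem_halfPeriod ((bijOn_foldedMomentum (hbij i) j).mapsTo hl))
  orthogonal j i k hik l hl m hm hlm := by
    have hl0 : 0 < l := (sq_nonneg _).trans_lt hl.1
    have hm0 : 0 < m := (sq_nonneg _).trans_lt hm.1
    have hne : √l ≠ √m := by
      rw [Ne, Real.sqrt_inj hl0.le hm0.le]
      rintro rfl
      exact Set.disjoint_left.1 (hdisj hik) hl hm
    have h1 := Φ.disc_eq_foldedMomentum (j := j) ((hbij i).mapsTo hl)
    have h2 := Φ.disc_eq_foldedMomentum (j := j) ((hbij k).mapsTo hm)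
    have hlm' : foldedMomentum (Φ.quasi ω) j √l = foldedMomentum (Φ.quasi ω) j √m := hlm
    rw [← hlm'] at h2 ⊢
    refine (mul_eq_zero.1 (Φ.inner_cellU_add_inner_cellV hω hφ hne h1 h2).2).resolve_left ?_
    exact_mod_cast (add_pos (Real.sqrt_pos.2 hl0) (Real.sqrt_pos.2 hm0)).ne'
  total j τ hτ g hg := by
    refine Φ.eq_zero_of_inner_cellU hω hφ (sin_ne_zero_of_mem_halfPeriod hτ) fun s hs hd => ?_
    obtain ⟨h1, h2⟩ := Φ.foldedMomentum_eq hτ hd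
    obtain ⟨i, hi⟩ := hall s hs h1
    have e : √(s ^ 2) = s := Real.sqrt_sq hs.le
    have h3 := hg i _ hi (by simp only [foldedMomentum, e] at h2 ⊢; exact h2)
    rwa [e, h2] at h3

end FundamentalSystem

/-- The left endpoints of the bands `(a n, b n)` on the half-line, for `n ≥ 0`, and of their
reflections `(-b n, -a n)`, for negative indices; the right endpoints are `reflectBands b a`. -/
def reflectBands (a b : ℕ → ℝ) : ℤ → ℝ
  | Int.ofNat n => a n
  | Int.negSucc n => -b n

section Reflect

variable {a b : ℕ → ℝ}

theorem reflectBands_le (h : ∀ n, 0 ≤ a n ∧ a n < b n ∧ b n ≤ a (n + 1)) (n : ℤ) :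
    reflectBands a b n < reflectBands b a n ∧ reflectBands b a n ≤ reflectBands a b (n + 1) := by
  match n with
  | Int.ofNat n => exact ⟨(h n).2.1, (h n).2.2⟩
  | Int.negSucc 0 => exact ⟨neg_lt_neg (h 0).2.1, (neg_nonpos.2 (h 0).1).trans (h 0).1⟩
  | Int.negSucc (n + 1) => exact ⟨neg_lt_neg (h _).2.1, neg_le_neg (h n).2.2⟩

theorem monotone_reflectBands (h : ∀ n, 0 ≤ a n ∧ a n < b n ∧ b n ≤ a (n + 1)) :
    Monotone (reflectBands a b) :=
  monotone_int_of_le_succ fun n => (reflectBands_le h n).1.le.trans (reflectBands_le h n).2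

theorem tendsto_reflectBands (h : ∀ n, 0 ≤ a n ∧ a n < b n ∧ b n ≤ a (n + 1))
    (ha : Tendsto a atTop atTop) : Tendsto (reflectBands a b) atTop atTop ∧
      Tendsto (reflectBands a b) atBot atBot := by
  refine ⟨tendsto_atTop_atTop_of_monotone (monotone_reflectBands h) fun x => ?_,
    tendsto_atBot_atBot_of_monotone (monotone_reflectBands h) fun x => ?_⟩
  · obtain ⟨n, hn⟩ := (ha.eventually_ge_atTop x).exists
    exact ⟨Int.ofNat n, hn⟩
  · obtain ⟨n, hn⟩ := (ha.eventually_ge_atTop (-x)).exists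
    exact ⟨Int.negSucc n, neg_le.1 (hn.trans (h n).2.1.le)⟩

end Reflect

section SpectralRepresentation

variable {φ : ℝ → ℝ} {ω : ℝ}

/-- The components of the direct integral decomposition of `D`. -/
theorem ae_mem_cellGraph (hω : 0 < ω) (hφ : IsUnifLocL2 φ) (hper : ∀ᵐ x, φ (x + ω) = φ x)
    {f h : WithLp 2 (L2Line × L2Line)} (hfh : (f, h) ∈ (diracOp φ).graph) :
    ∀ᵐ τ ∂floquetMeasure,
      ((floquetEquiv hω f τ).fst, (floquetEquiv hω h τ).snd) ∈ cellGraph ω φ τ ∧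
      ((floquetEquiv hω f τ).snd, -(floquetEquiv hω h τ).fst) ∈
        cellGraph ω (fun x => -φ x) τ := by
  have h1 := (intertwines_floquetEquiv hω hφ hper f h).1 hfh
  rw [graph_directIntegral] at h1
  refine Eventually.mono h1 fun τ h2 => ?_
  rwa [diracFiber_eq hω (hφ.memLp 0 ω), mem_graph_offDiagOp, mem_graph_neg, graph_cellOp hω,
    graph_cellOp hω] at h2

/-- The spectral representation of the Dirac operator. -/
theorem exists_intertwines_diracOp (hω : 0 < ω) (hφ : IsUnifLocL2 φ)
    (hper : ∀ᵐ x, φ (x + ω) = φ x) :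
    ∃ a b : ℤ → ℝ, (∀ n, a n < b n ∧ b n ≤ a (n + 1)) ∧ Tendsto a atTop atTop ∧
      Tendsto a atBot atBot ∧ ∃ U : WithLp 2 (L2Line × L2Line) ≃ₗᵢ[ℂ]
        Lp (EuclideanSpace ℂ (Fin 2)) 2 (volume.restrict (⋃ n, Ioo (a n) (b n))),
        Intertwines U (diracOp φ) (mulOp 2 (volume.restrict (⋃ n, Ioo (a n) (b n)))) := by
  obtain ⟨Φ⟩ := nonempty_fundamentalSystem hφ.intervalIntegrable
  obtain ⟨a, b, hab, ha, hbij, hall⟩ := Φ.exists_quasi_bands hω (hφ.memLp 0 ω)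
  have hle := reflectBands_le hab
  have hbij' : ∀ n, BijOn (Φ.quasi ω) (Ioo (reflectBands a b n) (reflectBands b a n))
      (Ioo 0 Real.pi) := by
    intro n
    match n with
    | Int.ofNat n => exact hbij n
    | Int.negSucc n =>
      have h1 : BijOn (fun s : ℝ => -s) (Ioo (-b n) (-a n)) (Ioo (a n) (b n)) := by
        refine ⟨fun s hs => ⟨lt_neg.1 hs.2, neg_lt.1 hs.1⟩, neg_injective.injOn, fun s hs =>
          ⟨-s, ⟨neg_lt_neg hs.2, neg_lt_neg hs.1⟩, neg_neg s⟩⟩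
      exact ((hbij n).comp h1).congr fun s _ => Φ.quasi_neg s
  have hall' : ∀ s, Φ.quasi ω s ∈ Ioo 0 Real.pi →
      ∃ n, s ∈ Ioo (reflectBands a b n) (reflectBands b a n) := by
    intro s hs
    rcases lt_trichotomy s 0 with h0 | rfl | h0
    · obtain ⟨n, hn⟩ := hall (-s) (neg_pos.2 h0) (by rwa [Φ.quasi_neg])
      exact ⟨Int.negSucc n, neg_lt.1 hn.2, lt_neg.1 hn.1⟩
    · exact absurd (Φ.quasi_mem_Ioo_iff.1 hs) (Φ.two_le_abs_disc_zero ω).not_gt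
    · obtain ⟨n, hn⟩ := hall s h0 hs
      exact ⟨Int.ofNat n, hn⟩
  have hB := Φ.bandSystem_dirac hω (hφ.memLp 0 ω)
    (disjoint_bands (monotone_reflectBands hab) fun n => (hle n).2) hbij' hall'
  refine ⟨_, _, hle, (tendsto_reflectBands hab ha).1, (tendsto_reflectBands hab ha).2, ?_⟩
  refine hB.exists_intertwines ?_ (floquetEquiv hω) fun f h hfh => ?_
  · rw [hφ.diracOp_eq]
    exact hφ.isAdjointPair.isSelfAdjoint_offDiagOp
  · filter_upwards [ae_mem_cellGraph hω hφ hper hfh] with τ hτ j i s hs hsτ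
    have hd := Φ.disc_eq_foldedMomentum (j := j) ((hbij' i).mapsTo hs)
    rw [hsτ] at hd ⊢
    obtain ⟨e1, e2⟩ := Φ.inner_cell_graph hω (hφ.memLp 0 ω) hd hτ.1 hτ.2
    change inner ℂ (Φ.cellU ω s τ) _ + inner ℂ (Φ.cellV ω s τ) _ =
      (s : ℂ) * (inner ℂ (Φ.cellU ω s τ) _ + inner ℂ (Φ.cellV ω s τ) _)
    rw [e1, e2]
    ring

/-- The spectral representation of `A* A`, with the squares of the bands of the Dirac operator. -/
theorem exists_intertwines_opT1 (hω : 0 < ω) (hφ : IsUnifLocL2 φ)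
    (hper : ∀ᵐ x, φ (x + ω) = φ x) :
    ∃ a b : ℕ → ℝ, (∀ n, a n < b n ∧ b n ≤ a (n + 1)) ∧ Tendsto a atTop atTop ∧
      ∃ U : L2Line ≃ₗᵢ[ℂ]
        Lp (EuclideanSpace ℂ (Fin 2)) 2 (volume.restrict (⋃ n, Ioo (a n) (b n))),
        Intertwines U (opT1 φ) (mulOp 2 (volume.restrict (⋃ n, Ioo (a n) (b n)))) := by
  obtain ⟨Φ⟩ := nonempty_fundamentalSystem hφ.intervalIntegrable
  obtain ⟨a, b, hab, ha, hbij, hall⟩ := Φ.exists_quasi_bands hω (hφ.memLp 0 ω)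
  have hb : ∀ n, 0 ≤ b n := fun n => (hab n).1.trans (hab n).2.1.le
  have hle : ∀ n, a n ^ 2 < b n ^ 2 ∧ b n ^ 2 ≤ a (n + 1) ^ 2 := fun n =>
    ⟨pow_lt_pow_left₀ (hab n).2.1 (hab n).1 two_ne_zero, pow_le_pow_left₀ (hb n) (hab n).2.2 2⟩
  have hbij' : ∀ n, BijOn (fun l => Φ.quasi ω √l) (Ioo (a n ^ 2) (b n ^ 2)) (Ioo 0 Real.pi) := by
    intro n
    refine (hbij n).comp ⟨fun l hl => ⟨Real.lt_sqrt_of_sq_lt hl.1, ?_⟩, fun l hl m hm hlm => ?_,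
      fun s hs => ⟨s ^ 2, ?_, Real.sqrt_sq ((hab n).1.trans hs.1.le)⟩⟩
    · exact (Real.sqrt_lt' ((hab n).1.trans_lt (hab n).2.1)).2 hl.2
    · exact (Real.sqrt_inj ((sq_nonneg _).trans hl.1.le) ((sq_nonneg _).trans hm.1.le)).1 hlm
    · exact ⟨pow_lt_pow_left₀ hs.1 (hab n).1 two_ne_zero,
        pow_lt_pow_left₀ hs.2 ((hab n).1.trans hs.1.le) two_ne_zero⟩
  have hB := Φ.bandSystem_square hω (hφ.memLp 0 ω)
    (disjoint_bands (monotone_nat_of_le_succ fun n => (hle n).1.le.trans (hle n).2)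
      fun n => (hle n).2) hbij' fun s hs hsq => by
        obtain ⟨n, hn⟩ := hall s hs hsq
        exact ⟨n, pow_lt_pow_left₀ hn.1 (hab n).1 two_ne_zero,
          pow_lt_pow_left₀ hn.2 hs.le two_ne_zero⟩
  refine ⟨_, _, hle, (tendsto_pow_atTop two_ne_zero).comp ha, ?_⟩
  refine hB.exists_intertwines ?_ (lineFloquetEquiv hω) fun f h hfh => ?_
  · rw [hφ.opT1_eq]
    exact hφ.isAdjointPair.isSelfAdjoint_opComp
  · rw [hφ.opT1_eq, mem_graph_opComp] at hfh
    obtain ⟨w, hw⟩ := hfh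
    -- with `w = A f` and `h = A* w`, the pair `(f, w)` is mapped to `(h, w)` by the Dirac operator
    have hD : (WithLp.toLp 2 (f, w), WithLp.toLp 2 (h, w)) ∈ (diracOp φ).graph := by
      rw [hφ.diracOp_eq, mem_graph_offDiagOp]
      exact hw
    filter_upwards [ae_mem_cellGraph hω hφ hper hD, ae_floquetEquiv hω (WithLp.toLp 2 (f, w)),
      ae_floquetEquiv hω (WithLp.toLp 2 (h, w))] with τ hτ hF hH j i l hl hlτ
    rw [hF.1, hF.2, hH.1, hH.2] at hτ
    have hl0 : 0 ≤ l := (sq_nonneg _).trans hl.1.le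
    have hlτ' : foldedMomentum (Φ.quasi ω) j √l = τ := hlτ
    have hd := Φ.disc_eq_foldedMomentum (j := j) ((hbij' i).mapsTo hl)
    rw [hlτ'] at hd ⊢
    obtain ⟨e1, e2⟩ := Φ.inner_cell_graph hω (hφ.memLp 0 ω) hd hτ.1 hτ.2
    have e3 : (√l : ℂ) * √l = l := by exact_mod_cast Real.mul_self_sqrt hl0
    exact (e1.trans (congrArg (fun z => (√l : ℂ) * z) e2)).trans (by rw [← mul_assoc, e3]; rfl)

/-- `A A*` is the operator `A* A` for the potential `-φ`, up to the sign of both factors. -/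
theorem IsUnifLocL2.opT2_eq_opT1_neg (hφ : IsUnifLocL2 φ) : opT2 φ = opT1 fun x => -φ x := by
  rw [hφ.opT2_eq, hφ.neg.opT1_eq]
  refine LinearPMap.eq_of_eq_graph (SetLike.ext fun p => ?_)
  obtain ⟨f, h⟩ := p
  simp only [mem_graph_opComp, mem_graph_neg, neg_neg]
  constructor
  · rintro ⟨w, h1, h2⟩
    exact ⟨-w, h1, by simpa using Submodule.neg_mem _ h2⟩
  · rintro ⟨w, h1, h2⟩
    exact ⟨-w, by simpa using h1, by simpa using Submodule.neg_mem _ h2⟩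

end SpectralRepresentation

end

theorem theorem4p3 (ω : ℝ) (hω : 0 < ω) (q : RealDistribution) (hq : MemHNegOneLoc q)
    (hper : IsPeriodicDistribution ω q) (hT : IsNonnegOp (schrodingerOp q)) :
    (∃ φ : ℝ → ℝ, IsPeriodicMiura ω q φ) ∧
    ∀ φ : ℝ → ℝ, IsPeriodicMiura ω q φ →
      schrodingerOp q = opT1 φ ∧
      (IsSelfAdjoint (diracOp φ) ∧
        (∀ θ ∈ Set.Icc 0 (2 * Real.pi), IsSelfAdjoint (diracFiber ω φ θ)) ∧
        (∃ V : WithLp 2 (L2Line × L2Line) ≃ₗᵢ[ℂ]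
            MeasureTheory.Lp (WithLp 2 (L2Cell ω × L2Cell ω)) 2 floquetMeasure,
          IsFloquetTransform ω V ∧
          Intertwines V (diracOp φ) (directIntegral floquetMeasure (diracFiber ω φ))) ∧
        pointSpectrum (diracOp φ) = ∅ ∧ scSpectrum (diracOp φ) = ∅ ∧
        IsPurelyAC (diracOp φ) ∧ HasUniformMultiplicity (diracOp φ) 2 ∧
        ∃ S : Set ℝ, IsTwoSidedBandUnion S ∧
          opSpectrum (diracOp φ) = (fun t : ℝ => (t : ℂ)) '' S) ∧
      ∀ T : L2Line →ₗ.[ℂ] L2Line, T = opT1 φ ∨ T = opT2 φ →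
        IsSelfAdjoint T ∧ pointSpectrum T = ∅ ∧ scSpectrum T = ∅ ∧
        IsPurelyAC T ∧ HasUniformMultiplicity T 2 ∧
        ∃ S : Set ℝ, IsOneSidedBandUnion S ∧
          opSpectrum T = (fun t : ℝ => (t : ℂ)) '' S := by
  refine ⟨exists_isPeriodicMiura hω hq hper hT, fun φ hφ => ?_⟩
  have hu := hφ.isUnifLocL2
  have hm : IsMiura q φ 0 := fun f => by rw [hφ.eq_miura f, zero_mul, sub_zero]
  have hper' : ∀ᵐ x, -φ (x + ω) = -φ x := hφ.periodic.mono fun x hx => by rw [hx]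
  have hone : ∀ ψ : ℝ → ℝ, IsUnifLocL2 ψ → (∀ᵐ x, ψ (x + ω) = ψ x) →
      IsSelfAdjoint (opT1 ψ) ∧ pointSpectrum (opT1 ψ) = ∅ ∧ scSpectrum (opT1 ψ) = ∅ ∧
        IsPurelyAC (opT1 ψ) ∧ HasUniformMultiplicity (opT1 ψ) 2 ∧
        ∃ S : Set ℝ, IsOneSidedBandUnion S ∧
          opSpectrum (opT1 ψ) = (fun t : ℝ => (t : ℂ)) '' S := by
    intro ψ hψ hψper
    obtain ⟨a, b, hab, ha, U, hU⟩ := exists_intertwines_opT1 hω hψ hψper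
    obtain ⟨h1, h2, h3, h4, h5⟩ := hU.spectral_consequences (fun n => (hab n).1)
      (finite_bands_nat ha)
    refine ⟨?_, h1, h2, h3, h4, _, ⟨a, b, hab, ha, rfl⟩, h5⟩
    rw [hψ.opT1_eq]
    exact hψ.isAdjointPair.isSelfAdjoint_opComp
  obtain ⟨a, b, hab, ha, ha', U, hU⟩ := exists_intertwines_diracOp hω hu hφ.periodic
  obtain ⟨h1, h2, h3, h4, h5⟩ := hU.spectral_consequences (fun n => (hab n).1)
    (finite_bands_int (fun n => (hab n).2) ha ha')
  refine ⟨schrodingerOp_eq_opT1 hu hm, ⟨?_, fun θ _ => isSelfAdjoint_diracFiber hω (hu.memLp 0 ω) θ,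
    ⟨floquetEquiv hω, isFloquetTransform_floquetEquiv hω, intertwines_floquetEquiv hω hu hφ.periodic⟩,
    h1, h2, h3, h4, _, ⟨a, b, hab, ha, ha', rfl⟩, h5⟩, ?_⟩
  · rw [hu.diracOp_eq]
    exact hu.isAdjointPair.isSelfAdjoint_offDiagOp
  · rintro T (rfl | rfl)
    · exact hone φ hu hφ.periodic
    · rw [hu.opT2_eq_opT1_neg]
      exact hone _ hu.neg hper'
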